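/- **Theorem 4.1.** *Setting.* For continuous $h,k:[0,\infty)\to\mathbb R$ put $\overline f(r)=\frac1r\int_0^r f(s)\,ds$ for $r>0$, $\overline f(0)=f(0)$, and $$g(r)=\exp\Big(-\int_r^\infty \tfrac1s\big[(h-\overline h)^2+(k-\overline k)^2\big]ds\Big),\qquad Q(r)=\int_0^r s\,(\overline h k-\overline k h)\,ds,\qquad a(r)=\int_0^r g\,\frac{Q}{s^2}\,ds,$$ $$\widetilde g(r)=\frac1r\int_0^r g\Big[1-\frac{Q^2}{2s^2}-s^2V\Big]ds\quad(\widetilde g(0)=g(0)),\qquad V=V(\overline h^2+\overline k^2),\quad V'=V'(\overline h^2+\overline k^2).$$ The reduced spherically symmetric Einstein–Yang–Mills–Higgs evolution system for $W=(h,k)^T$, $h=h(u,r)$, $k=k(u,r)$, $u,r\ge 0$, is (with the above functions formed at each fixed $u$) $$\Big(\partial_u-\frac{\widetilde g}{2}\partial_r\Big)W=\frac{g-\widetilde g}{2r}(W-\overline W)-\frac{Q^2g}{4r^3}(W-\overline W)+\frac{Qg}{4r}\begin{pmatrix}0&1\\1&0\end{pmatrix}\overline W+\frac a2\begin{pmatrix}0&1\\-1&0\end{pmatrix}W-\frac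 r2\big[Vg(W-\overline W)+V'g\overline W\big].\tag{3.8}$$ A global classical solution is a $W\in C^1([0,\infty)\times[0,\infty))$ for which the integral defining $g$ converges for every $u\ge0$ and (3.8) holds for all $u\ge 0$, $r>0$. Write $|W|=|h|+|k|$, $W'=\partial_rW$, and $\|W_0\|_{\mathcal X_0}=\sup_{r\ge0}\{(1+r)^2|W_0(r)|+(1+r)^3|W_0'(r)|\}$. *Statement.* There is a positive, continuous, increasing function $C$ on $[0,\infty)$, and for all $K_0\ge0$ and $p\ge\frac32$ there is $\epsilon>0$, such that the following holds. Let $V\in C^2([0,\infty))$ satisfy $$|V(t)|+t|V'(t)|+t^2|V''(t)|\le K_0t^{p+1}\qquad\text{for all }t\ge0,$$ and let $W_0\in C^1([0,\infty))$ satisfy $W_0(r)=O(r^{-2})$ and $W_0'(r)=O(r^{-3})$ as $r\to\infty$, and $\|W_0\|_{\mathcal X_0}<\epsilon$. Then (3.8) has a unique global classical solution $W$ with $W(0,r)=W_0(r)$, and for all $u,r\ge0$ $$|W(u,r)|\le C(K_0)(1+u+r)^{-2},\qquad |W'(u,r)|\le C(K_0)(1+u+r)^{-3}.$$ Moreover $\widetilde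 g>0$, and the corresponding space-time, i.e. $\{u\ge0,\ r\ge0\}$ with the metric $$ds^2=-e^{2\nu}du^2-2e^{\nu+\lambda}du\,dr+r^2(d\theta^2+\sin^2\theta\,d\varphi^2),\qquad e^{\nu+\lambda}=g,\quad e^{\nu-\lambda}=\widetilde g,$$ is timelike and null geodesically complete toward the future. Here the space-time, including its centre $r=0$, is the set $\{(t,x)\in\mathbb R\times\mathbb R^3:|x|\le t\}$, where $r=|x|$, $t=r+\int_0^ue^{\nu(v,0)}dv$ (the integral maps $[0,\infty)$ bijectively onto itself), and $\theta,\varphi$ are the angles of $x$; in the coordinates $(t,x)$ the metric is Lorentzian with $C^1$ coefficients, $\partial_t$ is timelike and future directed, and completeness means that every future directed timelike or null affinely parametrized geodesic on an interval $[0,b)$, $0<b<\infty$, extends to a geodesic on $[0,\infty)$. -/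

import Mathlib

open Set MeasureTheory Filter

noncomputable section

namespace EYMH

/-! Reduced unknowns. At a fixed retarded time `u` the unknown is a pair `h, k : ℝ → ℝ` of functions of
the area radius `r ≥ 0`; the evolving unknown is a pair `h, k : ℝ → ℝ → ℝ`, written `h u r`, `k u r`.
Only the values for `u, r ≥ 0` matter. -/

/-- The radial mean `f̄(r) = (1/r) ∫₀ʳ f(s) ds`, with its limit value `f(0)` at `r = 0`. -/
def mean (f : ℝ → ℝ) (r : ℝ) : ℝ :=
  if r = 0 then f 0 else (1 / r) * ∫ s in (0 : ℝ)..r, f s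

/-- The integrand `(1/s) [(h - h̄)² + (k - k̄)²]` of `-(λ + ν)`. -/
def massDensity (h k : ℝ → ℝ) (s : ℝ) : ℝ :=
  ((h s - mean h s) ^ 2 + (k s - mean k s) ^ 2) / s

/-- `g = e^{λ + ν}`, where `λ + ν = -∫_r^∞ (1/s) [(h - h̄)² + (k - k̄)²] ds`. -/
def gFun (h k : ℝ → ℝ) (r : ℝ) : ℝ :=
  Real.exp (-∫ s in Ioi r, massDensity h k s)

/-- The local charge `Q(r) = ∫₀ʳ s (h̄ k - k̄ h) ds`. -/
def charge (h k : ℝ → ℝ) (r : ℝ) : ℝ :=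
  ∫ s in (0 : ℝ)..r, s * (mean h s * k s - mean k s * h s)

/-- The Yang-Mills potential `a(r) = ∫₀ʳ g Q / s² ds`. -/
def ymPotential (h k : ℝ → ℝ) (r : ℝ) : ℝ :=
  ∫ s in (0 : ℝ)..r, gFun h k s * (charge h k s / s ^ 2)

/-- The squared modulus `Φ†Φ = h̄² + k̄²` of the Higgs field. -/
def higgsSq (h k : ℝ → ℝ) (r : ℝ) : ℝ := mean h r ^ 2 + mean k r ^ 2

/-- `g̃ = e^{ν - λ} = (1/r) ∫₀ʳ g [1 - Q²/(2 s²) - s² V(Φ†Φ)] ds`, with limit value `g(0)` at `r = 0`. -/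
def gTilde (V : ℝ → ℝ) (h k : ℝ → ℝ) : ℝ → ℝ :=
  mean fun s => gFun h k s *
    (1 - (1 / 2) * (charge h k s ^ 2 / s ^ 2) - s ^ 2 * V (higgsSq h k s))

/-- The derivative of a function on `[0, ∞)` (one-sided at `0`). -/
def deriv₀ (f : ℝ → ℝ) (r : ℝ) : ℝ := derivWithin f (Ici 0) r

/-- The part of the right-hand side of the evolution system that multiplies `f - f̄`, plus the
potential term in `f̄`; here `f` is either component `h` or `k` of `W = (h, k)`:
`(g - g̃)/(2r) (f - f̄) - Q² g/(4 r³) (f - f̄) - (r/2) [V g (f - f̄) + V' g f̄]`. -/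
def diagTerm (V : ℝ → ℝ) (h k f : ℝ → ℝ) (r : ℝ) : ℝ :=
  1 / (2 * r) * (gFun h k r - gTilde V h k r) * (f r - mean f r)
    - charge h k r ^ 2 * gFun h k r / (4 * r ^ 3) * (f r - mean f r)
    - r / 2 * (V (higgsSq h k r) * gFun h k r * (f r - mean f r)
        + deriv₀ V (higgsSq h k r) * gFun h k r * mean f r)

/-- `(h, k)` is a global classical solution of the evolution system
`D W = (g - g̃)/(2r) (W - W̄) - Q² g/(4 r³) (W - W̄) + Q g/(4 r) σ₁ W̄ + (a/2) i σ₂ W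
        - (r/2) [V g (W - W̄) + V' g W̄]`,
`D = ∂_u - (g̃/2) ∂_r`, `W = (h, k)`, with `W(0, r) = (h₀(r), k₀(r))`. Note `σ₁ (x, y) = (y, x)` and
`i σ₂ (x, y) = (y, -x)`. The convergence of the integral that defines `λ + ν` is part of the notion. -/
structure IsGlobalSolution (V : ℝ → ℝ) (h₀ k₀ : ℝ → ℝ) (h k : ℝ → ℝ → ℝ) : Prop where
  contDiff_h : ContDiffOn ℝ 1 (Function.uncurry h) (Ici 0 ×ˢ Ici 0)
  contDiff_k : ContDiffOn ℝ 1 (Function.uncurry k) (Ici 0 ×ˢ Ici 0)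
  integrable : ∀ u, 0 ≤ u → IntegrableOn (massDensity (h u) (k u)) (Ioi 0)
  eq_h : ∀ u r, 0 ≤ u → 0 < r →
    deriv₀ (fun v => h v r) u - gTilde V (h u) (k u) r / 2 * deriv₀ (h u) r
      = diagTerm V (h u) (k u) (h u) r
        + charge (h u) (k u) r * gFun (h u) (k u) r / (4 * r) * mean (k u) r
        + ymPotential (h u) (k u) r / 2 * k u r
  eq_k : ∀ u r, 0 ≤ u → 0 < r →
    deriv₀ (fun v => k v r) u - gTilde V (h u) (k u) r / 2 * deriv₀ (k u) r
      = diagTerm V (h u) (k u) (k u) r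
        + charge (h u) (k u) r * gFun (h u) (k u) r / (4 * r) * mean (h u) r
        - ymPotential (h u) (k u) r / 2 * h u r
  init_h : ∀ r, 0 ≤ r → h 0 r = h₀ r
  init_k : ∀ r, 0 ≤ r → k 0 r = k₀ r

/-- The norm `sup_{r ≥ 0} {(1 + r)² |v(r)| + (1 + r)³ |v'(r)|}` of `v = (h₀, k₀)`, where
`|(x, y)| = |x| + |y|`, as an element of `[0, ∞]`. -/
def normX₀ (h₀ k₀ : ℝ → ℝ) : ENNReal :=
  ⨆ r ∈ Ici (0 : ℝ), ENNReal.ofReal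
    ((1 + r) ^ 2 * (|h₀ r| + |k₀ r|) + (1 + r) ^ 3 * (|deriv₀ h₀ r| + |deriv₀ k₀ r|))

/-! The space-time. -/

/-- Proper time along the central world line `r = 0`: `T(u) = ∫₀ᵘ e^{ν(v, 0)} dv`. Since `λ = 0` at
the centre, `e^{ν(v, 0)} = g(v, 0)`. -/
def centralTime (h k : ℝ → ℝ → ℝ) (u : ℝ) : ℝ :=
  ∫ v in (0 : ℝ)..u, gFun (h v) (k v) 0

/-- The inverse function of `centralTime` on `[0, ∞)`. -/
def retardedTime (h k : ℝ → ℝ → ℝ) (σ : ℝ) : ℝ :=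
  Function.invFunOn (centralTime h k) (Ici 0) σ

/-- Coordinates `(t, x)`, with `x ∈ ℝ³`, that cover the centre: `r = |x|` and `t = T(u) + r`. -/
abbrev Coord : Type := ℝ × EuclideanSpace ℝ (Fin 3)

/-- The coordinate domain of the space-time `u ≥ 0`, `r ≥ 0`, that is `|x| ≤ t`. -/
def domain : Set Coord := {P | ‖P.2‖ ≤ P.1}

/-- The Bondi metric `-e^{2ν} du² - 2 e^{ν + λ} du dr + r² (dθ² + sin² θ dφ²)`, with
`e^{2ν} = g g̃` and `e^{ν + λ} = g`, written in the coordinates `(t, x)`: here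
`dr = ⟨x, dx⟩ / r`, `du = (dt - dr) / g(u, 0)` and `r² (dθ² + sin² θ dφ²) = |dx|² - dr²`.
At the centre `x = 0` the formula yields the limit value `-dt² + |dx|²`. -/
def bondiMetric (V : ℝ → ℝ) (h k : ℝ → ℝ → ℝ) (P v w : Coord) : ℝ :=
  let r : ℝ := ‖P.2‖
  let u : ℝ := retardedTime h k (P.1 - r)
  let g : ℝ := gFun (h u) (k u) r
  let gt : ℝ := gTilde V (h u) (k u) r
  let dr : Coord → ℝ := fun z => inner ℝ P.2 z.2 / r
  let du : Coord → ℝ := fun z => (z.1 - dr z) / gFun (h u) (k u) 0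
  inner ℝ v.2 w.2 - dr v * dr w - g * gt * (du v * du w)
    - g * (du v * dr w + du w * dr v)

section Lorentz

variable {E : Type*} [NormedAddCommGroup E] [NormedSpace ℝ E]

/-- `q` has `C¹` coefficients on `M` and Lorentzian signature `(-, +, …, +)` at each point of `M`,
with the constant field `e` timelike. -/
def IsLorentzian (q : E → E → E → ℝ) (M : Set E) (e : E) : Prop :=
  (∀ v w, ContDiffOn ℝ 1 (fun P => q P v w) M) ∧
  ∀ P ∈ M, q P e e < 0 ∧ ∀ w, w ≠ 0 → q P e w = 0 → 0 < q P w w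

/-- `γ` is a geodesic, affinely parametrized by `I`, of the metric `q` on `M`. With
`(∂_Z q)(v, w)` the derivative of the coefficients in the direction `Z`, the geodesic equation (index
lowered by the metric) is
`q(γ'', Z) + (∂_{γ'} q)(γ', Z) - ½ (∂_Z q)(γ', γ') = 0` for all `Z`. -/
def IsGeodesicOn (q : E → E → E → ℝ) (M : Set E) (I : Set ℝ) (γ : ℝ → E) : Prop :=
  ContDiffOn ℝ 2 γ I ∧ MapsTo γ I M ∧
  ∀ s ∈ I, ∀ Z : E,
    q (γ s) (derivWithin (derivWithin γ I) I s) Z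
      + fderivWithin ℝ (fun P => q P (derivWithin γ I s) Z) M (γ s) (derivWithin γ I s)
      - (1 / 2) *
        fderivWithin ℝ (fun P => q P (derivWithin γ I s) (derivWithin γ I s)) M (γ s) Z = 0

/-- The tangent of `γ` is timelike or null, and future directed for the time orientation by `e`. -/
def IsFutureCausalOn (q : E → E → E → ℝ) (e : E) (I : Set ℝ) (γ : ℝ → E) : Prop :=
  ∀ s ∈ I, q (γ s) (derivWithin γ I s) (derivWithin γ I s) ≤ 0 ∧
    q (γ s) (derivWithin γ I s) e < 0

/-- Timelike and null geodesic completeness toward the future: every future directed timelike or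
null geodesic defined on some `[0, b)` extends to a geodesic defined for all affine parameters
in `[0, ∞)`. -/
def IsFutureComplete (q : E → E → E → ℝ) (M : Set E) (e : E) : Prop :=
  ∀ (b : ℝ) (γ : ℝ → E), 0 < b → IsGeodesicOn q M (Ico 0 b) γ →
    IsFutureCausalOn q e (Ico 0 b) γ →
    ∃ γ' : ℝ → E, IsGeodesicOn q M (Ici 0) γ' ∧ EqOn γ' γ (Ico 0 b)

end Lorentz

/-- The time direction `∂_t`. -/
def timeDir : Coord := (1, 0)

end EYMH

end

/-! Put w = h + ik and divide `g`, `g̃` and `a` by the central value g(u, 0), which is `cc`. The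
normalized functionals at radius r see w only on [0, r], and g(u, 0) enters the evolution as one
common factor. In the proper time τ of the centre, dτ = g(u, 0) du, the system is therefore the
single equation w_τ = (Gt/2) w_r + ca w + cb. It is nonlocal only towards the centre, and its speed
is close to 1/2.

Existence comes from an iteration: freeze the coefficients, then solve the linear transport equation
along ingoing characteristics. The iterates satisfy |w| ≤ A/(1+τ+r)² and |w_r| ≤ A/(1+τ+r)³. With c
= 1 + τ, the radial mean of such a profile is at most p = A/(c(c+r)), and every coefficient is
estimated by powers of p. Up to the factor 1 + K, ca is O(A²/c²) and cb is O(A³/(c²(c+r)²)); the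
source of the equation for w_r gains one more power of c+r. The factor c⁻² is integrable in time.
Characteristics move inward with speed at least 3/8, so 1+τ+r at any earlier time is at least 3/8 of
its final value. The bounds thus reproduce themselves once (1+K)A is small (`Ball.norm_next_le`,
`Ball.norm_next'_le`). On each cone τ + r ≤ R the iteration contracts in a sup norm with weight
exp(Λτ) (`exists_contraction`, `exists_fixed_point`). The derivative of the limit is continuous at
the centre because the terms that may jump there combine into multiples of w minus its mean
(`dca_mul_add_dcb`, `Ball.exists_sol`).

The variable u is recovered by integrating 1/g(u, 0), which lies between 1 and 2, so decay in τ is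
decay in u. For uniqueness a competing solution is passed to its own central time. Its rate g(u, 0)
is only known to be measurable in u, but the evolution equation survives the change of time
(`hasDerivWithinAt_comp_inverse`). The contraction estimate asks only for local bounds on the
competitor (`Ball.eq_of_time_change`, `Ball.unique`).

For the geometry take t = τ + r and ξ = dt - dr. The metric is Minkowski minus aξ² + 2bξ dr, with a
= GG·Gt - 1 and b = GG - 1 uniformly small and O(r²) at the axis. Hence it is C¹ across the axis
(`contDiff_met`). The τ-derivatives of a and b are O((1+τ)⁻²). The energy E = -q(γ', ∂_t) of a
causal geodesic changes at a relative rate at most 5M τ'/(1+τ)², where τ' is the rate of τ along the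
curve; so E stays between positive constants and the velocity stays bounded (`energy_bounds`). A
geodesic cannot break down at a finite parameter. Since the connection is only continuous, it is
continued by Peano's theorem (`exists_extension`). -/

noncomputable section

namespace EYMH

open scoped Topology ComplexConjugate

set_option linter.unusedSectionVars false
set_option linter.unusedVariables false

section

/-! ### Differentiability on a product set from continuous partial derivatives -/

section Partials

variable {F : Type*} [NormedAddCommGroup F] [NormedSpace ℝ F]

/-- The increment is split at the corner (y1, x2), which lies in the product. The mean value
inequality is applied on each leg; convexity of the two factors keeps the legs inside, so boundary
points are allowed. -/
theorem hasFDerivWithinAt_of_partials {S T : Set ℝ} (hS : Convex ℝ S) (hT : Convex ℝ T)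
    {f p₁ p₂ : ℝ × ℝ → F}
    (h₁ : ∀ x ∈ S ×ˢ T, HasDerivWithinAt (fun s => f (s, x.2)) (p₁ x) S x.1)
    (h₂ : ∀ x ∈ S ×ˢ T, HasDerivWithinAt (fun t => f (x.1, t)) (p₂ x) T x.2)
    (c₁ : ContinuousOn p₁ (S ×ˢ T)) (c₂ : ContinuousOn p₂ (S ×ˢ T)) {x : ℝ × ℝ}
    (hx : x ∈ S ×ˢ T) :
    HasFDerivWithinAt f ((ContinuousLinearMap.fst ℝ ℝ ℝ).smulRight (p₁ x) +
      (ContinuousLinearMap.snd ℝ ℝ ℝ).smulRight (p₂ x)) (S ×ˢ T) x := by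
  rw [hasFDerivWithinAt_iff_isLittleO, Asymptotics.isLittleO_iff]
  intro ε hε
  have hε2 : 0 < ε / 2 := by positivity
  obtain ⟨δ₁, hδ₁, H₁⟩ := Metric.continuousWithinAt_iff.1 (c₁ x hx) (ε / 2) hε2
  obtain ⟨δ₂, hδ₂, H₂⟩ := Metric.continuousWithinAt_iff.1 (c₂ x hx) (ε / 2) hε2
  have hball : Metric.ball x (min δ₁ δ₂) ∈ 𝓝[S ×ˢ T] x :=
    mem_nhdsWithin_of_mem_nhds (Metric.ball_mem_nhds x (lt_min hδ₁ hδ₂))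
  filter_upwards [hball, self_mem_nhdsWithin] with y hy hyS
  obtain ⟨x1, x2⟩ := x
  obtain ⟨y1, y2⟩ := y
  have hx' : x1 ∈ S ∧ x2 ∈ T := hx
  have hy' : y1 ∈ S ∧ y2 ∈ T := hyS
  rw [Metric.mem_ball, Prod.dist_eq, max_lt_iff] at hy
  simp only at hy
  have k₁ : ‖(f (y1, x2) - y1 • p₁ (x1, x2)) - (f (x1, x2) - x1 • p₁ (x1, x2))‖
      ≤ ε / 2 * ‖y1 - x1‖ := by
    refine (hS.inter (convex_ball x1 (min δ₁ δ₂))).norm_image_sub_le_of_norm_hasDerivWithin_le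
      (f := fun s => f (s, x2) - s • p₁ (x1, x2)) (f' := fun s => p₁ (s, x2) - p₁ (x1, x2))
      (fun s hs => ?_) (fun s hs => ?_) ⟨hx'.1, Metric.mem_ball_self (lt_min hδ₁ hδ₂)⟩
      ⟨hy'.1, hy.1⟩
    · have := (h₁ (s, x2) ⟨hs.1, hx'.2⟩).mono (t := S) (s := S ∩ Metric.ball x1 (min δ₁ δ₂))
        inter_subset_left
      exact (this.sub ((hasDerivWithinAt_id s _).smul_const (p₁ (x1, x2)))).congr_deriv (by simp)
    · have := H₁ (x := (s, x2)) ⟨hs.1, hx'.2⟩ (by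
        rw [Prod.dist_eq]; simp only [dist_self]
        exact max_lt (lt_of_lt_of_le hs.2 (min_le_left _ _)) hδ₁)
      rw [dist_eq_norm] at this
      exact this.le
  have k₂ : ‖(f (y1, y2) - y2 • p₂ (x1, x2)) - (f (y1, x2) - x2 • p₂ (x1, x2))‖
      ≤ ε / 2 * ‖y2 - x2‖ := by
    refine (hT.inter (convex_ball x2 (min δ₁ δ₂))).norm_image_sub_le_of_norm_hasDerivWithin_le
      (f := fun t => f (y1, t) - t • p₂ (x1, x2)) (f' := fun t => p₂ (y1, t) - p₂ (x1, x2))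
      (fun t ht => ?_) (fun t ht => ?_) ⟨hx'.2, Metric.mem_ball_self (lt_min hδ₁ hδ₂)⟩
      ⟨hy'.2, hy.2⟩
    · have := (h₂ (y1, t) ⟨hy'.1, ht.1⟩).mono (t := T) (s := T ∩ Metric.ball x2 (min δ₁ δ₂))
        inter_subset_left
      exact (this.sub ((hasDerivWithinAt_id t _).smul_const (p₂ (x1, x2)))).congr_deriv (by simp)
    · have := H₂ (x := (y1, t)) ⟨hy'.1, ht.1⟩ (by
        rw [Prod.dist_eq]
        exact max_lt (lt_of_lt_of_le hy.1 (min_le_right _ _))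
          (lt_of_lt_of_le ht.2 (min_le_right _ _)))
      rw [dist_eq_norm] at this
      exact this.le
  have e : f (y1, y2) - f (x1, x2) - ((ContinuousLinearMap.fst ℝ ℝ ℝ).smulRight (p₁ (x1, x2)) +
      (ContinuousLinearMap.snd ℝ ℝ ℝ).smulRight (p₂ (x1, x2))) ((y1, y2) - (x1, x2)) =
      ((f (y1, y2) - y2 • p₂ (x1, x2)) - (f (y1, x2) - x2 • p₂ (x1, x2))) +
      ((f (y1, x2) - y1 • p₁ (x1, x2)) - (f (x1, x2) - x1 • p₁ (x1, x2))) := by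
    simp [sub_smul]; abel
  rw [e]
  refine (norm_add_le _ _).trans ((add_le_add k₂ k₁).trans ?_)
  have n1 : ‖y1 - x1‖ ≤ ‖((y1, y2) : ℝ × ℝ) - (x1, x2)‖ := norm_fst_le ((y1, y2) - (x1, x2) : ℝ × ℝ)
  have n2 : ‖y2 - x2‖ ≤ ‖((y1, y2) : ℝ × ℝ) - (x1, x2)‖ := norm_snd_le ((y1, y2) - (x1, x2) : ℝ × ℝ)
  nlinarith

theorem contDiffOn_of_partials {S T : Set ℝ} (hS : Convex ℝ S) (hT : Convex ℝ T)
    (uS : UniqueDiffOn ℝ S) (uT : UniqueDiffOn ℝ T) {f p₁ p₂ : ℝ × ℝ → F}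
    (h₁ : ∀ x ∈ S ×ˢ T, HasDerivWithinAt (fun s => f (s, x.2)) (p₁ x) S x.1)
    (h₂ : ∀ x ∈ S ×ˢ T, HasDerivWithinAt (fun t => f (x.1, t)) (p₂ x) T x.2)
    (c₁ : ContinuousOn p₁ (S ×ˢ T)) (c₂ : ContinuousOn p₂ (S ×ˢ T)) :
    ContDiffOn ℝ 1 f (S ×ˢ T) := by
  have key := fun x (hx : x ∈ S ×ˢ T) => hasFDerivWithinAt_of_partials hS hT h₁ h₂ c₁ c₂ hx
  rw [show (1 : WithTop ℕ∞) = 0 + 1 by simp, contDiffOn_succ_iff_fderivWithin (uS.prod uT)]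
  refine ⟨fun x hx => (key x hx).differentiableWithinAt, by simp, contDiffOn_zero.2 ?_⟩
  refine ContinuousOn.congr (f := fun x => (ContinuousLinearMap.fst ℝ ℝ ℝ).smulRight (p₁ x) +
      (ContinuousLinearMap.snd ℝ ℝ ℝ).smulRight (p₂ x)) ?_
    fun x hx => (key x hx).fderivWithin ((uS.prod uT) x hx)
  have e : ∀ L : ℝ × ℝ →L[ℝ] ℝ, ∀ p : ℝ × ℝ → F, ContinuousOn p (S ×ˢ T) →
      ContinuousOn (fun x => L.smulRight (p x)) (S ×ˢ T) := fun L p hp =>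
    (ContinuousLinearMap.smulRightL ℝ (ℝ × ℝ) F L).continuous.comp_continuousOn hp
  exact (e _ _ c₁).add (e _ _ c₂)

end Partials

/-! ### The radial mean, including its value at the centre -/

section Average

variable {E : Type*} [NormedAddCommGroup E] [NormedSpace ℝ E]

/-- The radial mean `(1/r) ∫₀ʳ f`, written so that it makes sense at `r = 0`. -/
def avg (f : ℝ → E) (r : ℝ) : E := ∫ θ in (0 : ℝ)..1, f (θ * r)

theorem avg_eq (f : ℝ → E) {r : ℝ} (hr : r ≠ 0) : avg f r = r⁻¹ • ∫ s in (0 : ℝ)..r, f s := by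
  simp [avg, intervalIntegral.integral_comp_mul_right f hr]

theorem avg_zero [CompleteSpace E] (f : ℝ → E) : avg f 0 = f 0 := by simp [avg]

theorem smul_avg (f : ℝ → E) (r : ℝ) : r • avg f r = ∫ s in (0 : ℝ)..r, f s := by
  rcases eq_or_ne r 0 with rfl | hr
  · simp
  · rw [avg_eq f hr, smul_inv_smul₀ hr]

theorem continuous_avg_uncurry {w : ℝ → ℝ → E} (hw : Continuous fun p : ℝ × ℝ => w p.1 p.2) :
    Continuous fun p : ℝ × ℝ => avg (w p.1) p.2 := by
  unfold avg
  refine intervalIntegral.continuous_parametric_intervalIntegral_of_continuous'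
    (f := fun (p : ℝ × ℝ) θ => w p.1 (θ * p.2)) ?_ 0 1
  exact hw.comp (f := fun q : (ℝ × ℝ) × ℝ => (q.1.1, q.2 * q.1.2)) (by fun_prop)

theorem norm_avg_le {f : ℝ → E} {r B : ℝ} (hr : 0 ≤ r) (h : ∀ s ∈ Icc 0 r, ‖f s‖ ≤ B) :
    ‖avg f r‖ ≤ B := by
  have := intervalIntegral.norm_integral_le_of_norm_le_const (a := 0) (b := 1) (C := B)
    (f := fun θ => f (θ * r)) (fun θ hθ => by
      rw [uIoc_of_le zero_le_one] at hθ
      exact h _ ⟨mul_nonneg hθ.1.le hr, mul_le_of_le_one_left hr hθ.2⟩)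
  simpa [avg] using this

theorem avg_sub {f g : ℝ → E} (hf : Continuous f) (hg : Continuous g) (r : ℝ) :
    avg (fun s => f s - g s) r = avg f r - avg g r := by
  unfold avg
  refine intervalIntegral.integral_sub ?_ ?_ <;> apply Continuous.intervalIntegrable <;> fun_prop

theorem avg_const [CompleteSpace E] (c : E) (r : ℝ) : avg (fun _ => c) r = c := by simp [avg]

theorem avg_congr {f g : ℝ → E} {r : ℝ} (hr : 0 ≤ r) (h : ∀ s ∈ Icc 0 r, f s = g s) :
    avg f r = avg g r := by
  unfold avg
  refine intervalIntegral.integral_congr fun θ hθ => ?_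
  rw [uIcc_of_le zero_le_one] at hθ
  exact h _ ⟨mul_nonneg hθ.1 hr, mul_le_of_le_one_left hr hθ.2⟩

theorem hasDerivAt_avg [CompleteSpace E] {f : ℝ → E} (hf : Continuous f) {r : ℝ} (hr : r ≠ 0) :
    HasDerivAt (avg f) (r⁻¹ • (f r - avg f r)) r := by
  have h1 : HasDerivAt (fun r => ∫ s in (0 : ℝ)..r, f s) (f r) r :=
    intervalIntegral.integral_hasDerivAt_right (hf.intervalIntegrable _ _)
      (hf.stronglyMeasurableAtFilter _ _) hf.continuousAt
  have h2 := (hasDerivAt_inv hr).smul h1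
  have h3 : (fun r => r⁻¹ • ∫ s in (0 : ℝ)..r, f s) =ᶠ[𝓝 r] avg f := by
    filter_upwards [isOpen_ne.mem_nhds hr] with s hs using (avg_eq f hs).symm
  refine (h2.congr_of_eventuallyEq h3.symm).congr_deriv ?_
  rw [avg_eq f hr, smul_sub, smul_smul, sub_eq_add_neg, ← neg_smul]
  congr 2
  field_simp

end Average

theorem mean_eq_avg (f : ℝ → ℝ) (r : ℝ) : mean f r = avg f r := by
  unfold mean
  split_ifs with h
  · rw [h, avg_zero]
  · rw [avg_eq f h]; simp

end

section

/-! ### The functionals in complex form, normalized at the centre -/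

section Functionals

/-- Deviation from the radial mean. -/
def dm (f : ℝ → ℂ) (s : ℝ) : ℂ := f s - avg f s

def md (f : ℝ → ℂ) (s : ℝ) : ℝ := ‖dm f s‖ ^ 2 / s

/-- `g(r) / g(0)`. -/
def GG (f : ℝ → ℂ) (r : ℝ) : ℝ := Real.exp (∫ s in (0 : ℝ)..r, md f s)

/-- For f = h + ik this is the charge density h̄k - k̄h. -/
def JJ (f : ℝ → ℂ) (s : ℝ) : ℝ := (conj (avg f s) * f s).im

/-- The local charge. -/
def QQ (f : ℝ → ℂ) (r : ℝ) : ℝ := ∫ s in (0 : ℝ)..r, s * JJ f s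

def qq (f : ℝ → ℂ) (s : ℝ) : ℝ := QQ f s / s ^ 2

/-- The Yang-Mills potential divided by `g(0)`. -/
def ym (f : ℝ → ℂ) (r : ℝ) : ℝ := ∫ s in (0 : ℝ)..r, GG f s * qq f s

/-- The squared modulus of the Higgs field. -/
def hs (f : ℝ → ℂ) (r : ℝ) : ℝ := ‖avg f r‖ ^ 2

def dens (V : ℝ → ℝ) (f : ℝ → ℂ) (s : ℝ) : ℝ :=
  GG f s * (1 - 1 / 2 * (QQ f s * qq f s) - s ^ 2 * V (hs f s))

/-- `g̃(r) / g(0)`. -/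
def Gt (V : ℝ → ℝ) (f : ℝ → ℂ) (r : ℝ) : ℝ := avg (dens V f) r

def al (V : ℝ → ℝ) (f : ℝ → ℂ) (r : ℝ) : ℝ :=
  (GG f r - Gt V f r) / (2 * r) - r * qq f r ^ 2 * GG f r / 4 - r / 2 * (V (hs f r) * GG f r)

/-- The coefficient of `w` in the evolution equation. -/
def ca (V : ℝ → ℝ) (f : ℝ → ℂ) (r : ℝ) : ℂ := al V f r - (ym f r / 2 : ℝ) * Complex.I

/-- The part of the evolution equation that involves the mean of `w` only. -/
def cb (V V₁ : ℝ → ℝ) (f : ℝ → ℂ) (r : ℝ) : ℂ :=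
  -(al V f r : ℂ) * avg f r + (r * qq f r * GG f r / 4 : ℝ) * (Complex.I * conj (avg f r))
    - (r / 2 * GG f r : ℝ) * (V₁ (hs f r) * avg f r)

/-- A bounded Lipschitz profile. -/
structure Loc (B : ℝ) (f : ℝ → ℂ) : Prop where
  bdd : ∀ s, ‖f s‖ ≤ B
  lip : ∀ s t, ‖f s - f t‖ ≤ B * |s - t|

/-- The properties of the potential that the proof uses. -/
structure Pot (V V₁ V₂ : ℝ → ℝ) (K : ℝ) : Prop where
  nonneg : 0 ≤ K
  deriv : ∀ t, 0 ≤ t → HasDerivWithinAt V (V₁ t) (Ici 0) t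
  deriv₁ : ∀ t, 0 ≤ t → HasDerivWithinAt V₁ (V₂ t) (Ici 0) t
  cont₂ : ContinuousOn V₂ (Ici 0)
  bd₀ : ∀ t ∈ Icc (0 : ℝ) 1, |V t| ≤ K * t
  bd₁ : ∀ t ∈ Icc (0 : ℝ) 1, |V₁ t| ≤ K * t
  bd₂ : ∀ t ∈ Icc (0 : ℝ) 1, t * |V₂ t| ≤ K * t

theorem Pot.cont {V V₁ V₂ : ℝ → ℝ} {K : ℝ} (h : Pot V V₁ V₂ K) : ContinuousOn V (Ici 0) :=
  fun t ht => (h.deriv t ht).continuousWithinAt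

theorem Pot.cont₁ {V V₁ V₂ : ℝ → ℝ} {K : ℝ} (h : Pot V V₁ V₂ K) : ContinuousOn V₁ (Ici 0) :=
  fun t ht => (h.deriv₁ t ht).continuousWithinAt

variable {B : ℝ} {f : ℝ → ℂ} {V V₁ V₂ : ℝ → ℝ} {K : ℝ}

theorem Loc.nonneg (h : Loc B f) : 0 ≤ B := (norm_nonneg _).trans (h.bdd 0)

theorem Loc.continuous (h : Loc B f) : Continuous f :=
  LipschitzWith.continuous (K := ⟨B, h.nonneg⟩)
    (LipschitzWith.of_dist_le_mul fun x y => by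
      rw [dist_eq_norm, Real.dist_eq]; exact h.lip x y)

theorem norm_avg_le' {f : ℝ → ℂ} (h : ∀ s, ‖f s‖ ≤ B) (r : ℝ) : ‖avg f r‖ ≤ B := by
  have := intervalIntegral.norm_integral_le_of_norm_le_const (a := 0) (b := 1) (C := B)
    (f := fun θ => f (θ * r)) (fun θ _ => h _)
  simpa [avg] using this

theorem Loc.norm_avg_le (h : Loc B f) (r : ℝ) : ‖avg f r‖ ≤ B := norm_avg_le' h.bdd r

theorem dm_eq (hf : Continuous f) (s : ℝ) : dm f s = ∫ θ in (0 : ℝ)..1, (f s - f (θ * s)) := by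
  rw [intervalIntegral.integral_sub] <;>
    first | simp [dm, avg] | (apply Continuous.intervalIntegrable; fun_prop)

theorem Loc.norm_dm_le (h : Loc B f) (s : ℝ) : ‖dm f s‖ ≤ B * |s| := by
  rw [dm_eq h.continuous]
  have := intervalIntegral.norm_integral_le_of_norm_le_const (a := 0) (b := 1) (C := B * |s|)
    (f := fun θ => f s - f (θ * s)) (fun θ hθ => by
      rw [uIoc_of_le zero_le_one] at hθ
      refine (h.lip _ _).trans (mul_le_mul_of_nonneg_left ?_ h.nonneg)
      rw [show s - θ * s = (1 - θ) * s by ring, abs_mul, abs_of_nonneg (by linarith [hθ.2])]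
      nlinarith [abs_nonneg s, hθ.1])
  simpa using this

/-- The number conj(avg) · avg is real, so subtracting the mean from `f` does not change the
imaginary part. The charge density therefore carries a factor `dm f`, which vanishes at the centre.
-/
theorem JJ_eq (f : ℝ → ℂ) (s : ℝ) : JJ f s = (conj (avg f s) * dm f s).im := by
  simp only [JJ, dm, Complex.mul_im, Complex.conj_re, Complex.conj_im, Complex.sub_re,
    Complex.sub_im]
  ring

theorem abs_JJ_le (f : ℝ → ℂ) (s : ℝ) : |JJ f s| ≤ ‖avg f s‖ * ‖dm f s‖ := by
  rw [JJ_eq]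
  refine (Complex.abs_im_le_norm _).trans ?_
  simp

theorem abs_JJ_le' (f : ℝ → ℂ) (s : ℝ) : |JJ f s| ≤ ‖avg f s‖ * ‖f s‖ := by
  refine (Complex.abs_im_le_norm _).trans ?_
  simp

theorem md_nonneg (f : ℝ → ℂ) {s : ℝ} (hs : 0 ≤ s) : 0 ≤ md f s := by unfold md; positivity

/-- The deviation from the mean is O(s) for a Lipschitz profile, so its square absorbs the division
by s. -/
theorem Loc.abs_md_le (h : Loc B f) (s : ℝ) : |md f s| ≤ B ^ 2 * |s| := by
  rcases eq_or_ne s 0 with rfl | hs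
  · simp [md]
  · rw [md, abs_div, abs_of_nonneg (by positivity), div_le_iff₀ (abs_pos.2 hs)]
    calc ‖dm f s‖ ^ 2 ≤ (B * |s|) ^ 2 := by gcongr; exact h.norm_dm_le s
      _ = _ := by ring

theorem Loc.abs_JJ_le (h : Loc B f) (s : ℝ) : |JJ f s| ≤ B ^ 2 * |s| := by
  refine (EYMH.abs_JJ_le f s).trans ?_
  calc _ ≤ B * (B * |s|) := by
        gcongr
        · exact h.nonneg
        · exact h.norm_avg_le s
        · exact h.norm_dm_le s
    _ = _ := by ring

theorem Loc.abs_qq_le (h : Loc B f) (s : ℝ) : |qq f s| ≤ B ^ 2 * |s| := by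
  rcases eq_or_ne s 0 with rfl | hs
  · simp [qq]
  have hQ : ‖QQ f s‖ ≤ B ^ 2 * |s| ^ 2 * |s - 0| := by
    refine intervalIntegral.norm_integral_le_of_norm_le_const fun t ht => ?_
    have ht' : |t| ≤ |s| := by
      rcases le_total 0 s with h0 | h0
      · rw [uIoc_of_le h0] at ht
        rw [abs_of_pos ht.1, abs_of_nonneg h0]; exact ht.2
      · rw [uIoc_of_ge h0] at ht
        rw [abs_of_nonpos ht.2, abs_of_nonpos h0]; linarith [ht.1]
    rw [Real.norm_eq_abs, abs_mul]
    calc |t| * |JJ f t| ≤ |t| * (B ^ 2 * |t|) := by gcongr; exact h.abs_JJ_le t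
      _ = B ^ 2 * |t| ^ 2 := by ring
      _ ≤ _ := by gcongr
  rw [qq, abs_div, div_le_iff₀ (by positivity)]
  rw [sub_zero, Real.norm_eq_abs] at hQ
  refine hQ.trans (le_of_eq ?_)
  rw [abs_pow]; ring

end Functionals

/-! ### Joint continuity in time and radius -/

section JointContinuity

/-- This handles the functionals that contain a division by r: a linear bound forces the value and
the limit 0 on the axis, in agreement with the convention x/0 = 0. -/
theorem continuous_of_abs_le_mul {F : ℝ × ℝ → ℝ} {C : ℝ} (h : ∀ p : ℝ × ℝ, p.2 ≠ 0 → ContinuousAt F p)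
    (hb : ∀ p, |F p| ≤ C * |p.2|) : Continuous F := by
  refine continuous_iff_continuousAt.2 fun p => ?_
  rcases eq_or_ne p.2 0 with h0 | h0
  · have h1 : F p = 0 := by simpa [h0] using hb p
    rw [ContinuousAt, h1]
    refine squeeze_zero_norm hb ?_
    have : Continuous fun p : ℝ × ℝ => C * |p.2| := by fun_prop
    simpa [h0] using this.tendsto p
  · exact h p h0

variable {B K : ℝ} {w : ℝ → ℝ → ℂ} {V V₁ V₂ : ℝ → ℝ}

/-- A jointly continuous family of bounded Lipschitz profiles. -/
structure Fam (B : ℝ) (w : ℝ → ℝ → ℂ) : Prop where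
  cont : Continuous fun p : ℝ × ℝ => w p.1 p.2
  loc : ∀ τ, Loc B (w τ)

theorem Fam.avg (h : Fam B w) : Continuous fun p : ℝ × ℝ => avg (w p.1) p.2 :=
  continuous_avg_uncurry h.cont

theorem Fam.dm (h : Fam B w) : Continuous fun p : ℝ × ℝ => dm (w p.1) p.2 := h.cont.sub h.avg

theorem Fam.hs (h : Fam B w) : Continuous fun p : ℝ × ℝ => hs (w p.1) p.2 := h.avg.norm.pow 2

theorem Fam.md (h : Fam B w) : Continuous fun p : ℝ × ℝ => md (w p.1) p.2 :=
  continuous_of_abs_le_mul (fun p hp => by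
    unfold EYMH.md
    exact (h.dm.norm.pow 2).continuousAt.div continuous_snd.continuousAt hp)
    fun p => (h.loc p.1).abs_md_le p.2

theorem Fam.GG (h : Fam B w) : Continuous fun p : ℝ × ℝ => GG (w p.1) p.2 := by
  unfold EYMH.GG
  refine Real.continuous_exp.comp ?_
  refine intervalIntegral.continuous_parametric_intervalIntegral_of_continuous
    (f := fun (p : ℝ × ℝ) s => EYMH.md (w p.1) s) ?_ continuous_snd
  exact h.md.comp (f := fun q : (ℝ × ℝ) × ℝ => (q.1.1, q.2)) (by fun_prop)

theorem Fam.JJ (h : Fam B w) : Continuous fun p : ℝ × ℝ => JJ (w p.1) p.2 :=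
  Complex.continuous_im.comp ((Complex.continuous_conj.comp h.avg).mul h.cont)

theorem Fam.QQ (h : Fam B w) : Continuous fun p : ℝ × ℝ => QQ (w p.1) p.2 := by
  unfold EYMH.QQ
  refine intervalIntegral.continuous_parametric_intervalIntegral_of_continuous
    (f := fun (p : ℝ × ℝ) s => s * EYMH.JJ (w p.1) s) ?_ continuous_snd
  exact continuous_snd.mul (h.JJ.comp (f := fun q : (ℝ × ℝ) × ℝ => (q.1.1, q.2)) (by fun_prop))

theorem Fam.qq (h : Fam B w) : Continuous fun p : ℝ × ℝ => qq (w p.1) p.2 :=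
  continuous_of_abs_le_mul (fun p hp => by
    unfold EYMH.qq
    exact h.QQ.continuousAt.div (continuous_snd.pow 2).continuousAt (pow_ne_zero 2 hp))
    fun p => (h.loc p.1).abs_qq_le p.2

theorem Fam.ym (h : Fam B w) : Continuous fun p : ℝ × ℝ => ym (w p.1) p.2 := by
  unfold EYMH.ym
  refine intervalIntegral.continuous_parametric_intervalIntegral_of_continuous
    (f := fun (p : ℝ × ℝ) s => EYMH.GG (w p.1) s * EYMH.qq (w p.1) s) ?_ continuous_snd
  exact (h.GG.mul h.qq).comp (f := fun q : (ℝ × ℝ) × ℝ => (q.1.1, q.2)) (by fun_prop)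

theorem Fam.comp_hs (h : Fam B w) {U : ℝ → ℝ} (hU : ContinuousOn U (Ici 0)) :
    Continuous fun p : ℝ × ℝ => U (EYMH.hs (w p.1) p.2) :=
  hU.comp_continuous h.hs fun p => by simp only [mem_Ici, EYMH.hs]; positivity

theorem Fam.dens (h : Fam B w) (hV : ContinuousOn V (Ici 0)) :
    Continuous fun p : ℝ × ℝ => dens V (w p.1) p.2 := by
  unfold EYMH.dens
  exact h.GG.mul ((continuous_const.sub (continuous_const.mul (h.QQ.mul h.qq))).sub
    ((continuous_snd.pow 2).mul (h.comp_hs hV)))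

theorem Fam.Gt (h : Fam B w) (hV : ContinuousOn V (Ici 0)) :
    Continuous fun p : ℝ × ℝ => Gt V (w p.1) p.2 :=
  continuous_avg_uncurry (w := fun τ => EYMH.dens V (w τ)) (h.dens hV)

theorem Fam.al (h : Fam B w) (hV : ContinuousOn V (Ici 0)) :
    ContinuousOn (fun p : ℝ × ℝ => al V (w p.1) p.2) {p | 0 < p.2} := by
  have h1 : ContinuousOn (fun p : ℝ × ℝ => (EYMH.GG (w p.1) p.2 - EYMH.Gt V (w p.1) p.2) / (2 * p.2))
      {p | 0 < p.2} := (h.GG.sub (h.Gt hV)).continuousOn.div (by fun_prop)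
        fun p hp => by have : 0 < p.2 := hp; positivity
  have h2 : Continuous (fun p : ℝ × ℝ => p.2 * EYMH.qq (w p.1) p.2 ^ 2 * EYMH.GG (w p.1) p.2 / 4) :=
    ((continuous_snd.mul (h.qq.pow 2)).mul h.GG).div_const 4
  have h3 : Continuous (fun p : ℝ × ℝ =>
      p.2 / 2 * (V (EYMH.hs (w p.1) p.2) * EYMH.GG (w p.1) p.2)) :=
    (continuous_snd.div_const 2).mul ((h.comp_hs hV).mul h.GG)
  exact (h1.sub h2.continuousOn).sub h3.continuousOn

/-- A single profile as a family. -/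
theorem Loc.fam {f : ℝ → ℂ} (h : Loc B f) : Fam B fun _ => f :=
  ⟨h.continuous.comp continuous_snd, fun _ => h⟩

theorem Fam.slice {E : Type*} [TopologicalSpace E] {F : ℝ × ℝ → E} (h : Continuous F) (τ : ℝ) :
    Continuous fun r : ℝ => F (τ, r) := h.comp (by fun_prop)

end JointContinuity

/-! ### Radial derivatives of the functionals -/

section RadialDerivatives

variable {B K : ℝ} {f : ℝ → ℂ} {V V₁ V₂ : ℝ → ℝ}

theorem Loc.hasDerivAt_avg (h : Loc B f) {r : ℝ} (hr : 0 < r) :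
    HasDerivAt (avg f) (dm f r / r) r := by
  refine (EYMH.hasDerivAt_avg h.continuous hr.ne').congr_deriv ?_
  rw [dm, div_eq_inv_mul, Complex.real_smul, Complex.ofReal_inv]

theorem hasDerivAt_primitive {g : ℝ → ℝ} (hg : Continuous g) (r : ℝ) :
    HasDerivAt (fun r => ∫ s in (0 : ℝ)..r, g s) (g r) r :=
  intervalIntegral.integral_hasDerivAt_right (hg.intervalIntegrable _ _)
      (hg.stronglyMeasurableAtFilter _ _) hg.continuousAt

theorem Loc.hasDerivAt_GG (h : Loc B f) (r : ℝ) : HasDerivAt (GG f) (GG f r * md f r) r :=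
  (hasDerivAt_primitive (Fam.slice h.fam.md 0) r).exp

theorem Loc.hasDerivAt_QQ (h : Loc B f) (r : ℝ) : HasDerivAt (QQ f) (r * JJ f r) r :=
  hasDerivAt_primitive (continuous_id.mul (Fam.slice h.fam.JJ 0)) r

def dqq (f : ℝ → ℂ) (r : ℝ) : ℝ := JJ f r / r - 2 * qq f r / r

theorem Loc.hasDerivAt_qq (h : Loc B f) {r : ℝ} (hr : 0 < r) : HasDerivAt (qq f) (dqq f r) r := by
  refine ((h.hasDerivAt_QQ r).div ((hasDerivAt_id r).pow 2) (by simp [hr.ne'])).congr_deriv ?_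
  simp [dqq, qq]; field_simp

theorem Loc.hasDerivAt_ym (h : Loc B f) (r : ℝ) : HasDerivAt (ym f) (GG f r * qq f r) r :=
  hasDerivAt_primitive ((Fam.slice h.fam.GG 0).mul (Fam.slice h.fam.qq 0)) r

theorem Loc.hasDerivAt_Gt (h : Loc B f) (hV : ContinuousOn V (Ici 0)) {r : ℝ} (hr : 0 < r) :
    HasDerivAt (Gt V f) ((dens V f r - Gt V f r) / r) r := by
  refine (EYMH.hasDerivAt_avg (Fam.slice (h.fam.dens hV) 0) hr.ne').congr_deriv ?_
  rw [Gt, div_eq_inv_mul, smul_eq_mul]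

def dhs (f : ℝ → ℂ) (r : ℝ) : ℝ := 2 * (conj (avg f r) * dm f r).re / r

theorem Loc.hasDerivAt_hs (h : Loc B f) {r : ℝ} (hr : 0 < r) : HasDerivAt (hs f) (dhs f r) r := by
  have := (h.hasDerivAt_avg hr).norm_sq
  refine this.congr_deriv ?_
  rw [dhs, Complex.inner]
  rw [show dm f r / (r : ℂ) = ((r⁻¹ : ℝ) : ℂ) * dm f r by push_cast; ring]
  simp [Complex.mul_re, Complex.mul_im]
  field_simp
  try ring

theorem Loc.hasDerivAt_comp_hs (h : Loc B f) {U U' : ℝ → ℝ}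
    (hU : ∀ t, 0 ≤ t → HasDerivWithinAt U (U' t) (Ici 0) t) {r : ℝ} (hr : 0 < r) :
    HasDerivAt (fun r => U (hs f r)) (U' (hs f r) * dhs f r) r := by
  have h0 : ∀ r, 0 ≤ hs f r := fun r => by unfold hs; positivity
  exact hasDerivWithinAt_univ.1
    ((hU _ (h0 r)).comp r (h.hasDerivAt_hs hr).hasDerivWithinAt fun s _ => h0 s)

/-- The radial derivative of `al`. -/
def dal (V V₁ : ℝ → ℝ) (f : ℝ → ℂ) (r : ℝ) : ℝ :=
  (GG f r * md f r - (dens V f r - Gt V f r) / r) / (2 * r) - (GG f r - Gt V f r) / (2 * r ^ 2)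
    - (qq f r ^ 2 * GG f r + r * (2 * qq f r * dqq f r) * GG f r
        + r * qq f r ^ 2 * (GG f r * md f r)) / 4
    - (V (hs f r) * GG f r + r * (V₁ (hs f r) * dhs f r) * GG f r
        + r * V (hs f r) * (GG f r * md f r)) / 2

theorem Loc.hasDerivAt_al (h : Loc B f) (hV : Pot V V₁ V₂ K) {r : ℝ} (hr : 0 < r) :
    HasDerivAt (al V f) (dal V V₁ f r) r := by
  have hG := h.hasDerivAt_GG r
  have ht := h.hasDerivAt_Gt hV.cont hr
  have hq := h.hasDerivAt_qq hr
  have hU := h.hasDerivAt_comp_hs hV.deriv hr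
  have h1 := (hG.sub ht).div ((hasDerivAt_id r).const_mul 2) (by simp [hr.ne'])
  have h2 := ((((hasDerivAt_id r).mul (hq.pow 2)).mul hG).div_const 4)
  have h3 := ((hasDerivAt_id r).div_const 2).mul (hU.mul hG)
  refine ((h1.sub h2).sub h3).congr_deriv ?_
  simp [dal]
  field_simp
  ring

/-- The radial derivative of `ca`. -/
def dca (V V₁ : ℝ → ℝ) (f : ℝ → ℂ) (r : ℝ) : ℂ :=
  dal V V₁ f r - (GG f r * qq f r / 2 : ℝ) * Complex.I

theorem Loc.hasDerivAt_ca (h : Loc B f) (hV : Pot V V₁ V₂ K) {r : ℝ} (hr : 0 < r) :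
    HasDerivAt (ca V f) (dca V V₁ f r) r :=
  (h.hasDerivAt_al hV hr).ofReal_comp.sub
    (((h.hasDerivAt_ym r).div_const 2).ofReal_comp.mul_const Complex.I)

/-- The radial derivative of `cb` apart from the term `-al' * avg`. -/
def dcb₁ (V V₁ V₂ : ℝ → ℝ) (f : ℝ → ℂ) (r : ℝ) : ℂ :=
  -(al V f r : ℂ) * (dm f r / r)
    + (((qq f r * GG f r + r * dqq f r * GG f r + r * qq f r * (GG f r * md f r)) / 4 : ℝ)
        * (Complex.I * conj (avg f r))
      + (r * qq f r * GG f r / 4 : ℝ) * (Complex.I * conj (dm f r / r)))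
    - (((GG f r + r * (GG f r * md f r)) / 2 : ℝ) * (V₁ (hs f r) * avg f r)
      + (r / 2 * GG f r : ℝ) * ((V₂ (hs f r) * dhs f r : ℝ) * avg f r
          + V₁ (hs f r) * (dm f r / r)))

/-- The radial derivative of `cb`. -/
def dcb (V V₁ V₂ : ℝ → ℝ) (f : ℝ → ℂ) (r : ℝ) : ℂ :=
  -(dal V V₁ f r : ℂ) * avg f r + dcb₁ V V₁ V₂ f r

theorem Loc.hasDerivAt_cb (h : Loc B f) (hV : Pot V V₁ V₂ K) {r : ℝ} (hr : 0 < r) :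
    HasDerivAt (cb V V₁ f) (dcb V V₁ V₂ f r) r := by
  have hG := h.hasDerivAt_GG r
  have hq := h.hasDerivAt_qq hr
  have ha := h.hasDerivAt_avg hr
  have hac : HasDerivAt (fun r => conj (avg f r)) (conj (dm f r / r)) r := ha.star
  have hU := (h.hasDerivAt_comp_hs hV.deriv₁ hr).ofReal_comp
  have h1 := (h.hasDerivAt_al hV hr).ofReal_comp.neg.mul ha
  have h2 := ((((hasDerivAt_id r).mul hq).mul hG).div_const 4).ofReal_comp.mul
    (hac.const_mul Complex.I)
  have h3 := (((hasDerivAt_id r).div_const 2).mul hG).ofReal_comp.mul (hU.mul ha)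
  refine ((h1.add h2).sub h3).congr_deriv ?_
  simp [dcb, dcb₁]
  ring

end RadialDerivatives

/-! ### Continuity of the radial derivatives away from the centre -/

section DerivContinuity

variable {B K : ℝ} {w : ℝ → ℝ → ℂ} {V V₁ V₂ : ℝ → ℝ}

theorem continuousOn_snd_div {F : ℝ × ℝ → ℝ} (hF : ContinuousOn F {p | 0 < p.2}) :
    ContinuousOn (fun p : ℝ × ℝ => F p / p.2) {p | 0 < p.2} :=
  hF.div continuous_snd.continuousOn fun p hp => (show (0 : ℝ) < p.2 from hp).ne'

theorem Fam.dqq (h : Fam B w) : ContinuousOn (fun p : ℝ × ℝ => dqq (w p.1) p.2) {p | 0 < p.2} :=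
  (continuousOn_snd_div h.JJ.continuousOn).sub
    (continuousOn_snd_div (continuous_const.mul h.qq).continuousOn)

theorem Fam.dhs (h : Fam B w) : ContinuousOn (fun p : ℝ × ℝ => dhs (w p.1) p.2) {p | 0 < p.2} :=
  continuousOn_snd_div (continuous_const.mul (Complex.continuous_re.comp
    ((Complex.continuous_conj.comp h.avg).mul h.dm))).continuousOn

theorem Fam.dal (h : Fam B w) (hV : Pot V V₁ V₂ K) :
    ContinuousOn (fun p : ℝ × ℝ => dal V V₁ (w p.1) p.2) {p | 0 < p.2} := by
  have hG := h.GG.continuousOn (s := {p | 0 < p.2})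
  have ht := (h.Gt hV.cont).continuousOn (s := {p | 0 < p.2})
  have hd := (h.dens hV.cont).continuousOn (s := {p | 0 < p.2})
  have hm := h.md.continuousOn (s := {p | 0 < p.2})
  have hq := h.qq.continuousOn (s := {p | 0 < p.2})
  have hdq := h.dqq
  have hU := (h.comp_hs hV.cont).continuousOn (s := {p | 0 < p.2})
  have hU₁ := (h.comp_hs hV.cont₁).continuousOn (s := {p | 0 < p.2})
  have hdh := h.dhs
  have hs : ContinuousOn (fun p : ℝ × ℝ => p.2) {p | 0 < p.2} := continuous_snd.continuousOn
  unfold EYMH.dal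
  refine ((ContinuousOn.sub ?_ ?_).sub ?_).sub ?_
  · exact ((hG.mul hm).sub (continuousOn_snd_div (hd.sub ht))).div (continuousOn_const.mul hs)
      fun p hp => by have : 0 < p.2 := hp; positivity
  · exact (hG.sub ht).div (continuousOn_const.mul (hs.pow 2))
      fun p hp => by have : 0 < p.2 := hp; positivity
  · exact ((((hq.pow 2).mul hG).add ((hs.mul ((continuousOn_const.mul hq).mul hdq)).mul hG)).add
      ((hs.mul (hq.pow 2)).mul (hG.mul hm))).div_const 4
  · exact (((hU.mul hG).add ((hs.mul (hU₁.mul hdh)).mul hG)).add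
      ((hs.mul hU).mul (hG.mul hm))).div_const 2

theorem Fam.ca (h : Fam B w) (hV : ContinuousOn V (Ici 0)) :
    ContinuousOn (fun p : ℝ × ℝ => ca V (w p.1) p.2) {p | 0 < p.2} :=
  (Complex.continuous_ofReal.comp_continuousOn (h.al hV)).sub
    ((Complex.continuous_ofReal.comp (h.ym.div_const 2)).mul continuous_const).continuousOn

theorem Fam.dca (h : Fam B w) (hV : Pot V V₁ V₂ K) :
    ContinuousOn (fun p : ℝ × ℝ => dca V V₁ (w p.1) p.2) {p | 0 < p.2} :=
  (Complex.continuous_ofReal.comp_continuousOn (h.dal hV)).sub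
    ((Complex.continuous_ofReal.comp ((h.GG.mul h.qq).div_const 2)).mul
      continuous_const).continuousOn

theorem Fam.cb (h : Fam B w) (hV : Pot V V₁ V₂ K) :
    ContinuousOn (fun p : ℝ × ℝ => cb V V₁ (w p.1) p.2) {p | 0 < p.2} := by
  have hc := Complex.continuous_ofReal
  refine (((hc.comp_continuousOn (h.al hV.cont)).neg.mul h.avg.continuousOn).add
    (Continuous.continuousOn ?_)).sub (Continuous.continuousOn ?_)
  · exact (hc.comp (((continuous_snd.mul h.qq).mul h.GG).div_const 4)).mul
      (continuous_const.mul (Complex.continuous_conj.comp h.avg))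
  · exact (hc.comp ((continuous_snd.div_const 2).mul h.GG)).mul
      ((hc.comp (h.comp_hs hV.cont₁)).mul h.avg)

theorem Fam.dm_div (h : Fam B w) :
    ContinuousOn (fun p : ℝ × ℝ => EYMH.dm (w p.1) p.2 / p.2) {p | 0 < p.2} :=
  h.dm.continuousOn.div (Complex.continuous_ofReal.comp continuous_snd).continuousOn
    fun p hp => Complex.ofReal_ne_zero.2 (show (0 : ℝ) < p.2 from hp).ne'

theorem Fam.dcb₁ (h : Fam B w) (hV : Pot V V₁ V₂ K) :
    ContinuousOn (fun p : ℝ × ℝ => dcb₁ V V₁ V₂ (w p.1) p.2) {p | 0 < p.2} := by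
  have hc := Complex.continuous_ofReal
  have hG := h.GG.continuousOn (s := {p | 0 < p.2})
  have ha := h.avg.continuousOn (s := {p | 0 < p.2})
  have hm := h.md.continuousOn (s := {p | 0 < p.2})
  have hq := h.qq.continuousOn (s := {p | 0 < p.2})
  have hdq := h.dqq
  have hU₂ := (h.comp_hs hV.cont₂).continuousOn (s := {p | 0 < p.2})
  have hU₁ := hc.comp_continuousOn ((h.comp_hs hV.cont₁).continuousOn (s := {p | 0 < p.2}))
  have hdh := h.dhs
  have hs : ContinuousOn (fun p : ℝ × ℝ => p.2) {p | 0 < p.2} := continuous_snd.continuousOn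
  have he := h.dm_div
  unfold EYMH.dcb₁
  refine (ContinuousOn.add ?_ (ContinuousOn.add ?_ ?_)).sub (ContinuousOn.add ?_ ?_)
  · exact (hc.comp_continuousOn (h.al hV.cont)).neg.mul he
  · exact (hc.comp_continuousOn ((((hq.mul hG).add ((hs.mul hdq).mul hG)).add
      ((hs.mul hq).mul (hG.mul hm))).div_const 4)).mul
      (continuousOn_const.mul (Complex.continuous_conj.comp_continuousOn ha))
  · exact (hc.comp_continuousOn (((hs.mul hq).mul hG).div_const 4)).mul
      (continuousOn_const.mul (Complex.continuous_conj.comp_continuousOn he))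
  · exact (hc.comp_continuousOn ((hG.add (hs.mul (hG.mul hm))).div_const 2)).mul (hU₁.mul ha)
  · exact (hc.comp_continuousOn ((hs.div_const 2).mul hG)).mul
      (((hc.comp_continuousOn (hU₂.mul hdh)).mul ha).add (hU₁.mul he))

theorem Fam.dcb (h : Fam B w) (hV : Pot V V₁ V₂ K) :
    ContinuousOn (fun p : ℝ × ℝ => dcb V V₁ V₂ (w p.1) p.2) {p | 0 < p.2} :=
  ((Complex.continuous_ofReal.comp_continuousOn (h.dal hV)).neg.mul h.avg.continuousOn).add
    (h.dcb₁ hV)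

end DerivContinuity

end

section

/-! ### A calculus of orders of vanishing and causal Lipschitz bounds -/

section LocalControl

variable {E : Type*} [NormedAddCommGroup E] [NormedSpace ℝ E] {B R : ℝ}

/-- `Φ f r` is `O(r ^ k)` and Lipschitz in `f` with constant `O(r ^ k)`, uniformly for `r ∈ [0, R]`
and `f` bounded and Lipschitz. -/
def Ctl (B R : ℝ) (k : ℕ) (Φ : (ℝ → ℂ) → ℝ → E) : Prop :=
  ∃ L, 0 ≤ L ∧ ∀ f, Loc B f → ∀ r ∈ Icc 0 R, ‖Φ f r‖ ≤ L * r ^ k ∧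
    ∀ g, Loc B g → ∀ d, 0 ≤ d → (∀ s ∈ Icc 0 r, ‖f s - g s‖ ≤ d) →
      ‖Φ f r - Φ g r‖ ≤ L * r ^ k * d

variable {k l : ℕ} {Φ Ψ : (ℝ → ℂ) → ℝ → E}

theorem Ctl.congr (h : Ctl B R k Φ) (e : ∀ f, Loc B f → ∀ r ∈ Icc 0 R, Φ f r = Ψ f r) :
    Ctl B R k Ψ := by
  obtain ⟨L, hL, h⟩ := h
  refine ⟨L, hL, fun f hf r hr => ?_⟩
  rw [← e f hf r hr]
  refine ⟨(h f hf r hr).1, fun g hg d hd hs => ?_⟩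
  rw [← e g hg r hr]
  exact (h f hf r hr).2 g hg d hd hs

theorem Ctl.add (h₁ : Ctl B R k Φ) (h₂ : Ctl B R k Ψ) : Ctl B R k fun f r => Φ f r + Ψ f r := by
  obtain ⟨L₁, hL₁, h₁⟩ := h₁
  obtain ⟨L₂, hL₂, h₂⟩ := h₂
  refine ⟨L₁ + L₂, by positivity, fun f hf r hr => ⟨?_, fun g hg d hd hs => ?_⟩⟩
  · refine (norm_add_le _ _).trans ?_
    have := (h₁ f hf r hr).1; have := (h₂ f hf r hr).1
    linarith
  · rw [add_sub_add_comm]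
    refine (norm_add_le _ _).trans ?_
    have := (h₁ f hf r hr).2 g hg d hd hs; have := (h₂ f hf r hr).2 g hg d hd hs
    linarith

theorem Ctl.neg (h : Ctl B R k Φ) : Ctl B R k fun f r => -Φ f r := by
  obtain ⟨L, hL, h⟩ := h
  refine ⟨L, hL, fun f hf r hr => ⟨by rw [norm_neg]; exact (h f hf r hr).1,
    fun g hg d hd hs => ?_⟩⟩
  rw [neg_sub_neg, norm_sub_rev]
  exact (h f hf r hr).2 g hg d hd hs

theorem Ctl.sub (h₁ : Ctl B R k Φ) (h₂ : Ctl B R k Ψ) : Ctl B R k fun f r => Φ f r - Ψ f r :=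
  (h₁.add h₂.neg).congr fun f _ r _ => (sub_eq_add_neg _ _).symm

theorem Ctl.mul {A : Type*} [NormedRing A] [NormedSpace ℝ A] {Φ Ψ : (ℝ → ℂ) → ℝ → A}
    (h₁ : Ctl B R k Φ) (h₂ : Ctl B R l Ψ) :
    Ctl B R (k + l) fun f r => Φ f r * Ψ f r := by
  obtain ⟨L₁, hL₁, h₁⟩ := h₁
  obtain ⟨L₂, hL₂, h₂⟩ := h₂
  refine ⟨2 * (L₁ * L₂), by positivity, fun f hf r hr => ⟨?_, fun g hg d hd hs => ?_⟩⟩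
  · have hr0 : 0 ≤ r := hr.1
    calc _ ≤ ‖Φ f r‖ * ‖Ψ f r‖ := norm_mul_le _ _
      _ ≤ (L₁ * r ^ k) * (L₂ * r ^ l) :=
        mul_le_mul (h₁ f hf r hr).1 (h₂ f hf r hr).1 (norm_nonneg _) (by positivity)
      _ = L₁ * L₂ * r ^ (k + l) := by ring
      _ ≤ _ := mul_le_mul_of_nonneg_right (by nlinarith [mul_nonneg hL₁ hL₂]) (by positivity)
  · have hr0 : 0 ≤ r := hr.1
    have e : Φ f r * Ψ f r - Φ g r * Ψ g r =
      (Φ f r - Φ g r) * Ψ f r + Φ g r * (Ψ f r - Ψ g r) := by noncomm_ring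
    rw [e]
    calc _ ≤ ‖Φ f r - Φ g r‖ * ‖Ψ f r‖ + ‖Φ g r‖ * ‖Ψ f r - Ψ g r‖ :=
          (norm_add_le _ _).trans (add_le_add (norm_mul_le _ _) (norm_mul_le _ _))
      _ ≤ (L₁ * r ^ k * d) * (L₂ * r ^ l) + (L₁ * r ^ k) * (L₂ * r ^ l * d) :=
        add_le_add (mul_le_mul ((h₁ f hf r hr).2 g hg d hd hs) (h₂ f hf r hr).1 (norm_nonneg _)
          (by positivity)) (mul_le_mul (h₁ g hg r hr).1 ((h₂ f hf r hr).2 g hg d hd hs)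
          (norm_nonneg _) (by positivity))
      _ = _ := by ring

/-- On [0, R] a surplus power of r is at most R, so it may be traded for a constant. -/
theorem Ctl.lower (h : Ctl B R (k + 1) Φ) (hR : 0 ≤ R) : Ctl B R k Φ := by
  obtain ⟨L, hL, h⟩ := h
  have e : ∀ r ∈ Icc 0 R, L * r ^ (k + 1) ≤ L * R * r ^ k := fun r hr => by
    have h0 : 0 ≤ r := hr.1
    calc L * r ^ (k + 1) = L * r * r ^ k := by ring
      _ ≤ _ := by gcongr; exact hr.2
  refine ⟨L * R, by positivity, fun f hf r hr => ⟨(h f hf r hr).1.trans (e r hr),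
    fun g hg d hd hs => ((h f hf r hr).2 g hg d hd hs).trans ?_⟩⟩
  exact mul_le_mul_of_nonneg_right (e r hr) hd

theorem Ctl.const (c : E) : Ctl B R 0 fun _ _ => c :=
  ⟨‖c‖, norm_nonneg _, fun f hf r hr => ⟨by simp, fun g hg d hd hs => by simp; positivity⟩⟩

theorem Ctl.id : Ctl B R 1 fun _ r => r :=
  ⟨1, zero_le_one, fun f hf r hr => ⟨by simp [abs_of_nonneg hr.1], fun g hg d hd hs => by
    simp; exact mul_nonneg hr.1 hd⟩⟩

/-- Division by r costs exactly one order. At r = 0 the quotient is 0 by convention, so the bounds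
hold there too. -/
theorem Ctl.div_id {Φ : (ℝ → ℂ) → ℝ → ℝ} (h : Ctl B R (k + 1) Φ) :
    Ctl B R k fun f r => Φ f r / r := by
  obtain ⟨L, hL, h⟩ := h
  refine ⟨L, hL, fun f hf r hr => ?_⟩
  rcases hr.1.eq_or_lt with rfl | h0
  · refine ⟨by simp only [div_zero, norm_zero]; positivity, fun g hg d hd hs => ?_⟩
    simp only [div_zero, sub_zero, norm_zero]; positivity
  refine ⟨?_, fun g hg d hd hs => ?_⟩
  · rw [norm_div, Real.norm_of_nonneg h0.le, div_le_iff₀ h0]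
    refine (h f hf r hr).1.trans (le_of_eq ?_); ring
  · rw [← sub_div, norm_div, Real.norm_of_nonneg h0.le, div_le_iff₀ h0]
    refine ((h f hf r hr).2 g hg d hd hs).trans (le_of_eq ?_); ring

theorem Ctl.integral {Φ : (ℝ → ℂ) → ℝ → ℝ} (h : Ctl B R k Φ)
    (hc : ∀ f, Loc B f → Continuous (Φ f)) :
    Ctl B R (k + 1) fun f r => ∫ s in (0 : ℝ)..r, Φ f s := by
  obtain ⟨L, hL, h⟩ := h
  refine ⟨L, hL, fun f hf r hr => ⟨?_, fun g hg d hd hs => ?_⟩⟩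
  · have := intervalIntegral.norm_integral_le_of_norm_le_const (a := 0) (b := r) (C := L * r ^ k)
      (f := Φ f) (fun s hs => by
        rw [uIoc_of_le hr.1] at hs
        refine (h f hf s ⟨hs.1.le, hs.2.trans hr.2⟩).1.trans ?_
        have := hs.1.le; have := hs.2
        gcongr)
    refine this.trans (le_of_eq ?_)
    rw [sub_zero, abs_of_nonneg hr.1]; ring
  · rw [← intervalIntegral.integral_sub ((hc f hf).intervalIntegrable _ _)
      ((hc g hg).intervalIntegrable _ _)]
    have := intervalIntegral.norm_integral_le_of_norm_le_const (a := 0) (b := r)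
      (C := L * r ^ k * d) (f := fun s => Φ f s - Φ g s) (fun s hs' => by
        rw [uIoc_of_le hr.1] at hs'
        refine ((h f hf s ⟨hs'.1.le, hs'.2.trans hr.2⟩).2 g hg d hd fun t ht =>
          hs t ⟨ht.1, ht.2.trans hs'.2⟩).trans ?_
        have := hs'.1.le; have := hs'.2
        gcongr)
    refine this.trans (le_of_eq ?_)
    rw [sub_zero, abs_of_nonneg hr.1]; ring

theorem Ctl.avg (h : Ctl B R k Φ) (hc : ∀ f, Loc B f → Continuous (Φ f)) :
    Ctl B R k fun f r => avg (Φ f) r := by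
  obtain ⟨L, hL, h⟩ := h
  refine ⟨L, hL, fun f hf r hr => ⟨?_, fun g hg d hd hs => ?_⟩⟩
  · refine EYMH.norm_avg_le hr.1 fun s hs => (h f hf s ⟨hs.1, hs.2.trans hr.2⟩).1.trans ?_
    have := hs.1; have := hs.2
    gcongr
  · rw [← avg_sub (hc f hf) (hc g hg)]
    refine EYMH.norm_avg_le hr.1 fun s hs' => ((h f hf s ⟨hs'.1, hs'.2.trans hr.2⟩).2 g hg d hd
      fun t ht => hs t ⟨ht.1, ht.2.trans hs'.2⟩).trans ?_
    have := hs'.1; have := hs'.2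
    gcongr

theorem Ctl.ofReal {Φ : (ℝ → ℂ) → ℝ → ℝ} (h : Ctl B R k Φ) :
    Ctl B R k fun f r => (Φ f r : ℂ) := by
  obtain ⟨L, hL, h⟩ := h
  refine ⟨L, hL, fun f hf r hr => ⟨?_, fun g hg d hd hs => ?_⟩⟩
  · rw [Complex.norm_real]; exact (h f hf r hr).1
  · rw [← Complex.ofReal_sub, Complex.norm_real]; exact (h f hf r hr).2 g hg d hd hs

theorem Ctl.conj {Φ : (ℝ → ℂ) → ℝ → ℂ} (h : Ctl B R k Φ) :
    Ctl B R k fun f r => (starRingEnd ℂ) (Φ f r) := by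
  obtain ⟨L, hL, h⟩ := h
  refine ⟨L, hL, fun f hf r hr => ⟨?_, fun g hg d hd hs => ?_⟩⟩
  · rw [Complex.norm_conj]; exact (h f hf r hr).1
  · rw [← map_sub, Complex.norm_conj]; exact (h f hf r hr).2 g hg d hd hs

theorem Ctl.im {Φ : (ℝ → ℂ) → ℝ → ℂ} (h : Ctl B R k Φ) : Ctl B R k fun f r => (Φ f r).im := by
  obtain ⟨L, hL, h⟩ := h
  refine ⟨L, hL, fun f hf r hr => ⟨?_, fun g hg d hd hs => ?_⟩⟩
  · exact (Complex.abs_im_le_norm _).trans (h f hf r hr).1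
  · rw [← Complex.sub_im]
    exact (Complex.abs_im_le_norm _).trans ((h f hf r hr).2 g hg d hd hs)

/-- Composition with a function that is Lipschitz on the relevant range. -/
theorem Ctl.comp {Φ : (ℝ → ℂ) → ℝ → ℝ} (h : Ctl B R k Φ) {S : Set ℝ}
    (hS : ∀ f, Loc B f → ∀ r, Φ f r ∈ S) {U : ℝ → ℝ} {C : ℝ} (hR : 0 ≤ R)
    (hb : ∀ t ∈ S, |U t| ≤ C) (hU : ∀ s ∈ S, ∀ t ∈ S, |U s - U t| ≤ C * |s - t|) :
    Ctl B R 0 fun f r => U (Φ f r) := by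
  obtain ⟨L, hL, h⟩ := h
  have hC : 0 ≤ |C| := abs_nonneg C
  refine ⟨|C| + |C| * (L * R ^ k), by positivity, fun f hf r hr => ⟨?_, fun g hg d hd hs => ?_⟩⟩
  · have h1 := hb _ (hS f hf r)
    rw [Real.norm_eq_abs, pow_zero, mul_one]
    have : 0 ≤ |C| * (L * R ^ k) := by positivity
    linarith [le_abs_self C]
  · have h0 := hr.1
    have h1 := hU _ (hS f hf r) _ (hS g hg r)
    have h2 := (h f hf r hr).2 g hg d hd hs
    rw [Real.norm_eq_abs] at h2 ⊢
    calc _ ≤ C * |Φ f r - Φ g r| := h1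
      _ ≤ |C| * (L * r ^ k * d) := by gcongr; exact le_abs_self C
      _ ≤ |C| * (L * R ^ k * d) := by gcongr; exact hr.2
      _ ≤ _ := by rw [pow_zero, mul_one, add_mul]; nlinarith [mul_nonneg hC hd]

end LocalControl

/-! ### Local Lipschitz dependence of the coefficients on the profile -/

section LocalControlFunctionals

variable {B R K : ℝ} {V V₁ V₂ : ℝ → ℝ}

theorem ctl_self : Ctl B R 0 fun f r => f r := by
  refine ⟨max B 1, le_max_of_le_right zero_le_one, fun f hf r hr => ⟨by
    simpa using Or.inl (hf.bdd r), fun g hg d hd hs => ?_⟩⟩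
  refine (hs r ⟨hr.1, le_rfl⟩).trans ?_
  rw [pow_zero, mul_one]
  nlinarith [le_max_right B 1]

theorem ctl_avg : Ctl B R 0 fun f r => avg f r := ctl_self.avg fun _ hf => hf.continuous

theorem ctl_dm : Ctl B R 0 fun f r => dm f r := ctl_self.sub ctl_avg

/-- In the difference of squares the sum of the two deviations is O(r), which cancels the
denominator; the other factor is controlled by the distance of the profiles. -/
theorem ctl_md (hR : 0 ≤ R) : Ctl B R 0 md := by
  obtain ⟨L, hL, h⟩ := ctl_dm (B := B) (R := R)
  refine ⟨B ^ 2 * R + 2 * |B| * L, by positivity, fun f hf r hr => ⟨?_, fun g hg d hd hs => ?_⟩⟩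
  · have := hf.abs_md_le r
    rw [abs_of_nonneg hr.1] at this
    rw [Real.norm_eq_abs, pow_zero, mul_one]
    have h3 : B ^ 2 * r ≤ B ^ 2 * R := by gcongr; exact hr.2
    have : 0 ≤ 2 * |B| * L := by positivity
    linarith
  · rcases hr.1.eq_or_lt with rfl | h0
    · simp [md]; positivity
    have h1 := (h f hf r hr).2 g hg d hd hs
    have h2 := hf.norm_dm_le r
    have h3 := hg.norm_dm_le r
    rw [abs_of_pos h0] at h2 h3
    rw [pow_zero, mul_one] at h1
    have h4 : |‖dm f r‖ - ‖dm g r‖| ≤ L * d := (abs_norm_sub_norm_le _ _).trans h1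
    rw [md, md, ← sub_div, norm_div, Real.norm_of_nonneg h0.le, div_le_iff₀ h0,
      sq_sub_sq, norm_mul, Real.norm_eq_abs, Real.norm_eq_abs, abs_of_nonneg (by positivity)]
    have hB : 0 ≤ B := hf.nonneg
    calc _ ≤ (B * r + B * r) * (L * d) := by gcongr
      _ = 2 * |B| * L * d * r := by rw [abs_of_nonneg hB]; ring
      _ ≤ _ := by rw [pow_zero, mul_one]; gcongr; nlinarith [mul_nonneg (sq_nonneg B) hR]

theorem Loc.continuous_md {f : ℝ → ℂ} (h : Loc B f) : Continuous (md f) := Fam.slice h.fam.md 0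

/-- The exponent is bounded by L R on the relevant range, where exp is Lipschitz with constant exp(L
R). -/
theorem ctl_GG_sub_one (hR : 0 ≤ R) : Ctl B R 1 fun f r => GG f r - 1 := by
  obtain ⟨L, hL, h⟩ := (ctl_md (B := B) hR).integral fun f hf => hf.continuous_md
  rw [zero_add] at h
  have key : ∀ x y : ℝ, |x| ≤ L * R → |y| ≤ L * R →
      |Real.exp x - Real.exp y| ≤ Real.exp (L * R) * |x - y| := fun x y hx hy => by
    have := (convex_Icc (-(L * R)) (L * R)).norm_image_sub_le_of_norm_hasDerivWithin_le
      (f := Real.exp) (f' := Real.exp) (C := Real.exp (L * R))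
      (fun z _ => (Real.hasDerivAt_exp z).hasDerivWithinAt) (fun z hz => by
        rw [Real.norm_eq_abs, Real.abs_exp]; exact Real.exp_le_exp.2 hz.2) (abs_le.1 hy) (abs_le.1 hx)
    simpa using this
  have hb : ∀ f, Loc B f → ∀ r ∈ Icc 0 R, |∫ s in (0 : ℝ)..r, md f s| ≤ L * R := fun f hf r hr =>
    ((h f hf r hr).1).trans (by rw [pow_one]; gcongr; exact hr.2)
  refine ⟨Real.exp (L * R) * L, by positivity, fun f hf r hr => ⟨?_, fun g hg d hd hs => ?_⟩⟩
  · have h1 := key _ 0 (hb f hf r hr) (by simp; positivity)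
    rw [Real.exp_zero, sub_zero] at h1
    refine h1.trans ?_
    rw [mul_assoc]
    gcongr
    exact (h f hf r hr).1
  · rw [sub_sub_sub_cancel_right]
    refine (key _ _ (hb f hf r hr) (hb g hg r hr)).trans ?_
    rw [mul_assoc, mul_assoc]
    gcongr
    rw [← mul_assoc]
    exact (h f hf r hr).2 g hg d hd hs

theorem ctl_GG (hR : 0 ≤ R) : Ctl B R 0 GG :=
  (((ctl_GG_sub_one (B := B) hR).lower hR).add (Ctl.const 1)).congr fun f _ r _ => by ring

theorem ctl_JJ : Ctl B R 0 JJ := (ctl_avg.conj.mul ctl_self).im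

theorem Loc.continuous_JJ {f : ℝ → ℂ} (h : Loc B f) : Continuous (JJ f) := Fam.slice h.fam.JJ 0

theorem ctl_QQ : Ctl B R 2 QQ :=
  (Ctl.id.mul ctl_JJ).integral fun _ hf => continuous_id.mul hf.continuous_JJ

theorem ctl_qq : Ctl B R 0 qq :=
  ctl_QQ.div_id.div_id.congr fun f _ r _ => by rw [qq, div_div, sq]

theorem ctl_ym (hR : 0 ≤ R) : Ctl B R 1 ym :=
  ((ctl_GG hR).mul ctl_qq).integral fun _ hf =>
    (Fam.slice hf.fam.GG 0).mul (Fam.slice hf.fam.qq 0)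

theorem ctl_hs : Ctl B R 0 hs := by
  obtain ⟨L, hL, h⟩ := ctl_avg (B := B) (R := R)
  refine ⟨2 * (L * L), by positivity, fun f hf r hr => ?_⟩
  have hb : ∀ f, Loc B f → ‖avg f r‖ ≤ L := fun f hf => by simpa using (h f hf r hr).1
  unfold hs
  refine ⟨?_, fun g hg d hd hs => ?_⟩
  · rw [pow_zero, mul_one, Real.norm_of_nonneg (by positivity)]
    nlinarith [hb f hf, norm_nonneg (avg f r)]
  · have h1 := (h f hf r hr).2 g hg d hd hs
    rw [pow_zero, mul_one] at h1 ⊢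
    have h4 : |‖avg f r‖ - ‖avg g r‖| ≤ L * d := (abs_norm_sub_norm_le _ _).trans h1
    rw [sq_sub_sq, norm_mul, Real.norm_eq_abs, Real.norm_eq_abs, abs_of_nonneg (by positivity)]
    calc _ ≤ (L + L) * (L * d) := by gcongr <;> [exact hb f hf; exact hb g hg]
      _ = _ := by ring

theorem Loc.hs_mem {f : ℝ → ℂ} (h : Loc B f) (r : ℝ) : hs f r ∈ Icc 0 (B ^ 2) :=
  ⟨by unfold hs; positivity, by unfold hs; gcongr; exact h.norm_avg_le r⟩

/-- A function with a continuous derivative on `[0, ∞)` is bounded and Lipschitz on `[0, T]`. -/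
theorem exists_lipschitz_of_hasDerivWithinAt {U U' : ℝ → ℝ}
    (hU : ∀ t, 0 ≤ t → HasDerivWithinAt U (U' t) (Ici 0) t) (hc : ContinuousOn U' (Ici 0)) (T : ℝ) :
    ∃ C, (∀ t ∈ Icc 0 T, |U t| ≤ C) ∧ ∀ s ∈ Icc 0 T, ∀ t ∈ Icc 0 T, |U s - U t| ≤ C * |s - t| := by
  have hU0 : ContinuousOn U (Ici 0) := fun t ht => (hU t ht).continuousWithinAt
  obtain ⟨C₁, h₁⟩ := isCompact_Icc.exists_bound_of_continuousOn (hU0.mono ((Icc_subset_Ici_self : Icc 0 T ⊆ Ici 0)))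
  obtain ⟨C₂, h₂⟩ := isCompact_Icc.exists_bound_of_continuousOn (hc.mono ((Icc_subset_Ici_self : Icc 0 T ⊆ Ici 0)))
  refine ⟨max C₁ C₂, fun t ht => (h₁ t ht).trans (le_max_left _ _), fun s hs t ht => ?_⟩
  exact (convex_Icc (0 : ℝ) T).norm_image_sub_le_of_norm_hasDerivWithin_le
      (fun z hz => (hU z hz.1).mono Icc_subset_Ici_self)
      (fun z hz => (h₂ z hz).trans (le_max_right _ _)) ht hs

theorem ctl_comp_hs {U U' : ℝ → ℝ} (hR : 0 ≤ R)
    (hU : ∀ t, 0 ≤ t → HasDerivWithinAt U (U' t) (Ici 0) t) (hc : ContinuousOn U' (Ici 0)) :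
    Ctl B R 0 fun f r => U (hs f r) := by
  obtain ⟨C, h₁, h₂⟩ := exists_lipschitz_of_hasDerivWithinAt hU hc (B ^ 2)
  exact ctl_hs.comp (fun f hf r => hf.hs_mem r) hR h₁ h₂

theorem ctl_dens_sub_one (hV : Pot V V₁ V₂ K) (hR : 0 ≤ R) :
    Ctl B R 1 fun f r => dens V f r - 1 := by
  have hU := ctl_comp_hs (B := B) hR hV.deriv hV.cont₁
  have h1 := ((Ctl.const (1 / 2 : ℝ)).mul (ctl_QQ.mul ctl_qq)).add ((Ctl.id.mul Ctl.id).mul hU)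
  have h2 := ((ctl_GG (B := B) hR).mul h1).lower (k := 1) hR
  exact ((ctl_GG_sub_one hR).sub h2).congr fun f _ r _ => by simp only [dens]; ring

theorem Loc.continuous_dens {f : ℝ → ℂ} (h : Loc B f) (hV : ContinuousOn V (Ici 0)) :
    Continuous (dens V f) := Fam.slice (h.fam.dens hV) 0

theorem ctl_Gt_sub_one (hV : Pot V V₁ V₂ K) (hR : 0 ≤ R) :
    Ctl B R 1 fun f r => Gt V f r - 1 :=
  ((ctl_dens_sub_one hV hR).avg fun _ hf => (hf.continuous_dens hV.cont).sub continuous_const).congr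
    fun f hf r _ => by rw [avg_sub (hf.continuous_dens hV.cont) continuous_const, avg_const, Gt]

/-- Both GG and Gt equal 1 at the centre, so their difference has order 1 and can be divided by r.
-/
theorem ctl_al (hV : Pot V V₁ V₂ K) (hR : 0 ≤ R) : Ctl B R 0 (al V) := by
  have hU := ctl_comp_hs (B := B) hR hV.deriv hV.cont₁
  have h1 := (((ctl_GG_sub_one (B := B) hR).sub (ctl_Gt_sub_one hV hR)).div_id).mul
    (Ctl.const (1 / 2 : ℝ))
  have h2 := ((((Ctl.id.mul (ctl_qq.mul ctl_qq)).mul (ctl_GG (B := B) hR))).mul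
    (Ctl.const (1 / 4 : ℝ))).lower hR
  have h3 := ((Ctl.id.mul (Ctl.const (1 / 2 : ℝ))).mul (hU.mul (ctl_GG hR))).lower hR
  refine ((h1.sub h2).sub h3).congr fun f _ r _ => ?_
  rw [al, sub_sub_sub_cancel_right, mul_comm 2 r, ← div_div]
  ring

theorem ctl_ca (hV : Pot V V₁ V₂ K) (hR : 0 ≤ R) : Ctl B R 0 (ca V) :=
  ((ctl_al hV hR).ofReal.sub
    ((((ctl_ym (B := B) hR).lower hR).mul (Ctl.const (1 / 2 : ℝ))).ofReal.mul
      (Ctl.const Complex.I))).congr fun f _ r _ => by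
        rw [ca]; congr 3; ring

theorem ctl_cb (hV : Pot V V₁ V₂ K) (hR : 0 ≤ R) : Ctl B R 0 (cb V V₁) := by
  have hU := ctl_comp_hs (B := B) hR hV.deriv₁ hV.cont₂
  have h1 := (ctl_al (B := B) hV hR).ofReal.neg.mul ctl_avg
  have h2 := (((((Ctl.id.mul ctl_qq).mul (ctl_GG (B := B) hR)).mul (Ctl.const (1 / 4 : ℝ))).lower
    hR).ofReal).mul ((Ctl.const Complex.I).mul ctl_avg.conj)
  have h3 := ((((Ctl.id.mul (Ctl.const (1 / 2 : ℝ))).mul (ctl_GG (B := B) hR)).lower hR).ofReal).mul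
    (hU.ofReal.mul ctl_avg)
  refine ((h1.add h2).sub h3).congr fun f _ r _ => ?_
  rw [cb]
  push_cast
  ring

end LocalControlFunctionals

end

/-! ### Quantitative decay of the functionals of a decaying profile -/

section

/-- A profile with the decay of the global solutions at the time `c - 1`. -/
structure Prof (A c : ℝ) (f : ℝ → ℂ) : Prop where
  one_le : 1 ≤ c
  nonneg : 0 ≤ A
  le_one : A ≤ 1
  bd : ∀ r, 0 ≤ r → ‖f r‖ ≤ A / (c + r) ^ 2
  lp : ∀ s r, 0 ≤ s → s ≤ r → ‖f r - f s‖ ≤ A / 2 * (1 / (c + s) ^ 2 - 1 / (c + r) ^ 2)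
  clamp : ∀ r, f r = f (max r 0)

/-- The majorant is given through its primitive, so that the radial integrals below are computed in
closed form. -/
theorem norm_integral_le_of_deriv {E : Type*} [NormedAddCommGroup E] [NormedSpace ℝ E]
    {g : ℝ → E} {F F' : ℝ → ℝ} {r : ℝ} (hr : 0 ≤ r)
    (hF : ∀ s ∈ Icc 0 r, HasDerivAt F (F' s) s) (hc : ContinuousOn F' (Icc 0 r))
    (hg : ∀ s ∈ Ioc 0 r, ‖g s‖ ≤ F' s) : ‖∫ s in (0 : ℝ)..r, g s‖ ≤ F r - F 0 := by
  have hi : IntervalIntegrable F' volume 0 r := by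
    apply ContinuousOn.intervalIntegrable; rwa [uIcc_of_le hr]
  rw [← intervalIntegral.integral_eq_sub_of_hasDerivAt (by rwa [uIcc_of_le hr]) hi]
  exact intervalIntegral.norm_integral_le_of_norm_le hr
    (Eventually.of_forall fun s hs => hg s hs) hi

theorem hasDerivAt_prim₁ {a c s : ℝ} (h : 0 < c + s) :
    HasDerivAt (fun s => -a / (c + s)) (a / (c + s) ^ 2) s := by
  refine (((hasDerivAt_id s).const_add c).inv h.ne' |>.const_mul (-a)).congr_deriv ?_ |>.congr_of_eventuallyEq ?_
  · simp; ring
  · exact Eventually.of_forall fun x => by simp [div_eq_mul_inv]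

theorem hasDerivAt_prim₂ {c s : ℝ} (hc : 0 < c) (h : 0 < c + s) :
    HasDerivAt (fun s => s ^ 2 / (2 * c * (c + s) ^ 2)) (s / (c + s) ^ 3) s := by
  refine (((hasDerivAt_id s).pow 2).div ((((hasDerivAt_id s).const_add c).pow 2).const_mul (2 * c))
    (by simp; exact ⟨hc.ne', h.ne'⟩)).congr_deriv ?_
  simp
  field_simp
  ring

namespace Prof

variable {A c : ℝ} {f : ℝ → ℂ} (h : Prof A c f)
include h

theorem pos : 0 < c := lt_of_lt_of_le one_pos h.one_le

/-- Since c ≥ 1, the weights (c+r)⁻² are at most 1 and have Lipschitz constant at most 2. The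
clamping extends the bounds to negative radii. -/
theorem loc : Loc A f := by
  have h1 := h.one_le
  have key : ∀ s r, 0 ≤ s → s ≤ r → ‖f r - f s‖ ≤ A * |r - s| := fun s r hs hr => by
    refine (h.lp s r hs hr).trans ?_
    rw [abs_of_nonneg (by linarith), div_mul_eq_mul_div, mul_div_assoc]
    refine mul_le_mul_of_nonneg_left ?_ h.nonneg
    have x1 : 0 < c + s := by linarith
    have x2 : 0 < c + r := by linarith
    rw [div_le_iff₀ two_pos, div_sub_div _ _ (by positivity) (by positivity),
      div_le_iff₀ (by positivity)]
    have e1 : 1 ≤ c + s := by linarith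
    have e2 : 1 ≤ c + r := by linarith
    have e3 : c + r ≤ (c + s) ^ 2 * (c + r) ^ 2 := by
      have : 1 ≤ (c + s) ^ 2 := by nlinarith
      nlinarith [mul_nonneg (sub_nonneg.2 this) (sq_nonneg (c + r))]
    have e4 : c + s ≤ (c + s) ^ 2 * (c + r) ^ 2 := by
      have : 1 ≤ (c + r) ^ 2 := by nlinarith
      nlinarith [mul_nonneg (sub_nonneg.2 this) (sq_nonneg (c + s))]
    nlinarith [mul_le_mul_of_nonneg_left (add_le_add e3 e4) (sub_nonneg.2 hr)]
  refine ⟨fun s => ?_, fun s t => ?_⟩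
  · rw [h.clamp]
    refine (h.bd _ (le_max_right _ _)).trans (div_le_self h.nonneg ?_)
    have : 1 ≤ c + max s 0 := by linarith [le_max_right s 0]
    nlinarith
  · rw [h.clamp s, h.clamp t]
    have h3 : |max s 0 - max t 0| ≤ |s - t| := abs_max_sub_max_le_abs s t 0
    refine le_trans ?_ (mul_le_mul_of_nonneg_left h3 h.nonneg)
    rcases le_total (max s 0) (max t 0) with hst | hst
    · rw [norm_sub_rev, abs_sub_comm]; exact key _ _ (le_max_right _ _) hst
    · exact key _ _ (le_max_right _ _) hst

theorem x_pos {r : ℝ} (hr : 0 ≤ r) : 0 < c + r := by linarith [h.one_le]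

theorem p_nonneg {r : ℝ} (hr : 0 ≤ r) : 0 ≤ A / (c * (c + r)) := by
  have := h.pos; have := h.nonneg; positivity

theorem p_le_one {r : ℝ} (hr : 0 ≤ r) : A / (c * (c + r)) ≤ 1 := by
  have h1 := h.one_le; have := h.le_one
  rw [div_le_one (by have := h.pos; positivity)]
  nlinarith

theorem rp_le_one {r : ℝ} (hr : 0 ≤ r) : r * (A / (c * (c + r))) ≤ 1 := by
  have h1 := h.one_le; have := h.le_one; have := h.nonneg
  rw [mul_div_assoc', div_le_one (by have := h.pos; positivity)]
  nlinarith [mul_nonneg hr h.nonneg]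

/-- The integral of A/(c+s)² over [0, r] is A r/(c(c+r)). The quantity p = A/(c(c+r)) is the unit in
which all later estimates are expressed; it satisfies p ≤ 1 and rp ≤ 1. -/
theorem norm_avg_le {r : ℝ} (hr : 0 ≤ r) : ‖avg f r‖ ≤ A / (c * (c + r)) := by
  have hc := h.pos
  rcases hr.eq_or_lt with rfl | h0
  · rw [avg_zero, add_zero, ← sq]; simpa using h.bd 0 le_rfl
  have key := norm_integral_le_of_deriv (g := f) hr
    (fun s hs => hasDerivAt_prim₁ (a := A) (h.x_pos hs.1)) (by
      refine continuousOn_const.div (by fun_prop) fun s hs => ?_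
      have := h.x_pos hs.1; positivity) fun s hs => h.bd s hs.1.le
  rw [← smul_avg, norm_smul, Real.norm_of_nonneg hr] at key
  have hx := h.x_pos hr
  have e : -A / (c + r) - -A / (c + 0) = r * (A / (c * (c + r))) := by field_simp; ring
  rw [e] at key
  exact le_of_mul_le_mul_left key h0

/-- Averaging the increments f(r) - f(θr) with the bound `lp` gains the factor r/(c+r) over the
bound for the mean; this is where the decay of the derivative enters. -/
theorem norm_dm_le_div {r : ℝ} (hr : 0 ≤ r) : ‖dm f r‖ ≤ r * (A / (c * (c + r))) / (c + r) := by
  have hc := h.pos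
  have hx := h.x_pos hr
  rw [dm_eq h.loc.continuous]
  have key := norm_integral_le_of_deriv (r := 1) (g := fun θ => f r - f (θ * r))
    (F := fun θ => A / 2 * (θ / (c * (c + θ * r)) - θ / (c + r) ^ 2))
    (F' := fun θ => A / 2 * (1 / (c + θ * r) ^ 2 - 1 / (c + r) ^ 2)) zero_le_one
    (fun θ hθ => by
      have h3 : 0 < c + θ * r := h.x_pos (mul_nonneg hθ.1 hr)
      have d1 : HasDerivAt (fun θ => c * (c + θ * r)) (c * r) θ := by
        simpa using (((hasDerivAt_id θ).mul_const r).const_add c).const_mul c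
      refine ((((hasDerivAt_id θ).div d1 (by positivity)).sub
        ((hasDerivAt_id θ).div_const ((c + r) ^ 2))).const_mul (A / 2)).congr_deriv ?_
      congr 1
      simp
      field_simp
      ring) (by
      refine continuousOn_const.mul ((continuousOn_const.div (by fun_prop) fun θ hθ => ?_).sub
        continuousOn_const)
      have h3 : 0 < c + θ * r := h.x_pos (mul_nonneg hθ.1 hr)
      positivity) fun θ hθ => h.lp _ _ (mul_nonneg hθ.1.le hr) (mul_le_of_le_one_left hr hθ.2)
  refine key.trans ?_
  have e : A / 2 * (1 / (c * (c + 1 * r)) - 1 / (c + r) ^ 2) -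
      A / 2 * (0 / (c * (c + 0 * r)) - 0 / (c + r) ^ 2) = 1 / 2 * (r * (A / (c * (c + r))) / (c + r)) := by
    field_simp; ring
  rw [e]
  have : 0 ≤ r * (A / (c * (c + r))) / (c + r) := by have := h.nonneg; positivity
  linarith

theorem norm_dm_le_mul {r : ℝ} (hr : 0 ≤ r) : ‖dm f r‖ ≤ r * (A / (c * (c + r))) :=
  (h.norm_dm_le_div hr).trans (div_le_self (mul_nonneg hr (h.p_nonneg hr)) (by linarith [h.one_le]))

theorem norm_dm_le {r : ℝ} (hr : 0 ≤ r) : ‖dm f r‖ ≤ A / (c * (c + r)) := by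
  refine (h.norm_dm_le_div hr).trans ?_
  rw [div_le_iff₀ (h.x_pos hr)]
  nlinarith [h.p_nonneg hr, h.pos]

theorem md_le {r : ℝ} (hr : 0 ≤ r) : md f r ≤ r * (A / (c * (c + r))) ^ 2 / (c + r) ^ 2 := by
  rcases hr.eq_or_lt with rfl | h0
  · simp [md]
  rw [md, div_le_iff₀ h0]
  calc ‖dm f r‖ ^ 2 ≤ (r * (A / (c * (c + r))) / (c + r)) ^ 2 := by
        gcongr; exact h.norm_dm_le_div hr
    _ = _ := by have := (h.x_pos hr).ne'; field_simp

theorem md_le' {r : ℝ} (hr : 0 ≤ r) : md f r ≤ r * (A / (c * (c + r))) ^ 2 :=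
  (h.md_le hr).trans (div_le_self (mul_nonneg hr (sq_nonneg _)) (by nlinarith [h.one_le]))

theorem integral_md_mem {r : ℝ} (hr : 0 ≤ r) :
    ∫ s in (0 : ℝ)..r, md f s ∈ Icc 0 (r ^ 2 * (A / (c * (c + r))) ^ 2 / 2) := by
  have hc := h.pos
  have hA := h.nonneg
  have hx := h.x_pos hr
  have h0 : 0 ≤ ∫ s in (0 : ℝ)..r, md f s :=
    intervalIntegral.integral_nonneg hr fun s hs => md_nonneg f hs.1
  refine ⟨h0, ?_⟩
  have key := norm_integral_le_of_deriv (g := md f) hr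
    (F := fun s => A ^ 2 / c * (s ^ 2 / (2 * c * (c + s) ^ 2)))
    (fun s hs => (hasDerivAt_prim₂ hc (h.x_pos hs.1)).const_mul (A ^ 2 / c)) (by
      refine continuousOn_const.mul (continuousOn_id.div (by fun_prop) fun s hs => ?_)
      have := h.x_pos hs.1; positivity) (fun s hs => by
      have hs0 := hs.1.le
      have hxs := h.x_pos hs0
      rw [Real.norm_of_nonneg (md_nonneg f hs0)]
      refine (h.md_le hs0).trans ?_
      rw [div_pow, mul_pow, mul_div_assoc', div_div, div_mul_div_comm, div_le_div_iff₀ (by positivity)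
        (by positivity)]
      have e1 : c ≤ c ^ 2 := by nlinarith [h.one_le]
      have e2 : (c + s) ^ 3 ≤ (c + s) ^ 4 := by
        have : 1 ≤ c + s := by linarith [h.one_le]
        exact pow_le_pow_right₀ this (by norm_num)
      calc s * A ^ 2 * (c * (c + s) ^ 3) ≤ s * A ^ 2 * (c ^ 2 * (c + s) ^ 4) := by gcongr
        _ = _ := by ring)
  rw [Real.norm_of_nonneg h0] at key
  refine key.trans (le_of_eq ?_)
  field_simp
  ring

/-- The exponent is at most r²p²/2 ≤ 1/2, and exp(x) - 1 ≤ 2x in that range. -/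
theorem GG_mem {r : ℝ} (hr : 0 ≤ r) : GG f r ∈ Icc 1 (1 + r ^ 2 * (A / (c * (c + r))) ^ 2) := by
  obtain ⟨h1, h2⟩ := h.integral_md_mem hr
  refine ⟨Real.one_le_exp h1, ?_⟩
  have h3 : r ^ 2 * (A / (c * (c + r))) ^ 2 ≤ 1 := by
    rw [← mul_pow]
    exact pow_le_one₀ (mul_nonneg hr (h.p_nonneg hr)) (h.rp_le_one hr)
  have h5 := Real.abs_exp_sub_one_le (x := ∫ s in (0 : ℝ)..r, md f s) (by
    rw [abs_of_nonneg h1]; linarith)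
  rw [abs_of_nonneg h1] at h5
  have := (abs_le.1 h5).2
  unfold GG
  linarith

theorem r2p2_le_one {r : ℝ} (hr : 0 ≤ r) : r ^ 2 * (A / (c * (c + r))) ^ 2 ≤ 1 := by
  rw [← mul_pow]
  exact pow_le_one₀ (mul_nonneg hr (h.p_nonneg hr)) (h.rp_le_one hr)

theorem GG_le_two {r : ℝ} (hr : 0 ≤ r) : GG f r ≤ 2 := by
  linarith [(h.GG_mem hr).2, h.r2p2_le_one hr]

theorem abs_JJ_le {r : ℝ} (hr : 0 ≤ r) : |JJ f r| ≤ (A / (c * (c + r))) ^ 2 := by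
  refine (EYMH.abs_JJ_le f r).trans ?_
  rw [sq]
  exact mul_le_mul (h.norm_avg_le hr) (h.norm_dm_le hr) (norm_nonneg _) (h.p_nonneg hr)

/-- Here |JJ| is bounded by |avg f| |f|, which is at most A²/(c(c+s)³). The bound p² for JJ would
lead to a logarithm after integration against s. -/
theorem abs_QQ_le {r : ℝ} (hr : 0 ≤ r) : |QQ f r| ≤ r ^ 2 * (A / (c * (c + r))) ^ 2 / 2 := by
  have hc := h.pos
  have hA := h.nonneg
  have hx := h.x_pos hr
  have key := norm_integral_le_of_deriv (g := fun s => s * JJ f s) hr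
    (F := fun s => A ^ 2 / c * (s ^ 2 / (2 * c * (c + s) ^ 2)))
    (fun s hs => (hasDerivAt_prim₂ hc (h.x_pos hs.1)).const_mul (A ^ 2 / c)) (by
      refine continuousOn_const.mul (continuousOn_id.div (by fun_prop) fun s hs => ?_)
      have := h.x_pos hs.1; positivity) (fun s hs => by
      have hs0 := hs.1.le
      have hxs := h.x_pos hs0
      rw [norm_mul, Real.norm_of_nonneg hs0, Real.norm_eq_abs]
      calc s * |JJ f s| ≤ s * (A / (c * (c + s)) * (A / (c + s) ^ 2)) := by
            gcongr
            exact (abs_JJ_le' f s).trans (mul_le_mul (h.norm_avg_le hs0) (h.bd s hs0)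
              (norm_nonneg _) (h.p_nonneg hs0))
        _ = _ := by field_simp)
  refine key.trans (le_of_eq ?_)
  field_simp
  ring

theorem abs_qq_le {r : ℝ} (hr : 0 ≤ r) : |qq f r| ≤ (A / (c * (c + r))) ^ 2 / 2 := by
  rcases hr.eq_or_lt with rfl | h0
  · simp [qq]; positivity
  rw [qq, abs_div, abs_of_nonneg (sq_nonneg r), div_le_iff₀ (by positivity)]
  refine (h.abs_QQ_le hr).trans (le_of_eq ?_)
  ring

theorem abs_mul_dqq_le {r : ℝ} (hr : 0 ≤ r) : |r * dqq f r| ≤ 2 * (A / (c * (c + r))) ^ 2 := by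
  rcases hr.eq_or_lt with rfl | h0
  · simp; positivity
  rw [show r * dqq f r = JJ f r - 2 * qq f r by rw [dqq]; field_simp]
  have h1 := abs_le.1 (h.abs_JJ_le hr); have h2 := abs_le.1 (h.abs_qq_le hr)
  rw [abs_le]; constructor <;> linarith [h1.1, h1.2, h2.1, h2.2]

theorem hs_le {r : ℝ} (hr : 0 ≤ r) : hs f r ≤ (A / (c * (c + r))) ^ 2 := by
  unfold hs; gcongr; exact h.norm_avg_le hr

theorem hs_mem {r : ℝ} (hr : 0 ≤ r) : hs f r ∈ Icc (0 : ℝ) 1 :=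
  ⟨by unfold hs; positivity, (h.hs_le hr).trans (pow_le_one₀ (h.p_nonneg hr) (h.p_le_one hr))⟩

/-- The integrand is at most p² = A²/(c²(c+s)²), which is integrable to infinity. The potential
itself does not decay in r, so the bound records decay in c alone. -/
theorem abs_ym_le {r : ℝ} (hr : 0 ≤ r) : |ym f r| ≤ A ^ 2 / c ^ 2 := by
  have hc := h.pos
  have hx := h.x_pos hr
  have key := norm_integral_le_of_deriv (g := fun s => GG f s * qq f s) hr
    (fun s hs => (hasDerivAt_prim₁ (a := A ^ 2 / c ^ 2) (h.x_pos hs.1))) (by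
      refine continuousOn_const.div (by fun_prop) fun s hs => ?_
      have := h.x_pos hs.1; positivity) (fun s hs => by
      have hs0 := hs.1.le
      have hxs := h.x_pos hs0
      rw [norm_mul, Real.norm_eq_abs, Real.norm_eq_abs, abs_of_pos (show 0 < GG f s from Real.exp_pos _)]
      calc _ ≤ 2 * ((A / (c * (c + s))) ^ 2 / 2) := by
            gcongr
            · exact h.GG_le_two hs0
            · exact h.abs_qq_le hs0
        _ = _ := by field_simp)
  refine key.trans ?_
  have e : -(A ^ 2 / c ^ 2) / (c + r) - -(A ^ 2 / c ^ 2) / (c + 0) = A ^ 2 / c ^ 2 * (r / (c * (c + r))) := by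
    field_simp; ring
  rw [e]
  refine mul_le_of_le_one_right (by positivity) ?_
  rw [div_le_one (by positivity)]
  nlinarith [h.one_le]

variable {V V₁ V₂ : ℝ → ℝ} {K : ℝ} (hV : Pot V V₁ V₂ K)
include hV

theorem abs_V_le {r : ℝ} (hr : 0 ≤ r) : |V (hs f r)| ≤ K * (A / (c * (c + r))) ^ 2 :=
  (hV.bd₀ _ (h.hs_mem hr)).trans (mul_le_mul_of_nonneg_left (h.hs_le hr) hV.nonneg)

theorem abs_V₁_le {r : ℝ} (hr : 0 ≤ r) : |V₁ (hs f r)| ≤ K * (A / (c * (c + r))) ^ 2 :=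
  (hV.bd₁ _ (h.hs_mem hr)).trans (mul_le_mul_of_nonneg_left (h.hs_le hr) hV.nonneg)

theorem abs_dens_sub_one_le {r : ℝ} (hr : 0 ≤ r) :
    |dens V f r - 1| ≤ (2 + 2 * K) * (r ^ 2 * (A / (c * (c + r))) ^ 2) := by
  obtain ⟨g1, g2⟩ := h.GG_mem hr
  have g3 := h.GG_le_two hr
  have h1 := h.abs_QQ_le hr
  have h2 := h.abs_qq_le hr
  have h3 := h.abs_V_le hV hr
  have hp := h.p_nonneg hr
  have hp1 := h.p_le_one hr
  set p := A / (c * (c + r)) with hpdef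
  have hp2 : p ^ 2 ≤ 1 := pow_le_one₀ hp hp1
  have e : dens V f r - 1 = (GG f r - 1) - GG f r * (1 / 2 * (QQ f r * qq f r) + r ^ 2 * V (hs f r)) := by
    rw [dens]; ring
  have e2 : |1 / 2 * (QQ f r * qq f r) + r ^ 2 * V (hs f r)| ≤ (1 / 2 + K) * (r ^ 2 * p ^ 2) := by
    refine (abs_add_le _ _).trans ?_
    rw [abs_mul, abs_mul, abs_mul, abs_of_nonneg (sq_nonneg r), abs_of_nonneg (by norm_num : (0 : ℝ) ≤ 1 / 2)]
    have i1 : |QQ f r| * |qq f r| ≤ (r ^ 2 * p ^ 2 / 2) * (p ^ 2 / 2) := by gcongr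
    have i2 : (r ^ 2 * p ^ 2 / 2) * (p ^ 2 / 2) ≤ r ^ 2 * p ^ 2 := by
      nlinarith [mul_nonneg (sq_nonneg r) (sq_nonneg p)]
    have i3 : r ^ 2 * |V (hs f r)| ≤ r ^ 2 * (K * p ^ 2) := by gcongr
    linarith
  rw [e]
  refine (abs_sub _ _).trans ?_
  rw [abs_mul, abs_of_nonneg (by linarith : 0 ≤ GG f r - 1), abs_of_nonneg (by linarith : 0 ≤ GG f r)]
  have : GG f r * |1 / 2 * (QQ f r * qq f r) + r ^ 2 * V (hs f r)| ≤ 2 * ((1 / 2 + K) * (r ^ 2 * p ^ 2)) := by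
    gcongr
  linarith

/-- The bound for the density is (s p(s))² up to a constant, and s p(s) is increasing, so its value
at r bounds the mean. -/
theorem abs_Gt_sub_one_le {r : ℝ} (hr : 0 ≤ r) :
    |Gt V f r - 1| ≤ (2 + 2 * K) * (r ^ 2 * (A / (c * (c + r))) ^ 2) := by
  have hd := h.loc.continuous_dens hV.cont
  have e : Gt V f r - 1 = avg (fun s => dens V f s - 1) r := by
    rw [avg_sub hd continuous_const, avg_const, Gt]
  rw [e, ← Real.norm_eq_abs]
  refine EYMH.norm_avg_le hr fun s hs => ?_
  rw [Real.norm_eq_abs]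
  refine (h.abs_dens_sub_one_le hV hs.1).trans ?_
  have hK := hV.nonneg
  have hc := h.pos
  have hA := h.nonneg
  have hxs := h.x_pos hs.1
  have hx := h.x_pos hr
  have hs0 := hs.1
  rw [← mul_pow, ← mul_pow]
  have e1 : s * (A / (c * (c + s))) ≤ r * (A / (c * (c + r))) := by
    rw [mul_div_assoc', mul_div_assoc', div_le_div_iff₀ (by positivity) (by positivity)]
    have h4 : s * (c + r) ≤ r * (c + s) := by nlinarith [hs.2]
    nlinarith [mul_le_mul_of_nonneg_left h4 (mul_nonneg hA hc.le)]
  gcongr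

theorem abs_GG_sub_Gt_le {r : ℝ} (hr : 0 ≤ r) :
    |GG f r - Gt V f r| ≤ (3 + 2 * K) * (r ^ 2 * (A / (c * (c + r))) ^ 2) := by
  obtain ⟨g1, g2⟩ := h.GG_mem hr
  have := abs_le.1 (h.abs_Gt_sub_one_le hV hr)
  have h0 : 0 ≤ r ^ 2 * (A / (c * (c + r))) ^ 2 := by positivity
  rw [abs_le]; constructor <;> nlinarith [this.1, this.2]

theorem abs_dGt_le {r : ℝ} (hr : 0 ≤ r) :
    |(dens V f r - Gt V f r) / r| ≤ 10 * (1 + K) * (r * (A / (c * (c + r))) ^ 2) := by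
  have hK := hV.nonneg
  rcases hr.eq_or_lt with rfl | h0
  · simp
  rw [abs_div, abs_of_pos h0, div_le_iff₀ h0]
  have h1 := abs_le.1 (h.abs_Gt_sub_one_le hV hr)
  have h2 := abs_le.1 (h.abs_dens_sub_one_le hV hr)
  have h3 : 0 ≤ r ^ 2 * (A / (c * (c + r))) ^ 2 := by positivity
  have e : 10 * (1 + K) * (r * (A / (c * (c + r))) ^ 2) * r = 10 * (1 + K) * (r ^ 2 * (A / (c * (c + r))) ^ 2) := by
    ring
  rw [e, abs_le]
  constructor <;> nlinarith [h1.1, h1.2, h2.1, h2.2, mul_nonneg hK h3]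

end Prof

end

/-! ### Decay of the coefficients of the evolution equation -/

section

namespace Prof

variable {A c : ℝ} {f : ℝ → ℂ} (h : Prof A c f) {V V₁ V₂ : ℝ → ℝ} {K : ℝ} (hV : Pot V V₁ V₂ K)
include h hV

/-- Each of the three terms is r p² times a bounded factor: GG - Gt is O(r²p²), while qq and V(hs)
are O(p²). -/
theorem abs_al_le {r : ℝ} (hr : 0 ≤ r) :
    |al V f r| ≤ 10 * (1 + K) * (r * (A / (c * (c + r))) ^ 2) := by
  have hK := hV.nonneg
  rcases hr.eq_or_lt with rfl | h0
  · simp [al]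
  have g3 := h.GG_le_two hr
  have g0 : 0 ≤ GG f r := (Real.exp_pos _).le
  have h1 := h.abs_GG_sub_Gt_le hV hr
  have h2 := h.abs_qq_le hr
  have h3 := h.abs_V_le hV hr
  have hp := h.p_nonneg hr
  have hp1 := h.p_le_one hr
  set p := A / (c * (c + r)) with hpdef
  have hp2 : p ^ 2 ≤ 1 := pow_le_one₀ hp hp1
  have i1 : |(GG f r - Gt V f r) / (2 * r)| ≤ (3 + 2 * K) / 2 * (r * p ^ 2) := by
    rw [abs_div, abs_of_pos (by positivity : 0 < 2 * r), div_le_iff₀ (by positivity)]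
    refine h1.trans (le_of_eq ?_); ring
  have i2 : |r * qq f r ^ 2 * GG f r / 4| ≤ r * p ^ 2 := by
    rw [abs_div, abs_mul, abs_mul, abs_of_pos h0, abs_of_nonneg g0, abs_pow]
    have : |qq f r| ^ 2 ≤ (p ^ 2 / 2) ^ 2 := by gcongr
    have i : r * |qq f r| ^ 2 * GG f r ≤ r * (p ^ 2 / 2) ^ 2 * 2 := by gcongr
    rw [abs_of_pos (by norm_num : (0 : ℝ) < 4)]
    have j : r * (p ^ 2 / 2) ^ 2 * 2 ≤ r * p ^ 2 * 4 := by
      nlinarith [mul_nonneg h0.le (sq_nonneg p), mul_le_mul_of_nonneg_left hp2 (mul_nonneg h0.le (sq_nonneg p))]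
    linarith
  have i3 : |r / 2 * (V (hs f r) * GG f r)| ≤ K * (r * p ^ 2) := by
    rw [abs_mul, abs_mul, abs_of_pos (by positivity : 0 < r / 2), abs_of_nonneg g0]
    calc r / 2 * (|V (hs f r)| * GG f r) ≤ r / 2 * ((K * p ^ 2) * 2) := by gcongr
      _ = _ := by ring
  rw [al]
  refine (abs_sub _ _).trans ((add_le_add ((abs_sub _ _).trans (add_le_add i1 i2)) i3).trans ?_)
  have : 0 ≤ r * p ^ 2 := by positivity
  nlinarith [mul_nonneg hK this]

-- A radial derivative costs only a division by r: the products r · `dqq` and r · `dhs` obey the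
-- bounds of `qq` and `hs` up to constants, so each term stays O(p²), even as r tends to 0.
set_option maxHeartbeats 800000 in
theorem abs_dal_le {r : ℝ} (h0 : 0 < r) :
    |dal V V₁ f r| ≤ 10 * (1 + K) * (A / (c * (c + r))) ^ 2 := by
  have hr := h0.le
  have hK := hV.nonneg
  have g3 := h.GG_le_two hr
  have g0 : 0 ≤ GG f r := (Real.exp_pos _).le
  have h1 := h.abs_GG_sub_Gt_le hV hr
  have h2 := h.abs_qq_le hr
  have h3 := h.abs_V_le hV hr
  have h3' := h.abs_V₁_le hV hr
  have h4 := h.md_le' hr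
  have h4' := md_nonneg f hr
  have h5 := h.abs_mul_dqq_le hr
  have h6 := abs_le.1 (h.abs_Gt_sub_one_le hV hr)
  have h7 := abs_le.1 (h.abs_dens_sub_one_le hV hr)
  have hp := h.p_nonneg hr
  have hp1 := h.p_le_one hr
  have hrp := h.r2p2_le_one hr
  have ha := h.norm_avg_le hr
  have hd := h.norm_dm_le hr
  set p := A / (c * (c + r)) with hpdef
  have hp2 : p ^ 2 ≤ 1 := pow_le_one₀ hp hp1
  have hpp := sq_nonneg p
  have hGm : GG f r * md f r ≤ 2 * (r * p ^ 2) := mul_le_mul g3 h4 h4' (by norm_num)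
  have hGm0 : 0 ≤ GG f r * md f r := mul_nonneg g0 h4'
  have hrGm : r * (GG f r * md f r) ≤ 2 := by
    have := mul_le_mul_of_nonneg_left hGm hr
    linarith
  have hdh : |r * dhs f r| ≤ 2 * p ^ 2 := by
    rw [show r * dhs f r = 2 * (conj (avg f r) * dm f r).re by rw [dhs]; field_simp, abs_mul,
      abs_of_pos two_pos]
    have : |(conj (avg f r) * dm f r).re| ≤ p ^ 2 := by
      refine (Complex.abs_re_le_norm _).trans ?_
      rw [norm_mul, Complex.norm_conj, sq]
      exact mul_le_mul ha hd (norm_nonneg _) hp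
    linarith
  have i1 : |(GG f r * md f r - (dens V f r - Gt V f r) / r) / (2 * r)| ≤ (3 + 2 * K) * p ^ 2 := by
    rw [abs_div, abs_of_pos (by positivity : 0 < 2 * r), div_le_iff₀ (by positivity)]
    refine (abs_sub _ _).trans ?_
    rw [abs_of_nonneg hGm0, abs_div, abs_of_pos h0]
    have : |dens V f r - Gt V f r| / r ≤ (4 + 4 * K) * (r * p ^ 2) := by
      rw [div_le_iff₀ h0, abs_le]
      constructor <;> linarith [h6.1, h6.2, h7.1, h7.2]
    linarith
  have i2 : |(GG f r - Gt V f r) / (2 * r ^ 2)| ≤ (3 / 2 + K) * p ^ 2 := by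
    rw [abs_div, abs_of_pos (by positivity : 0 < 2 * r ^ 2), div_le_iff₀ (by positivity)]
    refine h1.trans (le_of_eq ?_); ring
  have hp4 : p ^ 2 * p ^ 2 ≤ p ^ 2 := mul_le_of_le_one_left hpp hp2
  have q2 : |qq f r| ^ 2 ≤ p ^ 2 / 4 := by
    have : |qq f r| ^ 2 ≤ (p ^ 2 / 2) ^ 2 := by gcongr
    linarith
  have i3 : |(qq f r ^ 2 * GG f r + r * (2 * qq f r * dqq f r) * GG f r
        + r * qq f r ^ 2 * (GG f r * md f r)) / 4| ≤ 2 * p ^ 2 := by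
    rw [abs_div, abs_of_pos (by norm_num : (0 : ℝ) < 4), div_le_iff₀ (by norm_num)]
    refine (abs_add_le _ _).trans ((add_le_add_left (abs_add_le _ _) _).trans ?_)
    have j1 : |qq f r ^ 2 * GG f r| ≤ p ^ 2 / 4 * 2 := by
      rw [abs_mul, abs_pow, abs_of_nonneg g0]; gcongr
    have j2 : |r * (2 * qq f r * dqq f r) * GG f r| ≤ 2 * (p ^ 2 / 2) * (2 * p ^ 2) * 2 := by
      rw [show r * (2 * qq f r * dqq f r) * GG f r = 2 * qq f r * (r * dqq f r) * GG f r by ring,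
        abs_mul, abs_mul, abs_mul, abs_of_nonneg g0, abs_of_pos (two_pos (α := ℝ))]
      gcongr
    have j3 : |r * qq f r ^ 2 * (GG f r * md f r)| ≤ p ^ 2 / 4 * 2 := by
      rw [show r * qq f r ^ 2 * (GG f r * md f r) = qq f r ^ 2 * (r * (GG f r * md f r)) by ring,
        abs_mul, abs_pow, abs_of_nonneg (mul_nonneg hr hGm0)]
      gcongr
    linarith
  have i4 : |(V (hs f r) * GG f r + r * (V₁ (hs f r) * dhs f r) * GG f r
        + r * V (hs f r) * (GG f r * md f r)) / 2| ≤ 4 * K * p ^ 2 := by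
    rw [abs_div, abs_of_pos (two_pos (α := ℝ)), div_le_iff₀ (by norm_num)]
    refine (abs_add_le _ _).trans ((add_le_add_left (abs_add_le _ _) _).trans ?_)
    have j1 : |V (hs f r) * GG f r| ≤ K * p ^ 2 * 2 := by
      rw [abs_mul, abs_of_nonneg g0]; gcongr
    have j2 : |r * (V₁ (hs f r) * dhs f r) * GG f r| ≤ K * p ^ 2 * (2 * p ^ 2) * 2 := by
      rw [show r * (V₁ (hs f r) * dhs f r) * GG f r = V₁ (hs f r) * (r * dhs f r) * GG f r by ring,
        abs_mul, abs_mul, abs_of_nonneg g0]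
      gcongr
    have j3 : |r * V (hs f r) * (GG f r * md f r)| ≤ K * p ^ 2 * 2 := by
      rw [show r * V (hs f r) * (GG f r * md f r) = V (hs f r) * (r * (GG f r * md f r)) by ring,
        abs_mul, abs_of_nonneg (mul_nonneg hr hGm0)]
      gcongr
    have := mul_le_mul_of_nonneg_left hp4 hK
    linarith
  rw [dal]
  refine (abs_sub _ _).trans ((add_le_add ((abs_sub _ _).trans (add_le_add ((abs_sub _ _).trans
    (add_le_add i1 i2)) i3)) i4).trans ?_)
  linarith [mul_nonneg hK hpp]

theorem norm_dca_le {r : ℝ} (h0 : 0 < r) :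
    ‖dca V V₁ f r‖ ≤ 20 * (1 + K) * (A / (c * (c + r))) ^ 2 := by
  have hK := hV.nonneg
  have hp := sq_nonneg (A / (c * (c + r)))
  rw [dca]
  refine (norm_sub_le _ _).trans ?_
  rw [norm_mul, Complex.norm_I, mul_one, Complex.norm_real, Complex.norm_real, Real.norm_eq_abs,
    Real.norm_eq_abs]
  have h1 := h.abs_dal_le hV h0
  have h2 : |GG f r * qq f r / 2| ≤ (A / (c * (c + r))) ^ 2 := by
    have := h.GG_le_two h0.le
    have := h.abs_qq_le h0.le
    rw [abs_div, abs_mul, abs_of_pos (show 0 < GG f r from Real.exp_pos _),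
      abs_of_pos (two_pos (α := ℝ)), div_le_iff₀ (by norm_num)]
    calc GG f r * |qq f r| ≤ 2 * ((A / (c * (c + r))) ^ 2 / 2) := by gcongr
      _ ≤ _ := by linarith
  nlinarith [mul_nonneg hK hp]

/-- From r p² ≤ A²/c² the real part decays like the potential. With c = 1 + τ the bound is
integrable in time, so the linear term changes w by a bounded factor only. -/
theorem norm_ca_le {r : ℝ} (hr : 0 ≤ r) : ‖ca V f r‖ ≤ 20 * (1 + K) * (A ^ 2 / c ^ 2) := by
  have hK := hV.nonneg
  have hc := h.pos
  have hx := h.x_pos hr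
  rw [ca]
  refine (norm_sub_le _ _).trans ?_
  rw [norm_mul, Complex.norm_I, mul_one, Complex.norm_real, Complex.norm_real, Real.norm_eq_abs,
    Real.norm_eq_abs, abs_div, abs_of_pos (two_pos (α := ℝ))]
  have h1 := h.abs_al_le hV hr
  have h2 := h.abs_ym_le hr
  have h3 : r * (A / (c * (c + r))) ^ 2 ≤ A ^ 2 / c ^ 2 := by
    rw [div_pow, mul_pow, mul_div_assoc', div_le_div_iff₀ (by positivity) (by positivity)]
    have : r ≤ (c + r) ^ 2 := by nlinarith [h.one_le]
    calc r * A ^ 2 * c ^ 2 ≤ (c + r) ^ 2 * A ^ 2 * c ^ 2 := by gcongr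
      _ = _ := by ring
  have h4 : 0 ≤ A ^ 2 / c ^ 2 := by positivity
  have h5 : 10 * (1 + K) * (r * (A / (c * (c + r))) ^ 2) ≤ 10 * (1 + K) * (A ^ 2 / c ^ 2) := by gcongr
  nlinarith [mul_nonneg hK h4]

/-- Each term is a coefficient of size r p² times the mean, which contributes the third factor p.
The source is thus cubic in A. -/
theorem norm_cb_le {r : ℝ} (hr : 0 ≤ r) :
    ‖cb V V₁ f r‖ ≤ 20 * (1 + K) * (r * (A / (c * (c + r))) ^ 3) := by
  have hK := hV.nonneg
  have g3 := h.GG_le_two hr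
  have g0 : 0 ≤ GG f r := (Real.exp_pos _).le
  have h1 := h.abs_al_le hV hr
  have h2 := h.abs_qq_le hr
  have h3 := h.abs_V₁_le hV hr
  have hp := h.p_nonneg hr
  have ha := h.norm_avg_le hr
  set p := A / (c * (c + r)) with hpdef
  rw [cb]
  refine (norm_sub_le _ _).trans ((add_le_add_left (norm_add_le _ _) _).trans ?_)
  have i1 : ‖-(al V f r : ℂ) * avg f r‖ ≤ 10 * (1 + K) * (r * p ^ 2) * p := by
    rw [norm_mul, norm_neg, Complex.norm_real, Real.norm_eq_abs]; gcongr
  have i2 : ‖((r * qq f r * GG f r / 4 : ℝ) : ℂ) * (Complex.I * conj (avg f r))‖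
      ≤ r * (p ^ 2 / 2) * 2 / 4 * p := by
    rw [norm_mul, norm_mul, Complex.norm_I, one_mul, Complex.norm_conj, Complex.norm_real,
      Real.norm_eq_abs, abs_div, abs_mul, abs_mul, abs_of_nonneg hr, abs_of_nonneg g0,
      abs_of_pos (by norm_num : (0 : ℝ) < 4)]
    gcongr
  have i3 : ‖((r / 2 * GG f r : ℝ) : ℂ) * (V₁ (hs f r) * avg f r)‖ ≤ r / 2 * 2 * (K * p ^ 2 * p) := by
    rw [norm_mul, norm_mul, Complex.norm_real, Complex.norm_real, Real.norm_eq_abs, Real.norm_eq_abs,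
      abs_mul, abs_of_nonneg g0, abs_of_nonneg (by positivity : 0 ≤ r / 2)]
    gcongr
  have : 0 ≤ r * p ^ 3 := by positivity
  nlinarith [mul_nonneg hK this]

-- The second derivative of the potential occurs as V''(hs) · dhs · avg. The factor dhs contains one
-- more mean, so that |avg|² = hs combines with V'' into t|V''(t)|, for which `bd₂` is available.
set_option maxHeartbeats 800000 in
theorem norm_dcb_le {r : ℝ} (h0 : 0 < r) :
    ‖dcb V V₁ V₂ f r‖ ≤ 30 * (1 + K) * (A / (c * (c + r))) ^ 3 := by
  have hr := h0.le
  have hK := hV.nonneg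
  have g3 := h.GG_le_two hr
  have g0 : 0 ≤ GG f r := (Real.exp_pos _).le
  have hal := h.abs_al_le hV hr
  have hdal := h.abs_dal_le hV h0
  have h2 := h.abs_qq_le hr
  have h3' := h.abs_V₁_le hV hr
  have h4 := h.md_le' hr
  have h4' := md_nonneg f hr
  have h5 := h.abs_mul_dqq_le hr
  have hp := h.p_nonneg hr
  have hp1 := h.p_le_one hr
  have hrp := h.r2p2_le_one hr
  have ha := h.norm_avg_le hr
  have hd := h.norm_dm_le hr
  have hV2 := hV.bd₂ _ (h.hs_mem hr)
  have hhs := h.hs_le hr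
  set p := A / (c * (c + r)) with hpdef
  have hp2 : p ^ 2 ≤ 1 := pow_le_one₀ hp hp1
  have hpp := sq_nonneg p
  have hp3 : 0 ≤ p ^ 3 := by positivity
  have hGm : GG f r * md f r ≤ 2 * (r * p ^ 2) := mul_le_mul g3 h4 h4' (by norm_num)
  have hGm0 : 0 ≤ GG f r * md f r := mul_nonneg g0 h4'
  have hrGm : r * (GG f r * md f r) ≤ 2 := by
    have := mul_le_mul_of_nonneg_left hGm hr
    linarith
  have hdr : ‖dm f r / (r : ℂ)‖ = ‖dm f r‖ / r := by
    rw [norm_div, Complex.norm_real, Real.norm_of_nonneg hr]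
  have hrd : r * ‖dm f r / (r : ℂ)‖ ≤ p := by rw [hdr, mul_div_cancel₀ _ h0.ne']; exact hd
  have i1 : ‖-(al V f r : ℂ) * (dm f r / r)‖ ≤ 10 * (1 + K) * p ^ 3 := by
    rw [norm_mul, norm_neg, Complex.norm_real, Real.norm_eq_abs]
    calc _ ≤ 10 * (1 + K) * (r * p ^ 2) * ‖dm f r / (r : ℂ)‖ := by gcongr
      _ = 10 * (1 + K) * p ^ 2 * (r * ‖dm f r / (r : ℂ)‖) := by ring
      _ ≤ 10 * (1 + K) * p ^ 2 * p := by gcongr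
      _ = _ := by ring
  have i2 : ‖(((qq f r * GG f r + r * dqq f r * GG f r + r * qq f r * (GG f r * md f r)) / 4 : ℝ) : ℂ)
        * (Complex.I * conj (avg f r))‖ ≤ 3 / 2 * p ^ 3 := by
    rw [norm_mul, norm_mul, Complex.norm_I, one_mul, Complex.norm_conj, Complex.norm_real,
      Real.norm_eq_abs, abs_div, abs_of_pos (by norm_num : (0 : ℝ) < 4)]
    have j1 : |qq f r * GG f r| ≤ p ^ 2 / 2 * 2 := by
      rw [abs_mul, abs_of_nonneg g0]; gcongr
    have j2 : |r * dqq f r * GG f r| ≤ 2 * p ^ 2 * 2 := by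
      rw [abs_mul, abs_of_nonneg g0]; gcongr
    have j3 : |r * qq f r * (GG f r * md f r)| ≤ p ^ 2 / 2 * 2 := by
      rw [show r * qq f r * (GG f r * md f r) = qq f r * (r * (GG f r * md f r)) by ring, abs_mul,
        abs_of_nonneg (mul_nonneg hr hGm0)]
      gcongr
    have j4 : |qq f r * GG f r + r * dqq f r * GG f r + r * qq f r * (GG f r * md f r)| ≤ 6 * p ^ 2 := by
      refine (abs_add_le _ _).trans ((add_le_add_left (abs_add_le _ _) _).trans ?_)
      linarith
    calc _ ≤ 6 * p ^ 2 / 4 * p := by gcongr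
      _ = _ := by ring
  have i3 : ‖((r * qq f r * GG f r / 4 : ℝ) : ℂ) * (Complex.I * conj (dm f r / r))‖ ≤ 1 / 4 * p ^ 3 := by
    rw [norm_mul, norm_mul, Complex.norm_I, one_mul, Complex.norm_conj, Complex.norm_real,
      Real.norm_eq_abs, abs_div, abs_mul, abs_mul, abs_of_nonneg hr, abs_of_nonneg g0,
      abs_of_pos (by norm_num : (0 : ℝ) < 4)]
    calc _ = |qq f r| * GG f r / 4 * (r * ‖dm f r / (r : ℂ)‖) := by ring
      _ ≤ p ^ 2 / 2 * 2 / 4 * p := by gcongr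
      _ = _ := by ring
  have i4 : ‖(((GG f r + r * (GG f r * md f r)) / 2 : ℝ) : ℂ) * (V₁ (hs f r) * avg f r)‖ ≤ 2 * K * p ^ 3 := by
    rw [norm_mul, norm_mul, Complex.norm_real, Complex.norm_real, Real.norm_eq_abs, Real.norm_eq_abs,
      abs_of_nonneg (by have := mul_nonneg hr hGm0; positivity)]
    calc _ ≤ (2 + 2) / 2 * (K * p ^ 2 * p) := by gcongr
      _ = _ := by ring
  have i5 : ‖((r / 2 * GG f r : ℝ) : ℂ) * ((V₂ (hs f r) * dhs f r : ℝ) * avg f r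
          + V₁ (hs f r) * (dm f r / r))‖ ≤ 3 * K * p ^ 3 := by
    rw [norm_mul, Complex.norm_real, Real.norm_of_nonneg (by positivity)]
    have k1 : ‖((V₂ (hs f r) * dhs f r : ℝ) : ℂ) * avg f r‖ ≤ 2 * K * p ^ 2 * ‖dm f r / (r : ℂ)‖ := by
      rw [norm_mul, Complex.norm_real, Real.norm_eq_abs, abs_mul]
      have l1 : |dhs f r| ≤ 2 * ‖avg f r‖ * ‖dm f r / (r : ℂ)‖ := by
        rw [dhs, hdr, abs_div, abs_of_pos h0, abs_mul, abs_of_pos (two_pos (α := ℝ)), mul_div_assoc',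
          mul_assoc]
        gcongr
        refine (Complex.abs_re_le_norm _).trans ?_
        rw [norm_mul, Complex.norm_conj]
      calc |V₂ (hs f r)| * |dhs f r| * ‖avg f r‖
          ≤ |V₂ (hs f r)| * (2 * ‖avg f r‖ * ‖dm f r / (r : ℂ)‖) * ‖avg f r‖ := by gcongr
        _ = 2 * (hs f r * |V₂ (hs f r)|) * ‖dm f r / (r : ℂ)‖ := by rw [hs]; ring
        _ ≤ 2 * (K * p ^ 2) * ‖dm f r / (r : ℂ)‖ := by
          refine mul_le_mul_of_nonneg_right (mul_le_mul_of_nonneg_left ?_ two_pos.le) (norm_nonneg _)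
          exact hV2.trans (mul_le_mul_of_nonneg_left hhs hK)
        _ = _ := by ring
    have k2 : ‖(V₁ (hs f r) : ℂ) * (dm f r / r)‖ ≤ K * p ^ 2 * ‖dm f r / (r : ℂ)‖ := by
      rw [norm_mul, Complex.norm_real, Real.norm_eq_abs]; gcongr
    calc _ ≤ r / 2 * 2 * (2 * K * p ^ 2 * ‖dm f r / (r : ℂ)‖ + K * p ^ 2 * ‖dm f r / (r : ℂ)‖) := by
          gcongr
          exact (norm_add_le _ _).trans (add_le_add k1 k2)
      _ = 3 * K * p ^ 2 * (r * ‖dm f r / (r : ℂ)‖) := by ring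
      _ ≤ 3 * K * p ^ 2 * p := by gcongr
      _ = _ := by ring
  have i6 : ‖-(dal V V₁ f r : ℂ) * avg f r‖ ≤ 10 * (1 + K) * p ^ 2 * p := by
    rw [norm_mul, norm_neg, Complex.norm_real, Real.norm_eq_abs]; gcongr
  rw [dcb, dcb₁]
  refine (norm_add_le _ _).trans ((add_le_add i6 ((norm_sub_le _ _).trans (add_le_add
    ((norm_add_le _ _).trans (add_le_add i1 ((norm_add_le _ _).trans (add_le_add i2 i3))))
    ((norm_add_le _ _).trans (add_le_add i4 i5))))).trans ?_)
  linarith [mul_nonneg hK hp3]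

end Prof

end

/-! ### Ingoing characteristics and their dependence on the starting point -/

section

/-- The joint continuity of Φ' bounds it on a compact neighbourhood, so a constant dominates the
difference quotients. -/
theorem hasDerivAt_integral_param {E : Type*} [NormedAddCommGroup E] [NormedSpace ℝ E]
    {Φ Φ' : ℝ → ℝ → E} (hΦ : Continuous fun p : ℝ × ℝ => Φ p.1 p.2)
    (hΦ' : Continuous fun p : ℝ × ℝ => Φ' p.1 p.2) {t y₀ : ℝ} (ht : 0 ≤ t) {U : Set ℝ}
    (hU : U ∈ 𝓝 y₀) (hd : ∀ s ∈ Icc 0 t, ∀ y ∈ U, HasDerivAt (fun y => Φ s y) (Φ' s y) y) :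
    HasDerivAt (fun y => ∫ s in (0 : ℝ)..t, Φ s y) (∫ s in (0 : ℝ)..t, Φ' s y₀) y₀ := by
  obtain ⟨ρ, hρ, hρU⟩ := Metric.mem_nhds_iff.1 hU
  obtain ⟨C, hC⟩ := (isCompact_Icc.prod (isCompact_closedBall y₀ ρ)).exists_bound_of_continuousOn
    (hΦ'.continuousOn (s := Icc 0 t ×ˢ Metric.closedBall y₀ ρ))
  refine (intervalIntegral.hasDerivAt_integral_of_dominated_loc_of_deriv_le
    (F := fun y s => Φ s y) (F' := fun y s => Φ' s y) (bound := fun _ => C)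
    (Metric.ball_mem_nhds y₀ hρ) ?_ ?_ ?_ ?_ (by simp) ?_).2
  · refine Eventually.of_forall fun y => ?_
    exact (hΦ.comp (f := fun s : ℝ => (s, y)) (by fun_prop)).aestronglyMeasurable
  · exact (hΦ.comp (f := fun s : ℝ => (s, y₀)) (by fun_prop)).intervalIntegrable _ _
  · exact (hΦ'.comp (f := fun s : ℝ => (s, y₀)) (by fun_prop)).aestronglyMeasurable
  · refine Eventually.of_forall fun s hs y hy => ?_
    rw [uIoc_of_le ht] at hs
    exact hC (s, y) ⟨⟨hs.1.le, hs.2⟩, Metric.ball_subset_closedBall hy⟩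
  · refine Eventually.of_forall fun s hs y hy => ?_
    rw [uIoc_of_le ht] at hs
    exact hd s ⟨hs.1.le, hs.2⟩ y (hρU hy)

theorem hasDerivAt_primitive' {E : Type*} [NormedAddCommGroup E] [NormedSpace ℝ E] [CompleteSpace E]
    {g : ℝ → E} (hg : Continuous g) (r : ℝ) :
    HasDerivAt (fun r => ∫ s in (0 : ℝ)..r, g s) (g r) r :=
  intervalIntegral.integral_hasDerivAt_right (hg.intervalIntegrable _ _)
      (hg.stronglyMeasurableAtFilter _ _) hg.continuousAt

section Flow

/-- Existence of global solutions of `x' = f t x` for bounded Lipschitz `f`. -/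
theorem exists_global_solution {E : Type*} [NormedAddCommGroup E] [NormedSpace ℝ E] [CompleteSpace E]
    {f : ℝ → E → E} {L : NNReal} (hc : Continuous fun p : ℝ × E => f p.1 p.2)
    (hb : ∀ t x, ‖f t x‖ ≤ 1) (hl : ∀ t, LipschitzWith L (f t)) (x₀ : E) :
    ∃ α : ℝ → E, α 0 = x₀ ∧ ∀ t, HasDerivAt α (f t (α t)) t := by
  have loc : ∀ T : NNReal, ∃ α : ℝ → E, α 0 = x₀ ∧
      ∀ t ∈ Icc (-(T : ℝ)) T, HasDerivWithinAt α (f t (α t)) (Icc (-(T : ℝ)) T) t := fun T => by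
    have hT : (0 : ℝ) ∈ Icc (-(T : ℝ)) T := ⟨by simp, T.2⟩
    -- The field has norm at most 1, so a solution on [-T, T] stays in the ball of radius T and the
    -- Picard-Lindelöf conditions hold for every T.
    have hpl : IsPicardLindelof f (⟨0, hT⟩ : Icc (-(T : ℝ)) T) x₀ T 0 1 L :=
      ⟨fun t _ => (hl t).lipschitzOnWith, fun x _ => (hc.comp (f := fun t : ℝ => (t, x))
        (by fun_prop)).continuousOn, fun t _ x _ => by simpa using hb t x, by simp⟩
    exact hpl.exists_eq_forall_mem_Icc_hasDerivWithinAt₀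
  choose α h0 hα using loc
  have mem : ∀ (T : NNReal) (t : ℝ), |t| < T → t ∈ Ioo (-(T : ℝ)) T := fun T t ht => abs_lt.1 ht
  have hα' : ∀ (T : NNReal) (t : ℝ), |t| < T → HasDerivAt (α T) (f t (α T t)) t := fun T t ht =>
    (hα T t ⟨(mem T t ht).1.le, (mem T t ht).2.le⟩).hasDerivAt
      (Icc_mem_nhds (mem T t ht).1 (mem T t ht).2)
  have uniq : ∀ S T : NNReal, S ≤ T → ∀ t : ℝ, |t| < S → α S t = α T t := fun S T hST t ht => by
    have hST' : (S : ℝ) ≤ T := hST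
    have hS0 : 0 < (S : ℝ) := lt_of_le_of_lt (abs_nonneg t) ht
    refine ODE_solution_unique_of_mem_Ioo (v := f) (s := fun _ => univ) (K := L)
      (a := -(S : ℝ)) (b := S) (t₀ := 0) (fun t _ => (hl t).lipschitzOnWith)
      ⟨by linarith, hS0⟩ (fun t ht => ⟨hα' S t (abs_lt.2 ht), mem_univ _⟩)
      (fun t ht => ⟨hα' T t ((abs_lt.2 ht).trans_le hST'), mem_univ _⟩) (by rw [h0, h0]) (mem S t ht)
  -- By uniqueness the solutions on nested intervals agree; at the point t the one on the interval
  -- of half-length |t| + 1 is used.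
  refine ⟨fun t => α (‖t‖₊ + 1) t, by simp [h0], fun t => ?_⟩
  have h1 : HasDerivAt (α (‖t‖₊ + 2)) (f t (α (‖t‖₊ + 2) t)) t :=
    hα' _ t (by simp)
  have h2 : ∀ s, |s| < |t| + 1 → α (‖s‖₊ + 1) s = α (‖t‖₊ + 2) s := fun s hs => by
    refine uniq _ _ ?_ s (by simp)
    rw [← NNReal.coe_le_coe]; push_cast; simp only [Real.norm_eq_abs]; linarith
  have h3 : (fun s => α (‖s‖₊ + 1) s) =ᶠ[𝓝 t] α (‖t‖₊ + 2) := by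
    have : {s : ℝ | |s| < |t| + 1} ∈ 𝓝 t :=
      (isOpen_lt continuous_abs continuous_const).mem_nhds (by simp)
    filter_upwards [this] with s hs using h2 s hs
  have h4 := h1.congr_of_eventuallyEq h3
  rwa [← h2 t (by linarith)] at h4

/-- A bounded Lipschitz speed field. -/
structure Speed (L : ℝ) (v v' : ℝ → ℝ → ℝ) : Prop where
  L_nonneg : 0 ≤ L
  cont : Continuous fun p : ℝ × ℝ => v p.1 p.2
  nonneg : ∀ s r, 0 ≤ v s r
  le_one : ∀ s r, v s r ≤ 1
  lip : ∀ s r r', |v s r - v s r'| ≤ L * |r - r'|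
  deriv : ∀ s r, 0 < r → HasDerivAt (v s) (v' s r) r
  cont' : ContinuousOn (fun p : ℝ × ℝ => v' p.1 p.2) {p | 0 < p.2}

variable {L : ℝ} {v v' : ℝ → ℝ → ℝ}

theorem Speed.lipschitz (h : Speed L v v') (s : ℝ) :
    LipschitzWith ⟨L, h.L_nonneg⟩ fun x => -v s x :=
  LipschitzWith.of_dist_le_mul fun x y => by
    rw [dist_eq_norm, Real.norm_eq_abs, neg_sub_neg, abs_sub_comm, Real.dist_eq]; exact h.lip s x y

theorem Speed.exists_flow (h : Speed L v v') (y : ℝ) :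
    ∃ α : ℝ → ℝ, α 0 = y ∧ ∀ t, HasDerivAt α (-v t (α t)) t :=
  exists_global_solution (f := fun t x => -v t x) (L := ⟨L, h.L_nonneg⟩) h.cont.neg
    (fun t x => by rw [Real.norm_eq_abs, abs_neg, abs_of_nonneg (h.nonneg t x)]; exact h.le_one t x)
    h.lipschitz y

/-- The characteristic that starts at `y` at time `0`. -/
def Speed.X (h : Speed L v v') (t y : ℝ) : ℝ := (h.exists_flow y).choose t

variable (h : Speed L v v')
include h

namespace Speed

theorem X_zero (y : ℝ) : h.X 0 y = y := (h.exists_flow y).choose_spec.1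

theorem hasDerivAt_X (t y : ℝ) : HasDerivAt (fun t => h.X t y) (-v t (h.X t y)) t :=
  (h.exists_flow y).choose_spec.2 t

theorem continuous_X_left (y : ℝ) : Continuous fun t => h.X t y :=
  continuous_iff_continuousAt.2 fun t => (h.hasDerivAt_X t y).continuousAt

theorem antitone_X (y : ℝ) : Antitone fun t => h.X t y :=
  antitone_of_hasDerivAt_nonpos (f' := fun t => -v t (h.X t y)) (fun t => h.hasDerivAt_X t y)
    fun t => by simpa using h.nonneg t _

/-- The speed is at most 1. Hence a characteristic that ends in the cone t + r ≤ R lies in it at all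
earlier times, which confines the later comparison to bounded regions. -/
theorem monotone_X_add (y : ℝ) : Monotone fun t => h.X t y + t :=
  monotone_of_hasDerivAt_nonneg (f' := fun t => -v t (h.X t y) + 1)
    (fun t => (h.hasDerivAt_X t y).add (hasDerivAt_id t))
    fun t => by have := h.le_one t (h.X t y); simp; linarith

theorem abs_X_sub_le (s t y : ℝ) : |h.X s y - h.X t y| ≤ |s - t| := by
  rcases le_total s t with hst | hst
  · have h1 := h.antitone_X y hst; have h2 := h.monotone_X_add y hst
    simp only at h1 h2
    rw [abs_of_nonneg (by linarith), abs_of_nonpos (by linarith)]; linarith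
  · have h1 := h.antitone_X y hst; have h2 := h.monotone_X_add y hst
    simp only at h1 h2
    rw [abs_of_nonpos (by linarith), abs_of_nonneg (by linarith)]; linarith

theorem abs_X_sub_X_le {t : ℝ} (ht : 0 ≤ t) (y y' : ℝ) :
    |h.X t y - h.X t y'| ≤ |y - y'| * Real.exp (L * t) := by
  have := dist_le_of_trajectories_ODE (v := fun t x => -v t x) (K := ⟨L, h.L_nonneg⟩)
    (f := fun t => h.X t y) (g := fun t => h.X t y') (a := 0) (b := t) (δ := |y - y'|)
    h.lipschitz (h.continuous_X_left y).continuousOn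
    (fun s _ => (h.hasDerivAt_X s y).hasDerivWithinAt) (h.continuous_X_left y').continuousOn
    (fun s _ => (h.hasDerivAt_X s y').hasDerivWithinAt) (by
      rw [h.X_zero, h.X_zero, Real.dist_eq]) t ⟨ht, le_rfl⟩
  rw [Real.dist_eq, sub_zero] at this
  exact this

/-- Grönwall for the flow run backwards in time. It gives the Lipschitz dependence of the label on
the position. -/
theorem abs_sub_le_X_sub {t : ℝ} (ht : 0 ≤ t) (y y' : ℝ) :
    |y - y'| ≤ |h.X t y - h.X t y'| * Real.exp (L * t) := by
  have hd : ∀ y s, HasDerivAt (fun s => h.X (t - s) y) (v (t - s) (h.X (t - s) y)) s := fun y s => by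
    exact ((h.hasDerivAt_X (t - s) y).scomp s ((hasDerivAt_id s).const_sub t)).congr_deriv (by simp)
  have := dist_le_of_trajectories_ODE (v := fun s x => v (t - s) x) (K := ⟨L, h.L_nonneg⟩)
    (f := fun s => h.X (t - s) y) (g := fun s => h.X (t - s) y') (a := 0) (b := t)
    (δ := |h.X t y - h.X t y'|)
    (fun s => LipschitzWith.of_dist_le_mul fun x z => by
      rw [Real.dist_eq, Real.dist_eq]; exact h.lip _ x z)
    ((h.continuous_X_left y).comp (by fun_prop)).continuousOn
    (fun s _ => (hd y s).hasDerivWithinAt) ((h.continuous_X_left y').comp (by fun_prop)).continuousOn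
    (fun s _ => (hd y' s).hasDerivWithinAt) (by simp [Real.dist_eq]) t ⟨ht, le_rfl⟩
  rw [Real.dist_eq, sub_zero, sub_self, h.X_zero, h.X_zero] at this
  exact this

/-- If two characteristics exchanged their order they would meet at some time, which the backward
Grönwall estimate excludes. -/
theorem strictMono_X {t : ℝ} (ht : 0 ≤ t) : StrictMono (h.X t) := by
  intro y y' hy
  by_contra hcon
  push Not at hcon
  have hcont : ContinuousOn (fun s => h.X s y' - h.X s y) (Icc 0 t) :=
    ((h.continuous_X_left y').sub (h.continuous_X_left y)).continuousOn
  obtain ⟨s, hs, hs0⟩ := intermediate_value_Icc' ht hcont (show (0 : ℝ) ∈ _ from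
    ⟨sub_nonpos.2 hcon, by rw [h.X_zero, h.X_zero]; linarith⟩)
  replace hs0 : h.X s y' - h.X s y = 0 := hs0
  have := h.abs_sub_le_X_sub hs.1 y' y
  rw [hs0, abs_zero, zero_mul] at this
  have h2 := abs_nonpos_iff.1 this
  linarith

theorem continuousOn_X : Continuous fun p : ℝ × ℝ => h.X (max p.1 0) p.2 := by
  refine continuous_iff_continuousAt.2 fun p => ?_
  rw [ContinuousAt, tendsto_iff_norm_sub_tendsto_zero]
  have hb : ∀ q : ℝ × ℝ, ‖h.X (max q.1 0) q.2 - h.X (max p.1 0) p.2‖ ≤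
      |max q.1 0 - max p.1 0| + |q.2 - p.2| * Real.exp (L * max p.1 0) := fun q => by
    have e : h.X (max q.1 0) q.2 - h.X (max p.1 0) p.2 =
      (h.X (max q.1 0) q.2 - h.X (max p.1 0) q.2) + (h.X (max p.1 0) q.2 - h.X (max p.1 0) p.2) := by
      ring
    rw [e]
    exact (abs_add_le _ _).trans (add_le_add (h.abs_X_sub_le _ _ _)
      (h.abs_X_sub_X_le (le_max_right _ _) _ _))
  refine squeeze_zero (fun _ => norm_nonneg _) hb ?_
  have : Continuous fun q : ℝ × ℝ => |max q.1 0 - max p.1 0| + |q.2 - p.2| * Real.exp (L * max p.1 0) := by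
    fun_prop
  simpa using this.tendsto p

theorem surjective_X {t : ℝ} (ht : 0 ≤ t) : Function.Surjective (h.X t) := by
  intro r
  have hc : Continuous (h.X t) := by
    have := h.continuousOn_X.comp (f := fun y : ℝ => (t, y)) (by fun_prop)
    simpa [Function.comp_def, max_eq_left ht] using this
  have h1 : h.X t r ≤ r := by have := h.antitone_X r ht; simpa [h.X_zero] using this
  have h2 : r ≤ h.X t (r + t) := by
    have := h.monotone_X_add (r + t) ht; simp only [h.X_zero] at this; linarith
  obtain ⟨y, _, hy⟩ := intermediate_value_Icc (by linarith : r ≤ r + t) hc.continuousOn ⟨h1, h2⟩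
  exact ⟨y, hy⟩

/-- The label of the characteristic through `r` at time `t ≥ 0`. -/
def Y (t r : ℝ) : ℝ := Function.surjInv (h.surjective_X (le_max_right t 0)) r

theorem X_Y {t : ℝ} (ht : 0 ≤ t) (r : ℝ) : h.X t (h.Y t r) = r := by
  have key : h.X (max t 0) (h.Y t r) = r :=
    Function.surjInv_eq (h.surjective_X (le_max_right t 0)) r
  rwa [max_eq_left ht] at key

theorem Y_X {t : ℝ} (ht : 0 ≤ t) (y : ℝ) : h.Y t (h.X t y) = y :=
  (h.strictMono_X ht).injective (h.X_Y ht _)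

/-- The label is defined through a chosen preimage under the flow at time max t 0, and injectivity
of the flow makes the choice irrelevant. -/
theorem Y_max (t r : ℝ) : h.Y (max t 0) r = h.Y t r := by
  have h1 : h.X (max t 0) (h.Y t r) = r :=
    Function.surjInv_eq (h.surjective_X (le_max_right t 0)) r
  rw [← h.Y_X (le_max_right t 0) (h.Y t r), h1]

theorem continuous_Y : Continuous fun p : ℝ × ℝ => h.Y p.1 p.2 := by
  refine continuous_iff_continuousAt.2 fun p => ?_
  rw [ContinuousAt, tendsto_iff_norm_sub_tendsto_zero]
  have hb : ∀ q : ℝ × ℝ, ‖h.Y q.1 q.2 - h.Y p.1 p.2‖ ≤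
      (|q.2 - p.2| + |max p.1 0 - max q.1 0|) * Real.exp (L * max p.1 0) := fun q => by
    refine (h.abs_sub_le_X_sub (le_max_right p.1 0) _ _).trans ?_
    rw [← h.Y_max p.1, h.X_Y (le_max_right p.1 0)]
    gcongr
    have e : h.X (max p.1 0) (h.Y q.1 q.2) - p.2 =
        (q.2 - p.2) + (h.X (max p.1 0) (h.Y q.1 q.2) - h.X (max q.1 0) (h.Y q.1 q.2)) := by
      rw [← h.Y_max q.1, h.X_Y (le_max_right q.1 0)]; ring
    rw [e]
    exact (abs_add_le _ _).trans (add_le_add le_rfl (h.abs_X_sub_le _ _ _))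
  refine squeeze_zero (fun _ => norm_nonneg _) hb ?_
  have : Continuous fun q : ℝ × ℝ => (|q.2 - p.2| + |max p.1 0 - max q.1 0|) * Real.exp (L * max p.1 0) := by
    fun_prop
  simpa using this.tendsto p

/-- The `y`-derivative of the flow, as long as the characteristic stays above `δ`. -/
def jac (δ t y : ℝ) : ℝ := Real.exp (-∫ s in (0 : ℝ)..t, v' s (max (h.X (max s 0) y) δ))

/-- Derivatives of coefficients are continuous only for r > 0. Truncating the radius at δ makes them
continuous everywhere, and changes nothing along a characteristic that stays above δ. -/
theorem continuous_trunc {E : Type*} [TopologicalSpace E] {φ : ℝ → ℝ → E}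
    (hφ : ContinuousOn (fun p : ℝ × ℝ => φ p.1 p.2) {p | 0 < p.2}) {δ : ℝ} (hδ : 0 < δ) :
    Continuous fun p : ℝ × ℝ => φ p.1 (max (h.X (max p.1 0) p.2) δ) :=
  hφ.comp_continuous (f := fun p : ℝ × ℝ => (p.1, max (h.X (max p.1 0) p.2) δ))
    (continuous_fst.prodMk (h.continuousOn_X.max continuous_const))
    fun p => lt_max_of_lt_right hδ

theorem continuous_jac {δ : ℝ} (hδ : 0 < δ) : Continuous fun p : ℝ × ℝ => h.jac δ p.1 p.2 := by
  unfold jac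
  refine Real.continuous_exp.comp (Continuous.neg ?_)
  refine intervalIntegral.continuous_parametric_intervalIntegral_of_continuous
    (f := fun (p : ℝ × ℝ) s => v' s (max (h.X (max s 0) p.2) δ)) ?_ continuous_fst
  exact (h.continuous_trunc h.cont' hδ).comp (f := fun q : (ℝ × ℝ) × ℝ => (q.2, q.1.2)) (by fun_prop)

theorem lt_X_of_lt {δ t y s : ℝ} (hy : δ < h.X t y) (hs : s ∈ Icc 0 t) : δ < h.X s y :=
  lt_of_lt_of_le hy (h.antitone_X y hs.2)

/-- The difference quotient of the flow equals the exponential of minus the integral of the divided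
differences of v. These are bounded by L and converge to v' pointwise, so dominated convergence
applies. -/
theorem hasDerivAt_X_right {δ t y₀ : ℝ} (hδ : 0 < δ) (ht : 0 ≤ t) (hy : δ < h.X t y₀) :
    HasDerivAt (h.X t) (h.jac δ t y₀) y₀ := by
  -- the difference quotient solves a linear equation with the coefficient `κ`
  let κ : ℝ → ℝ → ℝ := fun y s =>
    (v s (h.X (max s 0) y) - v s (h.X (max s 0) y₀)) / (h.X (max s 0) y - h.X (max s 0) y₀)
  have hne : ∀ y, y ≠ y₀ → ∀ s, h.X (max s 0) y - h.X (max s 0) y₀ ≠ 0 := fun y hy s =>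
    sub_ne_zero.2 fun e => hy ((h.strictMono_X (le_max_right s 0)).injective e)
  have cX : ∀ y, Continuous fun s => h.X (max s 0) y := fun y =>
    h.continuousOn_X.comp (f := fun s : ℝ => (s, y)) (by fun_prop)
  have cv : ∀ y, Continuous fun s => v s (h.X (max s 0) y) := fun y =>
    h.cont.comp (f := fun s : ℝ => (s, h.X (max s 0) y)) (continuous_id.prodMk (cX y))
  have cκ : ∀ y, y ≠ y₀ → Continuous (κ y) := fun y hy =>
    ((cv y).sub (cv y₀)).div ((cX y).sub (cX y₀)) (hne y hy)
  have hslope : ∀ y, y ≠ y₀ → slope (h.X t) y₀ y = Real.exp (-∫ s in (0 : ℝ)..t, κ y s) := by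
    intro y hy
    let D : ℝ → ℝ := fun s => (h.X s y - h.X s y₀) * Real.exp (∫ σ in (0 : ℝ)..s, κ y σ)
    have hD : ∀ s ∈ Ico 0 t, HasDerivWithinAt D 0 (Ici s) s := fun s hs => by
      have h1 := ((h.hasDerivAt_X s y).sub (h.hasDerivAt_X s y₀)).mul
        (hasDerivAt_primitive (cκ y hy) s).exp
      refine (h1.congr_deriv ?_).hasDerivWithinAt
      have h2 := hne y hy s
      rw [max_eq_left hs.1] at h2
      simp only [κ, max_eq_left hs.1, Pi.sub_apply]
      field_simp
      ring
    have hDc : ContinuousOn D (Icc 0 t) := Continuous.continuousOn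
      (((h.continuous_X_left y).sub (h.continuous_X_left y₀)).mul
        (Real.continuous_exp.comp (continuous_iff_continuousAt.2 fun s =>
          (hasDerivAt_primitive (cκ y hy) s).continuousAt)))
    have h3 := constant_of_has_deriv_right_zero hDc hD t ⟨ht, le_rfl⟩
    simp only [D, h.X_zero, intervalIntegral.integral_same, Real.exp_zero, mul_one] at h3
    have hy' : y - y₀ ≠ 0 := sub_ne_zero.2 hy
    rw [slope_def_field, Real.exp_neg, div_eq_iff hy', ← h3]
    field_simp
  rw [hasDerivAt_iff_tendsto_slope]
  have hlim : Tendsto (fun y => Real.exp (-∫ s in (0 : ℝ)..t, κ y s)) (𝓝[≠] y₀) (𝓝 (h.jac δ t y₀)) := by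
    refine (Real.continuous_exp.tendsto _).comp (Tendsto.neg ?_)
    refine intervalIntegral.tendsto_integral_filter_of_dominated_convergence (fun _ => L) ?_ ?_
      (by simp) ?_
    · filter_upwards [self_mem_nhdsWithin] with y hy using (cκ y hy).aestronglyMeasurable
    · filter_upwards [self_mem_nhdsWithin] with y hy
      refine Eventually.of_forall fun s _ => ?_
      rw [norm_div, Real.norm_eq_abs, Real.norm_eq_abs, div_le_iff₀ (abs_pos.2 (hne y hy s))]
      exact h.lip _ _ _
    · refine Eventually.of_forall fun s hs => ?_
      rw [uIoc_of_le ht] at hs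
      have hX : δ < h.X s y₀ := h.lt_X_of_lt hy ⟨hs.1.le, hs.2⟩
      have hdv := (hasDerivAt_iff_tendsto_slope.1 (h.deriv s (h.X s y₀) (hδ.trans hX)))
      simp only [κ, max_eq_left hs.1.le, max_eq_left hX.le]
      have ht2 : Tendsto (fun y => h.X s y) (𝓝[≠] y₀) (𝓝[≠] (h.X s y₀)) := by
        refine tendsto_nhdsWithin_iff.2 ⟨?_, ?_⟩
        · have : Continuous fun y => h.X s y := by
            have := h.continuousOn_X.comp (f := fun y : ℝ => (s, y)) (by fun_prop)
            simpa [Function.comp_def, max_eq_left hs.1.le] using this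
          exact this.continuousAt.tendsto.mono_left nhdsWithin_le_nhds
        · filter_upwards [self_mem_nhdsWithin] with y hy
          exact fun e => hy ((h.strictMono_X hs.1.le).injective e)
      refine (hdv.comp ht2).congr fun y => ?_
      simp [slope_def_field]
  refine hlim.congr' ?_
  filter_upwards [self_mem_nhdsWithin] with y hy using (hslope y hy).symm

end Speed

end Flow

end

/-! ### The linear transport equation -/

section

/-- The time derivative at fixed radius is obtained from the one along a curve by subtracting the
transport part. Moving from X t back to X t₀ at time t costs (X t₀ - X t) z' up to a small error, by
the mean value inequality and continuity of z'. -/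
theorem hasDerivWithinAt_of_path {z z' : ℝ → ℝ → ℂ} {X : ℝ → ℝ} {S : Set ℝ} {t₀ x' : ℝ} {ℓ : ℂ}
    (hX : HasDerivWithinAt X x' S t₀) (hpath : HasDerivWithinAt (fun t => z t (X t)) ℓ S t₀)
    (ht₀ : t₀ ∈ S)
    (hd : ∀ᶠ p in 𝓝[S ×ˢ univ] (t₀, X t₀), HasDerivAt (z p.1) (z' p.1 p.2) p.2)
    (hc : ContinuousWithinAt (fun p : ℝ × ℝ => z' p.1 p.2) (S ×ˢ univ) (t₀, X t₀)) :
    HasDerivWithinAt (fun t => z t (X t₀)) (ℓ - x' • z' t₀ (X t₀)) S t₀ := by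
  set r₀ := X t₀ with hr₀
  have h1 : (fun t => z t r₀ - z t (X t) - (r₀ - X t) • z' t₀ r₀) =o[𝓝[S] t₀] fun t => X t - r₀ := by
    refine Asymptotics.isLittleO_iff.2 fun η hη => ?_
    have h2 : ∀ᶠ p in 𝓝[S ×ˢ univ] (t₀, r₀), HasDerivAt (z p.1) (z' p.1 p.2) p.2 ∧
        ‖z' p.1 p.2 - z' t₀ r₀‖ ≤ η := by
      refine hd.and ?_
      have := (tendsto_iff_norm_sub_tendsto_zero.1 hc).eventually (gt_mem_nhds hη)
      filter_upwards [this] with p hp using hp.le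
    rw [nhdsWithin_prod_eq, nhdsWithin_univ] at h2
    obtain ⟨U, hU, W, hW, hUW⟩ := Filter.mem_prod_iff.1 h2
    obtain ⟨ρ, hρ, hρW⟩ := Metric.mem_nhds_iff.1 hW
    have h3 : ∀ᶠ t in 𝓝[S] t₀, X t ∈ Metric.ball r₀ ρ :=
      hX.continuousWithinAt.eventually (Metric.ball_mem_nhds _ hρ)
    filter_upwards [hU, h3] with t htU htX
    have := (convex_ball r₀ ρ).norm_image_sub_le_of_norm_hasDerivWithin_le
      (f := fun r => z t r - r • z' t₀ r₀) (f' := fun r => z' t r - z' t₀ r₀) (C := η)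
      (fun r hr => ((hUW (show (t, r) ∈ U ×ˢ W from ⟨htU, hρW hr⟩)).1.sub
        ((hasDerivAt_id r).smul_const (z' t₀ r₀))).hasDerivWithinAt.congr_deriv (by simp))
      (fun r hr => (hUW (show (t, r) ∈ U ×ˢ W from ⟨htU, hρW hr⟩)).2) htX
      (Metric.mem_ball_self hρ)
    calc _ = ‖z t r₀ - r₀ • z' t₀ r₀ - (z t (X t) - X t • z' t₀ r₀)‖ := by
            congr 1; rw [sub_smul]; ring
      _ ≤ _ := by rw [norm_sub_rev (X t) r₀]; exact this
  have h4 : (fun t => X t - r₀) =O[𝓝[S] t₀] fun t => t - t₀ :=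
    hX.hasFDerivWithinAt.isBigO_sub
  have h5 := h1.trans_isBigO h4
  rw [hasDerivWithinAt_iff_isLittleO] at hX hpath ⊢
  have h6 : (fun t => (X t - X t₀ - (t - t₀) • x') • z' t₀ r₀) =o[𝓝[S] t₀] fun t => t - t₀ := by
    refine Asymptotics.IsBigO.trans_isLittleO ?_ hX
    refine Asymptotics.IsBigO.of_bound ‖z' t₀ r₀‖ (Eventually.of_forall fun t => ?_)
    rw [norm_smul, mul_comm]
  refine ((h5.add hpath).sub h6).congr_left fun t => ?_
  simp only [← hr₀, Complex.real_smul, smul_eq_mul]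
  push_cast
  ring

/-- Data of a linear transport equation `z_t - v z_r = a z + b`, `z(0) = z₀`, whose coefficients are
differentiable in `r > 0`. -/
structure Transp (L : ℝ) (v v' : ℝ → ℝ → ℝ) (a a' b b' : ℝ → ℝ → ℂ) (z₀ z₀' : ℝ → ℂ) : Prop extends
    Speed L v v' where
  cont_a : Continuous fun p : ℝ × ℝ => a p.1 p.2
  cont_b : Continuous fun p : ℝ × ℝ => b p.1 p.2
  deriv_a : ∀ s r, 0 < r → HasDerivAt (a s) (a' s r) r
  deriv_b : ∀ s r, 0 < r → HasDerivAt (b s) (b' s r) r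
  cont_a' : ContinuousOn (fun p : ℝ × ℝ => a' p.1 p.2) {p | 0 < p.2}
  cont_b' : ContinuousOn (fun p : ℝ × ℝ => b' p.1 p.2) {p | 0 < p.2}
  cont_z₀ : Continuous z₀
  deriv_z₀ : ∀ y, 0 < y → HasDerivAt z₀ (z₀' y) y
  cont_z₀' : ContinuousOn z₀' (Ioi 0)

namespace Transp

variable {L : ℝ} {v v' : ℝ → ℝ → ℝ} {a a' b b' : ℝ → ℝ → ℂ} {z₀ z₀' : ℝ → ℂ}
  (h : Transp L v v' a a' b b' z₀ z₀')
include h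

/-- The integral of `a` along a characteristic. -/
def P (t y : ℝ) : ℂ := ∫ s in (0 : ℝ)..t, a s (h.X (max s 0) y)

/-- The integral part of the Duhamel formula. -/
def I (t y : ℝ) : ℂ := z₀ y + ∫ s in (0 : ℝ)..t, Complex.exp (-h.P s y) * b s (h.X (max s 0) y)

/-- The solution along the characteristic with label `y`. -/
def zt (t y : ℝ) : ℂ := Complex.exp (h.P t y) * h.I t y

/-- The solution of the transport equation. -/
def z (t r : ℝ) : ℂ := h.zt (max t 0) (h.Y t (max r 0))

theorem continuous_aX : Continuous fun p : ℝ × ℝ => a p.1 (h.X (max p.1 0) p.2) :=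
  h.cont_a.comp (f := fun p : ℝ × ℝ => (p.1, h.X (max p.1 0) p.2)) (continuous_fst.prodMk h.continuousOn_X)

theorem continuous_bX : Continuous fun p : ℝ × ℝ => b p.1 (h.X (max p.1 0) p.2) :=
  h.cont_b.comp (f := fun p : ℝ × ℝ => (p.1, h.X (max p.1 0) p.2)) (continuous_fst.prodMk h.continuousOn_X)

omit h in
theorem continuous_integral {Φ : ℝ → ℝ → ℂ} (hΦ : Continuous fun p : ℝ × ℝ => Φ p.1 p.2) :
    Continuous fun p : ℝ × ℝ => ∫ s in (0 : ℝ)..p.1, Φ s p.2 :=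
  intervalIntegral.continuous_parametric_intervalIntegral_of_continuous
    (f := fun (p : ℝ × ℝ) s => Φ s p.2)
    (hΦ.comp (f := fun q : (ℝ × ℝ) × ℝ => (q.2, q.1.2)) (by fun_prop)) continuous_fst

theorem continuous_P : Continuous fun p : ℝ × ℝ => h.P p.1 p.2 :=
  continuous_integral (Φ := fun s y => a s (h.X (max s 0) y)) h.continuous_aX

theorem continuous_I_integrand :
    Continuous fun p : ℝ × ℝ => Complex.exp (-h.P p.1 p.2) * b p.1 (h.X (max p.1 0) p.2) :=
  (Complex.continuous_exp.comp h.continuous_P.neg).mul h.continuous_bX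

theorem continuous_I : Continuous fun p : ℝ × ℝ => h.I p.1 p.2 :=
  (h.cont_z₀.comp continuous_snd).add (continuous_integral
    (Φ := fun s y => Complex.exp (-h.P s y) * b s (h.X (max s 0) y)) h.continuous_I_integrand)

theorem continuous_zt : Continuous fun p : ℝ × ℝ => h.zt p.1 p.2 :=
  (Complex.continuous_exp.comp h.continuous_P).mul h.continuous_I

theorem continuous_z : Continuous fun p : ℝ × ℝ => h.z p.1 p.2 :=
  h.continuous_zt.comp (f := fun p : ℝ × ℝ => (max p.1 0, h.Y p.1 (max p.2 0)))
    ((continuous_fst.max continuous_const).prodMk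
      (h.continuous_Y.comp (f := fun p : ℝ × ℝ => (p.1, max p.2 0)) (by fun_prop)))

omit h in
theorem slice {Φ : ℝ → ℝ → ℂ} (hΦ : Continuous fun p : ℝ × ℝ => Φ p.1 p.2) (y : ℝ) :
    Continuous fun s => Φ s y := hΦ.comp (f := fun s : ℝ => (s, y)) (by fun_prop)

theorem hasDerivAt_P (t y : ℝ) : HasDerivAt (fun t => h.P t y) (a t (h.X (max t 0) y)) t :=
  hasDerivAt_primitive' (slice (Φ := fun s y => a s (h.X (max s 0) y)) h.continuous_aX y) t

theorem hasDerivAt_I (t y : ℝ) : HasDerivAt (fun t => h.I t y)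
    (Complex.exp (-h.P t y) * b t (h.X (max t 0) y)) t :=
  (hasDerivAt_primitive' (slice (Φ := fun s y => Complex.exp (-h.P s y) * b s (h.X (max s 0) y))
    h.continuous_I_integrand y) t).const_add _

theorem hasDerivAt_zt (t y : ℝ) : HasDerivAt (fun t => h.zt t y)
    (a t (h.X (max t 0) y) * h.zt t y + b t (h.X (max t 0) y)) t := by
  refine ((h.hasDerivAt_P t y).cexp.mul (h.hasDerivAt_I t y)).congr_deriv ?_
  rw [zt, ← mul_assoc (Complex.exp (h.P t y)), ← Complex.exp_add, add_neg_cancel, Complex.exp_zero]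
  ring

theorem zt_zero (y : ℝ) : h.zt 0 y = z₀ y := by simp [zt, I, P]

theorem z_X {t y : ℝ} (ht : 0 ≤ t) (hy : 0 ≤ h.X t y) : h.z t (h.X t y) = h.zt t y := by
  rw [z, max_eq_left ht, max_eq_left hy, h.Y_X ht]

theorem z_zero {r : ℝ} (hr : 0 ≤ r) : h.z 0 r = z₀ r := by
  have h1 := h.z_X (t := 0) (y := r) le_rfl (by rwa [h.X_zero])
  rwa [h.X_zero, h.zt_zero] at h1

theorem z_clamp (t r : ℝ) : h.z t r = h.z (max t 0) (max r 0) := by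
  simp [z, h.Y_max]

section Deriv

variable (δ : ℝ)

/-- The `y`-derivative of `P`. -/
def Py (t y : ℝ) : ℂ := ∫ s in (0 : ℝ)..t, a' s (max (h.X (max s 0) y) δ) * h.jac δ s y

/-- The `y`-derivative of `I`. -/
def Iy (t y : ℝ) : ℂ := z₀' (max y δ) + ∫ s in (0 : ℝ)..t,
  (Complex.exp (-h.P s y) * (b' s (max (h.X (max s 0) y) δ) * h.jac δ s y)
    - Complex.exp (-h.P s y) * h.Py δ s y * b s (h.X (max s 0) y))

/-- The `y`-derivative of `zt`. -/
def zy (t y : ℝ) : ℂ := Complex.exp (h.P t y) * (h.Py δ t y * h.I t y + h.Iy δ t y)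

variable {δ} (hδ : 0 < δ)
include hδ

theorem continuous_Py_integrand :
    Continuous fun p : ℝ × ℝ => a' p.1 (max (h.X (max p.1 0) p.2) δ) * h.jac δ p.1 p.2 :=
  (h.continuous_trunc h.cont_a' hδ).mul (Complex.continuous_ofReal.comp (h.continuous_jac hδ))

theorem continuous_Py : Continuous fun p : ℝ × ℝ => h.Py δ p.1 p.2 :=
  continuous_integral (Φ := fun s y => a' s (max (h.X (max s 0) y) δ) * h.jac δ s y)
    (h.continuous_Py_integrand hδ)

theorem continuous_Iy_integrand : Continuous fun p : ℝ × ℝ =>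
    Complex.exp (-h.P p.1 p.2) * (b' p.1 (max (h.X (max p.1 0) p.2) δ) * h.jac δ p.1 p.2)
    - Complex.exp (-h.P p.1 p.2) * h.Py δ p.1 p.2 * b p.1 (h.X (max p.1 0) p.2) := by
  have h1 := Complex.continuous_exp.comp h.continuous_P.neg
  exact (h1.mul ((h.continuous_trunc h.cont_b' hδ).mul
    (Complex.continuous_ofReal.comp (h.continuous_jac hδ)))).sub
    ((h1.mul (h.continuous_Py hδ)).mul h.continuous_bX)

theorem continuous_Iy : Continuous fun p : ℝ × ℝ => h.Iy δ p.1 p.2 := by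
  refine Continuous.add ?_ (continuous_integral (Φ := fun s y => Complex.exp (-h.P s y) *
    (b' s (max (h.X (max s 0) y) δ) * h.jac δ s y)
    - Complex.exp (-h.P s y) * h.Py δ s y * b s (h.X (max s 0) y)) (h.continuous_Iy_integrand hδ))
  exact h.cont_z₀'.comp_continuous (f := fun p : ℝ × ℝ => max p.2 δ) (by fun_prop)
    fun p => lt_max_of_lt_right hδ

theorem continuous_zy : Continuous fun p : ℝ × ℝ => h.zy δ p.1 p.2 :=
  (Complex.continuous_exp.comp h.continuous_P).mul
    (((h.continuous_Py hδ).mul h.continuous_I).add (h.continuous_Iy hδ))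

omit hδ in
theorem lt_X_mem_nhds {t y : ℝ} (ht : 0 ≤ t) (hy : δ < h.X t y) : {y | δ < h.X t y} ∈ 𝓝 y := by
  have hc : Continuous (h.X t) := by
    have := h.continuousOn_X.comp (f := fun y : ℝ => (t, y)) (by fun_prop)
    simpa [Function.comp_def, max_eq_left ht] using this
  exact (isOpen_lt continuous_const hc).mem_nhds hy

theorem hasDerivAt_comp_X {φ φ' : ℝ → ℝ → ℂ} (hφ : ∀ s r, 0 < r → HasDerivAt (φ s) (φ' s r) r)
    {s y : ℝ} (hs : 0 ≤ s) (hy : δ < h.X s y) :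
    HasDerivAt (fun y => φ s (h.X (max s 0) y))
      (φ' s (max (h.X (max s 0) y) δ) * h.jac δ s y) y := by
  simp only [max_eq_left hs, max_eq_left hy.le]
  exact ((hφ s _ (hδ.trans hy)).scomp y (h.hasDerivAt_X_right hδ hs hy)).congr_deriv (by
    rw [Complex.real_smul, mul_comm])

theorem hasDerivAt_P_right {t y : ℝ} (ht : 0 ≤ t) (hy : δ < h.X t y) :
    HasDerivAt (h.P t) (h.Py δ t y) y :=
  hasDerivAt_integral_param (Φ := fun s y => a s (h.X (max s 0) y))
    (Φ' := fun s y => a' s (max (h.X (max s 0) y) δ) * h.jac δ s y)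
    h.continuous_aX (h.continuous_Py_integrand hδ) ht (h.lt_X_mem_nhds ht hy)
    fun s hs y hy => h.hasDerivAt_comp_X hδ h.deriv_a hs.1 (h.lt_X_of_lt hy hs)

theorem hasDerivAt_I_right {t y : ℝ} (ht : 0 ≤ t) (hy : δ < h.X t y) :
    HasDerivAt (h.I t) (h.Iy δ t y) y := by
  have hy0 : δ < y := by simpa [h.X_zero] using h.lt_X_of_lt hy ⟨le_rfl, ht⟩
  refine HasDerivAt.add ?_ (hasDerivAt_integral_param
    (Φ := fun s y => Complex.exp (-h.P s y) * b s (h.X (max s 0) y))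
    (Φ' := fun s y => Complex.exp (-h.P s y) * (b' s (max (h.X (max s 0) y) δ) * h.jac δ s y)
    - Complex.exp (-h.P s y) * h.Py δ s y * b s (h.X (max s 0) y))
    h.continuous_I_integrand (h.continuous_Iy_integrand hδ) ht (h.lt_X_mem_nhds ht hy) ?_)
  · rw [max_eq_left hy0.le]; exact h.deriv_z₀ y (hδ.trans hy0)
  · intro s hs y hy
    have hys := h.lt_X_of_lt hy hs
    refine ((h.hasDerivAt_P_right hδ hs.1 hys).neg.cexp.mul
      (h.hasDerivAt_comp_X hδ h.deriv_b hs.1 hys)).congr_deriv ?_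
    simp only [Pi.neg_apply]
    ring

theorem hasDerivAt_zt_right {t y : ℝ} (ht : 0 ≤ t) (hy : δ < h.X t y) :
    HasDerivAt (h.zt t) (h.zy δ t y) y := by
  refine ((h.hasDerivAt_P_right hδ ht hy).cexp.mul (h.hasDerivAt_I_right hδ ht hy)).congr_deriv ?_
  rw [zy]; ring

theorem hasDerivAt_Py (t y : ℝ) : HasDerivAt (fun t => h.Py δ t y)
    (a' t (max (h.X (max t 0) y) δ) * h.jac δ t y) t :=
  hasDerivAt_primitive' (slice (Φ := fun s y => a' s (max (h.X (max s 0) y) δ) * h.jac δ s y)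
    (h.continuous_Py_integrand hδ) y) t

theorem hasDerivAt_Iy (t y : ℝ) : HasDerivAt (fun t => h.Iy δ t y)
    (Complex.exp (-h.P t y) * (b' t (max (h.X (max t 0) y) δ) * h.jac δ t y)
    - Complex.exp (-h.P t y) * h.Py δ t y * b t (h.X (max t 0) y)) t :=
  (hasDerivAt_primitive' (slice (Φ := fun s y => Complex.exp (-h.P s y) *
    (b' s (max (h.X (max s 0) y) δ) * h.jac δ s y)
    - Complex.exp (-h.P s y) * h.Py δ s y * b s (h.X (max s 0) y))
    (h.continuous_Iy_integrand hδ) y) t).const_add _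

theorem hasDerivAt_zy (t y : ℝ) : HasDerivAt (fun t => h.zy δ t y)
    (a t (h.X (max t 0) y) * h.zy δ t y + (a' t (max (h.X (max t 0) y) δ) * h.zt t y
      + b' t (max (h.X (max t 0) y) δ)) * h.jac δ t y) t := by
  refine ((h.hasDerivAt_P t y).cexp.mul (((h.hasDerivAt_Py hδ t y).mul (h.hasDerivAt_I t y)).add
    (h.hasDerivAt_Iy hδ t y))).congr_deriv ?_
  have e : Complex.exp (h.P t y) * Complex.exp (-h.P t y) = 1 := by
    rw [← Complex.exp_add, add_neg_cancel, Complex.exp_zero]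
  simp only [zy, zt, Pi.add_apply, Pi.mul_apply]
  linear_combination (b' t (max (h.X (max t 0) y) δ) * h.jac δ t y) * e

theorem hasDerivAt_jac (t y : ℝ) : HasDerivAt (fun t => h.jac δ t y)
    (-(v' t (max (h.X (max t 0) y) δ) * h.jac δ t y)) t := by
  have h1 : Continuous fun s => v' s (max (h.X (max s 0) y) δ) :=
    (h.continuous_trunc h.cont' hδ).comp (f := fun s : ℝ => (s, y)) (by fun_prop)
  refine (hasDerivAt_primitive' h1 t).neg.exp.congr_deriv ?_
  simp only [Speed.jac, Pi.neg_apply]; ring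

omit hδ in
theorem jac_pos (t y : ℝ) : 0 < h.jac δ t y := Real.exp_pos _

/-- The solution is zt composed with the label map, and the label map is differentiable as the
inverse of the flow, whose derivative `jac` is positive. -/
theorem hasDerivAt_z_aux {t r : ℝ} (ht : 0 ≤ t) (hr : δ < r) :
    HasDerivAt (h.z t) (h.zy δ t (h.Y t r) / h.jac δ t (h.Y t r)) r := by
  have hX : h.X t (h.Y t r) = r := h.X_Y ht r
  have hy : δ < h.X t (h.Y t r) := by rwa [hX]
  have hYc : ContinuousAt (h.Y t) r :=
    (h.continuous_Y.comp (f := fun r : ℝ => (t, r)) (by fun_prop)).continuousAt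
  have h1 : HasDerivAt (h.Y t) (h.jac δ t (h.Y t r))⁻¹ r :=
    HasDerivAt.of_local_left_inverse hYc (h.hasDerivAt_X_right hδ ht hy) (h.jac_pos t _).ne'
      (Eventually.of_forall fun r => h.X_Y ht r)
  have h2 := (h.hasDerivAt_zt_right hδ ht hy).scomp r h1
  have h3 : h.z t =ᶠ[𝓝 r] fun r => h.zt t (h.Y t r) := by
    filter_upwards [lt_mem_nhds (hδ.trans hr)] with r hr
    simp [z, max_eq_left ht, max_eq_left hr.le]
  refine (h2.congr_of_eventuallyEq h3).congr_deriv ?_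
  rw [Complex.real_smul, div_eq_mul_inv, mul_comm]; push_cast; rfl

end Deriv

/-- The radial derivative of the solution. -/
def z' (t r : ℝ) : ℂ := deriv (h.z t) r

theorem z'_eq {δ t r : ℝ} (hδ : 0 < δ) (ht : 0 ≤ t) (hr : δ < r) :
    h.z' t r = h.zy δ t (h.Y t r) / h.jac δ t (h.Y t r) := (h.hasDerivAt_z_aux hδ ht hr).deriv

theorem hasDerivAt_z {t r : ℝ} (ht : 0 ≤ t) (hr : 0 < r) : HasDerivAt (h.z t) (h.z' t r) r :=
  (h.hasDerivAt_z_aux (half_pos hr) ht (half_lt_self hr)).differentiableAt.hasDerivAt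

theorem continuousOn_z' : ContinuousOn (fun p : ℝ × ℝ => h.z' p.1 p.2) (Ici 0 ×ˢ Ioi 0) := by
  intro p hp
  have hδ := half_pos (show 0 < p.2 from hp.2)
  have h1 : Continuous fun q : ℝ × ℝ => h.zy (p.2 / 2) q.1 (h.Y q.1 q.2) /
      (h.jac (p.2 / 2) q.1 (h.Y q.1 q.2) : ℂ) := by
    have hY : Continuous fun q : ℝ × ℝ => (q.1, h.Y q.1 q.2) := continuous_fst.prodMk h.continuous_Y
    refine ((h.continuous_zy hδ).comp hY).div
      (Complex.continuous_ofReal.comp ((h.continuous_jac hδ).comp hY)) fun q => ?_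
    exact_mod_cast (h.jac_pos _ _).ne'
  refine h1.continuousWithinAt.congr_of_eventuallyEq ?_ (h.z'_eq hδ hp.1 (half_lt_self hp.2))
  have h2 : {q : ℝ × ℝ | p.2 / 2 < q.2} ∈ 𝓝[Ici 0 ×ˢ Ioi 0] p :=
    mem_nhdsWithin_of_mem_nhds ((isOpen_lt continuous_const continuous_snd).mem_nhds
      (half_lt_self (show 0 < p.2 from hp.2)))
  filter_upwards [h2, self_mem_nhdsWithin] with q hq hq'
  exact h.z'_eq hδ hq'.1 hq

/-- The equation satisfied by the radial derivative along a characteristic. -/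
theorem hasDerivWithinAt_z'_X {s t y : ℝ} (hs : s ∈ Ico 0 t) (hy : 0 < h.X t y) :
    HasDerivWithinAt (fun s => h.z' s (h.X s y)) ((a s (h.X s y) + v' s (h.X s y)) * h.z' s (h.X s y)
      + (a' s (h.X s y) * h.z s (h.X s y) + b' s (h.X s y))) (Ici s) s := by
  have hδ := half_pos hy
  set δ := h.X t y / 2
  have hlt : ∀ s ∈ Icc 0 t, δ < h.X s y := fun s hs => h.lt_X_of_lt (half_lt_self hy) hs
  -- Along a characteristic the radial derivative is the quotient of the label derivatives of
  -- solution and flow. Both solve ordinary equations in time, so no second derivative of z is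
  -- required.
  have e : ∀ s ∈ Icc 0 t, h.z' s (h.X s y) = h.zy δ s y / h.jac δ s y := fun s hs => by
    rw [h.z'_eq hδ hs.1 (hlt s hs), h.Y_X hs.1]
  have hs' : s ∈ Icc 0 t := ⟨hs.1, hs.2.le⟩
  have hj : ((h.jac δ s y : ℝ) : ℂ) ≠ 0 := by exact_mod_cast (h.jac_pos _ _).ne'
  have h1 := ((h.hasDerivAt_zy hδ s y).div (h.hasDerivAt_jac hδ s y).ofReal_comp hj)
  have h2 : (fun s => h.z' s (h.X s y)) =ᶠ[𝓝[Ici s] s] fun s => h.zy δ s y / h.jac δ s y := by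
    filter_upwards [Icc_mem_nhdsGE hs.2] with σ hσ using e σ ⟨hs.1.trans hσ.1, hσ.2⟩
  refine (h1.hasDerivWithinAt.congr_of_eventuallyEq h2 (e s hs')).congr_deriv ?_
  simp only [max_eq_left hs.1, max_eq_left (hlt s hs').le]
  rw [e s hs', h.z_X hs.1 (hδ.trans (hlt s hs')).le]
  push_cast
  field_simp
  ring

/-- Along its characteristic z satisfies an ordinary differential equation; subtracting the
transport term through `hasDerivWithinAt_of_path` gives the equation at fixed r. -/
theorem hasDerivWithinAt_z {t r : ℝ} (ht : 0 ≤ t) (hr : 0 < r) :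
    HasDerivWithinAt (fun t => h.z t r) (v t r * h.z' t r + a t r * h.z t r + b t r) (Ici 0) t := by
  have hX : h.X t (h.Y t r) = r := h.X_Y ht r
  set y := h.Y t r
  have hz : HasDerivWithinAt (fun s => h.z s (h.X s y)) (a t r * h.z t r + b t r) (Ici 0) t := by
    have h1 := h.hasDerivAt_zt t y
    rw [max_eq_left ht, hX] at h1
    have h2 : h.zt t y = h.z t r := by rw [← h.z_X ht (by rw [hX]; exact hr.le), hX]
    rw [h2] at h1
    refine h1.hasDerivWithinAt.congr_of_eventuallyEq ?_ (by rw [hX, h2])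
    have h3 : ∀ᶠ s in 𝓝[Ici 0] t, 0 < h.X s y :=
      ((h.continuous_X_left y).continuousWithinAt).eventually (lt_mem_nhds (hr.trans_eq hX.symm))
    filter_upwards [h3, self_mem_nhdsWithin] with s hs hs'
    exact h.z_X hs' hs.le
  have hmem : Ici (0 : ℝ) ×ˢ Ioi (0 : ℝ) ∈ 𝓝[Ici 0 ×ˢ univ] (t, r) := by
    rw [nhdsWithin_prod_eq, nhdsWithin_univ]
    exact prod_mem_prod self_mem_nhdsWithin (Ioi_mem_nhds hr)
  have h4 := hasDerivWithinAt_of_path (z := h.z) (z' := h.z') (h.hasDerivAt_X t y).hasDerivWithinAt hz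
    (show t ∈ Ici 0 from ht) (by
      rw [hX]
      filter_upwards [hmem] with p hp using h.hasDerivAt_z hp.1 hp.2) (by
      rw [hX]
      exact (h.continuousOn_z' (t, r) ⟨ht, hr⟩).mono_of_mem_nhdsWithin hmem)
  rw [hX] at h4
  refine h4.congr_deriv ?_
  rw [Complex.real_smul]; push_cast; ring

end Transp

end

/-! ### One step of the iteration preserves the decay -/

section

/-- Differentiability is not assumed at the left end point, which will be the centre; the estimate
is proved from x > a and x tends to a. -/
theorem norm_sub_le_of_norm_deriv_le {E : Type*} [NormedAddCommGroup E] [NormedSpace ℝ E]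
    {f f' : ℝ → E} {F F' : ℝ → ℝ} {a b : ℝ} (hab : a ≤ b) (hf : ContinuousOn f (Icc a b))
    (hF : ContinuousOn F (Icc a b)) (hd : ∀ x ∈ Ioc a b, HasDerivAt f (f' x) x)
    (hD : ∀ x ∈ Ioc a b, HasDerivAt F (F' x) x) (hle : ∀ x ∈ Ioc a b, ‖f' x‖ ≤ F' x) :
    ‖f b - f a‖ ≤ F b - F a := by
  rcases hab.eq_or_lt with rfl | hab
  · simp
  have h1 : ∀ x ∈ Ioo a b, ‖f b - f x‖ ≤ F b - F x := fun x hx => by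
    have hsub : Icc x b ⊆ Icc a b := Icc_subset_Icc_left hx.1.le
    have hm : ∀ y ∈ Ico x b, y ∈ Ioc a b := fun y hy => ⟨hx.1.trans_le hy.1, hy.2.le⟩
    exact image_norm_le_of_norm_deriv_right_le_deriv_boundary' (f := fun y => f y - f x)
      (f' := f') (B := fun y => F y - F x) (B' := F') ((hf.mono hsub).sub continuousOn_const)
      (fun y hy => ((hd y (hm y hy)).sub_const _).hasDerivWithinAt) (by simp)
      ((hF.mono hsub).sub continuousOn_const)
      (fun y hy => ((hD y (hm y hy)).sub_const _).hasDerivWithinAt)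
      (fun y hy => hle y (hm y hy)) ⟨hx.2.le, le_rfl⟩
  have hne : (𝓝[Ioo a b] a).NeBot := by
    rw [← mem_closure_iff_nhdsWithin_neBot, closure_Ioo hab.ne]; exact ⟨le_rfl, hab.le⟩
  have ha : a ∈ Icc a b := ⟨le_rfl, hab.le⟩
  refine le_of_tendsto_of_tendsto (b := 𝓝[Ioo a b] a) (f := fun x => ‖f b - f x‖)
    (g := fun x => F b - F x) ?_ ?_ ?_
  · exact (tendsto_const_nhds.sub ((hf a ha).mono Ioo_subset_Icc_self)).norm
  · exact tendsto_const_nhds.sub ((hF a ha).mono Ioo_subset_Icc_self)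
  · filter_upwards [self_mem_nhdsWithin] with x hx using h1 x hx

/-- A linear differential inequality with integrable coefficients. -/
theorem norm_le_of_deriv_le {ψ ψ' : ℝ → ℂ} {t N κ β : ℝ} (ht : 0 ≤ t) (hN : 0 < N) (hκ : κ ≤ 1 / 4)
    (hκ0 : 0 ≤ κ) (hβ : β ≤ N / 4) (hc : ContinuousOn ψ (Icc 0 t))
    (hd : ∀ s ∈ Ico 0 t, HasDerivWithinAt ψ (ψ' s) (Ici s) s)
    (hb : ∀ s ∈ Ico 0 t, ‖ψ' s‖ ≤ (κ * ‖ψ s‖ + β) / (1 + s) ^ 2) (h0 : ‖ψ 0‖ ≤ N) :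
    ‖ψ t‖ ≤ 2 * N := by
  have hBd : ∀ s, 0 ≤ s → HasDerivAt (fun s => N * (2 - 1 / (1 + s))) (N / (1 + s) ^ 2) s :=
    fun s hs => by
      have h1 : 1 + s ≠ 0 := by positivity
      have h2 := (((hasDerivAt_id s).const_add 1).inv h1).const_sub 2 |>.const_mul N
      refine (h2.congr_deriv ?_).congr_of_eventuallyEq ?_
      · simp [neg_div]; rfl
      · exact Eventually.of_forall fun s => by simp
  -- The barrier N(2 - 1/(1+s)) has derivative N/(1+s)². Where the norm meets it, the norm is at
  -- most 2N, so the right-hand side is at most (2N/4 + N/4)/(1+s)², strictly less.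
  have h1 := image_norm_le_of_norm_deriv_right_lt_deriv_boundary' (f := ψ) (f' := ψ')
    (B := fun s => N * (2 - 1 / (1 + s))) (B' := fun s => N / (1 + s) ^ 2) hc hd
    (by simpa using h0.trans_eq (by ring))
    (fun s hs => (hBd s hs.1).continuousAt.continuousWithinAt)
    (fun s hs => (hBd s hs.1).hasDerivWithinAt) (fun s hs he => by
      refine (hb s hs).trans_lt ?_
      have hs1 : 0 < 1 + s := by linarith [hs.1]
      gcongr
      have : ‖ψ s‖ ≤ 2 * N := by
        rw [he]; have : 0 ≤ 1 / (1 + s) := by positivity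
        nlinarith
      nlinarith) (x := t) ⟨ht, le_rfl⟩
  refine h1.trans ?_
  have : 0 ≤ 1 / (1 + t) := by positivity
  nlinarith

/-- The linear bound forces the value 0 at r = 0, so continuity on r > 0 extends across the axis
once negative radii are clamped to it. -/
theorem continuous_clamp {E : Type*} [NormedAddCommGroup E] {Φ : ℝ → ℝ → E} {C : ℝ}
    (hc : ContinuousOn (fun p : ℝ × ℝ => Φ p.1 p.2) {p | 0 < p.2})
    (hb : ∀ τ r, 0 ≤ r → ‖Φ τ r‖ ≤ C * r) : Continuous fun p : ℝ × ℝ => Φ p.1 (max p.2 0) := by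
  refine continuous_iff_continuousAt.2 fun p => ?_
  rcases lt_or_ge 0 p.2 with hp | hp
  · have h1 : ContinuousAt (fun p : ℝ × ℝ => Φ p.1 p.2) p :=
      hc.continuousAt ((isOpen_lt continuous_const continuous_snd).mem_nhds hp)
    refine h1.congr ?_
    filter_upwards [(isOpen_lt continuous_const continuous_snd).mem_nhds hp] with q hq
    rw [max_eq_left (show 0 ≤ q.2 from le_of_lt hq)]
  · have h0 : Φ p.1 (max p.2 0) = 0 := by
      rw [max_eq_right hp]; exact norm_le_zero_iff.1 ((hb _ _ le_rfl).trans_eq (mul_zero C))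
    rw [ContinuousAt, h0]
    refine squeeze_zero_norm (a := fun q : ℝ × ℝ => C * max q.2 0) (fun q => hb _ _ (le_max_right _ _)) ?_
    have : Continuous fun q : ℝ × ℝ => C * max q.2 0 := by fun_prop
    have := this.tendsto p
    rwa [max_eq_right hp, mul_zero] at this

/-- The set of functions in which the solution is constructed. -/
structure Ball (A : ℝ) (w : ℝ → ℝ → ℂ) : Prop where
  cont : Continuous fun p : ℝ × ℝ => w p.1 p.2
  clamp : ∀ τ r, w τ r = w (max τ 0) (max r 0)
  prof : ∀ τ, 0 ≤ τ → Prof A (1 + τ) (w τ)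

/-- The smallness of the ball. -/
structure Small (V V₁ V₂ : ℝ → ℝ) (K A : ℝ) : Prop extends Pot V V₁ V₂ K where
  pos : 0 < A
  le : (1 + K) * A ≤ 1 / 200

/-- Small initial data. -/
structure Init (A : ℝ) (z₀ z₀' : ℝ → ℂ) : Prop where
  cont : Continuous z₀
  deriv : ∀ y, 0 < y → HasDerivAt z₀ (z₀' y) y
  cont' : ContinuousOn z₀' (Ioi 0)
  bd : ∀ y, 0 ≤ y → ‖z₀ y‖ ≤ A / 80 / (1 + y) ^ 2
  bd' : ∀ y, 0 < y → ‖z₀' y‖ ≤ A / 80 / (1 + y) ^ 3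

section

variable {V V₁ V₂ : ℝ → ℝ} {K A : ℝ} {w : ℝ → ℝ → ℂ} {z₀ z₀' : ℝ → ℂ}

theorem Small.sq_le (h : Small V V₁ V₂ K A) : (1 + K) * A ^ 2 ≤ 1 / 40000 := by
  have h1 := h.le; have h2 := h.pos; have h3 := h.nonneg
  have h4 : A ≤ 1 / 200 := by nlinarith
  have h5 := mul_le_mul h1 h4 h2.le (by norm_num)
  nlinarith

theorem Small.le_one (h : Small V V₁ V₂ K A) : A ≤ 1 := by
  have h1 := h.le; have h2 := h.pos; have h3 := h.nonneg; nlinarith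

theorem Ball.eq_max (hw : Ball A w) (τ : ℝ) : w τ = w (max τ 0) := by
  funext r; rw [hw.clamp τ r, hw.clamp (max τ 0) r, max_eq_left (le_max_right τ 0)]

theorem Ball.fam (hw : Ball A w) : Fam A w :=
  ⟨hw.cont, fun τ => by rw [hw.eq_max]; exact (hw.prof _ (le_max_right τ 0)).loc⟩

theorem Ball.prof' (hw : Ball A w) (τ : ℝ) : Prof A (1 + max τ 0) (w τ) := by
  rw [hw.eq_max]; exact hw.prof _ (le_max_right τ 0)

theorem Prof.r_mul_sq_le {c : ℝ} {f : ℝ → ℂ} (h : Prof A c f) {r : ℝ} (hr : 0 ≤ r) :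
    r * (A / (c * (c + r))) ^ 2 ≤ A ^ 2 / c ^ 2 := by
  have hx := h.x_pos hr; have hc := h.pos; have hc1 := h.one_le
  rw [div_pow, mul_pow, ← mul_div_assoc, div_le_div_iff₀ (by positivity) (by positivity)]
  have h1 : r ≤ (c + r) ^ 2 := by nlinarith
  have : 0 ≤ A ^ 2 * c ^ 2 := by positivity
  nlinarith

theorem Prof.sq_div_le {c : ℝ} {f : ℝ → ℂ} (h : Prof A c f) : A ^ 2 / c ^ 2 ≤ A ^ 2 :=
  div_le_self (sq_nonneg _) (by nlinarith [h.one_le])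

theorem Prof.r_mul_cube_le {c : ℝ} {f : ℝ → ℂ} (h : Prof A c f) {r : ℝ} (hr : 0 ≤ r) :
    r * (A / (c * (c + r))) ^ 3 ≤ A ^ 3 / (c ^ 2 * (c + r) ^ 2) := by
  have hx := h.x_pos hr; have hc := h.pos; have hc1 := h.one_le
  have hA := h.nonneg
  rw [div_pow, mul_pow, ← mul_div_assoc, div_le_div_iff₀ (by positivity) (by positivity)]
  have h1 : r * 1 ≤ (c + r) * c := by gcongr; linarith
  have : 0 ≤ A ^ 3 * (c ^ 2 * (c + r) ^ 2) := by positivity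
  nlinarith

theorem Prof.cube_le {c : ℝ} {f : ℝ → ℂ} (h : Prof A c f) {r : ℝ} (hr : 0 ≤ r) :
    (A / (c * (c + r))) ^ 3 ≤ A ^ 3 / (c ^ 2 * (c + r) ^ 3) := by
  have hx := h.x_pos hr; have hc := h.pos; have hc1 := h.one_le
  have hA := h.nonneg
  rw [div_pow, mul_pow]
  have : c ^ 2 ≤ c ^ 3 := pow_le_pow_right₀ hc1 (by norm_num)
  gcongr

/-- Since rp ≤ A, the deviation from 1 is at most (2 + 2K)A² ≤ 1/20000. The interval chosen here
puts the speed Gt/2 between 3/8 and 5/8. -/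
theorem Prof.Gt_mem {c : ℝ} {f : ℝ → ℂ} (h : Prof A c f) (hV : Small V V₁ V₂ K A) {r : ℝ}
    (hr : 0 ≤ r) : Gt V f r ∈ Icc (3 / 4) (5 / 4) := by
  have h1 := h.abs_Gt_sub_one_le hV.toPot hr
  have h2 : r ^ 2 * (A / (c * (c + r))) ^ 2 ≤ A ^ 2 := by
    rw [← mul_pow]
    refine pow_le_pow_left₀ (mul_nonneg hr (h.p_nonneg hr)) ?_ 2
    have hx := h.x_pos hr; have hc := h.pos; have hc1 := h.one_le; have hA := h.nonneg
    rw [← mul_div_assoc, div_le_iff₀ (by positivity)]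
    have h3 : r * 1 ≤ (c + r) * c := by gcongr; linarith
    nlinarith
  have h3 := hV.sq_le; have h4 := hV.nonneg
  have h5 : (2 + 2 * K) * (r ^ 2 * (A / (c * (c + r))) ^ 2) ≤ (2 + 2 * K) * A ^ 2 := by gcongr
  have h6 := abs_le.1 (h1.trans h5)
  constructor <;> nlinarith [h6.1, h6.2]

/-- The derivative bound is available only for r > 0. Radii are first clamped at δ > 0, and δ then
tends to 0. -/
theorem Prof.abs_Gt_sub_le {c : ℝ} {f : ℝ → ℂ} (h : Prof A c f) (hV : Small V V₁ V₂ K A) (r r' : ℝ) :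
    |Gt V f (max r 0) - Gt V f (max r' 0)| ≤ |r - r'| := by
  have hcont : Continuous (Gt V f) := Fam.slice (h.loc.fam.Gt hV.cont) 0
  have h1 : ∀ x ∈ Ioi (0 : ℝ), ∀ y ∈ Ioi (0 : ℝ), |Gt V f x - Gt V f y| ≤ |x - y| := fun x hx y hy => by
    have := (convex_Ioi (0 : ℝ)).norm_image_sub_le_of_norm_hasDerivWithin_le (f := Gt V f)
      (f' := fun r => (dens V f r - Gt V f r) / r) (C := 1)
      (fun r hr => (h.loc.hasDerivAt_Gt hV.cont hr).hasDerivWithinAt) (fun r hr => by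
        refine (h.abs_dGt_le hV.toPot (le_of_lt hr)).trans ?_
        have h2 := (h.r_mul_sq_le (le_of_lt hr)).trans h.sq_div_le
        have h3 := hV.sq_le; have h4 := hV.nonneg
        have h5 := mul_le_mul_of_nonneg_left h2 (show 0 ≤ 10 * (1 + K) by positivity)
        linarith) hy hx
    simpa using this
  have h2 : ∀ δ ∈ Ioi (0 : ℝ), |Gt V f (max r δ) - Gt V f (max r' δ)| ≤ |r - r'| := fun δ hδ =>
    (h1 _ (mem_Ioi.2 (lt_max_of_lt_right hδ)) _ (mem_Ioi.2 (lt_max_of_lt_right hδ))).trans (abs_max_sub_max_le_abs _ _ _)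
  have h3 : Continuous fun δ => |Gt V f (max r δ) - Gt V f (max r' δ)| := by fun_prop
  exact le_of_tendsto (h3.continuousWithinAt (s := Ioi 0) (x := 0)).tendsto
    (by filter_upwards [self_mem_nhdsWithin] with δ hδ using h2 δ hδ)

theorem hasDerivAt_comp_clamp {E : Type*} [NormedAddCommGroup E] [NormedSpace ℝ E] {φ : ℝ → E} {φ' : E}
    {r : ℝ} (hr : 0 < r) (h : HasDerivAt φ φ' r) : HasDerivAt (fun r => φ (max r 0)) φ' r := by
  refine h.congr_of_eventuallyEq ?_
  filter_upwards [lt_mem_nhds hr] with s hs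
  rw [max_eq_left hs.le]

/-- The linear transport problem that is solved in one step of the iteration. -/
theorem Ball.transp (hw : Ball A w) (hV : Small V V₁ V₂ K A) (h₀ : Init A z₀ z₀') :
    Transp 1 (fun s r => Gt V (w s) (max r 0) / 2)
      (fun s r => (dens V (w s) r - Gt V (w s) r) / r / 2)
      (fun s r => ca V (w s) (max r 0)) (fun s r => dca V V₁ (w s) r)
      (fun s r => cb V V₁ (w s) (max r 0)) (fun s r => dcb V V₁ V₂ (w s) r) z₀ z₀' where
  L_nonneg := zero_le_one
  cont := ((hw.fam.Gt hV.cont).comp (f := fun p : ℝ × ℝ => (p.1, max p.2 0)) (by fun_prop)).div_const 2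
  nonneg s r := by
    have := ((hw.prof' s).Gt_mem hV (le_max_right r 0)).1
    linarith
  le_one s r := by
    have := ((hw.prof' s).Gt_mem hV (le_max_right r 0)).2
    linarith
  lip s r r' := by
    have := (hw.prof' s).abs_Gt_sub_le hV r r'
    rw [← sub_div, abs_div, abs_two]
    have := abs_nonneg (r - r')
    linarith
  deriv s r hr := hasDerivAt_comp_clamp (φ := fun r => Gt V (w s) r / 2) hr
    (((hw.fam.loc s).hasDerivAt_Gt hV.cont hr).div_const 2)
  cont' := (continuousOn_snd_div (((hw.fam.dens hV.cont).sub
    (hw.fam.Gt hV.cont)).continuousOn)).div_const 2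
  cont_a := by
    have h1 : Continuous fun p : ℝ × ℝ => al V (w p.1) (max p.2 0) :=
      continuous_clamp (Φ := fun s r => al V (w s) r) (C := 10 * (1 + K)) (hw.fam.al hV.cont)
        fun s r hr => by
          refine ((hw.prof' s).abs_al_le hV.toPot hr).trans ?_
          have h2 := (hw.prof' s).p_nonneg hr
          have h3 := pow_le_one₀ h2 ((hw.prof' s).p_le_one hr) (n := 2)
          have h4 := hV.nonneg
          have h5 : r * (A / ((1 + max s 0) * ((1 + max s 0) + r))) ^ 2 ≤ r * 1 := by gcongr
          calc _ ≤ 10 * (1 + K) * (r * 1) := by gcongr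
            _ = _ := by ring
    have h2 : Continuous fun p : ℝ × ℝ => ym (w p.1) (max p.2 0) :=
      hw.fam.ym.comp (f := fun p : ℝ × ℝ => (p.1, max p.2 0)) (by fun_prop)
    exact (Complex.continuous_ofReal.comp h1).sub
      ((Complex.continuous_ofReal.comp (h2.div_const 2)).mul continuous_const)
  cont_b := continuous_clamp (Φ := fun s r => cb V V₁ (w s) r) (C := 20 * (1 + K))
    (hw.fam.cb hV.toPot) fun s r hr => by
      refine ((hw.prof' s).norm_cb_le hV.toPot hr).trans ?_
      have h2 := (hw.prof' s).p_nonneg hr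
      have h3 := pow_le_one₀ h2 ((hw.prof' s).p_le_one hr) (n := 3)
      have h4 := hV.nonneg
      have h5 : r * (A / ((1 + max s 0) * ((1 + max s 0) + r))) ^ 3 ≤ r * 1 := by gcongr
      calc _ ≤ 20 * (1 + K) * (r * 1) := by gcongr
        _ = _ := by ring
  deriv_a s r hr := hasDerivAt_comp_clamp hr ((hw.fam.loc s).hasDerivAt_ca hV.toPot hr)
  deriv_b s r hr := hasDerivAt_comp_clamp hr ((hw.fam.loc s).hasDerivAt_cb hV.toPot hr)
  cont_a' := hw.fam.dca hV.toPot
  cont_b' := hw.fam.dcb hV.toPot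
  cont_z₀ := h₀.cont
  deriv_z₀ := h₀.deriv
  cont_z₀' := h₀.cont'

/-- One step of the iteration. -/
def Ball.next (hw : Ball A w) (hV : Small V V₁ V₂ K A) (h₀ : Init A z₀ z₀') : ℝ → ℝ → ℂ :=
  (hw.transp hV h₀).z

variable (hw : Ball A w) (hV : Small V V₁ V₂ K A) (h₀ : Init A z₀ z₀')

/-- The speed is at least 3/8, so the distance travelled inwards between s and t is at least 3/8 (t
- s). -/
theorem Ball.X_lower {s t y : ℝ} (hst : s ≤ t) :
    (hw.transp hV h₀).X t y + 3 / 8 * (t - s) ≤ (hw.transp hV h₀).X s y := by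
  have := antitone_of_hasDerivAt_nonpos (f := fun t => (hw.transp hV h₀).X t y + 3 / 8 * t)
    (f' := fun t => -(Gt V (w t) (max ((hw.transp hV h₀).X t y) 0) / 2) + 3 / 8)
    (fun t => (((hw.transp hV h₀).hasDerivAt_X t y).add ((hasDerivAt_id t).const_mul (3 / 8))).congr_deriv
      (by simp))
    (fun t => by
      have := ((hw.prof' t).Gt_mem hV (le_max_right ((hw.transp hV h₀).X t y) 0)).1
      simp only [Pi.zero_apply]; linarith) hst
  simp only at this
  linarith

/-- The time lost by going back from t to s is compensated by the larger radius. The weight 1 + s +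
r at any earlier time is comparable to the final one, so decay at the start is inherited at the end.
-/
theorem Ball.x_lower {s t y : ℝ} (hst : s ≤ t) (hs : 0 ≤ s) (hX : 0 ≤ (hw.transp hV h₀).X t y) :
    3 / 8 * (1 + t + (hw.transp hV h₀).X t y) ≤ 1 + s + (hw.transp hV h₀).X s y := by
  have := hw.X_lower hV h₀ hst (y := y)
  linarith

theorem inv_sq_le {x x' : ℝ} (hx : 0 < x) (h : 3 / 8 * x ≤ x') : 1 / x' ^ 2 ≤ 8 / x ^ 2 := by
  have hx' : 0 < x' := by linarith
  rw [div_le_div_iff₀ (by positivity) (by positivity)]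
  have := pow_le_pow_left₀ (by positivity) h 2
  nlinarith [sq_nonneg x]

theorem inv_cube_le {x x' : ℝ} (hx : 0 < x) (h : 3 / 8 * x ≤ x') : 1 / x' ^ 3 ≤ 19 / x ^ 3 := by
  have hx' : 0 < x' := by linarith
  rw [div_le_div_iff₀ (by positivity) (by positivity)]
  have := pow_le_pow_left₀ (by positivity) h 3
  have h3 : 0 < x ^ 3 := by positivity
  nlinarith

/-- Along the characteristic the solution obeys a linear inequality with factor (1+s)⁻². Data and
source carry (1+s+X)⁻², which `x_lower` replaces by the final weight x⁻². The source is cubic in A,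
hence small compared with A. -/
theorem Ball.norm_next_le {t r : ℝ} (ht : 0 ≤ t) (hr : 0 ≤ r) :
    ‖hw.next hV h₀ t r‖ ≤ A / (1 + t + r) ^ 2 := by
  set T := hw.transp hV h₀
  have hA := hV.pos; have hK := hV.nonneg; have hsq := hV.sq_le
  set y := T.Y t r
  have hXt : T.X t y = r := T.X_Y ht r
  set x := 1 + t + r
  have hx : 0 < x := by positivity
  have hz : hw.next hV h₀ t r = T.zt t y := by
    have := T.z_X ht (y := y) (by rw [hXt]; exact hr)
    rw [hXt] at this; exact this
  rw [hz]
  have hX : ∀ s ∈ Icc 0 t, 3 / 8 * x ≤ 1 + s + T.X s y := fun s hs => by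
    have := hw.x_lower hV h₀ hs.2 hs.1 (y := y) (by rw [hXt]; exact hr)
    rwa [hXt] at this
  have hX0 : ∀ s ∈ Icc 0 t, 0 ≤ T.X s y := fun s hs => by
    have := T.antitone_X y hs.2; simp only [hXt] at this; linarith
  -- With (1+K)A² ≤ 1/40000: κ = 20/40000, β is A/x² times 20 · 8/40000 = 1/250, and N is A/x² times
  -- 8/80 = 1/10. The factor 8 bounds (8/3)².
  have key := norm_le_of_deriv_le (ψ := fun s => T.zt s y)
    (ψ' := fun s => ca V (w s) (max (T.X (max s 0) y) 0) * T.zt s y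
      + cb V V₁ (w s) (max (T.X (max s 0) y) 0))
    (t := t) (N := A / (10 * x ^ 2)) (κ := 1 / 2000) (β := A / (250 * x ^ 2)) ht (by positivity)
    (by norm_num) (by norm_num) (by
      rw [div_div, div_le_div_iff₀ (by positivity) (by positivity)]
      nlinarith [mul_pos hA (pow_pos hx 2)])
    (fun s _ => (T.hasDerivAt_zt s y).continuousAt.continuousWithinAt)
    (fun s _ => (T.hasDerivAt_zt s y).hasDerivWithinAt) (fun s hs => by
      have hs' : s ∈ Icc 0 t := ⟨hs.1, hs.2.le⟩
      have hP := hw.prof s hs.1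
      have hs1 : 0 < 1 + s := hP.pos
      rw [max_eq_left hs.1, max_eq_left (hX0 s hs')]
      refine (norm_add_le _ _).trans ?_
      rw [norm_mul, add_div]
      refine add_le_add ?_ ?_
      · rw [mul_div_right_comm]
        gcongr
        refine (hP.norm_ca_le hV.toPot (hX0 s hs')).trans ?_
        rw [← mul_div_assoc]
        gcongr
        linarith
      · refine (hP.norm_cb_le hV.toPot (hX0 s hs')).trans ?_
        have h1 := hP.r_mul_cube_le (hX0 s hs')
        have h2 := inv_sq_le hx (hX s hs')
        calc _ ≤ 20 * (1 + K) * (A ^ 3 / ((1 + s) ^ 2 * (1 + s + T.X s y) ^ 2)) := by gcongr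
          _ = 20 * ((1 + K) * A ^ 2) * A * (1 / (1 + s + T.X s y) ^ 2) / (1 + s) ^ 2 := by
              field_simp
          _ ≤ 20 * (1 / 40000) * A * (8 / x ^ 2) / (1 + s) ^ 2 := by gcongr
          _ = _ := by field_simp; ring) (by
      rw [T.zt_zero]
      have hy0 : 0 ≤ y := by have := hX0 0 ⟨le_rfl, ht⟩; rwa [T.X_zero] at this
      refine (h₀.bd y hy0).trans ?_
      have h2 := inv_sq_le hx (hX 0 ⟨le_rfl, ht⟩)
      rw [T.X_zero, add_zero] at h2
      calc _ = A / 80 * (1 / (1 + y) ^ 2) := by ring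
        _ ≤ A / 80 * (8 / x ^ 2) := by gcongr
        _ = _ := by field_simp; norm_num)
  refine key.trans ?_
  rw [← mul_div_assoc, div_le_div_iff₀ (by positivity) (by positivity)]
  nlinarith [mul_pos hA (pow_pos hx 2)]

/-- The radial derivative obeys the same kind of inequality, with v' added to the linear coefficient
and dca · z + dcb as source. That source decays one power faster in 1 + s + X than cb does. -/
theorem Ball.norm_next'_le {t r : ℝ} (ht : 0 ≤ t) (hr : 0 < r) :
    ‖(hw.transp hV h₀).z' t r‖ ≤ A / (1 + t + r) ^ 3 := by
  set T := hw.transp hV h₀ with hT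
  have hA := hV.pos; have hK := hV.nonneg; have hsq := hV.sq_le
  set y := T.Y t r
  have hXt : T.X t y = r := T.X_Y ht r
  set x := 1 + t + r
  have hx : 0 < x := by positivity
  have hX : ∀ s ∈ Icc 0 t, 3 / 8 * x ≤ 1 + s + T.X s y := fun s hs => by
    have := hw.x_lower hV h₀ hs.2 hs.1 (y := y) (by rw [hXt]; exact hr.le)
    rwa [hXt] at this
  have hX0 : ∀ s ∈ Icc 0 t, 0 < T.X s y := fun s hs => by
    have := T.antitone_X y hs.2; simp only [hXt] at this; linarith
  have hpos : 0 < T.X t y := by rw [hXt]; exact hr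
  -- The data contribute 19/80 ≤ 1/4, where 19 bounds (8/3)³. The source contributes 50 · 19/40000 ≤
  -- 1/40, and the linear coefficient at most 40/40000 = 1/1000.
  have key := norm_le_of_deriv_le (ψ := fun s => T.z' s (T.X s y))
    (ψ' := fun s => (ca V (w s) (max (T.X s y) 0)
        + ((dens V (w s) (T.X s y) - Gt V (w s) (T.X s y)) / T.X s y / 2 : ℝ)) * T.z' s (T.X s y)
      + (dca V V₁ (w s) (T.X s y) * T.z s (T.X s y) + dcb V V₁ V₂ (w s) (T.X s y)))
    (t := t) (N := A / (4 * x ^ 3)) (κ := 1 / 1000) (β := A / (40 * x ^ 3)) ht (by positivity)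
    (by norm_num) (by norm_num) (by
      rw [div_div, div_le_div_iff₀ (by positivity) (by positivity)]
      nlinarith [mul_pos hA (pow_pos hx 3)])
    (T.continuousOn_z'.comp (f := fun s => (s, T.X s y))
      (continuous_id.prodMk (T.continuous_X_left y)).continuousOn
      fun s hs => ⟨hs.1, hX0 s hs⟩)
    (fun s hs => T.hasDerivWithinAt_z'_X hs hpos) (fun s hs => by
      have hs' : s ∈ Icc 0 t := ⟨hs.1, hs.2.le⟩
      have hP := hw.prof s hs.1
      have hs1 : 0 < 1 + s := hP.pos
      have hX1 := hX0 s hs'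
      have hx1 := hP.x_pos hX1.le
      rw [max_eq_left hX1.le]
      refine (norm_add_le _ _).trans ?_
      rw [norm_mul, add_div]
      refine add_le_add ?_ ?_
      · rw [mul_div_right_comm]
        gcongr
        refine (norm_add_le _ _).trans ?_
        rw [Complex.norm_real, Real.norm_eq_abs, abs_div _ (2 : ℝ), abs_two]
        have h1 := hP.norm_ca_le hV.toPot hX1.le
        have h2 := hP.abs_dGt_le hV.toPot hX1.le
        have h3 := hP.r_mul_sq_le hX1.le
        have h4 : 10 * (1 + K) * (T.X s y * (A / ((1 + s) * (1 + s + T.X s y))) ^ 2)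
          ≤ 10 * (1 + K) * (A ^ 2 / (1 + s) ^ 2) := by gcongr
        have h5 : (1 + K) * (A ^ 2 / (1 + s) ^ 2) ≤ 1 / 40000 / (1 + s) ^ 2 := by
          rw [← mul_div_assoc]; gcongr
        have h6 : 0 ≤ 1 / 40000 / (1 + s) ^ 2 := by positivity
        have h7 : 1 / 1000 / (1 + s) ^ 2 = 40 * (1 / 40000 / (1 + s) ^ 2) := by ring
        rw [h7]
        linarith
      · refine (norm_add_le _ _).trans ?_
        rw [norm_mul]
        have h1 := hP.norm_dca_le hV.toPot hX1
        have h2 := hP.norm_dcb_le hV.toPot hX1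
        have h3 := hw.norm_next_le hV h₀ hs.1 hX1.le
        have h4 := hP.cube_le hX1.le
        have h5 := inv_cube_le hx (hX s hs')
        have hz : hw.next hV h₀ s (T.X s y) = T.z s (T.X s y) := rfl
        rw [hz] at h3
        have h6 : ‖dca V V₁ (w s) (T.X s y)‖ * ‖T.z s (T.X s y)‖ ≤
            20 * (1 + K) * (A ^ 3 / ((1 + s) ^ 2 * (1 + s + T.X s y) ^ 3)) := by
          calc _ ≤ 20 * (1 + K) * (A / ((1 + s) * (1 + s + T.X s y))) ^ 2
                * (A / (1 + s + T.X s y) ^ 2) := by gcongr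
            _ = 20 * (1 + K) * (A ^ 3 / ((1 + s) ^ 2 * (1 + s + T.X s y) ^ 4)) := by field_simp
            _ ≤ _ := by
                gcongr 20 * (1 + K) * (A ^ 3 / ((1 + s) ^ 2 * ?_))
                exact pow_le_pow_right₀ (by linarith [hP.one_le]) (by norm_num)
        calc _ ≤ 20 * (1 + K) * (A ^ 3 / ((1 + s) ^ 2 * (1 + s + T.X s y) ^ 3))
              + 30 * (1 + K) * (A ^ 3 / ((1 + s) ^ 2 * (1 + s + T.X s y) ^ 3)) :=
              add_le_add h6 (h2.trans (by gcongr))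
          _ = 50 * ((1 + K) * A ^ 2) * A * (1 / (1 + s + T.X s y) ^ 3) / (1 + s) ^ 2 := by
              field_simp; ring
          _ ≤ 50 * (1 / 40000) * A * (19 / x ^ 3) / (1 + s) ^ 2 := by gcongr
          _ ≤ _ := by
              gcongr
              rw [← mul_div_assoc, div_le_div_iff₀ (by positivity) (by positivity)]
              nlinarith [mul_pos hA (pow_pos hx 3)]) (by
      have hy0 : 0 < y := by have := hX0 0 ⟨le_rfl, ht⟩; rwa [T.X_zero] at this
      have e0 : T.z' 0 y = z₀' y := by
        refine (T.hasDerivAt_z le_rfl hy0).unique ((h₀.deriv y hy0).congr_of_eventuallyEq ?_)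
        filter_upwards [lt_mem_nhds hy0] with r hr using T.z_zero hr.le
      simp only [T.X_zero, e0]
      refine (h₀.bd' y hy0).trans ?_
      have h2 := inv_cube_le hx (hX 0 ⟨le_rfl, ht⟩)
      rw [T.X_zero, add_zero] at h2
      calc _ = A / 80 * (1 / (1 + y) ^ 3) := by ring
        _ ≤ A / 80 * (19 / x ^ 3) := by gcongr
        _ ≤ _ := by
            rw [← mul_div_assoc, div_le_div_iff₀ (by positivity) (by positivity)]
            nlinarith [mul_pos hA (pow_pos hx 3)])
  simp only [hXt] at key
  refine key.trans ?_
  rw [← mul_div_assoc, div_le_div_iff₀ (by positivity) (by positivity)]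
  nlinarith [mul_pos hA (pow_pos hx 3)]

/-- The derivative bound is integrated, A/(c+x)³ being the derivative of -(A/2)(c+x)⁻². Unlike the
derivative bound, the integrated form passes to pointwise limits, which the iteration needs. -/
theorem prof_of_deriv_le {c : ℝ} {f f' : ℝ → ℂ} (hc : 1 ≤ c) (hA : 0 ≤ A) (hA1 : A ≤ 1)
    (hf : Continuous f) (hcl : ∀ r, f r = f (max r 0)) (hbd : ∀ r, 0 ≤ r → ‖f r‖ ≤ A / (c + r) ^ 2)
    (hd : ∀ r, 0 < r → HasDerivAt f (f' r) r) (hbd' : ∀ r, 0 < r → ‖f' r‖ ≤ A / (c + r) ^ 3) :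
    Prof A c f where
  one_le := hc
  nonneg := hA
  le_one := hA1
  bd := hbd
  clamp := hcl
  lp s r hs hsr := by
    have hF : ∀ x, 0 ≤ x → HasDerivAt (fun x => -(A / 2 * (1 / (c + x) ^ 2))) (A / (c + x) ^ 3) x :=
      fun x hx => by
        have h0 : (c + x) ^ 2 ≠ 0 := by positivity
        have h1 := (((((hasDerivAt_id x).const_add c).pow 2).inv h0).const_mul (A / 2)).neg
        refine (h1.congr_deriv ?_).congr_of_eventuallyEq (Eventually.of_forall fun x => by simp)
        have h2 : c + x ≠ 0 := by positivity
        simp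
        field_simp
    have := norm_sub_le_of_norm_deriv_le (f := f) (f' := f')
      (F := fun x => -(A / 2 * (1 / (c + x) ^ 2))) (F' := fun x => A / (c + x) ^ 3) hsr
      hf.continuousOn (fun x hx => (hF x (hs.trans hx.1)).continuousAt.continuousWithinAt)
      (fun x hx => hd x (hs.trans_lt hx.1)) (fun x hx => hF x (hs.trans hx.1.le))
      (fun x hx => hbd' x (hs.trans_lt hx.1))
    linarith

theorem Ball.ball_next : Ball A (hw.next hV h₀) where
  cont := (hw.transp hV h₀).continuous_z
  clamp := (hw.transp hV h₀).z_clamp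
  prof t ht := prof_of_deriv_le (by linarith) hV.pos.le hV.le_one
    ((hw.transp hV h₀).continuous_z.comp (f := fun r : ℝ => (t, r)) (by fun_prop))
    (fun r => by
      rw [Ball.next, (hw.transp hV h₀).z_clamp t r, (hw.transp hV h₀).z_clamp t (max r 0),
        max_eq_left (le_max_right r 0)])
    (fun r hr => hw.norm_next_le hV h₀ ht hr) (fun r hr => (hw.transp hV h₀).hasDerivAt_z ht hr)
    fun r hr => hw.norm_next'_le hV h₀ ht hr

end

end

/-! ### Contraction on cones and the fixed point -/

section

section

variable {V V₁ V₂ : ℝ → ℝ} {K A : ℝ} {w : ℝ → ℝ → ℂ} {z₀ z₀' : ℝ → ℂ}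

/-- `z` solves the transport equation with the coefficients formed with `w` for times in `[0, T₁]`, and
it is bounded by `M` together with its radial derivative `z'` on `{s + r ≤ R}`. -/
structure Solves (V V₁ : ℝ → ℝ) (w z z' : ℝ → ℝ → ℂ) (T₁ R M : ℝ) : Prop where
  cont : ContinuousOn (fun p : ℝ × ℝ => z p.1 p.2) (Icc 0 T₁ ×ˢ Ici 0)
  deriv : ∀ s ∈ Icc 0 T₁, ∀ r ∈ Ioo 0 (R + 1), HasDerivAt (z s) (z' s r) r
  eqn : ∀ s ∈ Icc 0 T₁, ∀ r ∈ Ioo 0 (R + 1), HasDerivWithinAt (fun s => z s r)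
    ((Gt V (w s) r / 2 : ℝ) * z' s r + ca V (w s) r * z s r + cb V V₁ (w s) r) (Icc 0 T₁) s
  cont_eqn : ContinuousOn (fun p : ℝ × ℝ => (Gt V (w p.1) p.2 / 2 : ℝ) * z' p.1 p.2 +
    ca V (w p.1) p.2 * z p.1 p.2 + cb V V₁ (w p.1) p.2) (Icc 0 T₁ ×ˢ Ioo 0 (R + 1))
  cont' : ContinuousOn (fun p : ℝ × ℝ => z' p.1 p.2) (Icc 0 T₁ ×ˢ Ioo 0 (R + 1))
  bd : ∀ s ∈ Icc 0 T₁, ∀ r, 0 < r → s + r ≤ R → ‖z s r‖ ≤ M ∧ ‖z' s r‖ ≤ M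

theorem Loc.mono {B B' : ℝ} {f : ℝ → ℂ} (h : Loc B f) (hB : B ≤ B') : Loc B' f :=
  ⟨fun s => (h.bdd s).trans hB, fun s t => (h.lip s t).trans (by gcongr)⟩

/-- Solutions depend on the functions that enter the coefficients in a contracting way. -/
theorem exists_contraction (hV : Small V V₁ V₂ K A) (h₀ : Init A z₀ z₀') {B R M : ℝ} (hAB : A ≤ B)
    (hR : 0 ≤ R) (hM : 0 ≤ M) :
    ∃ Λ, 0 ≤ Λ ∧ ∀ (w₁ : ℝ → ℝ → ℂ) (hw₁ : Ball A w₁) (w₂ z z' : ℝ → ℝ → ℂ) (T₁ d : ℝ),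
      (∀ s ∈ Icc 0 T₁, Loc B (w₂ s)) → Solves V V₁ w₂ z z' T₁ R M → (∀ r, 0 ≤ r → r ≤ R → z 0 r = z₀ r) →
      0 ≤ d → (∀ s ∈ Icc 0 T₁, ∀ r, 0 ≤ r → s + r ≤ R → ‖w₁ s r - w₂ s r‖ ≤ d * Real.exp (Λ * s)) →
      ∀ s ∈ Icc 0 T₁, ∀ r, 0 ≤ r → s + r ≤ R →
        ‖hw₁.next hV h₀ s r - z s r‖ ≤ 1 / 2 * d * Real.exp (Λ * s) := by
  obtain ⟨La, hLa0, hLa⟩ := ctl_ca (B := B) hV.toPot hR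
  obtain ⟨Lb, hLb0, hLb⟩ := ctl_cb (B := B) hV.toPot hR
  obtain ⟨Lg, hLg0, hLg⟩ := ctl_Gt_sub_one (B := B) hV.toPot hR
  set C := La * M + Lb * (1 + R) + Lg * R * M
  have hC : 0 ≤ C := by positivity
  -- With this rate the barrier (d/2) exp(Λs) grows like (1 + C) d exp(Λs), which exceeds the growth
  -- d/2 + Cd of the difference where it meets the barrier; this gives the contraction factor 1/2.
  refine ⟨2 + 2 * C, by positivity, ?_⟩
  intro w₁ hw₁ w₂ z z' T₁ d hw₂ hz hz0 hd hw
  set Λ := 2 + 2 * C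
  set T := hw₁.transp hV h₀
  have main : ∀ t ∈ Icc 0 T₁, ∀ r, 0 < r → t + r ≤ R →
      ‖hw₁.next hV h₀ t r - z t r‖ ≤ 1 / 2 * d * Real.exp (Λ * t) := by
    intro t ht r hr htr
    set y := T.Y t r
    have hXt : T.X t y = r := T.X_Y ht.1 r
    have hX0 : ∀ s ∈ Icc 0 t, 0 < T.X s y := fun s hs => by
      have := T.antitone_X y hs.2; simp only [hXt] at this; linarith
    have hXR : ∀ s ∈ Icc 0 t, s + T.X s y ≤ R := fun s hs => by
      have := T.monotone_X_add y hs.2; simp only [hXt] at this; linarith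
    have hXI : ∀ s ∈ Icc 0 t, T.X s y ∈ Ioo 0 (R + 1) := fun s hs =>
      ⟨hX0 s hs, by linarith [hXR s hs, hs.1]⟩
    have hsub : Icc 0 t ⊆ Icc 0 T₁ := Icc_subset_Icc_right ht.2
    -- The comparison follows the characteristics of the first function. The second solution is then
    -- transported with the wrong speed, and the error is the difference of the speeds times its
    -- bounded derivative z'; no derivative of the difference occurs.
    let ψ : ℝ → ℂ := fun s => T.zt s y - z s (T.X s y)
    have hψc : ContinuousOn ψ (Icc 0 t) := by
      refine ContinuousOn.sub (fun s _ => (T.hasDerivAt_zt s y).continuousAt.continuousWithinAt) ?_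
      exact hz.cont.comp (f := fun s => (s, T.X s y))
        (continuous_id.prodMk (T.continuous_X_left y)).continuousOn
        fun s hs => ⟨hsub hs, (hX0 s hs).le⟩
    let D : ℝ → ℂ := fun s =>
      (ca V (w₁ s) (T.X s y) * T.zt s y + cb V V₁ (w₁ s) (T.X s y)) -
      ((Gt V (w₂ s) (T.X s y) / 2 : ℝ) * z' s (T.X s y) + ca V (w₂ s) (T.X s y) * z s (T.X s y)
        + cb V V₁ (w₂ s) (T.X s y) + (-(Gt V (w₁ s) (T.X s y) / 2) : ℝ) * z' s (T.X s y))
    have hψd : ∀ s ∈ Ico 0 t, HasDerivWithinAt ψ (D s) (Ici s) s := fun s hs => by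
      have hs' : s ∈ Icc 0 t := ⟨hs.1, hs.2.le⟩
      have h1 := T.hasDerivAt_zt s y
      rw [max_eq_left hs.1, max_eq_left (hX0 s hs').le] at h1
      refine h1.hasDerivWithinAt.sub ?_
      have h2 := hasFDerivWithinAt_of_partials (convex_Icc (0 : ℝ) T₁) (convex_Ioo (0 : ℝ) (R + 1))
        (f := fun p : ℝ × ℝ => z p.1 p.2) (fun p hp => hz.eqn p.1 hp.1 p.2 hp.2)
        (fun p hp => (hz.deriv p.1 hp.1 p.2 hp.2).hasDerivWithinAt)
        hz.cont_eqn hz.cont' (x := (s, T.X s y)) ⟨hsub hs', hXI s hs'⟩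
      have hpath : HasDerivWithinAt (fun s => (s, T.X s y)) (1, -(Gt V (w₁ s) (T.X s y) / 2))
          (Icc s t) s := by
        have h3 := T.hasDerivAt_X s y
        rw [max_eq_left (hX0 s hs').le] at h3
        exact ((hasDerivAt_id s).prodMk h3).hasDerivWithinAt
      have hmaps : MapsTo (fun s => (s, T.X s y)) (Icc s t) (Icc 0 T₁ ×ˢ Ioo 0 (R + 1)) := fun σ hσ =>
        ⟨hsub ⟨hs.1.trans hσ.1, hσ.2⟩, hXI σ ⟨hs.1.trans hσ.1, hσ.2⟩⟩
      have h4 := h2.comp_hasDerivWithinAt s hpath hmaps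
      refine (h4.mono_of_mem_nhdsWithin (Icc_mem_nhdsGE hs.2)).congr_deriv ?_
      simp
    have hbound : ∀ s ∈ Ico 0 t, ‖D s‖ ≤ ‖ψ s‖ + C * (d * Real.exp (Λ * s)) := fun s hs => by
      have hs' : s ∈ Icc 0 t := ⟨hs.1, hs.2.le⟩
      have hX := hX0 s hs'
      have hXR' := hXR s hs'
      have hr' : T.X s y ∈ Icc 0 R := ⟨hX.le, by linarith [hs.1]⟩
      have l1 : Loc B (w₁ s) := (hw₁.fam.loc s).mono hAB
      have l2 := hw₂ s (hsub hs')
      have hdiff : ∀ σ ∈ Icc 0 (T.X s y), ‖w₁ s σ - w₂ s σ‖ ≤ d * Real.exp (Λ * s) := fun σ hσ =>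
        hw s (hsub hs') σ hσ.1 (by linarith [hσ.2])
      have hd0 : 0 ≤ d * Real.exp (Λ * s) := by positivity
      have ea := (hLa _ l1 _ hr').2 _ l2 _ hd0 hdiff
      have eb := (hLb _ l1 _ hr').2 _ l2 _ hd0 hdiff
      have eg := (hLg _ l1 _ hr').2 _ l2 _ hd0 hdiff
      have hP := hw₁.prof s hs.1
      have ha : ‖ca V (w₁ s) (T.X s y)‖ ≤ 1 := by
        refine (hP.norm_ca_le hV.toPot hX.le).trans ?_
        have h2 := mul_le_mul_of_nonneg_left hP.sq_div_le (show 0 ≤ 20 * (1 + K) by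
          have := hV.nonneg; positivity)
        have := hV.sq_le
        linarith
      obtain ⟨m1, m2⟩ := hz.bd s (hsub hs') _ hX hXR'
      have eD : D s = ca V (w₁ s) (T.X s y) * ψ s
          + (ca V (w₁ s) (T.X s y) - ca V (w₂ s) (T.X s y)) * z s (T.X s y)
          + (cb V V₁ (w₁ s) (T.X s y) - cb V V₁ (w₂ s) (T.X s y))
          + (((Gt V (w₁ s) (T.X s y) - 1) - (Gt V (w₂ s) (T.X s y) - 1)) / 2 : ℝ) * z' s (T.X s y) := by
        simp only [D, ψ]; push_cast; ring
      rw [eD]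
      refine (norm_add_le _ _).trans ?_
      refine (add_le_add (norm_add₃_le) le_rfl).trans ?_
      rw [norm_mul, norm_mul, norm_mul, Complex.norm_real, Real.norm_eq_abs, abs_div _ (2 : ℝ), abs_two]
      rw [Real.norm_eq_abs] at eg
      set dd := d * Real.exp (Λ * s)
      have e1 : ‖ca V (w₁ s) (T.X s y)‖ * ‖ψ s‖ ≤ 1 * ‖ψ s‖ := by gcongr
      have e2 : ‖ca V (w₁ s) (T.X s y) - ca V (w₂ s) (T.X s y)‖ * ‖z s (T.X s y)‖ ≤ La * dd * M := by
        rw [pow_zero, mul_one] at ea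
        gcongr
      have e3 : ‖cb V V₁ (w₁ s) (T.X s y) - cb V V₁ (w₂ s) (T.X s y)‖ ≤ Lb * (1 + R) * dd := by
        refine eb.trans ?_
        gcongr
        simp; linarith
      have e4 : |Gt V (w₁ s) (T.X s y) - 1 - (Gt V (w₂ s) (T.X s y) - 1)| / 2 * ‖z' s (T.X s y)‖
          ≤ Lg * R * dd * M := by
        rw [pow_one] at eg
        have : |Gt V (w₁ s) (T.X s y) - 1 - (Gt V (w₂ s) (T.X s y) - 1)| / 2 ≤ Lg * R * dd := by
          refine (half_le_self (abs_nonneg _)).trans (eg.trans ?_)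
          gcongr
          exact hr'.2
        gcongr
      calc _ ≤ 1 * ‖ψ s‖ + La * dd * M + Lb * (1 + R) * dd + Lg * R * dd * M := by linarith
        _ = _ := by simp only [C]; ring
    have key : ∀ η, 0 < η → ‖ψ t‖ ≤ 1 / 2 * (d + η) * Real.exp (Λ * t) := fun η hη => by
      have hBd : ∀ s, HasDerivAt (fun s => 1 / 2 * (d + η) * Real.exp (Λ * s))
          (1 / 2 * (d + η) * (Real.exp (Λ * s) * Λ)) s := fun s =>
        ((((hasDerivAt_id s).const_mul Λ).exp).const_mul _).congr_deriv (by simp)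
      refine image_norm_le_of_norm_deriv_right_lt_deriv_boundary hψc hψd
        (B := fun s => 1 / 2 * (d + η) * Real.exp (Λ * s)) ?_ hBd (fun s hs he => ?_) ⟨ht.1, le_rfl⟩
      · have : ψ 0 = 0 := by
          have hX00 := hX0 0 ⟨le_rfl, ht.1⟩
          have hXR0 := hXR 0 ⟨le_rfl, ht.1⟩
          rw [T.X_zero] at hX00 hXR0
          simp only [ψ, T.zt_zero, T.X_zero]
          rw [hz0 y hX00.le (by linarith), sub_self]
        rw [this, norm_zero]; positivity
      · refine (hbound s hs).trans_lt ?_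
        rw [he]
        have hE := Real.exp_pos (Λ * s)
        have h1 : C * (d * Real.exp (Λ * s)) ≤ C * ((d + η) * Real.exp (Λ * s)) := by
          gcongr; linarith
        have h2 : 0 < (d + η) * Real.exp (Λ * s) := by positivity
        have h3 : 1 / 2 * (d + η) * (Real.exp (Λ * s) * Λ) =
          (1 + C) * ((d + η) * Real.exp (Λ * s)) := by simp only [Λ]; ring
        rw [h3]
        linarith
    have hψt : hw₁.next hV h₀ t r - z t r = ψ t := by
      have := T.z_X ht.1 (y := y) (by rw [hXt]; exact hr.le)
      simp only [ψ, hXt, ← this]; rfl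
    rw [hψt]
    -- For c above the claimed bound, η is chosen so that (d + η)/2 · exp(Λt) equals c.
    refine le_of_forall_gt_imp_ge_of_dense fun c hc => ?_
    have hE := Real.exp_pos (Λ * t)
    refine (key (2 * (c - 1 / 2 * d * Real.exp (Λ * t)) / Real.exp (Λ * t))
      (by have := sub_pos.2 hc; positivity)).trans_eq ?_
    field_simp
    ring
  intro s hs r hr hsr
  rcases hr.eq_or_lt with rfl | hr
  · rcases hs.1.eq_or_lt with rfl | hs0
    · rw [hz0 0 le_rfl hR, Ball.next, (hw₁.transp hV h₀).z_zero le_rfl, sub_self, norm_zero]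
      positivity
    -- The estimate on the axis is the limit along (s - δ, δ), a path that stays inside the cone s +
    -- r ≤ R.
    have hpath : Tendsto (fun δ : ℝ => (s - δ, δ)) (𝓝[Ioo 0 s] 0) (𝓝 (s, 0)) := by
      have : Continuous fun δ : ℝ => (s - δ, δ) := by fun_prop
      simpa using (this.continuousWithinAt (s := Ioo 0 s) (x := 0)).tendsto
    have hmem : ∀ δ ∈ Ioo 0 s, s - δ ∈ Icc 0 T₁ := fun δ hδ =>
      ⟨by linarith [hδ.2], by linarith [hs.2, hδ.1]⟩
    have hpath' : Tendsto (fun δ : ℝ => (s - δ, δ)) (𝓝[Ioo 0 s] 0) (𝓝[Icc 0 T₁ ×ˢ Ici 0] (s, 0)) :=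
      tendsto_nhdsWithin_iff.2 ⟨hpath, by
        filter_upwards [self_mem_nhdsWithin] with δ hδ using ⟨hmem δ hδ, hδ.1.le⟩⟩
    have hne : (𝓝[Ioo 0 s] (0 : ℝ)).NeBot := by
      rw [← mem_closure_iff_nhdsWithin_neBot, closure_Ioo hs0.ne]; exact ⟨le_rfl, hs0.le⟩
    refine le_of_tendsto_of_tendsto (b := 𝓝[Ioo 0 s] 0)
      (f := fun δ => ‖hw₁.next hV h₀ (s - δ) δ - z (s - δ) δ‖)
      (g := fun δ => 1 / 2 * d * Real.exp (Λ * (s - δ))) ?_ ?_ ?_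
    · exact (((T.continuous_z.tendsto (s, 0)).comp hpath).sub
        (Tendsto.comp (hz.cont (s, 0) ⟨hs, self_mem_Ici⟩) hpath')).norm
    · have : Continuous fun δ : ℝ => 1 / 2 * d * Real.exp (Λ * (s - δ)) := by fun_prop
      simpa using (this.continuousWithinAt (s := Ioo 0 s) (x := 0)).tendsto
    · filter_upwards [self_mem_nhdsWithin] with δ hδ
      exact main (s - δ) (hmem δ hδ) δ hδ.1 (by linarith)
  · exact main s hs r hr hsr

variable (hV : Small V V₁ V₂ K A) (h₀ : Init A z₀ z₀')

theorem Ball.solves (hw : Ball A w) {T₁ R : ℝ} :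
    Solves V V₁ w (hw.next hV h₀) (hw.transp hV h₀).z' T₁ R 1 where
  cont := (hw.transp hV h₀).continuous_z.continuousOn
  deriv s hs r hr := (hw.transp hV h₀).hasDerivAt_z hs.1 hr.1
  eqn s hs r hr := by
    have := (hw.transp hV h₀).hasDerivWithinAt_z hs.1 hr.1
    rw [max_eq_left hr.1.le] at this
    exact this.mono Icc_subset_Ici_self
  cont_eqn := by
    have h1 : Icc 0 T₁ ×ˢ Ioo 0 (R + 1) ⊆ {p : ℝ × ℝ | 0 < p.2} := fun p hp => hp.2.1
    have h2 : Icc 0 T₁ ×ˢ Ioo 0 (R + 1) ⊆ Ici (0 : ℝ) ×ˢ Ioi 0 :=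
      prod_mono Icc_subset_Ici_self Ioo_subset_Ioi_self
    exact (((Complex.continuous_ofReal.comp ((hw.fam.Gt hV.cont).div_const 2)).continuousOn.mul
      ((hw.transp hV h₀).continuousOn_z'.mono h2)).add (((hw.fam.ca hV.cont).mono h1).mul
      (hw.transp hV h₀).continuous_z.continuousOn)).add ((hw.fam.cb hV.toPot).mono h1)
  cont' := (hw.transp hV h₀).continuousOn_z'.mono (prod_mono Icc_subset_Ici_self Ioo_subset_Ioi_self)
  bd s hs r hr _ := by
    have h1 : 1 ≤ 1 + s + r := by linarith [hs.1]
    have hA := hV.pos.le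
    refine ⟨(hw.norm_next_le hV h₀ hs.1 hr.le).trans ?_, (hw.norm_next'_le hV h₀ hs.1 hr).trans ?_⟩
    · exact (div_le_self hA (one_le_pow₀ h1)).trans hV.le_one
    · exact (div_le_self hA (one_le_pow₀ h1)).trans hV.le_one

theorem ball_zero (hV : Small V V₁ V₂ K A) : Ball A 0 where
  cont := continuous_const
  clamp _ _ := rfl
  prof τ hτ := prof_of_deriv_le (f' := 0) (by linarith) hV.pos.le hV.le_one continuous_const
    (fun _ => rfl) (fun r hr => by have := hV.pos; simp; positivity)
    (fun r _ => hasDerivAt_const r 0) (fun r hr => by have := hV.pos; simp; positivity)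

/-- The iteration. -/
def iter : ℕ → {w // Ball A w}
  | 0 => ⟨0, ball_zero hV⟩
  | n + 1 => ⟨(iter n).2.next hV h₀, (iter n).2.ball_next hV h₀⟩

theorem Ball.norm_le (hw : Ball A w) (hV : Small V V₁ V₂ K A) (τ r : ℝ) : ‖w τ r‖ ≤ 1 :=
  ((hw.fam.loc τ).bdd r).trans hV.le_one

/-- Successive iterates differ by O(2⁻ⁿ) on each cone, so they converge locally uniformly. The ball
is closed under such limits, and one more application of the contraction identifies the limit as a
fixed point. -/
theorem exists_fixed_point : ∃ (w : ℝ → ℝ → ℂ) (hw : Ball A w), hw.next hV h₀ = w := by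
  have step : ∀ R, 0 ≤ R → ∃ Λ, 0 ≤ Λ ∧ ∀ n s r, 0 ≤ s → 0 ≤ r → s + r ≤ R →
      ‖(iter hV h₀ n).1 s r - (iter hV h₀ (n + 1)).1 s r‖ ≤ 2 * (1 / 2) ^ n * Real.exp (Λ * s) := by
    intro R hR
    obtain ⟨Λ, hΛ, H⟩ := exists_contraction hV h₀ (le_refl A) hR zero_le_one
    refine ⟨Λ, hΛ, fun n => ?_⟩
    induction n with
    | zero =>
      intro s r hs hr hsr
      refine (norm_sub_le _ _).trans ?_
      have h1 := (iter hV h₀ 0).2.norm_le hV s r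
      have h2 := (iter hV h₀ (0 + 1)).2.norm_le hV s r
      have h3 := Real.one_le_exp (mul_nonneg hΛ hs)
      simp only [pow_zero, mul_one]
      linarith
    | succ n ih =>
      intro s r hs hr hsr
      have := H (iter hV h₀ n).1 (iter hV h₀ n).2 (iter hV h₀ (n + 1)).1 (iter hV h₀ (n + 2)).1 _ R
        (2 * (1 / 2) ^ n) (fun s _ => (iter hV h₀ (n + 1)).2.fam.loc s)
        ((iter hV h₀ (n + 1)).2.solves hV h₀) (fun r hr _ => (Transp.z_zero _ hr)) (by positivity)
        (fun s hs r hr hsr => ih s r hs.1 hr hsr) s ⟨hs, by linarith⟩ r hr hsr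
      refine this.trans_eq ?_
      rw [pow_succ]; ring
  have hE : ∀ R, 0 ≤ R → ∃ D, ∀ n s r, 0 ≤ s → 0 ≤ r → s + r ≤ R →
      dist ((iter hV h₀ n).1 s r) ((iter hV h₀ (n + 1)).1 s r) ≤ D * (1 / 2) ^ n := fun R hR => by
    obtain ⟨Λ, hΛ, H⟩ := step R hR
    refine ⟨2 * Real.exp (Λ * R), fun n s r hs hr hsr => ?_⟩
    rw [dist_eq_norm]
    refine (H n s r hs hr hsr).trans ?_
    have : Real.exp (Λ * s) ≤ Real.exp (Λ * R) := by gcongr; linarith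
    calc _ ≤ 2 * (1 / 2) ^ n * Real.exp (Λ * R) := by gcongr
      _ = _ := by ring
  have hlim : ∀ τ r, ∃ ℓ, Tendsto (fun n => (iter hV h₀ n).1 (max τ 0) (max r 0)) atTop (𝓝 ℓ) :=
    fun τ r => by
      obtain ⟨D, hD⟩ := hE (max τ 0 + max r 0) (by positivity)
      exact cauchySeq_tendsto_of_complete (cauchySeq_of_le_geometric (1 / 2) D (by norm_num)
        fun n => hD n _ _ (le_max_right _ _) (le_max_right _ _) le_rfl)
  choose w hw using hlim
  have hw' : ∀ τ r, Tendsto (fun n => (iter hV h₀ n).1 τ r) atTop (𝓝 (w τ r)) := fun τ r =>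
    (hw τ r).congr fun n => ((iter hV h₀ n).2.clamp τ r).symm
  have hunif : ∀ R, 0 ≤ R → ∃ D, ∀ n s r, 0 ≤ s → 0 ≤ r → s + r ≤ R →
      dist ((iter hV h₀ n).1 s r) (w s r) ≤ D * (1 / 2) ^ n := fun R hR => by
    obtain ⟨D, hD⟩ := hE R hR
    refine ⟨2 * D, fun n s r hs hr hsr => ?_⟩
    refine (dist_le_of_le_geometric_of_tendsto (1 / 2) D (by norm_num)
      (fun n => hD n s r hs hr hsr) (hw' s r) n).trans_eq ?_
    ring
  have hclamp : ∀ τ r, w τ r = w (max τ 0) (max r 0) := fun τ r =>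
    tendsto_nhds_unique (hw τ r) (hw' _ _)
  have hcont : Continuous fun p : ℝ × ℝ => w p.1 p.2 := by
    refine continuous_iff_continuousAt.2 fun p => ?_
    set R := max p.1 0 + max p.2 0 + 1
    have hR : 0 ≤ R := by positivity
    obtain ⟨D, hD⟩ := hunif R hR
    have hcl : Continuous fun q : ℝ × ℝ => max q.1 0 + max q.2 0 := by fun_prop
    have hmem : {q : ℝ × ℝ | max q.1 0 + max q.2 0 ≤ R} ∈ 𝓝 p :=
      Filter.mem_of_superset ((isOpen_lt hcl continuous_const).mem_nhds
        (show max p.1 0 + max p.2 0 < R from lt_add_one _))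
        fun q (hq : max q.1 0 + max q.2 0 < R) => le_of_lt hq
    have hU : TendstoUniformlyOn (fun n (q : ℝ × ℝ) => (iter hV h₀ n).1 q.1 q.2)
        (fun q => w q.1 q.2) atTop {q : ℝ × ℝ | max q.1 0 + max q.2 0 ≤ R} := by
      rw [Metric.tendstoUniformlyOn_iff]
      intro ε hε
      have h1 : Tendsto (fun n : ℕ => D * (1 / 2 : ℝ) ^ n) atTop (𝓝 0) := by
        simpa using (tendsto_pow_atTop_nhds_zero_of_lt_one (r := (1 / 2 : ℝ)) (by norm_num)
          (by norm_num)).const_mul D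
      filter_upwards [h1.eventually (gt_mem_nhds hε)] with n hn q hq
      rw [hclamp, (iter hV h₀ n).2.clamp, dist_comm]
      exact (hD n _ _ (le_max_right _ _) (le_max_right _ _) hq).trans_lt hn
    exact (hU.continuousOn (Frequently.of_forall fun n =>
      (iter hV h₀ n).2.cont.continuousOn)).continuousAt hmem
  -- All conditions on a profile are non-strict inequalities between values of w, hence survive
  -- pointwise limits.
  have hball : Ball A w := by
    refine ⟨hcont, hclamp, fun τ hτ => ⟨by linarith, hV.pos.le, hV.le_one, fun r hr => ?_,
      fun s r hs hsr => ?_, fun r => ?_⟩⟩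
    · exact le_of_tendsto (hw' τ r).norm (Eventually.of_forall fun n =>
        ((iter hV h₀ n).2.prof τ hτ).bd r hr)
    · exact le_of_tendsto ((hw' τ r).sub (hw' τ s)).norm (Eventually.of_forall fun n =>
        ((iter hV h₀ n).2.prof τ hτ).lp s r hs hsr)
    · rw [hclamp τ r, hclamp τ (max r 0), max_eq_left (le_max_right r 0)]
  refine ⟨w, hball, ?_⟩
  funext τ r
  rw [hclamp τ r, (hball.ball_next hV h₀).clamp τ r]
  set s := max τ 0
  set ρ := max r 0
  have hs : 0 ≤ s := le_max_right _ _
  have hρ : 0 ≤ ρ := le_max_right _ _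
  obtain ⟨Λ, hΛ, H⟩ := exists_contraction hV h₀ (le_refl A) (add_nonneg hs hρ) zero_le_one
  obtain ⟨D, hD⟩ := hunif (s + ρ) (by positivity)
  have hD0 : 0 ≤ D := by simpa using dist_nonneg.trans (hD 0 s ρ hs hρ le_rfl)
  have h1 : ∀ n, ‖hball.next hV h₀ s ρ - (iter hV h₀ (n + 1)).1 s ρ‖ ≤
      1 / 2 * (D * (1 / 2) ^ n) * Real.exp (Λ * s) := fun n =>
    H w hball (iter hV h₀ n).1 (iter hV h₀ (n + 1)).1 _ (s + ρ)
        (D * (1 / 2) ^ n) (fun s _ => (iter hV h₀ n).2.fam.loc s)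
        ((iter hV h₀ n).2.solves hV h₀) (fun r hr _ => (Transp.z_zero _ hr)) (by positivity)
        (fun s hs r hr hsr => by
          rw [← dist_eq_norm, dist_comm]
          refine (hD n s r hs.1 hr hsr).trans ?_
          exact le_mul_of_one_le_right (by positivity) (Real.one_le_exp (mul_nonneg hΛ hs.1)))
        s ⟨hs, by linarith⟩ ρ hρ le_rfl
  have h2 : Tendsto (fun n : ℕ => 1 / 2 * (D * (1 / 2 : ℝ) ^ n) * Real.exp (Λ * s)) atTop (𝓝 0) := by
    have := (((tendsto_pow_atTop_nhds_zero_of_lt_one (r := (1 / 2 : ℝ)) (by norm_num)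
      (by norm_num)).const_mul D).const_mul (1 / 2)).mul_const (Real.exp (Λ * s))
    rwa [mul_zero, mul_zero, zero_mul] at this
  have h3 : Tendsto (fun n => (iter hV h₀ (n + 1)).1 s ρ) atTop (𝓝 (hball.next hV h₀ s ρ)) := by
    rw [tendsto_iff_norm_sub_tendsto_zero]
    exact squeeze_zero (fun _ => norm_nonneg _) (fun n => by rw [norm_sub_rev]; exact h1 n) h2
  exact tendsto_nhds_unique h3 ((hw' s ρ).comp (tendsto_add_atTop_nat 1))

end

end

/-! ### Regularity of the solution at the centre -/

section

/-- A classical solution of the evolution equation up to the centre. -/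
structure Sol (V V₁ : ℝ → ℝ) (A : ℝ) (z₀ : ℝ → ℂ) (w ω₀ ω₁ : ℝ → ℝ → ℂ) : Prop where
  ball : Ball A w
  cont₀ : Continuous fun p : ℝ × ℝ => ω₀ p.1 p.2
  cont₁ : Continuous fun p : ℝ × ℝ => ω₁ p.1 p.2
  hasDeriv₀ : ∀ τ r, 0 ≤ τ → 0 ≤ r → HasDerivWithinAt (fun τ => w τ r) (ω₀ τ r) (Ici 0) τ
  hasDeriv₁ : ∀ τ r, 0 ≤ τ → 0 ≤ r → HasDerivWithinAt (w τ) (ω₁ τ r) (Ici 0) r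
  eqn : ∀ τ r, 0 ≤ τ → 0 < r → ω₀ τ r =
    (Gt V (w τ) r / 2 : ℝ) * ω₁ τ r + ca V (w τ) r * w τ r + cb V V₁ (w τ) r
  bd₀ : ∀ τ r, 0 ≤ τ → 0 ≤ r → ‖ω₀ τ r‖ ≤ 1
  bd₁ : ∀ τ r, 0 ≤ τ → 0 ≤ r → ‖ω₁ τ r‖ ≤ A / (1 + τ + r) ^ 3
  init : ∀ r, 0 ≤ r → w 0 r = z₀ r

section Centre

variable {V V₁ V₂ : ℝ → ℝ} {K A : ℝ} {w : ℝ → ℝ → ℂ} {z₀ z₀' : ℝ → ℂ}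

/-- The part of the source of the equation for the radial derivative that is continuous at `r = 0`. -/
def src (V₁ V₂ : ℝ → ℝ) (f : ℝ → ℂ) (r : ℝ) : ℂ :=
  -((GG f r * qq f r / 2 : ℝ) * Complex.I) * f r
    + (((qq f r * GG f r + (JJ f r - 2 * qq f r) * GG f r + r * qq f r * (GG f r * md f r)) / 4 : ℝ)
        * (Complex.I * conj (avg f r))
      + (qq f r * GG f r / 4 : ℝ) * (Complex.I * conj (dm f r)))
    - (((GG f r + r * (GG f r * md f r)) / 2 : ℝ) * (V₁ (hs f r) * avg f r)
      + (GG f r / 2 : ℝ) * ((V₂ (hs f r) * (2 * (conj (avg f r) * dm f r).re) : ℝ) * avg f r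
          + V₁ (hs f r) * dm f r))

/-- The derivative `dal` is bounded, but nothing is known about its limit at r = 0. Its two
occurrences combine into `dal` times f minus its mean, which is O(r). The other delicate term is
`al` times a bounded quotient, also O(r). All that remains is continuous on the axis. -/
theorem dca_mul_add_dcb (f : ℝ → ℂ) {r : ℝ} (hr : 0 < r) :
    dca V V₁ f r * f r + dcb V V₁ V₂ f r =
      (dal V V₁ f r : ℂ) * dm f r - (al V f r : ℂ) * (dm f r / r) + src V₁ V₂ f r := by
  have e1 : r * dqq f r = JJ f r - 2 * qq f r := by rw [dqq]; field_simp
  have e2 : r * dhs f r = 2 * (conj (avg f r) * dm f r).re := by rw [dhs]; field_simp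
  have hr' : (r : ℂ) ≠ 0 := by exact_mod_cast hr.ne'
  have e3 : f r = dm f r + avg f r := by simp [dm]
  have e4 : (r : ℂ) * (dm f r / r) = dm f r := by field_simp
  have e5 : (r : ℂ) * (conj (dm f r) / r) = conj (dm f r) := by field_simp
  rw [dca, dcb, dcb₁, src, ← e1, ← e2]
  push_cast
  rw [map_div₀, Complex.conj_ofReal]
  have h1 : (r : ℂ) * (qq f r) * (GG f r) / 4 * (Complex.I * (conj (dm f r) / r)) =
      (qq f r) * (GG f r) / 4 * (Complex.I * conj (dm f r)) := by
    rw [← e5]; ring_nf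
    field_simp
  have h2 : (r : ℂ) / 2 * (GG f r) * ((V₂ (hs f r)) * (dhs f r) * avg f r
      + (V₁ (hs f r)) * (dm f r / r)) = (GG f r) / 2 * ((V₂ (hs f r)) * (r * (dhs f r)) * avg f r
      + (V₁ (hs f r)) * dm f r) := by
    field_simp
  rw [h1, h2]
  linear_combination (dal V V₁ f r : ℂ) * e3

theorem Fam.src {B : ℝ} (h : Fam B w) (hV : Pot V V₁ V₂ K) :
    Continuous fun p : ℝ × ℝ => src V₁ V₂ (w p.1) p.2 := by
  have c1 := h.GG; have c2 := h.qq; have c3 := h.JJ; have c4 := h.md; have c5 := h.avg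
  have c6 := h.dm; have c7 := h.comp_hs hV.cont₁; have c8 := h.comp_hs hV.cont₂; have c9 := h.cont
  have c10 := Complex.continuous_conj.comp c5
  have c11 := Complex.continuous_conj.comp c6
  have c12 := Complex.continuous_re.comp (c10.mul c6)
  have o {φ : ℝ × ℝ → ℝ} (hφ : Continuous φ) : Continuous fun p => (φ p : ℂ) :=
    Complex.continuous_ofReal.comp hφ
  have hc : Continuous fun _ : ℝ × ℝ => Complex.I := continuous_const
  have k2 : Continuous fun _ : ℝ × ℝ => (2 : ℝ) := continuous_const
  exact (((((o ((c1.mul c2).div_const 2)).mul hc).neg).mul c9).add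
    (((o ((((c2.mul c1).add ((c3.sub (k2.mul c2)).mul c1)).add
      ((continuous_snd.mul c2).mul (c1.mul c4))).div_const 4)).mul (hc.mul c10)).add
      ((o ((c2.mul c1).div_const 4)).mul (hc.mul c11)))).sub
    (((o ((c1.add (continuous_snd.mul (c1.mul c4))).div_const 2)).mul ((o c7).mul c5)).add
      ((o (c1.div_const 2)).mul (((o (c8.mul (k2.mul c12))).mul c5).add ((o c7).mul c6))))

/-- Linear equations along characteristics have solutions that are continuous up to the centre. -/
theorem Speed.exists_duhamel {L : ℝ} {v v' : ℝ → ℝ → ℝ} (S : Speed L v v') {κ F : ℝ → ℝ → ℂ} {ζ : ℝ → ℂ}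
    (hκ : Continuous fun p : ℝ × ℝ => κ p.1 p.2) (hF : Continuous fun p : ℝ × ℝ => F p.1 p.2)
    (hζ : Continuous ζ) : ∃ ω : ℝ → ℝ → ℂ, (Continuous fun p : ℝ × ℝ => ω p.1 p.2) ∧
    ∀ t y, 0 ≤ t → ∀ ψ : ℝ → ℂ, ContinuousOn ψ (Icc 0 t) → ψ 0 = ζ y →
      (∀ s ∈ Ico 0 t, HasDerivWithinAt ψ (κ s (S.X s y) * ψ s + F s (S.X s y)) (Ici s) s) →
      ψ t = ω t (S.X t y) := by
  have hX : Continuous fun p : ℝ × ℝ => (p.1, S.X (max p.1 0) p.2) := continuous_fst.prodMk S.continuousOn_X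
  have hκX : Continuous fun p : ℝ × ℝ => κ p.1 (S.X (max p.1 0) p.2) := hκ.comp hX
  have hFX : Continuous fun p : ℝ × ℝ => F p.1 (S.X (max p.1 0) p.2) := hF.comp hX
  set P : ℝ → ℝ → ℂ := fun t y => ∫ s in (0 : ℝ)..t, κ s (S.X (max s 0) y) with hP
  have hPc : Continuous fun p : ℝ × ℝ => P p.1 p.2 :=
    Transp.continuous_integral (Φ := fun s y => κ s (S.X (max s 0) y)) hκX
  have hGc : Continuous fun p : ℝ × ℝ => Complex.exp (-P p.1 p.2) * F p.1 (S.X (max p.1 0) p.2) :=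
    (Complex.continuous_exp.comp hPc.neg).mul hFX
  set I : ℝ → ℝ → ℂ := fun t y => ∫ s in (0 : ℝ)..t, Complex.exp (-P s y) * F s (S.X (max s 0) y)
    with hI
  have hIc : Continuous fun p : ℝ × ℝ => I p.1 p.2 :=
    Transp.continuous_integral (Φ := fun s y => Complex.exp (-P s y) * F s (S.X (max s 0) y)) hGc
  have hζc : Continuous fun p : ℝ × ℝ => Complex.exp (P p.1 p.2) * (ζ p.2 + I p.1 p.2) :=
    (Complex.continuous_exp.comp hPc).mul ((hζ.comp continuous_snd).add hIc)
  refine ⟨fun t r => Complex.exp (P t (S.Y t r)) * (ζ (S.Y t r) + I t (S.Y t r)),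
    hζc.comp (continuous_fst.prodMk S.continuous_Y), fun t y ht ψ hψ hψ0 hψd => ?_⟩
  simp only [S.Y_X ht]
  have hPd : ∀ s, HasDerivAt (fun s => P s y) (κ s (S.X (max s 0) y)) s := fun s =>
    hasDerivAt_primitive' (Transp.slice (Φ := fun s y => κ s (S.X (max s 0) y)) hκX y) s
  have hId : ∀ s, HasDerivAt (fun s => I s y) (Complex.exp (-P s y) * F s (S.X (max s 0) y)) s :=
    fun s => hasDerivAt_primitive'
      (Transp.slice (Φ := fun s y => Complex.exp (-P s y) * F s (S.X (max s 0) y)) hGc y) s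
  let D : ℝ → ℂ := fun s => ψ s * Complex.exp (-P s y) - I s y
  have hDd : ∀ s ∈ Ico 0 t, HasDerivWithinAt D 0 (Ici s) s := fun s hs => by
    refine (((hψd s hs).mul (hPd s).neg.cexp.hasDerivWithinAt).sub
      (hId s).hasDerivWithinAt).congr_deriv ?_
    simp only [max_eq_left hs.1, Pi.neg_apply]
    ring
  have hDc : ContinuousOn D (Icc 0 t) :=
    (hψ.mul fun s _ => (hPd s).neg.cexp.continuousAt.continuousWithinAt).sub
      fun s _ => (hId s).continuousAt.continuousWithinAt
  have h3 := constant_of_has_deriv_right_zero hDc hDd t ⟨ht, le_rfl⟩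
  have hP0 : P 0 y = 0 := by simp [hP]
  have hI0 : I 0 y = 0 := by simp [hI]
  simp only [D, hψ0, hP0, hI0, neg_zero, Complex.exp_zero, mul_one, sub_zero] at h3
  rw [← h3, sub_add_cancel, mul_comm, mul_assoc, ← Complex.exp_add, neg_add_cancel, Complex.exp_zero,
    mul_one]

variable (hw : Ball A w) (hV : Small V V₁ V₂ K A)
include hw hV

theorem Ball.continuous_dGt : Continuous fun p : ℝ × ℝ =>
    (dens V (w p.1) (max p.2 0) - Gt V (w p.1) (max p.2 0)) / (max p.2 0) / 2 := by
  refine (continuous_clamp (Φ := fun s r => (dens V (w s) r - Gt V (w s) r) / r) (C := 10 * (1 + K))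
    (continuousOn_snd_div ((hw.fam.dens hV.cont).sub (hw.fam.Gt hV.cont)).continuousOn)
    fun s r hr => ?_).div_const 2
  refine ((hw.prof' s).abs_dGt_le hV.toPot hr).trans ?_
  have h2 := (hw.prof' s).p_nonneg hr
  have h3 := pow_le_one₀ h2 ((hw.prof' s).p_le_one hr) (n := 2)
  have h4 := hV.nonneg
  calc _ ≤ 10 * (1 + K) * (r * 1) := by gcongr
    _ = _ := by ring

/-- The source in the equation for the radial derivative is continuous up to the centre. -/
theorem Ball.continuous_source : ∃ F : ℝ → ℝ → ℂ, (Continuous fun p : ℝ × ℝ => F p.1 p.2) ∧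
    ∀ s r, 0 < r → F s r = dca V V₁ (w s) r * w s r + dcb V V₁ V₂ (w s) r := by
  have hK := hV.nonneg
  have hA := hV.pos.le
  have hd : ∀ s r, 0 ≤ r → ‖dm (w s) r‖ ≤ r := fun s r hr => by
    refine ((hw.prof' s).norm_dm_le_mul hr).trans ?_
    exact mul_le_of_le_one_right hr ((hw.prof' s).p_le_one hr)
  have hp : ∀ s r, 0 ≤ r → (A / ((1 + max s 0) * ((1 + max s 0) + r))) ^ 2 ≤ 1 := fun s r hr =>
    pow_le_one₀ ((hw.prof' s).p_nonneg hr) ((hw.prof' s).p_le_one hr)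
  have h1 : Continuous fun p : ℝ × ℝ =>
      (if 0 < max p.2 0 then (dal V V₁ (w p.1) (max p.2 0) : ℂ) * dm (w p.1) (max p.2 0) else 0) := by
    refine continuous_clamp (Φ := fun s r => if 0 < r then (dal V V₁ (w s) r : ℂ) * dm (w s) r else 0)
      (C := 10 * (1 + K)) ?_ fun s r hr => ?_
    · refine ((Complex.continuous_ofReal.comp_continuousOn (hw.fam.dal hV.toPot)).mul
        hw.fam.dm.continuousOn).congr fun p hp => ?_
      replace hp : 0 < p.2 := hp
      simp [hp]
    · split_ifs with h0
      · rw [norm_mul, Complex.norm_real, Real.norm_eq_abs]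
        have := (hw.prof' s).abs_dal_le hV.toPot h0
        calc _ ≤ 10 * (1 + K) * (A / ((1 + max s 0) * ((1 + max s 0) + r))) ^ 2 * r := by
              gcongr; exact hd s r hr
          _ ≤ 10 * (1 + K) * 1 * r := by gcongr; exact hp s r hr
          _ = _ := by ring
      · rw [norm_zero]; positivity
  have h2 : Continuous fun p : ℝ × ℝ =>
      (al V (w p.1) (max p.2 0) : ℂ) * (dm (w p.1) (max p.2 0) / (max p.2 0 : ℝ)) := by
    refine continuous_clamp (Φ := fun s r => (al V (w s) r : ℂ) * (dm (w s) r / r))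
      (C := 10 * (1 + K)) ?_ fun s r hr => ?_
    · exact (Complex.continuous_ofReal.comp_continuousOn (hw.fam.al hV.cont)).mul hw.fam.dm_div
    · rw [norm_mul, Complex.norm_real, Real.norm_eq_abs, norm_div, Complex.norm_real, Real.norm_eq_abs,
        abs_of_nonneg hr]
      have := (hw.prof' s).abs_al_le hV.toPot hr
      calc _ ≤ 10 * (1 + K) * (r * (A / ((1 + max s 0) * ((1 + max s 0) + r))) ^ 2) * 1 := by
            gcongr; exact div_le_one_of_le₀ (hd s r hr) hr
        _ ≤ 10 * (1 + K) * (r * 1) * 1 := by gcongr; exact hp s r hr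
        _ = _ := by ring
  -- The test 0 < r is there because the bound on `dal` is available only off the axis; the product
  -- with `dm` tends to 0 in any case.
  refine ⟨fun s r => (if 0 < max r 0 then (dal V V₁ (w s) (max r 0) : ℂ) * dm (w s) (max r 0) else 0)
    - (al V (w s) (max r 0) : ℂ) * (dm (w s) (max r 0) / (max r 0 : ℝ)) + src V₁ V₂ (w s) r,
    (h1.sub h2).add (hw.fam.src hV.toPot), fun s r hr => ?_⟩
  rw [dca_mul_add_dcb _ hr]
  simp [hr, max_eq_left hr.le]

variable (h₀ : Init A z₀ z₀') (hz₀ : Continuous z₀') (hfix : hw.next hV h₀ = w)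
include h₀ hz₀ hfix

/-- Along characteristics the radial derivative solves a linear equation whose coefficient and
source extend continuously to the axis. The Duhamel formula with the extended data defines a
continuous function everywhere, equal to the derivative for r > 0. -/
theorem Ball.exists_radial_deriv : ∃ ω₁ : ℝ → ℝ → ℂ, (Continuous fun p : ℝ × ℝ => ω₁ p.1 p.2) ∧
    ∀ t r, 0 ≤ t → 0 < r → ω₁ t r = (hw.transp hV h₀).z' t r := by
  set T := hw.transp hV h₀
  have hzw : T.z = w := hfix
  obtain ⟨F, hF, hFeq⟩ := hw.continuous_source hV
  obtain ⟨ω, hω, H⟩ := T.toSpeed.exists_duhamel (κ := fun s r => ca V (w s) (max r 0) +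
      ((dens V (w s) (max r 0) - Gt V (w s) (max r 0)) / (max r 0) / 2 : ℝ))
    (T.cont_a.add (Complex.continuous_ofReal.comp (hw.continuous_dGt hV))) hF hz₀
  refine ⟨ω, hω, fun t r ht hr => ?_⟩
  set y := T.Y t r
  have hXt : T.X t y = r := T.X_Y ht r
  have hpos : 0 < T.X t y := by rw [hXt]; exact hr
  have hX0 : ∀ s ∈ Icc 0 t, 0 < T.X s y := fun s hs => by
    have := T.antitone_X y hs.2; simp only [hXt] at this; linarith
  have hy0 : 0 < y := by have := hX0 0 ⟨le_rfl, ht⟩; rwa [T.X_zero] at this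
  have e0 : T.z' 0 y = z₀' y := by
    refine (T.hasDerivAt_z le_rfl hy0).unique ((h₀.deriv y hy0).congr_of_eventuallyEq ?_)
    filter_upwards [lt_mem_nhds hy0] with r hr using T.z_zero hr.le
  have key := H t y ht (fun s => T.z' s (T.X s y))
    (T.continuousOn_z'.comp (f := fun s => (s, T.X s y))
        (continuous_id.prodMk (T.continuous_X_left y)).continuousOn fun s hs => ⟨hs.1, hX0 s hs⟩)
    (by simp only [T.X_zero, e0]) fun s hs => by
      have hs' : s ∈ Icc 0 t := ⟨hs.1, hs.2.le⟩
      refine (T.hasDerivWithinAt_z'_X hs hpos).congr_deriv ?_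
      rw [max_eq_left (hX0 s hs').le, hFeq s _ (hX0 s hs'), hzw]
  simp only [hXt] at key
  exact key.symm

/-- The right-hand side of the equation is continuous up to the axis once the radial derivative is.
On the axis the time derivative comes from the integrated equation, the one-sided radial derivative
from the limit of derivatives. -/
theorem Ball.exists_sol : ∃ ω₀ ω₁ : ℝ → ℝ → ℂ, Sol V V₁ A z₀ w ω₀ ω₁ := by
  obtain ⟨ω₁, hc₁, he₁⟩ := hw.exists_radial_deriv hV h₀ hz₀ hfix
  set T := hw.transp hV h₀
  have hzw : T.z = w := hfix
  have hA := hV.pos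
  set ω₀ : ℝ → ℝ → ℂ := fun s r => (Gt V (w s) (max r 0) / 2 : ℝ) * ω₁ s r +
    ca V (w s) (max r 0) * w s r + cb V V₁ (w s) (max r 0) with hω₀
  have hc₀ : Continuous fun p : ℝ × ℝ => ω₀ p.1 p.2 :=
    (((Complex.continuous_ofReal.comp T.cont).mul hc₁).add (T.cont_a.mul hw.cont)).add T.cont_b
  have hr : ∀ t r, 0 ≤ t → 0 < r → HasDerivAt (w t) (ω₁ t r) r := fun t r ht hr => by
    have := T.hasDerivAt_z ht hr
    rw [← he₁ t r ht hr, hzw] at this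
    exact this
  have ht : ∀ t r, 0 ≤ t → 0 < r → HasDerivWithinAt (fun t => w t r) (ω₀ t r) (Ici 0) t :=
    fun t r ht hr => by
      have := T.hasDerivWithinAt_z ht hr
      rw [← he₁ t r ht hr, hzw] at this
      exact this
  have hbd₁ : ∀ τ r, 0 ≤ τ → 0 ≤ r → ‖ω₁ τ r‖ ≤ A / (1 + τ + r) ^ 3 := fun τ r hτ hr0 => by
    have h1 : ∀ δ, 0 < δ → ‖ω₁ τ (r + δ)‖ ≤ A / (1 + τ + r) ^ 3 := fun δ hδ => by
      rw [he₁ τ _ hτ (by positivity)]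
      refine (hw.norm_next'_le hV h₀ hτ (by positivity)).trans ?_
      gcongr
      linarith
    have h2 : Continuous fun δ : ℝ => ‖ω₁ τ (r + δ)‖ :=
      (hc₁.comp (f := fun δ : ℝ => (τ, r + δ)) (by fun_prop)).norm
    have h3 := (h2.continuousWithinAt (s := Ioi 0) (x := 0)).tendsto
    rw [add_zero] at h3
    exact le_of_tendsto h3 (by filter_upwards [self_mem_nhdsWithin] with δ hδ using h1 δ hδ)
  refine ⟨ω₀, ω₁, hw, hc₀, hc₁, fun t r ht0 hr0 => ?_, fun t r ht0 hr0 => ?_, fun t r ht0 hr0 => ?_,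
    fun t r ht0 hr0 => ?_, hbd₁, fun r hr => ?_⟩
  · rcases hr0.eq_or_lt with rfl | hr0
    -- The integrated equation holds for r > 0, and both sides are continuous in r, so it also holds
    -- at r = 0 and can be differentiated there.
    · have key : ∀ r, 0 ≤ r → ∀ t, 0 ≤ t → w t r = w 0 r + ∫ s in (0 : ℝ)..t, ω₀ s r := by
        have pos : ∀ r, 0 < r → ∀ t, 0 ≤ t → w t r = w 0 r + ∫ s in (0 : ℝ)..t, ω₀ s r :=
          fun r hr t ht0 => by
            rw [intervalIntegral.integral_eq_sub_of_hasDeriv_right_of_le ht0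
              (f := fun t => w t r) (f' := fun s => ω₀ s r)]
            · ring
            · exact (hw.cont.comp (f := fun s : ℝ => (s, r)) (by fun_prop)).continuousOn
            · intro s hs
              exact (ht s r hs.1.le hr).mono (fun x hx => hs.1.le.trans (le_of_lt hx))
            · exact (hc₀.comp (f := fun s : ℝ => (s, r)) (by fun_prop)).intervalIntegrable _ _
        intro r hr0 t ht0
        have c1 : Continuous fun r : ℝ => w t r := hw.cont.comp (f := fun r : ℝ => (t, r)) (by fun_prop)
        have c2 : Continuous fun r : ℝ => w 0 r + ∫ s in (0 : ℝ)..t, ω₀ s r :=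
          (hw.cont.comp (f := fun r : ℝ => ((0 : ℝ), r)) (by fun_prop)).add
            ((Transp.continuous_integral (Φ := ω₀) hc₀).comp (f := fun r : ℝ => (t, r)) (by fun_prop))
        have h1 : Tendsto (fun r => w t r) (𝓝[>] r) (𝓝 (w t r)) := c1.continuousWithinAt
        have h2 : Tendsto (fun r => w 0 r + ∫ s in (0 : ℝ)..t, ω₀ s r) (𝓝[>] r)
          (𝓝 (w 0 r + ∫ s in (0 : ℝ)..t, ω₀ s r)) := c2.continuousWithinAt
        refine tendsto_nhds_unique h1 (h2.congr' ?_)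
        filter_upwards [self_mem_nhdsWithin] with ρ hρ
        exact (pos ρ (hr0.trans_lt hρ) t ht0).symm
      have h1 : HasDerivAt (fun t => w 0 0 + ∫ s in (0 : ℝ)..t, ω₀ s 0) (ω₀ t 0) t :=
        (hasDerivAt_primitive' (g := fun s => ω₀ s 0)
          (hc₀.comp (f := fun s : ℝ => (s, (0 : ℝ))) (by fun_prop)) t).const_add _
      exact h1.hasDerivWithinAt.congr (fun s hs => key 0 le_rfl s hs) (key 0 le_rfl t ht0)
    · exact ht t r ht0 hr0
  · rcases hr0.eq_or_lt with rfl | hr0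
    · have hcw : Continuous (w t) := hw.cont.comp (f := fun r : ℝ => (t, r)) (by fun_prop)
      have hcω : Continuous (ω₁ t) := hc₁.comp (f := fun r : ℝ => (t, r)) (by fun_prop)
      refine hasDerivWithinAt_Ici_of_tendsto_deriv (s := Ioi 0)
        (fun r hr0 => (hr t r ht0 hr0).differentiableAt.differentiableWithinAt)
        hcw.continuousWithinAt self_mem_nhdsWithin ?_
      refine (hcω.continuousWithinAt (s := Ioi 0) (x := 0)).tendsto.congr' ?_
      filter_upwards [self_mem_nhdsWithin] with r hr0 using (hr t r ht0 hr0).deriv.symm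
    · exact (hr t r ht0 hr0).hasDerivWithinAt
  · simp only [hω₀, max_eq_left hr0.le]
  · simp only [hω₀, max_eq_left hr0]
    have hP := hw.prof t ht0
    have hK := hV.nonneg
    have hsq := hV.sq_le
    have hA1 := hV.le
    have b1 := hbd₁ t r ht0 hr0
    have b2 : ‖ω₁ t r‖ ≤ A := b1.trans (div_le_self hA.le (one_le_pow₀ (by linarith)))
    have b3 := hP.Gt_mem hV hr0
    have b4 : ‖ca V (w t) r‖ ≤ 1 := by
      refine (hP.norm_ca_le hV.toPot hr0).trans ?_
      have h2 := mul_le_mul_of_nonneg_left hP.sq_div_le (show 0 ≤ 20 * (1 + K) by positivity)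
      linarith
    have b5 : ‖w t r‖ ≤ A := (hw.fam.loc t).bdd r
    have b6 : ‖cb V V₁ (w t) r‖ ≤ 1 / 2 := by
      refine (hP.norm_cb_le hV.toPot hr0).trans ?_
      have h1 := hP.r_mul_cube_le hr0
      have h2 : A ^ 3 / ((1 + t) ^ 2 * (1 + t + r) ^ 2) ≤ A ^ 3 :=
        div_le_self (by positivity) (by
          have := one_le_pow₀ (n := 2) (show 1 ≤ 1 + t by linarith)
          have := one_le_pow₀ (n := 2) (show 1 ≤ 1 + t + r by linarith)
          nlinarith)
      have h3 : A ^ 3 ≤ A ^ 2 := pow_le_pow_of_le_one hA.le hV.le_one (by norm_num)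
      have h4 := mul_le_mul_of_nonneg_left (h1.trans (h2.trans h3)) (show 0 ≤ 20 * (1 + K) by positivity)
      linarith
    refine (norm_add₃_le).trans ?_
    rw [norm_mul, norm_mul, Complex.norm_real, Real.norm_eq_abs, abs_of_nonneg (by linarith [b3.1])]
    have hA2 : A ≤ 1 / 200 := by nlinarith
    have m1 : Gt V (w t) r / 2 * ‖ω₁ t r‖ ≤ 1 * A := by gcongr; linarith [b3.2]
    have m2 : ‖ca V (w t) r‖ * ‖w t r‖ ≤ 1 * A := by gcongr
    linarith
  · rw [← hzw]; exact T.z_zero hr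

end Centre

end

section

/-! ### Translation between the real system and its complex normalized form -/

section Identification

/-- The complex profile of a pair of real functions on `[0, ∞)`. -/
def cx (h k : ℝ → ℝ) (r : ℝ) : ℂ := ⟨h (max r 0), k (max r 0)⟩

/-- The value of `g` at the centre. -/
def cc (f : ℝ → ℂ) : ℝ := Real.exp (-∫ s in Ioi (0 : ℝ), md f s)

theorem cc_pos (f : ℝ → ℂ) : 0 < cc f := Real.exp_pos _

variable {h k : ℝ → ℝ} (hh : ContinuousOn h (Ici 0)) (hk : ContinuousOn k (Ici 0))
include hh hk

theorem continuous_cx : Continuous (cx h k) := by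
  have h1 : Continuous fun r => h (max r 0) := hh.comp_continuous (by fun_prop) fun r => le_max_right r 0
  have h2 : Continuous fun r => k (max r 0) := hk.comp_continuous (by fun_prop) fun r => le_max_right r 0
  have : cx h k = fun r => ((h (max r 0) : ℂ) + (k (max r 0) : ℂ) * Complex.I) := by
    funext r; apply Complex.ext <;> simp [cx]
  rw [this]
  exact (Complex.continuous_ofReal.comp h1).add ((Complex.continuous_ofReal.comp h2).mul continuous_const)

theorem cx_re {r : ℝ} (hr : 0 ≤ r) : (cx h k r).re = h r := by simp [cx, max_eq_left hr]

theorem cx_im {r : ℝ} (hr : 0 ≤ r) : (cx h k r).im = k r := by simp [cx, max_eq_left hr]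

theorem mean_eq_re {r : ℝ} (hr : 0 ≤ r) : mean h r = (avg (cx h k) r).re := by
  have h1 : (avg (cx h k) r).re = ∫ θ in (0 : ℝ)..1, (cx h k (θ * r)).re :=
    (Complex.reCLM.intervalIntegral_comp_comm
      ((continuous_cx hh hk).comp (by fun_prop : Continuous fun θ : ℝ => θ * r)
        |>.intervalIntegrable _ _)).symm
  rw [h1, mean_eq_avg]
  exact (avg_congr (g := fun s => (cx h k s).re) hr fun s hs => (cx_re hh hk hs.1).symm)

theorem mean_eq_im {r : ℝ} (hr : 0 ≤ r) : mean k r = (avg (cx h k) r).im := by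
  have h1 : (avg (cx h k) r).im = ∫ θ in (0 : ℝ)..1, (cx h k (θ * r)).im :=
    (Complex.imCLM.intervalIntegral_comp_comm
      ((continuous_cx hh hk).comp (by fun_prop : Continuous fun θ : ℝ => θ * r)
        |>.intervalIntegrable _ _)).symm
  rw [h1, mean_eq_avg]
  exact (avg_congr (g := fun s => (cx h k s).im) hr fun s hs => (cx_im hh hk hs.1).symm)

theorem massDensity_eq {s : ℝ} (hs : 0 ≤ s) : massDensity h k s = md (cx h k) s := by
  rw [massDensity, md, mean_eq_re hh hk hs, mean_eq_im hh hk hs, ← Complex.normSq_eq_norm_sq,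
    Complex.normSq_apply, dm, Complex.sub_re, Complex.sub_im, cx_re hh hk hs, cx_im hh hk hs]
  ring

theorem charge_eq {r : ℝ} (hr : 0 ≤ r) : charge h k r = QQ (cx h k) r := by
  refine intervalIntegral.integral_congr fun s hs => ?_
  rw [uIcc_of_le hr] at hs
  simp only [mean_eq_re hh hk hs.1, mean_eq_im hh hk hs.1, JJ, Complex.mul_im, Complex.conj_re,
    Complex.conj_im, cx_re hh hk hs.1, cx_im hh hk hs.1]
  ring

theorem higgsSq_eq {r : ℝ} (hr : 0 ≤ r) : higgsSq h k r = hs (cx h k) r := by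
  rw [higgsSq, hs, ← Complex.normSq_eq_norm_sq, Complex.normSq_apply, mean_eq_re hh hk hr,
    mean_eq_im hh hk hr]
  ring

variable (hi : IntegrableOn (massDensity h k) (Ioi 0))
include hi

theorem integrableOn_md : IntegrableOn (md (cx h k)) (Ioi 0) :=
  hi.congr_fun (fun s hs => massDensity_eq hh hk (le_of_lt hs)) measurableSet_Ioi

theorem gFun_eq {r : ℝ} (hr : 0 ≤ r) : gFun h k r = cc (cx h k) * GG (cx h k) r := by
  have hI := integrableOn_md hh hk hi
  have h1 : ∫ s in Ioi r, massDensity h k s = ∫ s in Ioi r, md (cx h k) s :=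
    setIntegral_congr_fun measurableSet_Ioi fun s hs => massDensity_eq hh hk (hr.trans (le_of_lt hs))
  have h2 : ∫ s in Ioi (0 : ℝ), md (cx h k) s =
      (∫ s in (0 : ℝ)..r, md (cx h k) s) + ∫ s in Ioi r, md (cx h k) s := by
    rw [intervalIntegral.integral_of_le hr, ← setIntegral_union
      (Ioc_disjoint_Ioi le_rfl) measurableSet_Ioi (hI.mono_set Ioc_subset_Ioi_self)
      (hI.mono_set (Ioi_subset_Ioi hr)), Ioc_union_Ioi_eq_Ioi hr]
  rw [gFun, h1, cc, GG, ← Real.exp_add, h2]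
  congr 1
  ring

theorem ymPotential_eq {r : ℝ} (hr : 0 ≤ r) : ymPotential h k r = cc (cx h k) * ym (cx h k) r := by
  rw [ym, ← intervalIntegral.integral_const_mul]
  refine intervalIntegral.integral_congr fun s hs => ?_
  rw [uIcc_of_le hr] at hs
  simp only [gFun_eq hh hk hi hs.1, charge_eq hh hk hs.1, qq]
  ring

theorem gTilde_eq (V : ℝ → ℝ) {r : ℝ} (hr : 0 ≤ r) :
    gTilde V h k r = cc (cx h k) * Gt V (cx h k) r := by
  rw [gTilde, mean_eq_avg, Gt, avg, avg, ← intervalIntegral.integral_const_mul]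
  refine intervalIntegral.integral_congr fun θ hθ => ?_
  rw [uIcc_of_le zero_le_one] at hθ
  have h0 : 0 ≤ θ * r := mul_nonneg hθ.1 hr
  simp only [gFun_eq hh hk hi h0, charge_eq hh hk h0, higgsSq_eq hh hk h0, dens, qq]
  ring

/-- The right-hand side of the evolution system in complex form. -/
theorem rhs_eq (V : ℝ → ℝ) {r : ℝ} (hr : 0 < r) :
    ((diagTerm V h k h r + charge h k r * gFun h k r / (4 * r) * mean k r
        + ymPotential h k r / 2 * k r : ℝ) : ℂ) +
      ((diagTerm V h k k r + charge h k r * gFun h k r / (4 * r) * mean h r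
        - ymPotential h k r / 2 * h r : ℝ) : ℂ) * Complex.I =
    cc (cx h k) * (ca V (cx h k) r * cx h k r + cb V (deriv₀ V) (cx h k) r) := by
  simp only [diagTerm, gFun_eq hh hk hi hr.le, gTilde_eq hh hk hi V hr.le, charge_eq hh hk hr.le,
    ymPotential_eq hh hk hi hr.le, higgsSq_eq hh hk hr.le, mean_eq_re hh hk hr.le,
    mean_eq_im hh hk hr.le]
  have e1 : h r = (cx h k r).re := (cx_re hh hk hr.le).symm
  have e2 : k r = (cx h k r).im := (cx_im hh hk hr.le).symm
  rw [e1, e2]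
  set f := cx h k
  apply Complex.ext
  · simp only [ca, cb, Complex.add_re, Complex.add_im, Complex.sub_re, Complex.sub_im, Complex.mul_re,
      Complex.mul_im, Complex.neg_re, Complex.neg_im, Complex.ofReal_re, Complex.ofReal_im, Complex.I_re,
      Complex.I_im, Complex.conj_re, Complex.conj_im, al, qq]
    field_simp
    ring
  · simp only [ca, cb, Complex.add_re, Complex.add_im, Complex.sub_re, Complex.sub_im, Complex.mul_re,
      Complex.mul_im, Complex.neg_re, Complex.neg_im, Complex.ofReal_re, Complex.ofReal_im, Complex.I_re,
      Complex.I_im, Complex.conj_re, Complex.conj_im, al, qq]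
    field_simp
    ring

/-- The evolution system in complex form. -/
theorem eqs_iff (V : ℝ → ℝ) {r : ℝ} (hr : 0 < r) (a b c d : ℝ) :
    (a - gTilde V h k r / 2 * b = diagTerm V h k h r
        + charge h k r * gFun h k r / (4 * r) * mean k r + ymPotential h k r / 2 * k r ∧
      c - gTilde V h k r / 2 * d = diagTerm V h k k r
        + charge h k r * gFun h k r / (4 * r) * mean h r - ymPotential h k r / 2 * h r) ↔
    (a + c * Complex.I : ℂ) = cc (cx h k) * ((Gt V (cx h k) r / 2 : ℝ) * (b + d * Complex.I)
      + ca V (cx h k) r * cx h k r + cb V (deriv₀ V) (cx h k) r) := by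
  have key := rhs_eq hh hk hi V hr
  have e3 := gTilde_eq hh hk hi V hr.le
  set RH := diagTerm V h k h r + charge h k r * gFun h k r / (4 * r) * mean k r
        + ymPotential h k r / 2 * k r
  set RK := diagTerm V h k k r + charge h k r * gFun h k r / (4 * r) * mean h r
        - ymPotential h k r / 2 * h r
  have e4 : (cc (cx h k) * ((Gt V (cx h k) r / 2 : ℝ) * (b + d * Complex.I)
      + ca V (cx h k) r * cx h k r + cb V (deriv₀ V) (cx h k) r) : ℂ) =
      ((gTilde V h k r / 2 * b + RH : ℝ) : ℂ) + ((gTilde V h k r / 2 * d + RK : ℝ) : ℂ) * Complex.I := by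
    rw [add_assoc, mul_add, ← key, e3]; push_cast; ring
  rw [e4, Complex.ext_iff]
  simp
  constructor
  · rintro ⟨h1, h2⟩; constructor <;> linarith
  · rintro ⟨h1, h2⟩; constructor <;> linarith

end Identification

/-! ### From central proper time back to retarded time -/

section TimeChange

variable {V V₁ V₂ : ℝ → ℝ} {K A : ℝ} {w ω₀ ω₁ : ℝ → ℝ → ℂ} {z₀ : ℝ → ℂ}

theorem Prof.md_le_inv {c : ℝ} {f : ℝ → ℂ} (h : Prof A c f) {s : ℝ} (hs : 0 ≤ s) :
    md f s ≤ (1 + s ^ 2)⁻¹ := by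
  refine (h.md_le hs).trans ?_
  have hx := h.x_pos hs
  have hp := h.p_nonneg hs
  have h1 : s * (A / (c * (c + s))) ^ 2 ≤ 1 := by
    have h2 : s * (A / (c * (c + s))) ≤ 1 := h.rp_le_one hs
    calc _ = s * (A / (c * (c + s))) * (A / (c * (c + s))) := by ring
      _ ≤ 1 * 1 := by gcongr; exact h.p_le_one hs
      _ = 1 := one_mul 1
  rw [inv_eq_one_div]
  have h3 : 1 + s ^ 2 ≤ (c + s) ^ 2 := by nlinarith [h.one_le]
  gcongr

theorem Prof.integrableOn_md {c : ℝ} {f : ℝ → ℂ} (h : Prof A c f) : IntegrableOn (md f) (Ioi 0) := by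
  refine Integrable.mono' (integrable_inv_one_add_sq.integrableOn)
    (h.loc.continuous_md.aestronglyMeasurable) ?_
  filter_upwards [ae_restrict_mem measurableSet_Ioi] with s hs
  rw [Real.norm_eq_abs, abs_of_nonneg (md_nonneg f (le_of_lt hs))]
  exact h.md_le_inv (le_of_lt hs)

/-- GG ≤ 2 at every radius says that the integral of `md` is at most log 2, which is the lower bound
on the central value of g. -/
theorem Prof.cc_mem {c : ℝ} {f : ℝ → ℂ} (h : Prof A c f) : cc f ∈ Icc (1 / 2) 1 := by
  have h1 : 0 ≤ ∫ s in Ioi (0 : ℝ), md f s :=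
    setIntegral_nonneg measurableSet_Ioi fun s hs => md_nonneg f (le_of_lt hs)
  have h2 : ∫ s in Ioi (0 : ℝ), md f s ≤ Real.log 2 := by
    refine le_of_tendsto (intervalIntegral_tendsto_integral_Ioi 0 h.integrableOn_md tendsto_id) ?_
    filter_upwards [eventually_ge_atTop 0] with r hr
    exact (Real.le_log_iff_exp_le two_pos).2 (h.GG_le_two hr)
  constructor
  · rw [cc, Real.exp_neg, one_div]
    refine inv_anti₀ (Real.exp_pos _) ?_
    exact (Real.le_log_iff_exp_le two_pos).1 h2
  · rw [cc, Real.exp_le_one_iff]; linarith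

/-- The densities of all profiles in the ball are dominated by the single integrable function
1/(1+s²). -/
theorem Ball.continuous_cc (hw : Ball A w) : Continuous fun τ => cc (w τ) := by
  refine Real.continuous_exp.comp (Continuous.neg ?_)
  refine continuous_of_dominated (bound := fun s => (1 + s ^ 2)⁻¹) ?_ ?_
    integrable_inv_one_add_sq.integrableOn ?_
  · exact fun τ => (hw.fam.loc τ).continuous_md.aestronglyMeasurable
  · intro τ
    filter_upwards [ae_restrict_mem measurableSet_Ioi] with s hs
    rw [Real.norm_eq_abs, abs_of_nonneg (md_nonneg _ (le_of_lt hs))]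
    exact (hw.prof' τ).md_le_inv (le_of_lt hs)
  · exact Eventually.of_forall fun s => hw.fam.md.comp (f := fun τ : ℝ => (τ, s)) (by fun_prop)

/-- The proper time along the centre as a function of the retarded time that is normalized at
infinity. -/
theorem Ball.exists_time (hw : Ball A w) : ∃ σ θ : ℝ → ℝ, σ 0 = 0 ∧ StrictMono σ ∧
    Function.LeftInverse θ σ ∧ Function.RightInverse θ σ ∧ (∀ u, HasDerivAt σ (cc (w (σ u))) u) ∧
    (∀ τ, HasDerivAt θ (cc (w τ))⁻¹ τ) ∧ ∀ u, 0 ≤ u → u ≤ 2 * σ u := by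
  have hc := hw.continuous_cc
  have hpos : ∀ τ, 0 < cc (w τ) := fun τ => cc_pos _
  set θ : ℝ → ℝ := fun τ => ∫ s in (0 : ℝ)..τ, (cc (w s))⁻¹ with hθ
  have hci : Continuous fun s => (cc (w s))⁻¹ := hc.inv₀ fun s => (hpos s).ne'
  have hd : ∀ τ, HasDerivAt θ (cc (w τ))⁻¹ τ := fun τ => hasDerivAt_primitive hci τ
  have hθc : Continuous θ := continuous_iff_continuousAt.2 fun τ => (hd τ).continuousAt
  have hmono : StrictMono θ := strictMono_of_hasDerivAt_pos hd fun τ => inv_pos.2 (hpos τ)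
  have h0 : θ 0 = 0 := by simp [hθ]
  -- The upper bound cc ≤ 1 makes θ grow at least like τ, so θ is onto; the lower bound cc ≥ 1/2
  -- makes it grow at most like 2τ, which is the comparison u ≤ 2σ(u).
  have hge : Monotone fun τ => θ τ - τ := monotone_of_hasDerivAt_nonneg
    (fun τ => (hd τ).sub (hasDerivAt_id τ)) fun τ => by
      have h1 := (hw.prof' τ).cc_mem.2
      have : 1 ≤ (cc (w τ))⁻¹ := (one_le_inv₀ (hpos τ)).2 h1
      simp only [Pi.zero_apply]; linarith
  have hle : Monotone fun τ => 2 * τ - θ τ := monotone_of_hasDerivAt_nonneg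
    (fun τ => ((hasDerivAt_id τ).const_mul 2).sub (hd τ)) fun τ => by
      have h1 := (hw.prof' τ).cc_mem.1
      have : (cc (w τ))⁻¹ ≤ (1 / 2)⁻¹ := inv_anti₀ (by norm_num) h1
      norm_num at this
      simp only [Pi.zero_apply]; linarith
  have hsurj : Function.Surjective θ := by
    refine hθc.surjective ?_ ?_
    · refine tendsto_atTop_mono' _ ?_ tendsto_id
      filter_upwards [eventually_ge_atTop 0] with τ hτ
      have := hge hτ; simp only [h0] at this; simp only [id]; linarith
    · refine tendsto_atBot_mono' _ ?_ tendsto_id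
      filter_upwards [eventually_le_atBot 0] with τ hτ
      have := hge hτ; simp only [h0] at this; simp only [id]; linarith
  set e := hmono.orderIsoOfSurjective θ hsurj
  have he : ∀ τ, e τ = θ τ := fun τ => rfl
  have hes : ∀ u, θ (e.symm u) = u := fun u => e.apply_symm_apply u
  have hse : ∀ τ, e.symm (θ τ) = τ := fun τ => e.symm_apply_apply τ
  refine ⟨e.symm, θ, by have := hse 0; rwa [h0] at this, e.symm.strictMono, hes, hse, fun u => ?_,
    hd, fun u hu => ?_⟩
  · have := HasDerivAt.of_local_left_inverse (f := θ) (g := e.symm)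
      e.symm.continuous.continuousAt (hd (e.symm u)) (inv_pos.2 (hpos _)).ne'
      (Eventually.of_forall hes)
    simpa using this
  · have h1 : 0 ≤ e.symm u := by
      have h2 : e.symm 0 = 0 := by have := hse 0; rwa [h0] at this
      exact h2 ▸ e.symm.monotone hu
    have := hle h1
    simp only [h0, hes] at this
    linarith

variable {σ : ℝ → ℝ} (hV : Small V (deriv₀ V) V₂ K A) (S : Sol V (deriv₀ V) A z₀ w ω₀ ω₁)
  (h0 : σ 0 = 0) (hm : StrictMono σ) (hd : ∀ u, HasDerivAt σ (cc (w (σ u))) u)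

theorem cx_re_im (hw : Ball A w) (τ : ℝ) :
    cx (fun r => (w τ r).re) (fun r => (w τ r).im) = w τ := by
  funext r
  have : w τ r = w τ (max r 0) := by
    rw [hw.clamp τ r, hw.clamp τ (max r 0), max_eq_left (le_max_right r 0)]
  rw [this]; rfl

theorem Ball.continuousOn_re (hw : Ball A w) (τ : ℝ) : ContinuousOn (fun r => (w τ r).re) (Ici 0) :=
  (Complex.continuous_re.comp (hw.fam.loc τ).continuous).continuousOn

theorem Ball.continuousOn_im (hw : Ball A w) (τ : ℝ) : ContinuousOn (fun r => (w τ r).im) (Ici 0) :=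
  (Complex.continuous_im.comp (hw.fam.loc τ).continuous).continuousOn

theorem Ball.integrableOn_massDensity (hw : Ball A w) (τ : ℝ) :
    IntegrableOn (massDensity (fun r => (w τ r).re) fun r => (w τ r).im) (Ioi 0) := by
  refine (hw.prof' τ).integrableOn_md.congr_fun (fun s hs => ?_) measurableSet_Ioi
  rw [massDensity_eq (hw.continuousOn_re τ) (hw.continuousOn_im τ) (le_of_lt hs), cx_re_im hw]

theorem Ball.gFun_eq (hw : Ball A w) (τ : ℝ) {r : ℝ} (hr : 0 ≤ r) :
    gFun (fun r => (w τ r).re) (fun r => (w τ r).im) r = cc (w τ) * GG (w τ) r := by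
  rw [EYMH.gFun_eq (hw.continuousOn_re τ) (hw.continuousOn_im τ) (hw.integrableOn_massDensity τ) hr,
    cx_re_im hw]

theorem Ball.gTilde_eq (hw : Ball A w) (τ : ℝ) {r : ℝ} (hr : 0 ≤ r) :
    gTilde V (fun r => (w τ r).re) (fun r => (w τ r).im) r = cc (w τ) * Gt V (w τ) r := by
  rw [EYMH.gTilde_eq (hw.continuousOn_re τ) (hw.continuousOn_im τ) (hw.integrableOn_massDensity τ) V hr,
    cx_re_im hw]

include S h0 hm hd

theorem Sol.time_nonneg {u : ℝ} (hu : 0 ≤ u) : 0 ≤ σ u := h0 ▸ hm.monotone hu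

theorem Sol.hasDerivWithinAt_u {u r : ℝ} (hu : 0 ≤ u) (hr : 0 ≤ r) :
    HasDerivWithinAt (fun u => w (σ u) r) (cc (w (σ u)) * ω₀ (σ u) r) (Ici 0) u :=
  ((S.hasDeriv₀ (σ u) r (S.time_nonneg h0 hm hd hu) hr).scomp u (hd u).hasDerivWithinAt
    fun v hv => S.time_nonneg h0 hm hd hv).congr_deriv (by rw [Complex.real_smul])

theorem Sol.contDiffOn :
    ContDiffOn ℝ 1 (fun p : ℝ × ℝ => w (σ p.1) p.2) (Ici 0 ×ˢ Ici 0) := by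
  have hσ : Continuous σ := continuous_iff_continuousAt.2 fun u => (hd u).continuousAt
  have hp : Continuous fun p : ℝ × ℝ => (σ p.1, p.2) := by fun_prop
  refine contDiffOn_of_partials (convex_Ici 0) (convex_Ici 0) (uniqueDiffOn_Ici 0) (uniqueDiffOn_Ici 0)
    (p₁ := fun p => cc (w (σ p.1)) * ω₀ (σ p.1) p.2) (p₂ := fun p => ω₁ (σ p.1) p.2) ?_ ?_ ?_ ?_
  · exact fun x hx => S.hasDerivWithinAt_u h0 hm hd hx.1 hx.2
  · exact fun x hx => S.hasDeriv₁ _ _ (S.time_nonneg h0 hm hd hx.1) hx.2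
  · exact ((Complex.continuous_ofReal.comp (S.ball.continuous_cc.comp (hσ.comp continuous_fst))).mul
      (S.cont₀.comp hp)).continuousOn
  · exact (S.cont₁.comp hp).continuousOn

theorem Sol.deriv₀_re {u r : ℝ} (hu : 0 ≤ u) (hr : 0 ≤ r) :
    deriv₀ (fun r => (w (σ u) r).re) r = (ω₁ (σ u) r).re :=
  (Complex.reCLM.hasFDerivAt.comp_hasDerivWithinAt r
    (S.hasDeriv₁ _ _ (S.time_nonneg h0 hm hd hu) hr)).derivWithin (uniqueDiffOn_Ici 0 r hr)

theorem Sol.deriv₀_im {u r : ℝ} (hu : 0 ≤ u) (hr : 0 ≤ r) :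
    deriv₀ (fun r => (w (σ u) r).im) r = (ω₁ (σ u) r).im :=
  (Complex.imCLM.hasFDerivAt.comp_hasDerivWithinAt r
    (S.hasDeriv₁ _ _ (S.time_nonneg h0 hm hd hu) hr)).derivWithin (uniqueDiffOn_Ici 0 r hr)

theorem Sol.isGlobalSolution {h₀ k₀ : ℝ → ℝ} (hh₀ : ∀ r, 0 ≤ r → (z₀ r).re = h₀ r)
    (hk₀ : ∀ r, 0 ≤ r → (z₀ r).im = k₀ r) :
    IsGlobalSolution V h₀ k₀ (fun u r => (w (σ u) r).re) (fun u r => (w (σ u) r).im) := by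
  have eqs : ∀ u r : ℝ, 0 ≤ u → 0 < r → _ := fun u r hu hr =>
    (eqs_iff (S.ball.continuousOn_re (σ u)) (S.ball.continuousOn_im (σ u))
      (S.ball.integrableOn_massDensity (σ u)) V hr
      (deriv₀ (fun v => (w (σ v) r).re) u) (deriv₀ (fun r => (w (σ u) r).re) r)
      (deriv₀ (fun v => (w (σ v) r).im) u) (deriv₀ (fun r => (w (σ u) r).im) r)).2 (by
        have e1 : deriv₀ (fun v => (w (σ v) r).re) u = (cc (w (σ u)) * ω₀ (σ u) r).re :=
          (Complex.reCLM.hasFDerivAt.comp_hasDerivWithinAt u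
            (S.hasDerivWithinAt_u h0 hm hd hu hr.le)).derivWithin (uniqueDiffOn_Ici 0 u hu)
        have e2 : deriv₀ (fun v => (w (σ v) r).im) u = (cc (w (σ u)) * ω₀ (σ u) r).im :=
          (Complex.imCLM.hasFDerivAt.comp_hasDerivWithinAt u
            (S.hasDerivWithinAt_u h0 hm hd hu hr.le)).derivWithin (uniqueDiffOn_Ici 0 u hu)
        rw [e1, e2, S.deriv₀_re h0 hm hd hu hr.le, S.deriv₀_im h0 hm hd hu hr.le, cx_re_im S.ball,
          Complex.re_add_im, Complex.re_add_im, S.eqn _ _ (S.time_nonneg h0 hm hd hu) hr])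
  refine ⟨?_, ?_, fun u _ => S.ball.integrableOn_massDensity (σ u), fun u r hu hr => (eqs u r hu hr).1,
    fun u r hu hr => (eqs u r hu hr).2, fun r hr => ?_, fun r hr => ?_⟩
  · exact Complex.reCLM.contDiff.comp_contDiffOn (S.contDiffOn h0 hm hd)
  · exact Complex.imCLM.contDiff.comp_contDiffOn (S.contDiffOn h0 hm hd)
  · rw [h0, S.init r hr, hh₀ r hr]
  · rw [h0, S.init r hr, hk₀ r hr]

theorem Sol.centralTime_eq {u : ℝ} :
    centralTime (fun u r => (w (σ u) r).re) (fun u r => (w (σ u) r).im) u = σ u := by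
  have hσ : Continuous σ := continuous_iff_continuousAt.2 fun u => (hd u).continuousAt
  have h1 : ∀ v, gFun (fun r => (w (σ v) r).re) (fun r => (w (σ v) r).im) 0 = cc (w (σ v)) := fun v => by
    rw [S.ball.gFun_eq _ le_rfl]; simp [GG]
  simp only [centralTime, h1]
  rw [intervalIntegral.integral_eq_sub_of_hasDerivAt (f := σ) (fun v _ => hd v)
    ((S.ball.continuous_cc.comp hσ).intervalIntegrable _ _), h0, sub_zero]

end TimeChange

end

section

/-! ### Coefficients at radius r depend only on the profile on [0, r] -/

section Congr

variable {f g : ℝ → ℂ} {r : ℝ} (hr : 0 ≤ r) (h : ∀ s ∈ Icc 0 r, f s = g s)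
include hr h

theorem dm_congr : dm f r = dm g r := by rw [dm, dm, avg_congr hr h, h r ⟨hr, le_rfl⟩]

theorem md_congr : md f r = md g r := by rw [md, md, dm_congr hr h]

theorem JJ_congr : JJ f r = JJ g r := by rw [JJ, JJ, avg_congr hr h, h r ⟨hr, le_rfl⟩]

omit hr in
theorem congr_mono {s : ℝ} (hs : s ∈ uIcc 0 r) (hr : 0 ≤ r) :
    0 ≤ s ∧ ∀ t ∈ Icc 0 s, f t = g t := by
  rw [uIcc_of_le hr] at hs
  exact ⟨hs.1, fun t ht => h t ⟨ht.1, ht.2.trans hs.2⟩⟩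

theorem GG_congr : GG f r = GG g r := by
  rw [GG, GG]
  congr 1
  refine intervalIntegral.integral_congr fun s hs => ?_
  obtain ⟨h0, h1⟩ := congr_mono h hs hr
  exact md_congr h0 h1

theorem QQ_congr : QQ f r = QQ g r := by
  refine intervalIntegral.integral_congr fun s hs => ?_
  obtain ⟨h0, h1⟩ := congr_mono h hs hr
  simp only [JJ_congr h0 h1]

theorem qq_congr : qq f r = qq g r := by rw [qq, qq, QQ_congr hr h]

theorem ym_congr : ym f r = ym g r := by
  refine intervalIntegral.integral_congr fun s hs => ?_
  obtain ⟨h0, h1⟩ := congr_mono h hs hr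
  simp only [GG_congr h0 h1, qq_congr h0 h1]

theorem hs_congr : hs f r = hs g r := by rw [hs, hs, avg_congr hr h]

theorem dens_congr (V : ℝ → ℝ) : dens V f r = dens V g r := by
  rw [dens, dens, GG_congr hr h, QQ_congr hr h, qq_congr hr h, hs_congr hr h]

theorem Gt_congr (V : ℝ → ℝ) : Gt V f r = Gt V g r :=
  avg_congr hr fun s hs => dens_congr hs.1 (fun t ht => h t ⟨ht.1, ht.2.trans hs.2⟩) V

theorem al_congr (V : ℝ → ℝ) : al V f r = al V g r := by
  rw [al, al, GG_congr hr h, Gt_congr hr h, qq_congr hr h, hs_congr hr h]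

theorem ca_congr (V : ℝ → ℝ) : ca V f r = ca V g r := by
  rw [ca, ca, al_congr hr h, ym_congr hr h]

theorem cb_congr (V V₁ : ℝ → ℝ) : cb V V₁ f r = cb V V₁ g r := by
  rw [cb, cb, al_congr hr h, GG_congr hr h, qq_congr hr h, hs_congr hr h, avg_congr hr h]

end Congr

/-- Change of the time variable by a merely measurable rate. -/
theorem hasDerivWithinAt_comp_inverse {c T μ : ℝ → ℝ} {F e : ℝ → ℂ} {U T₁ t₀ : ℝ}
    (hci : ∀ a b, IntervalIntegrable c volume a b) (hc0 : ∀ u, 0 ≤ c u)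
    (hT : ∀ a b, T b - T a = ∫ s in a..b, c s) (hμ : Continuous μ) (hTμ : ∀ t, T (μ t) = t)
    (hmaps : MapsTo μ (Icc 0 T₁) (Icc 0 U)) (he : Continuous e) (hF : Continuous F)
    (hFd : ∀ u ∈ Ioo 0 U, HasDerivAt F (c u * e u) u) (ht₀ : t₀ ∈ Icc 0 T₁) :
    HasDerivWithinAt (fun t => F (μ t)) (e (μ t₀)) (Icc 0 T₁) t₀ := by
  have hcC : ∀ a b, IntervalIntegrable (fun s => (c s : ℂ)) volume a b := fun a b =>
    ⟨(hci a b).1.ofReal, (hci a b).2.ofReal⟩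
  have hcei : ∀ a b, IntervalIntegrable (fun s => (c s : ℂ) * e s) volume a b := fun a b =>
    (hcC a b).mul_continuousOn he.continuousOn
  have hFi' : ∀ a ∈ Icc 0 U, ∀ b ∈ Icc 0 U, a ≤ b → F b - F a = ∫ s in a..b, (c s : ℂ) * e s :=
    fun a ha b hb hab => (intervalIntegral.integral_eq_sub_of_hasDerivAt_of_le hab hF.continuousOn
      (fun s hs => hFd s ⟨ha.1.trans_lt hs.1, hs.2.trans_le hb.2⟩) (hcei a b)).symm
  have hFi : ∀ a ∈ Icc 0 U, ∀ b ∈ Icc 0 U, F b - F a = ∫ s in a..b, (c s : ℂ) * e s :=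
    fun a ha b hb => by
      rcases le_total a b with hab | hab
      · exact hFi' a ha b hb hab
      · rw [intervalIntegral.integral_symm, ← hFi' b hb a ha hab]; ring
  rw [hasDerivWithinAt_iff_isLittleO]
  refine Asymptotics.isLittleO_iff.2 fun η hη => ?_
  obtain ⟨δ, hδ, hball⟩ := Metric.continuousAt_iff.1 (he.continuousAt (x := μ t₀)) η hη
  have h1 : ∀ᶠ t in 𝓝[Icc 0 T₁] t₀, μ t ∈ Metric.ball (μ t₀) δ :=
    hμ.continuousWithinAt.eventually (Metric.ball_mem_nhds _ hδ)
  filter_upwards [h1, self_mem_nhdsWithin] with t ht htT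
  -- The increment t - t₀ is itself the integral of c between μ t₀ and μ t. The remainder is the
  -- integral of c(e - e(μ t₀)), hence at most η |t - t₀|; continuity is needed for e but not for c.
  have e1 : (t - t₀) • e (μ t₀) = ∫ s in (μ t₀)..(μ t), (c s : ℂ) * e (μ t₀) := by
    rw [intervalIntegral.integral_mul_const, intervalIntegral.integral_ofReal, ← hT, hTμ, hTμ,
      Complex.real_smul]
  rw [hFi _ (hmaps ht₀) _ (hmaps htT), e1, ← intervalIntegral.integral_sub (hcei _ _)
    ((hcC _ _).mul_const _)]
  have h2 := intervalIntegral.norm_integral_le_abs_of_norm_le (f := fun s => (c s : ℂ) * e s - c s * e (μ t₀))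
    (g := fun s => η * c s) (a := μ t₀) (b := μ t) (μ := volume) ((ae_restrict_iff' measurableSet_uIoc).2 <|
    Eventually.of_forall fun s hs => by
      rw [← mul_sub, norm_mul, Complex.norm_real, Real.norm_eq_abs, abs_of_nonneg (hc0 s), mul_comm]
      refine mul_le_mul_of_nonneg_right ?_ (hc0 s)
      have h3 : s ∈ Metric.ball (μ t₀) δ := by
        have := uIoc_subset_uIcc hs
        rw [Real.ball_eq_Ioo] at ht ⊢
        exact (ordConnected_Ioo.uIcc_subset ⟨by linarith, by linarith⟩ ht) this
      rw [← dist_eq_norm]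
      exact (hball h3).le) ((hci _ _).const_mul η)
  refine h2.trans_eq ?_
  rw [intervalIntegral.integral_const_mul, ← hT, hTμ, hTμ, abs_mul, abs_of_pos hη, Real.norm_eq_abs]

theorem exists_partials {f : ℝ × ℝ → ℂ} (hf : ContDiffOn ℝ 1 f (Ici 0 ×ˢ Ici 0)) :
    ∃ d₀ d₁ : ℝ → ℝ → ℂ, (Continuous fun p : ℝ × ℝ => d₀ p.1 p.2) ∧
      (Continuous fun p : ℝ × ℝ => d₁ p.1 p.2) ∧
      (∀ u r, 0 ≤ u → 0 ≤ r → HasDerivWithinAt (fun u => f (u, r)) (d₀ u r) (Ici 0) u) ∧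
      ∀ u r, 0 ≤ u → 0 ≤ r → HasDerivWithinAt (fun r => f (u, r)) (d₁ u r) (Ici 0) r := by
  have hu : UniqueDiffOn ℝ (Ici (0 : ℝ) ×ˢ Ici (0 : ℝ)) := (uniqueDiffOn_Ici 0).prod (uniqueDiffOn_Ici 0)
  have hD := hf.continuousOn_fderivWithin hu le_rfl
  have hcl : Continuous fun p : ℝ × ℝ => (max p.1 0, max p.2 0) := by fun_prop
  have hD' : Continuous fun p : ℝ × ℝ =>
      fderivWithin ℝ f (Ici 0 ×ˢ Ici 0) (max p.1 0, max p.2 0) :=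
    hD.comp_continuous hcl fun p => ⟨le_max_right p.1 0, le_max_right p.2 0⟩
  have hd : ∀ u r, 0 ≤ u → 0 ≤ r → HasFDerivWithinAt f
      (fderivWithin ℝ f (Ici 0 ×ˢ Ici 0) (max u 0, max r 0)) (Ici 0 ×ˢ Ici 0) (u, r) :=
    fun u r hu hr => by
      rw [max_eq_left hu, max_eq_left hr]
      exact (hf.differentiableOn one_ne_zero (u, r) ⟨hu, hr⟩).hasFDerivWithinAt
  refine ⟨fun u r => fderivWithin ℝ f (Ici 0 ×ˢ Ici 0) (max u 0, max r 0) (1, 0),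
    fun u r => fderivWithin ℝ f (Ici 0 ×ˢ Ici 0) (max u 0, max r 0) (0, 1),
    hD'.clm_apply continuous_const, hD'.clm_apply continuous_const,
    fun u r hu hr => ?_, fun u r hu hr => ?_⟩
  · have hm : MapsTo (fun v : ℝ => (v, r)) (Ici 0) (Ici 0 ×ˢ Ici 0) := fun v hv => ⟨hv, hr⟩
    exact (hd u r hu hr).comp_hasDerivWithinAt u
      ((hasDerivAt_id u).prodMk (hasDerivAt_const u r)).hasDerivWithinAt hm
  · have hm : MapsTo (fun v : ℝ => (u, v)) (Ici 0) (Ici 0 ×ˢ Ici 0) := fun v hv => ⟨hu, hv⟩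
    exact (hd u r hu hr).comp_hasDerivWithinAt r
      ((hasDerivAt_const r u).prodMk (hasDerivAt_id r)).hasDerivWithinAt hm

/-! ### Uniqueness among all global classical solutions -/

section Uniqueness

/-- For an arbitrary solution the mass density is only integrable at each time, without a dominating
function uniform in time. Measurability in u of the central value of g still follows from Fubini
measurability. -/
theorem measurable_cc {W : ℝ → ℝ → ℂ} (hW : Continuous fun p : ℝ × ℝ => W p.1 p.2) :
    Measurable fun u => cc (W u) := by
  have h1 : Continuous fun p : ℝ × ℝ => dm (W p.1) p.2 := hW.sub (continuous_avg_uncurry hW)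
  have h2 : Measurable fun p : ℝ × ℝ => md (W p.1) p.2 :=
    ((h1.norm.pow 2).measurable).div measurable_snd
  have h3 : StronglyMeasurable fun u => ∫ s in Ioi (0 : ℝ), md (W u) s :=
    StronglyMeasurable.integral_prod_right (f := fun u s => md (W u) s)
      h2.stronglyMeasurable
  exact Real.measurable_exp.comp h3.measurable.neg

theorem cc_le_one (f : ℝ → ℂ) : cc f ≤ 1 := by
  have h1 : 0 ≤ ∫ s in Ioi (0 : ℝ), md f s :=
    setIntegral_nonneg measurableSet_Ioi fun s hs => md_nonneg f (le_of_lt hs)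
  rw [cc, Real.exp_le_one_iff]; linarith

/-- The time change with rate `c`, for measurable `0 < c ≤ 1` equal to `1` outside `[0, U]`. -/
theorem exists_time_change {c : ℝ → ℝ} {U : ℝ} (hU : 0 ≤ U) (hc : Measurable c) (h0 : ∀ u, 0 < c u)
    (h1 : ∀ u, c u ≤ 1) (hout : ∀ u, u ∉ Icc 0 U → c u = 1) :
    (∀ a b, IntervalIntegrable c volume a b) ∧ ∃ T μ : ℝ → ℝ, Continuous T ∧ Continuous μ ∧
      (∀ a b, T b - T a = ∫ s in a..b, c s) ∧ T 0 = 0 ∧ (∀ t, T (μ t) = t) ∧ (∀ u, μ (T u) = u) ∧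
      StrictMono T ∧ StrictMono μ := by
  have hci : ∀ a b, IntervalIntegrable c volume a b := fun a b =>
    (intervalIntegrable_const (c := (1 : ℝ))).mono_fun' hc.aestronglyMeasurable
      (Eventually.of_forall fun s => by simpa [abs_of_pos (h0 s)] using h1 s)
  refine ⟨hci, ?_⟩
  set T : ℝ → ℝ := fun u => ∫ s in (0 : ℝ)..u, c s with hT
  have hdiff : ∀ a b, T b - T a = ∫ s in a..b, c s := fun a b =>
    intervalIntegral.integral_interval_sub_left (hci _ _) (hci _ _)
  have hTc : Continuous T := intervalIntegral.continuous_primitive hci 0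
  have hmono : StrictMono T := fun a b hab => by
    have := intervalIntegral.intervalIntegral_pos_of_pos (hci a b) h0 hab
    rw [← hdiff] at this; linarith
  have hT0 : T 0 = 0 := by simp [hT]
  have hright : ∀ u, U ≤ u → u - U ≤ T u := fun u hu => by
    have e : ∫ s in U..u, c s = ∫ s in U..u, (1 : ℝ) := by
      refine intervalIntegral.integral_congr_ae (Eventually.of_forall fun s hs => ?_)
      rw [uIoc_of_le hu] at hs
      exact hout s fun h => absurd h.2 (not_le.2 hs.1)
    have h2 := hdiff U u
    rw [e, intervalIntegral.integral_const, smul_eq_mul, mul_one] at h2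
    have := hmono.monotone hU
    linarith
  have hleft : ∀ u, u ≤ 0 → T u ≤ u := fun u hu => by
    have e : ∫ s in u..0, c s = ∫ s in u..0, (1 : ℝ) := by
      refine intervalIntegral.integral_congr_ae ?_
      have : ∀ᵐ s : ℝ, s ≠ 0 := by simp [ae_iff]
      filter_upwards [this] with s hs0 hs
      rw [uIoc_of_le hu] at hs
      exact hout s fun h => hs0 (le_antisymm hs.2 h.1)
    have h2 := hdiff u 0
    rw [e, intervalIntegral.integral_const, smul_eq_mul, mul_one, hT0] at h2
    linarith
  have hsurj : Function.Surjective T := by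
    refine hTc.surjective ?_ ?_
    · refine tendsto_atTop_mono' _ ?_ (tendsto_atTop_add_const_right _ (-U) tendsto_id)
      filter_upwards [eventually_ge_atTop U] with u hu
      exact hright u hu
    · refine tendsto_atBot_mono' _ ?_ tendsto_id
      filter_upwards [eventually_le_atBot 0] with u hu
      exact hleft u hu
  set e := hmono.orderIsoOfSurjective T hsurj
  exact ⟨T, e.symm, hTc, e.symm.continuous, hdiff, hT0, fun t => e.apply_symm_apply t,
    fun u => e.symm_apply_apply u, hmono, e.symm.strictMono⟩

variable {V V₂ : ℝ → ℝ} {K A : ℝ} {w ω₀ ω₁ : ℝ → ℝ → ℂ} {z₀ z₀' : ℝ → ℂ}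

theorem continuous_line {Φ : ℝ → ℝ → ℂ} (h : ContinuousOn (fun p : ℝ × ℝ => Φ p.1 p.2) {p | 0 < p.2})
    {r : ℝ} (hr : 0 < r) : Continuous fun u => Φ u r :=
  h.comp_continuous (f := fun u : ℝ => (u, r)) (by fun_prop) fun u => hr

/-- Passing to the central time of the solution removes the factor c, leaving an equation with
coefficients that depend on the profile causally; this is the form required by `exists_contraction`.
-/
theorem solves_of_time_change {V₁ : ℝ → ℝ} (hV : Pot V V₁ V₂ K) {W d₁ : ℝ → ℝ → ℂ} {c T μ : ℝ → ℝ}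
    {U R M B T₁ : ℝ} (hfam : Fam B W) (hd₁ : Continuous fun p : ℝ × ℝ => d₁ p.1 p.2)
    (hci : ∀ a b, IntervalIntegrable c volume a b) (hc0 : ∀ u, 0 ≤ c u)
    (hTi : ∀ a b, T b - T a = ∫ s in a..b, c s) (hμ : Continuous μ) (hTμ : ∀ t, T (μ t) = t)
    (hmaps : MapsTo μ (Icc 0 T₁) (Icc 0 U)) {s₀ : ℝ} (hs₀ : 0 ≤ s₀)
    (hDr : ∀ u ∈ Icc 0 U, ∀ r ∈ Ioo 0 (R + 1), HasDerivAt (W u) (d₁ u r) r)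
    (hDu : ∀ u ∈ Ioo 0 U, ∀ r ∈ Ioo 0 (R + 1), HasDerivAt (fun u => W u r)
      (c u * ((Gt V (W u) r / 2 : ℝ) * d₁ u r + ca V (W u) r * W u r + cb V V₁ (W u) r)) u)
    (hbd : ∀ u ∈ Icc 0 U, ∀ r ∈ Icc 0 (R + 1), ‖W u r‖ ≤ M ∧ ‖d₁ u r‖ ≤ M) :
    Solves V V₁ (fun s => W (μ s)) (fun s => W (μ s)) (fun s => d₁ (μ s)) T₁ R M := by
  have hp : Continuous fun p : ℝ × ℝ => (μ p.1, p.2) := by fun_prop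
  have hfamμ : Fam B fun s => W (μ s) := ⟨hfam.cont.comp hp, fun s => hfam.loc _⟩
  have hd₁μ : Continuous fun p : ℝ × ℝ => d₁ (μ p.1) p.2 := hd₁.comp hp
  refine ⟨hfamμ.cont.continuousOn, fun s hs r hr => hDr _ (hmaps hs) r hr, fun s hs r hr => ?_, ?_,
    hd₁μ.continuousOn, fun s hs r hr hsr => hbd _ (hmaps hs) r ⟨hr.le, by linarith [hs.1]⟩⟩
  · have hline : Continuous fun u : ℝ => (u, r) := by fun_prop
    have c1 : Continuous fun u : ℝ => W u r := hfam.cont.comp hline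
    have c2 : Continuous fun u : ℝ => (Gt V (W u) r / 2 : ℝ) * d₁ u r :=
      (Complex.continuous_ofReal.comp (((hfam.Gt hV.cont).comp hline).div_const 2)).mul
        (hd₁.comp hline)
    have c3 : Continuous fun u : ℝ => ca V (W u) r :=
      continuous_line (Φ := fun u r => ca V (W u) r) (hfam.ca hV.cont) hr.1
    have c4 : Continuous fun u : ℝ => cb V V₁ (W u) r :=
      continuous_line (Φ := fun u r => cb V V₁ (W u) r) (hfam.cb hV) hr.1
    exact hasDerivWithinAt_comp_inverse (F := fun u => W u r)
      (e := fun u => (Gt V (W u) r / 2 : ℝ) * d₁ u r + ca V (W u) r * W u r + cb V V₁ (W u) r)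
      hci hc0 hTi hμ hTμ hmaps ((c2.add (c3.mul c1)).add c4) c1 (fun u hu => hDu u hu r hr) hs
  · have h1 : Icc 0 T₁ ×ˢ Ioo 0 (R + 1) ⊆ {p : ℝ × ℝ | 0 < p.2} := fun p hp => hp.2.1
    have c2 : Continuous fun p : ℝ × ℝ => ((Gt V (W (μ p.1)) p.2 / 2 : ℝ) : ℂ) * d₁ (μ p.1) p.2 :=
      (Complex.continuous_ofReal.comp ((hfamμ.Gt hV.cont).div_const 2)).mul hd₁μ
    exact (c2.continuousOn.add (((hfamμ.ca hV.cont).mono h1).mul hfamμ.cont.continuousOn)).add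
      ((hfamμ.cb hV).mono h1)

/-- A solution in the gauge at infinity agrees with the fixed point after a change of time. -/
theorem Ball.eq_of_time_change (hw : Ball A w) (hV : Small V (deriv₀ V) V₂ K A) (h₀ : Init A z₀ z₀')
    (hfix : hw.next hV h₀ = w) {W d₀ d₁ : ℝ → ℝ → ℂ}
    (hW : Continuous fun p : ℝ × ℝ => W p.1 p.2) (hd₁ : Continuous fun p : ℝ × ℝ => d₁ p.1 p.2)
    (hclamp : ∀ u r, W u r = W (max u 0) (max r 0))
    (hDu : ∀ u r, 0 ≤ u → 0 ≤ r → HasDerivWithinAt (fun u => W u r) (d₀ u r) (Ici 0) u)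
    (hDr : ∀ u r, 0 ≤ u → 0 ≤ r → HasDerivWithinAt (W u) (d₁ u r) (Ici 0) r)
    (heq : ∀ u r, 0 ≤ u → 0 < r → d₀ u r = cc (W u) * ((Gt V (W u) r / 2 : ℝ) * d₁ u r
      + ca V (W u) r * W u r + cb V (deriv₀ V) (W u) r))
    (hinit : ∀ r, 0 ≤ r → W 0 r = z₀ r) {U : ℝ} (hU : 0 ≤ U) :
    ∃ T : ℝ → ℝ, Continuous T ∧ T 0 = 0 ∧ (∀ u ∈ Icc 0 U, T u = ∫ v in (0 : ℝ)..u, cc (W v)) ∧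
      ∀ u ∈ Icc 0 U, W u = w (T u) := by
  -- Setting the rate to 1 outside [0, U] makes its primitive a homeomorphism of the line, so that
  -- the inverse time change is globally defined.
  set c : ℝ → ℝ := fun u => if u ∈ Icc 0 U then cc (W u) else 1 with hc
  have hcm : Measurable c := Measurable.ite measurableSet_Icc (measurable_cc hW) measurable_const
  have hc0 : ∀ u, 0 < c u := fun u => by
    simp only [hc]; split_ifs; exacts [cc_pos _, one_pos]
  have hc1 : ∀ u, c u ≤ 1 := fun u => by
    simp only [hc]; split_ifs; exacts [cc_le_one _, le_rfl]
  obtain ⟨hci, T, μ, hTc, hμc, hTi, hT0, hTμ, hμT, hTm, hμm⟩ :=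
    exists_time_change hU hcm hc0 hc1 fun u hu => by simp only [hc, if_neg hu]
  have hμ0 : μ 0 = 0 := by have := hμT 0; rwa [hT0] at this
  have hTU : 0 ≤ T U := hT0 ▸ hTm.monotone hU
  have hmaps : MapsTo μ (Icc 0 (T U)) (Icc 0 U) := fun t ht =>
    ⟨hμ0 ▸ hμm.monotone ht.1, hμT U ▸ hμm.monotone ht.2⟩
  have key : ∀ s ∈ Icc 0 (T U), ∀ r, 0 ≤ r → w s r = W (μ s) r := by
    intro s hs r hr
    set R := s + r
    have hR : 0 ≤ R := add_nonneg hs.1 hr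
    -- localize
    obtain ⟨M₀, hM₀⟩ := (isCompact_Icc.prod isCompact_Icc).exists_bound_of_continuousOn
      (hW.continuousOn (s := Icc 0 U ×ˢ Icc 0 (R + 1)))
    obtain ⟨M₁, hM₁⟩ := (isCompact_Icc.prod isCompact_Icc).exists_bound_of_continuousOn
      (hd₁.continuousOn (s := Icc 0 U ×ˢ Icc 0 (R + 1)))
    set M := max M₀ M₁
    have hM0 : ∀ u ∈ Icc 0 U, ∀ r ∈ Icc 0 (R + 1), ‖W u r‖ ≤ M := fun u hu r hr =>
      (hM₀ (u, r) ⟨hu, hr⟩).trans (le_max_left _ _)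
    have hM1 : ∀ u ∈ Icc 0 U, ∀ r ∈ Icc 0 (R + 1), ‖d₁ u r‖ ≤ M := fun u hu r hr =>
      (hM₁ (u, r) ⟨hu, hr⟩).trans (le_max_right _ _)
    have hMnn : 0 ≤ M := (norm_nonneg _).trans (hM0 0 ⟨le_rfl, hU⟩ 0 ⟨le_rfl, by linarith⟩)
    set cl : ℝ → ℝ := fun r => max (min r (R + 1)) 0 with hcl
    have hclm : ∀ r, cl r ∈ Icc 0 (R + 1) := fun r =>
      ⟨le_max_right _ _, max_le (min_le_right _ _) (by linarith)⟩
    have hcle : ∀ r ∈ Icc 0 (R + 1), cl r = r := fun r hr => by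
      simp only [hcl, min_eq_left hr.2, max_eq_left hr.1]
    set cu : ℝ → ℝ := fun u => max (min u U) 0 with hcu
    have hcum : ∀ u, cu u ∈ Icc 0 U := fun u => ⟨le_max_right _ _, max_le (min_le_right _ _) hU⟩
    have hcue : ∀ u ∈ Icc 0 U, cu u = u := fun u hu => by
      simp only [hcu, min_eq_left hu.2, max_eq_left hu.1]
    -- Freezing both variables outside [0, U] × [0, R + 1] yields globally bounded Lipschitz
    -- profiles. Nothing changes on the cone s + r ≤ R.
    set Wc : ℝ → ℝ → ℂ := fun u r => W (cu u) (cl r) with hWc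
    have hWcc : Continuous fun p : ℝ × ℝ => Wc p.1 p.2 :=
      hW.comp (f := fun p : ℝ × ℝ => (cu p.1, cl p.2)) (by fun_prop)
    set B := max A M
    have hloc : ∀ u, Loc B (Wc u) := fun u => by
      refine Loc.mono ⟨fun r => hM0 _ (hcum u) _ (hclm r), fun r r' => ?_⟩ (le_max_right A M)
      have h1 := (convex_Icc 0 (R + 1)).norm_image_sub_le_of_norm_hasDerivWithin_le
        (f := W (cu u)) (f' := d₁ (cu u)) (C := M)
        (fun r hr => (hDr (cu u) r (hcum u).1 hr.1).mono Icc_subset_Ici_self)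
        (fun r hr => hM1 _ (hcum u) r hr) (hclm r') (hclm r)
      refine h1.trans ?_
      gcongr
      rw [Real.norm_eq_abs]
      refine (abs_max_sub_max_le_abs _ _ _).trans ?_
      simpa using (abs_min_sub_min_le_max r (R + 1) r' (R + 1))
    have hfam : Fam B Wc := ⟨hWcc, hloc⟩
    have hWc_eq : ∀ u ∈ Icc 0 U, ∀ r ∈ Icc 0 (R + 1), Wc u r = W u r := fun u hu r hr => by
      simp only [hWc, hcue u hu, hcle r hr]
    have hsolves : Solves V (deriv₀ V) (fun s => Wc (μ s)) (fun s => Wc (μ s)) (fun s => d₁ (μ s))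
        (T U) R M := by
      refine solves_of_time_change hV.toPot hfam hd₁ hci (fun u => (hc0 u).le) hTi hμc hTμ hmaps hs.1
        (fun u hu r hr => ?_) (fun u hu r hr => ?_) fun u hu r hr => ?_
      · have h1 := (hDr u r hu.1 hr.1.le).hasDerivAt (Ici_mem_nhds hr.1)
        refine h1.congr_of_eventuallyEq ?_
        filter_upwards [Ioo_mem_nhds hr.1 hr.2] with ρ hρ
        exact hWc_eq _ hu _ ⟨hρ.1.le, hρ.2.le⟩
      · have hu' : u ∈ Icc 0 U := ⟨hu.1.le, hu.2.le⟩
        have hr' : r ∈ Icc 0 (R + 1) := ⟨hr.1.le, hr.2.le⟩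
        have h1 := (hDu u r hu.1.le hr.1.le).hasDerivAt (Ici_mem_nhds hu.1)
        refine (h1.congr_of_eventuallyEq ?_).congr_deriv ?_
        · filter_upwards [Ioo_mem_nhds hu.1 hu.2] with v hv
          exact hWc_eq _ ⟨hv.1.le, hv.2.le⟩ _ hr'
        -- The coefficients at radius r are causal, so the cut-off beyond R + 1 leaves them
        -- unchanged for r < R + 1.
        · have hag : ∀ ρ ∈ Icc 0 r, W u ρ = Wc u ρ := fun ρ hρ =>
            (hWc_eq u hu' ρ ⟨hρ.1, hρ.2.trans hr'.2⟩).symm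
          rw [heq u r hu.1.le hr.1, Gt_congr hr.1.le hag, ca_congr hr.1.le hag, cb_congr hr.1.le hag,
            hag r ⟨hr.1.le, le_rfl⟩]
          have : c u = cc (W u) := if_pos hu'
          rw [this]
      · exact ⟨(hWc_eq u hu r hr).symm ▸ hM0 u hu r hr, hM1 u hu r hr⟩
    obtain ⟨Λ, hΛ, H⟩ := exists_contraction hV h₀ (le_max_left A M) hR hMnn
    have hstart : ∀ r, 0 ≤ r → r ≤ R → Wc (μ 0) r = z₀ r := fun r hr hrR => by
      rw [hμ0, hWc_eq 0 ⟨le_rfl, hU⟩ r ⟨hr, by linarith⟩, hinit r hr]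
    have hB : 0 ≤ B := hMnn.trans (le_max_right _ _)
    -- The function w is its own next iterate, and the competitor solves the equation with its own
    -- coefficients. The contraction can be repeated, halving the bound each time from the crude
    -- start 2B.
    have hit : ∀ n : ℕ, ∀ s ∈ Icc 0 (T U), ∀ r, 0 ≤ r → s + r ≤ R →
        ‖w s r - Wc (μ s) r‖ ≤ 2 * B * (1 / 2) ^ n * Real.exp (Λ * s) := by
      intro n
      induction n with
      | zero =>
        intro s hs r hr hsr
        refine (norm_sub_le _ _).trans ?_
        have h1 := ((hw.fam.loc s).bdd r).trans (le_max_left A M)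
        have h2 := (hloc (μ s)).bdd r
        have h3 := Real.one_le_exp (mul_nonneg hΛ hs.1)
        rw [pow_zero, mul_one]
        have h4 : ‖w s r‖ + ‖Wc (μ s) r‖ ≤ 2 * B := by
          have : ‖w s r‖ ≤ B := h1
          linarith
        exact h4.trans (le_mul_of_one_le_right (by positivity) h3)
      | succ n ih =>
        intro s hs r hr hsr
        have := H w hw (fun s => Wc (μ s)) (fun s => Wc (μ s)) (fun s => d₁ (μ s)) (T U)
          (2 * B * (1 / 2) ^ n) (fun s _ => hloc _) hsolves hstart (by positivity) ih s hs r hr hsr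
        rw [hfix] at this
        refine this.trans_eq ?_
        rw [pow_succ]; ring
    have hlim : Tendsto (fun n : ℕ => 2 * B * (1 / 2 : ℝ) ^ n * Real.exp (Λ * s)) atTop (𝓝 0) := by
      have := ((tendsto_pow_atTop_nhds_zero_of_lt_one (r := (1 / 2 : ℝ)) (by norm_num)
        (by norm_num)).const_mul (2 * B)).mul_const (Real.exp (Λ * s))
      rwa [mul_zero, zero_mul] at this
    have h5 := ge_of_tendsto' hlim fun n => hit n s hs r hr le_rfl
    rw [norm_le_zero_iff, sub_eq_zero] at h5
    rw [h5, hWc_eq _ (hmaps hs) r ⟨hr, by linarith [hs.1]⟩]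
  refine ⟨T, hTc, hT0, fun u hu => ?_, fun u hu => ?_⟩
  · have h1 := hTi 0 u
    rw [hT0, sub_zero] at h1
    rw [h1]
    refine intervalIntegral.integral_congr fun v hv => ?_
    rw [uIcc_of_le hu.1] at hv
    simp only [hc, if_pos (show v ∈ Icc 0 U from ⟨hv.1, hv.2.trans hu.2⟩)]
  · have h1 : T u ∈ Icc 0 (T U) := ⟨hT0 ▸ hTm.monotone hu.1, hTm.monotone hu.2⟩
    funext r
    rw [hclamp u r, hw.clamp (T u) r, max_eq_left hu.1, max_eq_left h1.1,
      key _ h1 _ (le_max_right r 0), hμT]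

/-- Uniqueness of the global solution. -/
theorem Ball.unique (hw : Ball A w) (hV : Small V (deriv₀ V) V₂ K A) (h₀ : Init A z₀ z₀')
    (hfix : hw.next hV h₀ = w) {σ θ : ℝ → ℝ} (hθσ : Function.LeftInverse θ σ)
    (hσθ : Function.RightInverse θ σ) (hσ0 : σ 0 = 0) (hθ : ∀ τ, HasDerivAt θ (cc (w τ))⁻¹ τ)
    {a₀ b₀ : ℝ → ℝ} (ha₀ : ∀ r, 0 ≤ r → (z₀ r).re = a₀ r) (hb₀ : ∀ r, 0 ≤ r → (z₀ r).im = b₀ r)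
    {h k : ℝ → ℝ → ℝ} (hG : IsGlobalSolution V a₀ b₀ h k) {u r : ℝ} (hu : 0 ≤ u) (hr : 0 ≤ r) :
    h u r = (w (σ u) r).re ∧ k u r = (w (σ u) r).im := by
  set F : ℝ × ℝ → ℂ := fun p => (h p.1 p.2 : ℂ) + (k p.1 p.2 : ℂ) * Complex.I with hF
  have hFre : ∀ p, (F p).re = h p.1 p.2 := fun p => by simp [hF]
  have hFim : ∀ p, (F p).im = k p.1 p.2 := fun p => by simp [hF]
  have hFc : ContDiffOn ℝ 1 F (Ici 0 ×ˢ Ici 0) :=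
    (Complex.ofRealCLM.contDiff.comp_contDiffOn hG.contDiff_h).add
      ((Complex.ofRealCLM.contDiff.comp_contDiffOn hG.contDiff_k).mul contDiffOn_const)
  obtain ⟨d₀, d₁, hd₀, hd₁, hDu, hDr⟩ := exists_partials hFc
  have hhc : ∀ u, 0 ≤ u → ContinuousOn (h u) (Ici 0) := fun u hu =>
    hG.contDiff_h.continuousOn.comp (f := fun r : ℝ => (u, r)) (by fun_prop) fun r hr => ⟨hu, hr⟩
  have hkc : ∀ u, 0 ≤ u → ContinuousOn (k u) (Ici 0) := fun u hu =>
    hG.contDiff_k.continuousOn.comp (f := fun r : ℝ => (u, r)) (by fun_prop) fun r hr => ⟨hu, hr⟩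
  set W : ℝ → ℝ → ℂ := fun u r => F (max u 0, max r 0) with hW
  have hWc : Continuous fun p : ℝ × ℝ => W p.1 p.2 :=
    hFc.continuousOn.comp_continuous (f := fun p : ℝ × ℝ => (max p.1 0, max p.2 0)) (by fun_prop)
      fun p => ⟨le_max_right p.1 0, le_max_right p.2 0⟩
  have hWF : ∀ u r, 0 ≤ u → 0 ≤ r → W u r = F (u, r) := fun u r hu hr => by
    simp only [hW, max_eq_left hu, max_eq_left hr]
  have hWcx : ∀ u, 0 ≤ u → W u = cx (h u) (k u) := fun u hu => by
    funext r
    apply Complex.ext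
    · simp only [hW, hFre, cx, max_eq_left hu]
    · simp only [hW, hFim, cx, max_eq_left hu]
  have hDu' : ∀ u r, 0 ≤ u → 0 ≤ r → HasDerivWithinAt (fun u => W u r) (d₀ u r) (Ici 0) u :=
    fun u r hu hr => (hDu u r hu hr).congr (fun v hv => hWF v r hv hr) (hWF u r hu hr)
  have hDr' : ∀ u r, 0 ≤ u → 0 ≤ r → HasDerivWithinAt (W u) (d₁ u r) (Ici 0) r :=
    fun u r hu hr => (hDr u r hu hr).congr (fun v hv => hWF u v hu hv) (hWF u r hu hr)
  have heq : ∀ u r, 0 ≤ u → 0 < r → d₀ u r = cc (W u) * ((Gt V (W u) r / 2 : ℝ) * d₁ u r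
      + ca V (W u) r * W u r + cb V (deriv₀ V) (W u) r) := fun u r hu hr => by
    have e1 : deriv₀ (fun v => h v r) u = (d₀ u r).re :=
      ((Complex.reCLM.hasFDerivAt.comp_hasDerivWithinAt u (hDu u r hu hr.le)).congr
        (fun v _ => (hFre (v, r)).symm) (hFre (u, r)).symm).derivWithin (uniqueDiffOn_Ici 0 u hu)
    have e2 : deriv₀ (fun v => k v r) u = (d₀ u r).im :=
      ((Complex.imCLM.hasFDerivAt.comp_hasDerivWithinAt u (hDu u r hu hr.le)).congr
        (fun v _ => (hFim (v, r)).symm) (hFim (u, r)).symm).derivWithin (uniqueDiffOn_Ici 0 u hu)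
    have e3 : deriv₀ (h u) r = (d₁ u r).re :=
      ((Complex.reCLM.hasFDerivAt.comp_hasDerivWithinAt r (hDr u r hu hr.le)).congr
        (fun v _ => (hFre (u, v)).symm) (hFre (u, r)).symm).derivWithin (uniqueDiffOn_Ici 0 r hr.le)
    have e4 : deriv₀ (k u) r = (d₁ u r).im :=
      ((Complex.imCLM.hasFDerivAt.comp_hasDerivWithinAt r (hDr u r hu hr.le)).congr
        (fun v _ => (hFim (u, v)).symm) (hFim (u, r)).symm).derivWithin (uniqueDiffOn_Ici 0 r hr.le)
    have := (eqs_iff (hhc u hu) (hkc u hu) (hG.integrable u hu) V hr _ _ _ _).1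
      ⟨hG.eq_h u r hu hr, hG.eq_k u r hu hr⟩
    rw [e1, e2, e3, e4, Complex.re_add_im, Complex.re_add_im, ← hWcx u hu] at this
    exact this
  have hinit : ∀ r, 0 ≤ r → W 0 r = z₀ r := fun r hr => by
    apply Complex.ext
    · rw [hWF 0 r le_rfl hr, hFre, ha₀ r hr]; exact hG.init_h r hr
    · rw [hWF 0 r le_rfl hr, hFim, hb₀ r hr]; exact hG.init_k r hr
  obtain ⟨T, hTc, hT0, hTi, hWw⟩ := hw.eq_of_time_change hV h₀ hfix hWc hd₁
    (fun u r => by simp only [hW, max_eq_left (le_max_right u 0), max_eq_left (le_max_right r 0)])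
    hDu' hDr' heq hinit hu
  -- the time change satisfies the equation of `σ`
  have hcT : Continuous fun v => cc (w (T v)) := hw.continuous_cc.comp hTc
  set S : ℝ → ℝ := fun u => ∫ v in (0 : ℝ)..u, cc (w (T v)) with hS
  have hST : ∀ v ∈ Icc 0 u, S v = T v := fun v hv => by
    rw [hTi v hv]
    refine intervalIntegral.integral_congr fun x hx => ?_
    rw [uIcc_of_le hv.1] at hx
    simp only [hWw x ⟨hx.1, hx.2.trans hv.2⟩]
  have hSd : ∀ v, HasDerivAt S (cc (w (T v))) v := fun v => hasDerivAt_primitive hcT v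
  -- Since θ' is the reciprocal of the rate of S, the function θ(S(v)) - v is constant, so S is the
  -- inverse of θ, which is σ.
  have hconst := constant_of_has_deriv_right_zero (f := fun v => θ (S v) - v) (a := 0) (b := u)
    (fun v _ => (((hθ _).comp v (hSd v)).sub (hasDerivAt_id v)).continuousAt.continuousWithinAt)
    (fun v hv => by
      refine (((hθ _).comp v (hSd v)).sub (hasDerivAt_id v)).hasDerivWithinAt.congr_deriv ?_
      rw [hST v ⟨hv.1, hv.2.le⟩, inv_mul_cancel₀ (cc_pos _).ne', sub_self]) u ⟨hu, le_rfl⟩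
  have hS0 : S 0 = 0 := by simp [hS]
  have hθ0 : θ 0 = 0 := by have := hθσ 0; rwa [hσ0] at this
  simp only [hS0, hθ0, sub_zero] at hconst
  have hTσ : T u = σ u := by
    rw [← hST u ⟨hu, le_rfl⟩, ← hσθ (S u)]
    congr 1
    linarith
  have hfin : F (u, r) = w (σ u) r := by rw [← hWF u r hu hr, hWw u ⟨hu, le_rfl⟩, hTσ]
  exact ⟨by rw [← hfin, hFre], by rw [← hfin, hFim]⟩

end Uniqueness

end

/-! ### Time regularity and decay of the metric coefficients -/

section

/-! Time derivatives of the functionals; `φ` is the time derivative of `f`. -/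

def tmd (f φ : ℝ → ℂ) (s : ℝ) : ℝ := 2 * (conj (dm f s) * dm φ s).re / s

def tGG (f φ : ℝ → ℂ) (r : ℝ) : ℝ := GG f r * ∫ s in (0 : ℝ)..r, tmd f φ s

def tJJ (f φ : ℝ → ℂ) (s : ℝ) : ℝ := (conj (avg φ s) * f s + conj (avg f s) * φ s).im

def tQQ (f φ : ℝ → ℂ) (r : ℝ) : ℝ := ∫ s in (0 : ℝ)..r, s * tJJ f φ s

def ths (f φ : ℝ → ℂ) (r : ℝ) : ℝ := 2 * (conj (avg f r) * avg φ r).re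

def tdens (V V₁ : ℝ → ℝ) (f φ : ℝ → ℂ) (s : ℝ) : ℝ :=
  tGG f φ s * (1 - 1 / 2 * (QQ f s * qq f s) - s ^ 2 * V (hs f s))
    - GG f s * (qq f s * tQQ f φ s + s ^ 2 * (V₁ (hs f s) * ths f φ s))

def tGt (V V₁ : ℝ → ℝ) (f φ : ℝ → ℂ) (r : ℝ) : ℝ := avg (tdens V V₁ f φ) r

/-- A family of profiles with a bounded continuous time derivative. -/
structure TFam (B : ℝ) (w ω : ℝ → ℝ → ℂ) : Prop where
  fam : Fam B w
  cont : Continuous fun p : ℝ × ℝ => ω p.1 p.2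
  deriv : ∀ τ r : ℝ, HasDerivAt (fun τ => w τ r) (ω τ r) τ
  bd : ∀ τ r : ℝ, ‖ω τ r‖ ≤ 1

theorem norm_dm_le_two {φ : ℝ → ℂ} (h : ∀ s, ‖φ s‖ ≤ 1) (s : ℝ) : ‖dm φ s‖ ≤ 2 :=
  (norm_sub_le _ _).trans (by linarith [h s, norm_avg_le' h s])

theorem abs_two_mul_re_le (x y : ℂ) : |2 * (conj x * y).re| ≤ 2 * (‖x‖ * ‖y‖) := by
  rw [abs_mul, abs_two]
  have := Complex.abs_re_le_norm (conj x * y)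
  rw [norm_mul, Complex.norm_conj] at this
  linarith

theorem hasDerivAt_norm_sq {f : ℝ → ℂ} {f' : ℂ} {τ : ℝ} (h : HasDerivAt f f' τ) :
    HasDerivAt (fun τ => ‖f τ‖ ^ 2) (2 * (conj (f τ) * f').re) τ := by
  refine h.norm_sq.congr_deriv ?_
  rw [Complex.inner, mul_comm (conj (f τ))]

theorem GG_pos (f : ℝ → ℂ) (r : ℝ) : 0 < GG f r := Real.exp_pos _

namespace TFam

variable {B : ℝ} {w ω : ℝ → ℝ → ℂ} (h : TFam B w ω) {V V₁ V₂ : ℝ → ℝ} {K : ℝ} (hV : Pot V V₁ V₂ K)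
include h

theorem cont_avg : Continuous fun p : ℝ × ℝ => avg (ω p.1) p.2 := continuous_avg_uncurry h.cont

theorem cont_dm : Continuous fun p : ℝ × ℝ => dm (ω p.1) p.2 := h.cont.sub h.cont_avg

/-- The Lipschitz bound on the profile absorbs the division by s and leaves a multiple of `dm` of
the time derivative, which vanishes on the axis. -/
theorem cont_tmd : Continuous fun p : ℝ × ℝ => tmd (w p.1) (ω p.1) p.2 := by
  have hb : ∀ p : ℝ × ℝ, |tmd (w p.1) (ω p.1) p.2| ≤ 2 * B * ‖dm (ω p.1) p.2‖ := fun p => by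
    have h0 := (h.fam.loc p.1).nonneg
    rcases eq_or_ne p.2 0 with hp | hp
    · rw [tmd, hp, div_zero, abs_zero]; positivity
    · rw [tmd, abs_div, div_le_iff₀ (abs_pos.2 hp)]
      refine (abs_two_mul_re_le _ _).trans ?_
      have := mul_le_mul_of_nonneg_right ((h.fam.loc p.1).norm_dm_le p.2) (norm_nonneg (dm (ω p.1) p.2))
      linarith
  refine continuous_iff_continuousAt.2 fun p => ?_
  rcases eq_or_ne p.2 0 with hp | hp
  · have h1 : tmd (w p.1) (ω p.1) p.2 = 0 := by rw [tmd, hp, div_zero]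
    rw [ContinuousAt, h1]
    refine squeeze_zero_norm hb ?_
    have h2 : Continuous fun p : ℝ × ℝ => 2 * B * ‖dm (ω p.1) p.2‖ := continuous_const.mul h.cont_dm.norm
    have := h2.tendsto p
    rwa [hp, dm, avg_zero, sub_self, norm_zero, mul_zero] at this
  · have h1 : Continuous fun p : ℝ × ℝ => 2 * (conj (dm (w p.1) p.2) * dm (ω p.1) p.2).re :=
      continuous_const.mul (Complex.continuous_re.comp
        ((Complex.continuous_conj.comp h.fam.dm).mul h.cont_dm))
    exact h1.continuousAt.div continuous_snd.continuousAt hp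

theorem cont_tGG : Continuous fun p : ℝ × ℝ => tGG (w p.1) (ω p.1) p.2 := by
  refine h.fam.GG.mul ?_
  refine intervalIntegral.continuous_parametric_intervalIntegral_of_continuous
    (f := fun (p : ℝ × ℝ) s => tmd (w p.1) (ω p.1) s) ?_ continuous_snd
  exact h.cont_tmd.comp (f := fun q : (ℝ × ℝ) × ℝ => (q.1.1, q.2)) (by fun_prop)

theorem cont_tJJ : Continuous fun p : ℝ × ℝ => tJJ (w p.1) (ω p.1) p.2 :=
  Complex.continuous_im.comp (((Complex.continuous_conj.comp h.cont_avg).mul h.fam.cont).add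
    ((Complex.continuous_conj.comp h.fam.avg).mul h.cont))

theorem cont_tQQ : Continuous fun p : ℝ × ℝ => tQQ (w p.1) (ω p.1) p.2 := by
  refine intervalIntegral.continuous_parametric_intervalIntegral_of_continuous
    (f := fun (p : ℝ × ℝ) s => s * tJJ (w p.1) (ω p.1) s) ?_ continuous_snd
  exact continuous_snd.mul (h.cont_tJJ.comp (f := fun q : (ℝ × ℝ) × ℝ => (q.1.1, q.2)) (by fun_prop))

theorem cont_ths : Continuous fun p : ℝ × ℝ => ths (w p.1) (ω p.1) p.2 :=
  continuous_const.mul (Complex.continuous_re.comp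
    ((Complex.continuous_conj.comp h.fam.avg).mul h.cont_avg))

include hV in
theorem cont_tdens : Continuous fun p : ℝ × ℝ => tdens V V₁ (w p.1) (ω p.1) p.2 :=
  (h.cont_tGG.mul ((continuous_const.sub (continuous_const.mul (h.fam.QQ.mul h.fam.qq))).sub
    ((continuous_snd.pow 2).mul (h.fam.comp_hs hV.cont)))).sub
    (h.fam.GG.mul ((h.fam.qq.mul h.cont_tQQ).add
      ((continuous_snd.pow 2).mul ((h.fam.comp_hs hV.cont₁).mul h.cont_ths))))

include hV in
theorem cont_tGt : Continuous fun p : ℝ × ℝ => tGt V V₁ (w p.1) (ω p.1) p.2 :=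
  continuous_avg_uncurry (w := fun τ => tdens V V₁ (w τ) (ω τ)) (h.cont_tdens hV)

theorem hasDerivAt_avg {E : Type*} [NormedAddCommGroup E] [NormedSpace ℝ E] {F F' : ℝ → ℝ → E}
    (hF : Continuous fun p : ℝ × ℝ => F p.1 p.2) (hF' : Continuous fun p : ℝ × ℝ => F' p.1 p.2)
    {r : ℝ} (hr : 0 ≤ r) (hd : ∀ τ s : ℝ, 0 ≤ s → HasDerivAt (fun τ => F τ s) (F' τ s) τ) (τ : ℝ) :
    HasDerivAt (fun τ => avg (F τ) r) (avg (F' τ) r) τ :=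
  hasDerivAt_integral_param (Φ := fun θ τ => F τ (θ * r)) (Φ' := fun θ τ => F' τ (θ * r))
    (hF.comp (f := fun p : ℝ × ℝ => (p.2, p.1 * r)) (by fun_prop))
    (hF'.comp (f := fun p : ℝ × ℝ => (p.2, p.1 * r)) (by fun_prop)) zero_le_one univ_mem
    fun θ hθ y _ => hd y _ (mul_nonneg hθ.1 hr)

theorem deriv_avg (τ : ℝ) {r : ℝ} (hr : 0 ≤ r) :
    HasDerivAt (fun τ => avg (w τ) r) (avg (ω τ) r) τ :=
  hasDerivAt_avg h h.fam.cont h.cont hr (fun τ s _ => h.deriv τ s) τ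

theorem deriv_md (τ : ℝ) {s : ℝ} (hs : 0 ≤ s) :
    HasDerivAt (fun τ => md (w τ) s) (tmd (w τ) (ω τ) s) τ :=
  (hasDerivAt_norm_sq ((h.deriv τ s).sub (h.deriv_avg τ hs))).div_const s

theorem deriv_GG (τ : ℝ) {r : ℝ} (hr : 0 ≤ r) :
    HasDerivAt (fun τ => GG (w τ) r) (tGG (w τ) (ω τ) r) τ :=
  (hasDerivAt_integral_param (Φ := fun s τ => md (w τ) s) (Φ' := fun s τ => tmd (w τ) (ω τ) s)
    (h.fam.md.comp continuous_swap) (h.cont_tmd.comp continuous_swap) hr univ_mem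
    fun s hs y _ => h.deriv_md y hs.1).exp

theorem deriv_QQ (τ : ℝ) {r : ℝ} (hr : 0 ≤ r) :
    HasDerivAt (fun τ => QQ (w τ) r) (tQQ (w τ) (ω τ) r) τ := by
  refine hasDerivAt_integral_param (Φ := fun s τ => s * JJ (w τ) s)
    (Φ' := fun s τ => s * tJJ (w τ) (ω τ) s)
    (continuous_fst.mul (h.fam.JJ.comp continuous_swap))
    (continuous_fst.mul (h.cont_tJJ.comp continuous_swap)) hr univ_mem fun s hs y _ => ?_
  have h1 : HasDerivAt (fun τ => conj (avg (w τ) s)) (conj (avg (ω y) s)) y :=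
    (h.deriv_avg y hs.1).star
  exact (Complex.imCLM.hasFDerivAt.comp_hasDerivAt y (h1.mul (h.deriv y s))).const_mul s

theorem deriv_hs (τ : ℝ) {r : ℝ} (hr : 0 ≤ r) :
    HasDerivAt (fun τ => hs (w τ) r) (ths (w τ) (ω τ) r) τ :=
  hasDerivAt_norm_sq (h.deriv_avg τ hr)

include hV in
theorem deriv_dens (τ : ℝ) {r : ℝ} (hr : 0 ≤ r) :
    HasDerivAt (fun τ => dens V (w τ) r) (tdens V V₁ (w τ) (ω τ) r) τ := by
  have h0 : ∀ τ, 0 ≤ hs (w τ) r := fun τ => by unfold hs; positivity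
  have h1 : HasDerivAt (fun τ => V (hs (w τ) r)) (V₁ (hs (w τ) r) * ths (w τ) (ω τ) r) τ :=
    hasDerivWithinAt_univ.1 <| (hV.deriv _ (h0 τ)).comp τ
      (h.deriv_hs τ hr).hasDerivWithinAt fun τ _ => h0 τ
  have h2 := h.deriv_QQ τ hr
  have h3 : HasDerivAt (fun τ => qq (w τ) r) (tQQ (w τ) (ω τ) r / r ^ 2) τ := h2.div_const _
  refine ((h.deriv_GG τ hr).mul ((((h2.mul h3).const_mul (1 / 2)).const_sub 1).sub
    (h1.const_mul (r ^ 2)))).congr_deriv ?_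
  simp only [tdens, qq, Pi.sub_apply, Pi.mul_apply]
  ring

include hV in
theorem deriv_Gt (τ : ℝ) {r : ℝ} (hr : 0 ≤ r) :
    HasDerivAt (fun τ => Gt V (w τ) r) (tGt V V₁ (w τ) (ω τ) r) τ :=
  hasDerivAt_avg h (F := fun τ => dens V (w τ)) (F' := fun τ => tdens V V₁ (w τ) (ω τ))
    (h.fam.dens hV.cont) (h.cont_tdens hV) hr (fun τ s hs => h.deriv_dens hV τ hs) τ

end TFam

namespace Prof

variable {A c : ℝ} {f φ : ℝ → ℂ} (h : Prof A c f) (hφ : ∀ s, ‖φ s‖ ≤ 1) {V V₁ V₂ : ℝ → ℝ} {K : ℝ}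
  (hV : Small V V₁ V₂ K A)
include h hφ

/-- The time derivative φ enters only through the bound 1; the decay comes from the deviation of f
from its mean. Integration then gives r/(c²(c+r)), which is how the time decay c⁻² of the metric
coefficients arises. -/
theorem abs_tmd_le {s : ℝ} (hs : 0 < s) : |tmd f φ s| ≤ 4 * A / c / (c + s) ^ 2 := by
  have hc := h.pos; have hx := h.x_pos hs.le; have hA := h.nonneg
  rw [tmd, abs_div, abs_of_pos hs, div_le_iff₀ hs]
  refine (abs_two_mul_re_le _ _).trans ?_
  have h1 := mul_le_mul (h.norm_dm_le_div hs.le) (norm_dm_le_two hφ s) (norm_nonneg _)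
    (div_nonneg (mul_nonneg hs.le (h.p_nonneg hs.le)) hx.le)
  refine (mul_le_mul_of_nonneg_left h1 zero_le_two).trans_eq ?_
  field_simp
  ring

theorem abs_tGG_le {r : ℝ} (hr : 0 ≤ r) : |tGG f φ r| ≤ 8 * A * (r / (c ^ 2 * (c + r))) := by
  have hc := h.pos; have hx := h.x_pos hr; have hA := h.nonneg
  have h1 := norm_integral_le_of_deriv (g := tmd f φ) hr
    (fun s hs => hasDerivAt_prim₁ (a := 4 * A / c) (h.x_pos hs.1)) (by
      refine ContinuousOn.div continuousOn_const (by fun_prop) fun s hs => ?_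
      have := h.x_pos hs.1; positivity) fun s hs => h.abs_tmd_le hφ hs.1
  rw [tGG, abs_mul, abs_of_pos (GG_pos f r)]
  have h2 := mul_le_mul (h.GG_le_two hr) h1 (norm_nonneg _) zero_le_two
  refine h2.trans_eq ?_
  field_simp
  ring

theorem abs_tJJ_le {s : ℝ} (hs : 0 ≤ s) : |tJJ f φ s| ≤ 2 * (A / (c * (c + s))) := by
  have hc := h.pos; have hx := h.x_pos hs; have hA := h.nonneg
  refine (Complex.abs_im_le_norm _).trans ((norm_add_le _ _).trans ?_)
  rw [norm_mul, norm_mul, Complex.norm_conj, Complex.norm_conj]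
  have h1 : ‖f s‖ ≤ A / (c * (c + s)) := (h.bd s hs).trans (by
    rw [sq]
    gcongr
    linarith)
  have h2 := mul_le_mul (norm_avg_le' hφ s) h1 (norm_nonneg _) zero_le_one
  have h3 := mul_le_mul (h.norm_avg_le hs) (hφ s) (norm_nonneg _) (h.p_nonneg hs)
  linarith

theorem abs_tQQ_le {r : ℝ} (hr : 0 ≤ r) : |tQQ f φ r| ≤ 2 * A / c * r := by
  have hc := h.pos; have hA := h.nonneg
  have := intervalIntegral.norm_integral_le_of_norm_le_const (a := 0) (b := r) (C := 2 * A / c)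
    (f := fun s => s * tJJ f φ s) fun s hs => by
      rw [uIoc_of_le hr] at hs
      have hx := h.x_pos hs.1.le
      rw [norm_mul, Real.norm_eq_abs, Real.norm_eq_abs, abs_of_pos hs.1]
      refine (mul_le_mul_of_nonneg_left (h.abs_tJJ_le hφ hs.1.le) hs.1.le).trans ?_
      rw [show s * (2 * (A / (c * (c + s)))) = 2 * A / c * (s / (c + s)) by field_simp]
      refine mul_le_of_le_one_right (by positivity) ?_
      rw [div_le_one hx]; linarith
  rwa [sub_zero, abs_of_nonneg hr] at this

theorem abs_ths_le {r : ℝ} (hr : 0 ≤ r) : |ths f φ r| ≤ 2 * (A / (c * (c + r))) := by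
  refine (abs_two_mul_re_le _ _).trans ?_
  have := mul_le_mul (h.norm_avg_le hr) (norm_avg_le' hφ r) (norm_nonneg _) (h.p_nonneg hr)
  linarith

include hV

theorem abs_tdens_le {r : ℝ} (hr : 0 ≤ r) :
    |tdens V V₁ f φ r| ≤ 20 * (1 + K) * (r / (c ^ 2 * (c + r))) := by
  have hc := h.pos; have hx := h.x_pos hr; have hA := h.nonneg; have hA1 := h.le_one
  have hc1 := h.one_le
  have hK := hV.nonneg
  have hp := h.p_nonneg hr
  have hp1 := h.p_le_one hr
  have hq := h.abs_qq_le hr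
  have hQ := h.abs_QQ_le hr
  have hrp := h.r2p2_le_one hr
  have hv := h.abs_V_le hV.toPot hr
  have hv1 := h.abs_V₁_le hV.toPot hr
  have hg := h.abs_tGG_le hφ hr
  have hG2 := h.GG_le_two hr
  have hG0 : 0 < GG f r := Real.exp_pos _
  have htQ := h.abs_tQQ_le hφ hr
  have hth := h.abs_ths_le hφ hr
  set p := A / (c * (c + r)) with hpd
  set T := r / (c ^ 2 * (c + r)) with hT
  have hT0 : 0 ≤ T := by positivity
  have hp2 : p ^ 2 ≤ 1 := pow_le_one₀ hp hp1
  have b1 : |1 - 1 / 2 * (QQ f r * qq f r) - r ^ 2 * V (hs f r)| ≤ 2 + K := by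
    have i1 : |QQ f r * qq f r| ≤ 1 / 4 := by
      rw [abs_mul]
      have := mul_le_mul hQ hq (abs_nonneg _) (by positivity)
      have : r ^ 2 * p ^ 2 / 2 * (p ^ 2 / 2) ≤ 1 / 4 := by
        have := mul_le_mul hrp hp2 (by positivity) zero_le_one
        nlinarith
      linarith
    have i2 : |r ^ 2 * V (hs f r)| ≤ K := by
      rw [abs_mul, abs_of_nonneg (sq_nonneg r)]
      calc r ^ 2 * |V (hs f r)| ≤ r ^ 2 * (K * p ^ 2) := by gcongr
        _ = K * (r ^ 2 * p ^ 2) := by ring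
        _ ≤ K * 1 := by gcongr
        _ = K := mul_one K
    rw [abs_le] at i1 i2 ⊢
    constructor <;> linarith [i1.1, i1.2, i2.1, i2.2]
  have hpT : p ^ 2 * (2 * A / c * r) ≤ 2 * T := by
    have e : p ^ 2 * (2 * A / c * r) = 2 * T * (A ^ 3 * (1 / (c * (c + r)))) := by
      rw [hpd, hT]; field_simp
    rw [e]
    refine mul_le_of_le_one_right (by positivity) ?_
    have i1 : 1 / (c * (c + r)) ≤ 1 := by rw [div_le_one (by positivity)]; nlinarith
    have i2 : A ^ 3 ≤ 1 := pow_le_one₀ hA hA1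
    exact mul_le_one₀ i2 (by positivity) i1
  have hrT : r ^ 2 * (p ^ 2 * p) ≤ T := by
    have e : r ^ 2 * (p ^ 2 * p) = T * (A ^ 3 * (r / (c * (c + r) ^ 2))) := by
      rw [hpd, hT]; field_simp
    rw [e]
    refine mul_le_of_le_one_right hT0 ?_
    have i1 : r / (c * (c + r) ^ 2) ≤ 1 := by rw [div_le_one (by positivity)]; nlinarith [mul_nonneg hr hr]
    have i2 : A ^ 3 ≤ 1 := pow_le_one₀ hA hA1
    exact mul_le_one₀ i2 (by positivity) i1
  have b2 : |qq f r * tQQ f φ r + r ^ 2 * (V₁ (hs f r) * ths f φ r)| ≤ T + 2 * K * T := by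
    refine (abs_add_le _ _).trans (add_le_add ?_ ?_)
    · rw [abs_mul]
      have := mul_le_mul hq htQ (abs_nonneg _) (by positivity)
      linarith
    · rw [abs_mul, abs_mul, abs_of_nonneg (sq_nonneg r)]
      calc r ^ 2 * (|V₁ (hs f r)| * |ths f φ r|) ≤ r ^ 2 * (K * p ^ 2 * (2 * p)) := by gcongr
        _ = 2 * K * (r ^ 2 * (p ^ 2 * p)) := by ring
        _ ≤ 2 * K * T := by gcongr
  rw [tdens]
  refine (abs_sub _ _).trans ?_
  rw [abs_mul, abs_mul, abs_of_pos hG0]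
  have j1 := mul_le_mul hg b1 (abs_nonneg _) (by positivity)
  have j2 := mul_le_mul hG2 b2 (abs_nonneg _) zero_le_two
  have j3 : 8 * A * T * (2 + K) ≤ 8 * T * (2 + K) := by
    have := mul_le_mul_of_nonneg_right hA1 (show 0 ≤ 8 * T * (2 + K) by positivity)
    linarith
  nlinarith [mul_nonneg hK hT0]

/-- The bound on the density increases with the radius, so its value at r bounds the mean. -/
theorem abs_tGt_le {r : ℝ} (hr : 0 ≤ r) :
    |tGt V V₁ f φ r| ≤ 20 * (1 + K) * (r / (c ^ 2 * (c + r))) := by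
  have hc := h.pos; have hK := hV.nonneg
  refine EYMH.norm_avg_le (f := tdens V V₁ f φ) hr fun s hs => ?_
  rw [Real.norm_eq_abs]
  refine (h.abs_tdens_le hφ hV hs.1).trans ?_
  have hx := h.x_pos hr; have hx' := h.x_pos hs.1
  refine mul_le_mul_of_nonneg_left ?_ (by positivity)
  rw [div_le_div_iff₀ (by positivity) (by positivity)]
  have : s * (c + r) ≤ r * (c + s) := by nlinarith [hs.2]
  nlinarith [mul_le_mul_of_nonneg_left this (sq_nonneg c)]

end Prof

/-- A radial coefficient of the metric, as a function of the time `τ` at the centre and of `r`, with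
its partial derivatives. -/
structure Coeff (M : ℝ) (a a₀ a₁ : ℝ → ℝ → ℝ) : Prop where
  nonneg : 0 ≤ M
  deriv₀ : ∀ τ r, 0 < r → HasDerivAt (fun τ => a τ r) (a₀ τ r) τ
  deriv₁ : ∀ τ r, 0 < r → HasDerivAt (a τ) (a₁ τ r) r
  cont₀ : ContinuousOn (fun p : ℝ × ℝ => a₀ p.1 p.2) {p | 0 < p.2}
  cont₁ : ContinuousOn (fun p : ℝ × ℝ => a₁ p.1 p.2) {p | 0 < p.2}
  bd : ∀ τ r, 0 ≤ r → |a τ r| ≤ M * (r * min r 1)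
  bd₀ : ∀ τ r, 0 ≤ r → |a₀ τ r| ≤ M * min r 1 / (1 + max τ 0) ^ 2
  bd₁ : ∀ τ r, 0 ≤ r → |a₁ τ r| ≤ M * min r 1
  small : ∀ τ r, 0 ≤ r → |a τ r| ≤ 1 / 100

section Bounds

variable {A c : ℝ} {f : ℝ → ℂ} (h : Prof A c f)
include h

theorem Prof.div_le_min {r : ℝ} (hr : 0 ≤ r) : r / (c ^ 2 * (c + r)) ≤ min r 1 / c ^ 2 := by
  have hc := h.pos; have hc1 := h.one_le; have hx := h.x_pos hr
  rw [mul_comm, ← div_div]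
  gcongr
  rw [le_min_iff, div_le_one hx, div_le_iff₀ hx]
  exact ⟨by nlinarith, by linarith⟩

theorem Prof.r_mul_p_sq_le_min {r : ℝ} (hr : 0 ≤ r) : r * (A / (c * (c + r))) ^ 2 ≤ min r 1 := by
  have h1 := h.rp_le_one hr
  have h2 := h.p_nonneg hr
  have h3 := h.p_le_one hr
  rw [le_min_iff]
  exact ⟨mul_le_of_le_one_right hr (pow_le_one₀ h2 h3), by nlinarith⟩

theorem Prof.r2p2_le_sq {r : ℝ} (hr : 0 ≤ r) : r ^ 2 * (A / (c * (c + r))) ^ 2 ≤ A ^ 2 := by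
  rw [← mul_pow]
  refine pow_le_pow_left₀ (mul_nonneg hr (h.p_nonneg hr)) ?_ 2
  have hx := h.x_pos hr; have hc := h.pos; have hc1 := h.one_le; have hA := h.nonneg
  rw [← mul_div_assoc, div_le_iff₀ (by positivity)]
  have h3 : r * 1 ≤ (c + r) * c := by gcongr; linarith
  nlinarith

end Bounds

section Coeffs

variable {A K : ℝ} {w ω : ℝ → ℝ → ℂ} {V V₁ V₂ : ℝ → ℝ} (h : TFam A w ω) (hV : Small V V₁ V₂ K A)
  (hp : ∀ τ, Prof A (1 + max τ 0) (w τ))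
include h hV hp

theorem TFam.coeff_GG : Coeff (100 * (1 + K)) (fun τ r => GG (w τ) r - 1)
    (fun τ r => tGG (w τ) (ω τ) r) (fun τ r => GG (w τ) r * md (w τ) r) := by
  have hK := hV.nonneg
  refine ⟨by positivity, fun τ r hr => (h.deriv_GG τ hr.le).sub_const 1,
    fun τ r hr => ((h.fam.loc τ).hasDerivAt_GG r).sub_const 1, h.cont_tGG.continuousOn,
    (h.fam.GG.mul h.fam.md).continuousOn, fun τ r hr => ?_, fun τ r hr => ?_, fun τ r hr => ?_,
    fun τ r hr => ?_⟩
  · obtain ⟨h1, h2⟩ := (hp τ).GG_mem hr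
    rw [abs_of_nonneg (by linarith)]
    have h3 := mul_le_mul_of_nonneg_left ((hp τ).r_mul_p_sq_le_min hr) hr
    have h4 : 0 ≤ r * min r 1 := mul_nonneg hr (le_min hr zero_le_one)
    nlinarith [mul_nonneg hK h4]
  · have hA := (hp τ).nonneg; have hA1 := (hp τ).le_one
    refine ((hp τ).abs_tGG_le (h.bd τ) hr).trans ?_
    have h3 := (hp τ).div_le_min hr
    rw [mul_div_assoc]
    have hm : 0 ≤ min r 1 / (1 + max τ 0) ^ 2 := div_nonneg (le_min hr zero_le_one) (sq_nonneg _)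
    have h4 := mul_le_mul_of_nonneg_left h3 (show 0 ≤ 8 * A by positivity)
    nlinarith [mul_nonneg hK hm, mul_le_mul_of_nonneg_right hA1 hm]
  · have h1 := (hp τ).GG_le_two hr
    have h2 := (hp τ).md_le' hr
    have h3 := (hp τ).r_mul_p_sq_le_min hr
    have h4 := md_nonneg (w τ) hr
    have hm : 0 ≤ min r 1 := le_min hr zero_le_one
    rw [abs_of_nonneg (mul_nonneg (GG_pos (w τ) r).le h4)]
    have := mul_le_mul h1 (h2.trans h3) h4 zero_le_two
    nlinarith [mul_nonneg hK hm]
  · obtain ⟨h1, h2⟩ := (hp τ).GG_mem hr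
    rw [abs_of_nonneg (by linarith)]
    have h3 := (hp τ).r2p2_le_sq hr
    have h4 := hV.sq_le
    nlinarith [mul_nonneg hK (sq_nonneg A)]

theorem TFam.coeff_GG_mul_Gt : Coeff (100 * (1 + K)) (fun τ r => GG (w τ) r * Gt V (w τ) r - 1)
    (fun τ r => tGG (w τ) (ω τ) r * Gt V (w τ) r + GG (w τ) r * tGt V V₁ (w τ) (ω τ) r)
    (fun τ r => GG (w τ) r * md (w τ) r * Gt V (w τ) r
      + GG (w τ) r * ((dens V (w τ) r - Gt V (w τ) r) / r)) := by
  have hK := hV.nonneg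
  have hGt := h.fam.Gt hV.cont
  have key : ∀ τ r, 0 ≤ r → |GG (w τ) r * Gt V (w τ) r - 1| ≤
      4 * (1 + K) * (r ^ 2 * (A / ((1 + max τ 0) * (1 + max τ 0 + r))) ^ 2) := fun τ r hr => by
    obtain ⟨h1, h2⟩ := (hp τ).GG_mem hr
    obtain ⟨g1, g2⟩ := (hp τ).Gt_mem hV hr
    have h3 := (hp τ).abs_Gt_sub_one_le hV.toPot hr
    set x := r ^ 2 * (A / ((1 + max τ 0) * (1 + max τ 0 + r))) ^ 2
    have hx : 0 ≤ x := by positivity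
    rw [show GG (w τ) r * Gt V (w τ) r - 1 = (GG (w τ) r - 1) * Gt V (w τ) r + (Gt V (w τ) r - 1) by ring]
    refine (abs_add_le _ _).trans ?_
    rw [abs_mul, abs_of_nonneg (by linarith : 0 ≤ GG (w τ) r - 1),
      abs_of_nonneg (by linarith : 0 ≤ Gt V (w τ) r)]
    have h4 := mul_le_mul (show GG (w τ) r - 1 ≤ x by linarith) g2 (by linarith) hx
    nlinarith [mul_nonneg hK hx]
  refine ⟨by positivity, fun τ r hr => ((h.deriv_GG τ hr.le).mul (h.deriv_Gt hV.toPot τ hr.le)).sub_const 1,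
    fun τ r hr => ((((h.fam.loc τ).hasDerivAt_GG r).mul
      ((h.fam.loc τ).hasDerivAt_Gt hV.cont hr)).sub_const 1),
    ((h.cont_tGG.mul hGt).add (h.fam.GG.mul (h.cont_tGt hV.toPot))).continuousOn,
    ((h.fam.GG.mul h.fam.md).mul hGt).continuousOn.add (h.fam.GG.continuousOn.mul
      (continuousOn_snd_div ((h.fam.dens hV.cont).sub hGt).continuousOn)),
    fun τ r hr => ?_, fun τ r hr => ?_, fun τ r hr => ?_, fun τ r hr => ?_⟩
  · refine (key τ r hr).trans ?_
    have h3 := mul_le_mul_of_nonneg_left ((hp τ).r_mul_p_sq_le_min hr) hr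
    have h4 : 0 ≤ r * min r 1 := mul_nonneg hr (le_min hr zero_le_one)
    have h5 := mul_le_mul_of_nonneg_left h3 (show 0 ≤ 4 * (1 + K) by positivity)
    nlinarith [mul_nonneg hK h4]
  · have hA := (hp τ).nonneg; have hA1 := (hp τ).le_one
    have h1 := (hp τ).abs_tGG_le (h.bd τ) hr
    have h2 := (hp τ).abs_tGt_le (h.bd τ) hV hr
    have h3 := (hp τ).div_le_min hr
    have h5 := (hp τ).GG_le_two hr
    obtain ⟨g1, g2⟩ := (hp τ).Gt_mem hV hr
    have hx := (hp τ).x_pos hr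
    have hc := (hp τ).pos
    rw [mul_div_assoc]
    set T := r / ((1 + max τ 0) ^ 2 * (1 + max τ 0 + r))
    have hT : 0 ≤ T := by positivity
    refine (abs_add_le _ _).trans ?_
    rw [abs_mul, abs_mul, abs_of_pos (GG_pos (w τ) r),
      abs_of_nonneg (by linarith : 0 ≤ Gt V (w τ) r)]
    have i1 := mul_le_mul h1 g2 (by linarith) (by positivity)
    have i2 := mul_le_mul h5 h2 (abs_nonneg _) zero_le_two
    have i3 := mul_le_mul_of_nonneg_right hA1 hT
    have i4 := mul_le_mul_of_nonneg_left h3 (show 0 ≤ 100 * (1 + K) by positivity)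
    nlinarith [mul_nonneg hK hT]
  · have h1 := (hp τ).GG_le_two hr
    have h2 := (hp τ).md_le' hr
    have h3 := (hp τ).r_mul_p_sq_le_min hr
    have h4 := md_nonneg (w τ) hr
    have h5 := (hp τ).abs_dGt_le hV.toPot hr
    obtain ⟨g1, g2⟩ := (hp τ).Gt_mem hV hr
    have hm : 0 ≤ min r 1 := le_min hr zero_le_one
    set y := r * (A / ((1 + max τ 0) * (1 + max τ 0 + r))) ^ 2
    refine (abs_add_le _ _).trans ?_
    rw [abs_mul, abs_mul, abs_mul, abs_of_pos (GG_pos (w τ) r),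
      abs_of_nonneg (by linarith : 0 ≤ Gt V (w τ) r), abs_of_nonneg h4]
    have i1 := mul_le_mul (mul_le_mul h1 (h2.trans h3) h4 zero_le_two) g2 (by linarith) (by positivity)
    have i2 := mul_le_mul h1 h5 (abs_nonneg _) zero_le_two
    have i3 := mul_le_mul_of_nonneg_left h3 (show 0 ≤ 20 * (1 + K) by positivity)
    nlinarith [mul_nonneg hK hm]
  · refine (key τ r hr).trans ?_
    have h3 := mul_le_mul_of_nonneg_left ((hp τ).r2p2_le_sq hr) (show 0 ≤ 4 * (1 + K) by positivity)
    have h4 := hV.sq_le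
    linarith

end Coeffs

/-! ### Continuation of the solution to negative times -/

section Reflection

variable {A K : ℝ} {z₀ : ℝ → ℂ} {w ω₀ ω₁ : ℝ → ℝ → ℂ} {V V₁ : ℝ → ℝ}

/-- The continuation of `w` to negative times by reflection. -/
def refl (w : ℝ → ℝ → ℂ) (τ r : ℝ) : ℂ := w τ r + w 0 r - w (-τ) r

theorem Ball.refl_of_nonneg (hw : Ball A w) {τ : ℝ} (hτ : 0 ≤ τ) : refl w τ = w τ := by
  funext r
  rw [refl, hw.eq_max (-τ), max_eq_right (by linarith)]; ring

theorem Ball.refl_of_nonpos (hw : Ball A w) {τ : ℝ} (hτ : τ ≤ 0) (r : ℝ) :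
    refl w τ r = 2 * w 0 r - w (-τ) r := by
  rw [refl, hw.eq_max τ, max_eq_right hτ]; ring

/-- For τ ≤ 0 the continuation is 2w(0) - w(-τ), hence the constant 2A + A. The decay at the time -τ
is at least that at time 0, since 1/x² - 1/y² with y - x fixed decreases under a common shift to the
right. -/
theorem Ball.prof_refl (hw : Ball A w) (hA : 3 * A ≤ 1) (τ : ℝ) :
    Prof (3 * A) (1 + max τ 0) (refl w τ) := by
  have h0 := hw.prof 0 le_rfl
  rw [add_zero] at h0
  have hA0 := h0.nonneg
  rcases le_total 0 τ with hτ | hτ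
  · rw [hw.refl_of_nonneg hτ, max_eq_left hτ]
    have hp := hw.prof τ hτ
    refine ⟨hp.one_le, by positivity, hA, fun r hr => (hp.bd r hr).trans ?_,
      fun s r hs hsr => (hp.lp s r hs hsr).trans ?_, hp.clamp⟩
    · have := hp.x_pos hr
      gcongr; linarith
    · refine mul_le_mul_of_nonneg_right (by linarith) (sub_nonneg.2 ?_)
      have := hp.x_pos hs
      gcongr
  · rw [max_eq_right hτ, add_zero]
    have hn : 0 ≤ -τ := by linarith
    have hp := hw.prof (-τ) hn
    refine ⟨le_rfl, by positivity, hA, fun r hr => ?_, fun s r hs hsr => ?_, fun r => ?_⟩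
    · rw [hw.refl_of_nonpos hτ]
      refine (norm_sub_le _ _).trans ?_
      rw [norm_mul, Complex.norm_ofNat]
      have h1 := h0.bd r hr
      have h2 : A / (1 + -τ + r) ^ 2 ≤ A / (1 + r) ^ 2 := by gcongr; linarith
      have h3 := hp.bd r hr
      rw [mul_div_assoc]; linarith
    · rw [hw.refl_of_nonpos hτ, hw.refl_of_nonpos hτ,
        show 2 * w 0 r - w (-τ) r - (2 * w 0 s - w (-τ) s) = 2 * (w 0 r - w 0 s) - (w (-τ) r - w (-τ) s) by ring]
      refine (norm_sub_le _ _).trans ?_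
      rw [norm_mul, Complex.norm_ofNat]
      have h1 := h0.lp s r hs hsr
      have h3 := hp.lp s r hs hsr
      have h4 : 1 / (1 + -τ + s) ^ 2 - 1 / (1 + -τ + r) ^ 2 ≤ 1 / (1 + s) ^ 2 - 1 / (1 + r) ^ 2 := by
        have hx : 0 < 1 + s := by linarith
        have hy : 0 < 1 + r := by linarith
        have hx' : 0 < 1 + -τ + s := by linarith
        have hy' : 0 < 1 + -τ + r := by linarith
        have e : ∀ x y : ℝ, 0 < x → 0 < y → 1 / x ^ 2 - 1 / y ^ 2 =
            (y - x) * (1 / (x ^ 2 * y) + 1 / (x * y ^ 2)) := fun x y hx hy => by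
          field_simp; ring
        rw [e _ _ hx' hy', e _ _ hx hy]
        have i1 : 1 / ((1 + -τ + s) ^ 2 * (1 + -τ + r)) ≤ 1 / ((1 + s) ^ 2 * (1 + r)) := by
          gcongr <;> linarith
        have i2 : 1 / ((1 + -τ + s) * (1 + -τ + r) ^ 2) ≤ 1 / ((1 + s) * (1 + r) ^ 2) := by
          gcongr <;> linarith
        have i3 := mul_le_mul_of_nonneg_left (add_le_add i1 i2) (sub_nonneg.2 hsr)
        linarith
      have h5 := mul_le_mul_of_nonneg_left h4 (show 0 ≤ A / 2 by positivity)
      linarith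
    · have hcl : ∀ τ, w τ r = w τ (max r 0) := fun τ => by
        rw [hw.clamp τ r, hw.clamp τ (max r 0), max_eq_left (le_max_right r 0)]
      rw [refl, refl, hcl, hcl 0, hcl (-τ)]

/-- The one-sided time derivatives at τ = 0 agree because the reflection is odd about the initial
value. The metric thus extends to a C¹ metric on all of ℝ × ℝ³, so that derivatives within the
domain become ordinary ones. -/
theorem Sol.refl_tfam (h : Sol V V₁ A z₀ w ω₀ ω₁) (hA : 3 * A ≤ 1) :
    TFam (3 * A) (refl w) (fun τ r => ω₀ |τ| (max r 0)) := by
  have hw := h.ball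
  have hc : Continuous fun p : ℝ × ℝ => w p.1 p.2 := hw.cont
  refine ⟨⟨?_, fun τ => (hw.prof_refl hA τ).loc⟩, ?_, fun τ r => ?_,
    fun τ r => h.bd₀ _ _ (abs_nonneg τ) (le_max_right r 0)⟩
  · exact (hc.add (hc.comp (f := fun p : ℝ × ℝ => ((0 : ℝ), p.2)) (by fun_prop))).sub
      (hc.comp (f := fun p : ℝ × ℝ => (-p.1, p.2)) (by fun_prop))
  · exact h.cont₀.comp (f := fun p : ℝ × ℝ => (|p.1|, max p.2 0)) (by fun_prop)
  · have hr := le_max_right r 0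
    have hclr : ∀ τ, w τ r = w τ (max r 0) := fun τ => by
      rw [hw.clamp τ r, hw.clamp τ (max r 0), max_eq_left hr]
    have hright : ∀ τ, 0 ≤ τ → HasDerivWithinAt (fun τ => refl w τ r) (ω₀ τ (max r 0)) (Ici 0) τ :=
      fun τ hτ => (h.hasDeriv₀ τ _ hτ hr).congr
        (fun x hx => by rw [hw.refl_of_nonneg hx, hclr]) (by rw [hw.refl_of_nonneg hτ, hclr])
    have hleft : ∀ τ, τ ≤ 0 → HasDerivWithinAt (fun τ => refl w τ r) (ω₀ (-τ) (max r 0)) (Iic 0) τ :=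
      fun τ hτ => by
        have h1 := (h.hasDeriv₀ (-τ) _ (by linarith) hr).scomp τ
          ((hasDerivAt_neg τ).hasDerivWithinAt (s := Iic 0)) fun x hx => neg_nonneg.2 hx
        refine ((h1.const_sub (2 * w 0 (max r 0))).congr_deriv (by simp)).congr (fun x hx => ?_) ?_
        · rw [hw.refl_of_nonpos hx, hclr, hclr (-x)]; rfl
        · rw [hw.refl_of_nonpos hτ, hclr, hclr (-τ)]; rfl
    rcases lt_trichotomy τ 0 with hτ | rfl | hτ
    · rw [abs_of_neg hτ]; exact (hleft τ hτ.le).hasDerivAt (Iic_mem_nhds hτ)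
    · have h1 := hleft 0 le_rfl
      have h2 := hright 0 le_rfl
      rw [neg_zero] at h1
      rw [abs_zero]
      have := h1.union h2
      rwa [Iic_union_Ici, hasDerivWithinAt_univ] at this
    · rw [abs_of_pos hτ]; exact (hright τ hτ.le).hasDerivAt (Ici_mem_nhds hτ)

end Reflection

end

/-! ### The metric in Cartesian coordinates across the axis -/

section

/-- The derivative `dr(v)` of the radius along `v`, zero on the axis. -/
def rho (P v : Coord) : ℝ := inner ℝ P.2 v.2 / ‖P.2‖

/-- The derivative of `t - r` along `v`. -/
def xi (P v : Coord) : ℝ := v.1 - rho P v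

/-- Off the axis a `C¹` function whose derivative is bounded by the inverse distance to the axis. -/
structure Tame (κ : ℝ) (m : Coord → ℝ) : Prop where
  smooth : ∀ P : Coord, P.2 ≠ 0 → ContDiffAt ℝ 1 m P
  bd : ∀ P, |m P| ≤ κ
  bd' : ∀ P : Coord, P.2 ≠ 0 → ‖fderiv ℝ m P‖ ≤ κ / ‖P.2‖

theorem contDiffAt_radius {P : Coord} (hP : P.2 ≠ 0) : ContDiffAt ℝ 1 (fun P : Coord => ‖P.2‖) P :=
  contDiffAt_snd.norm ℝ hP

theorem norm_fderiv_radius_le (P : Coord) : ‖fderiv ℝ (fun P : Coord => ‖P.2‖) P‖ ≤ 1 := by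
  have : LipschitzWith 1 fun P : Coord => ‖P.2‖ := LipschitzWith.of_dist_le_mul fun P Q => by
    rw [NNReal.coe_one, one_mul, dist_eq_norm, dist_eq_norm]
    exact (abs_norm_sub_norm_le P.2 Q.2).trans (norm_snd_le (P - Q))
  simpa using norm_fderiv_le_of_lipschitz ℝ this

theorem abs_rho_le (P v : Coord) : |rho P v| ≤ ‖v.2‖ := by
  rw [rho, abs_div, abs_norm]
  exact div_le_of_le_mul₀ (norm_nonneg _) (norm_nonneg _)
    ((abs_real_inner_le_norm _ _).trans_eq (mul_comm _ _))

theorem Tame.const (c : ℝ) : Tame |c| fun _ => c :=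
  ⟨fun P _ => contDiffAt_const, fun P => le_rfl, fun P hP => by simp; positivity⟩

theorem Tame.nonneg {κ : ℝ} {m : Coord → ℝ} (h : Tame κ m) : 0 ≤ κ := (abs_nonneg _).trans (h.bd 0)

theorem Tame.diff {κ : ℝ} {m : Coord → ℝ} (h : Tame κ m) {P : Coord} (hP : P.2 ≠ 0) :
    DifferentiableAt ℝ m P := (h.smooth P hP).differentiableAt one_ne_zero

theorem Tame.mono {κ κ' : ℝ} {m : Coord → ℝ} (h : Tame κ m) (hκ : κ ≤ κ') : Tame κ' m :=
  ⟨h.smooth, fun P => (h.bd P).trans hκ, fun P hP => (h.bd' P hP).trans (by gcongr)⟩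

theorem Tame.add {κ κ' : ℝ} {m m' : Coord → ℝ} (h : Tame κ m) (h' : Tame κ' m') :
    Tame (κ + κ') fun P => m P + m' P :=
  ⟨fun P hP => (h.smooth P hP).add (h'.smooth P hP),
    fun P => (abs_add_le _ _).trans (add_le_add (h.bd P) (h'.bd P)), fun P hP => by
      rw [fderiv_fun_add (h.diff hP) (h'.diff hP), add_div]
      exact (norm_add_le _ _).trans (add_le_add (h.bd' P hP) (h'.bd' P hP))⟩

theorem Tame.sub {κ κ' : ℝ} {m m' : Coord → ℝ} (h : Tame κ m) (h' : Tame κ' m') :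
    Tame (κ + κ') fun P => m P - m' P :=
  ⟨fun P hP => (h.smooth P hP).sub (h'.smooth P hP),
    fun P => (abs_sub _ _).trans (add_le_add (h.bd P) (h'.bd P)), fun P hP => by
      rw [fderiv_fun_sub (h.diff hP) (h'.diff hP), add_div]
      exact (norm_sub_le _ _).trans (add_le_add (h.bd' P hP) (h'.bd' P hP))⟩

theorem Tame.mul {κ κ' : ℝ} {m m' : Coord → ℝ} (h : Tame κ m) (h' : Tame κ' m') :
    Tame (2 * (κ * κ')) fun P => m P * m' P :=
  ⟨fun P hP => (h.smooth P hP).mul (h'.smooth P hP), fun P => by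
      rw [abs_mul]
      have := mul_le_mul (h.bd P) (h'.bd P) (abs_nonneg _) h.nonneg
      linarith [mul_nonneg h.nonneg h'.nonneg], fun P hP => by
      rw [fderiv_fun_mul (h.diff hP) (h'.diff hP)]
      refine (norm_add_le _ _).trans ?_
      rw [norm_smul, norm_smul, Real.norm_eq_abs, Real.norm_eq_abs]
      have h1 := mul_le_mul (h.bd P) (h'.bd' P hP) (norm_nonneg _) h.nonneg
      have h2 := mul_le_mul (h'.bd P) (h.bd' P hP) (norm_nonneg _) h'.nonneg
      refine (add_le_add h1 h2).trans_eq ?_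
      ring⟩

/-- The function is homogeneous of degree 0 in x, so it is bounded and its derivative is of size
1/|x|. -/
theorem tame_rho (v : Coord) : Tame (2 * ‖v‖) fun P => rho P v := by
  have hv : ‖v.2‖ ≤ ‖v‖ := norm_snd_le v
  have hi : ∀ P : Coord, HasFDerivAt (fun P : Coord => inner ℝ P.2 v.2)
      ((innerSL ℝ v.2).comp (ContinuousLinearMap.snd ℝ ℝ (EuclideanSpace ℝ (Fin 3)))) P := fun P => by
    have := ((innerSL ℝ v.2).comp (ContinuousLinearMap.snd ℝ ℝ (EuclideanSpace ℝ (Fin 3)))).hasFDerivAt (x := P)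
    refine this.congr_of_eventuallyEq (Eventually.of_forall fun P => ?_)
    simp [real_inner_comm]
  refine ⟨fun P hP => ?_, fun P => (abs_rho_le P v).trans (by linarith [norm_nonneg v]), fun P hP => ?_⟩
  · exact (contDiffAt_snd.inner ℝ contDiffAt_const).div (contDiffAt_radius hP) (norm_ne_zero_iff.2 hP)
  · have hr : 0 < ‖P.2‖ := norm_pos_iff.2 hP
    have hd := ((contDiffAt_radius hP).differentiableAt one_ne_zero).hasFDerivAt
    have hinv := (hasDerivAt_inv hr.ne').comp_hasFDerivAt P hd
    have h1 := (hi P).mul hinv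
    have e : (fun P => rho P v) = (fun P : Coord => inner ℝ P.2 v.2) * (Inv.inv ∘ fun P : Coord => ‖P.2‖) := by
      funext P; simp [rho, div_eq_mul_inv]
    rw [e, h1.fderiv]
    refine (norm_add_le _ _).trans ?_
    rw [norm_smul, norm_smul, norm_smul, Real.norm_eq_abs, Real.norm_eq_abs, Real.norm_eq_abs]
    have n1 : ‖(innerSL ℝ v.2).comp (ContinuousLinearMap.snd ℝ ℝ (EuclideanSpace ℝ (Fin 3)))‖ ≤ ‖v‖ := by
      refine (ContinuousLinearMap.opNorm_comp_le _ _).trans ?_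
      rw [innerSL_apply_norm]
      have := ContinuousLinearMap.norm_snd_le ℝ ℝ (EuclideanSpace ℝ (Fin 3))
      exact (mul_le_of_le_one_right (norm_nonneg _) this).trans hv
    have n2 := norm_fderiv_radius_le P
    have n3 : |inner ℝ P.2 v.2| ≤ ‖P.2‖ * ‖v‖ :=
      (abs_real_inner_le_norm _ _).trans (by gcongr)
    have e1 : |-(‖P.2‖ ^ 2)⁻¹| = (‖P.2‖ ^ 2)⁻¹ := by
      rw [abs_neg, abs_of_pos (by positivity)]
    have e2 : |(Inv.inv ∘ fun P : Coord => ‖P.2‖) P| = ‖P.2‖⁻¹ := by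
      simp
    rw [e1, e2]
    calc |inner ℝ P.2 v.2| * ((‖P.2‖ ^ 2)⁻¹ * ‖fderiv ℝ (fun P : Coord => ‖P.2‖) P‖) + ‖P.2‖⁻¹ * _
        ≤ ‖P.2‖ * ‖v‖ * ((‖P.2‖ ^ 2)⁻¹ * 1) + ‖P.2‖⁻¹ * ‖v‖ := by gcongr
      _ = 2 * ‖v‖ / ‖P.2‖ := by field_simp; ring

theorem tame_xi (v : Coord) : Tame (3 * ‖v‖) fun P => xi P v :=
  ((Tame.const v.1).sub (tame_rho v)).mono (by
    have : |v.1| ≤ ‖v‖ := norm_fst_le v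
    linarith)

/-- A function that is O(r²) near the axis has derivative 0 there, and the assumed bound on its
derivative off the axis tends to 0, so the derivative is continuous. -/
theorem contDiff_of_axis {Φ : Coord → ℝ} {C : ℝ} (hs : ∀ P : Coord, P.2 ≠ 0 → ContDiffAt ℝ 1 Φ P)
    (hb : ∀ P, |Φ P| ≤ C * (‖P.2‖ * min ‖P.2‖ 1))
    (hb' : ∀ P : Coord, P.2 ≠ 0 → ‖fderiv ℝ Φ P‖ ≤ C * min ‖P.2‖ 1) :
    ContDiff ℝ 1 Φ ∧ ∀ P, ‖fderiv ℝ Φ P‖ ≤ C * min ‖P.2‖ 1 := by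
  have hC : 0 ≤ C := by
    obtain ⟨x, hx⟩ := exists_ne (0 : EuclideanSpace ℝ (Fin 3))
    have h1 := (abs_nonneg _).trans (hb (0, x))
    have : 0 < ‖x‖ := norm_pos_iff.2 hx
    exact nonneg_of_mul_nonneg_left h1 (mul_pos this (lt_min this one_pos))
  have h0 : ∀ P : Coord, P.2 = 0 → HasFDerivAt Φ (0 : Coord →L[ℝ] ℝ) P := fun P hP => by
    refine Asymptotics.IsBigO.hasFDerivAt (n := 2) ?_ one_lt_two
    refine Asymptotics.IsBigO.of_bound C (Eventually.of_forall fun x => ?_)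
    have h1 : ‖x.2‖ ≤ ‖x - P‖ := by
      have := norm_snd_le (x - P)
      rwa [Prod.snd_sub, hP, sub_zero] at this
    rw [Real.norm_eq_abs, norm_pow, norm_norm]
    refine (hb x).trans ?_
    have h2 : ‖x.2‖ * min ‖x.2‖ 1 ≤ ‖x - P‖ ^ 2 := by
      rw [sq]
      exact mul_le_mul h1 ((min_le_left _ _).trans h1) (le_min (norm_nonneg _) zero_le_one) (norm_nonneg _)
    gcongr
  have hbd : ∀ P, ‖fderiv ℝ Φ P‖ ≤ C * min ‖P.2‖ 1 := fun P => by
    by_cases hP : P.2 = 0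
    · rw [(h0 P hP).fderiv, hP]; simp
    · exact hb' P hP
  refine ⟨contDiff_one_iff_fderiv.2 ⟨fun P => ?_, continuous_iff_continuousAt.2 fun P => ?_⟩, hbd⟩
  · by_cases hP : P.2 = 0
    · exact (h0 P hP).differentiableAt
    · exact (hs P hP).differentiableAt one_ne_zero
  · by_cases hP : P.2 = 0
    · rw [ContinuousAt, (h0 P hP).fderiv]
      refine squeeze_zero_norm hbd ?_
      have : Continuous fun P : Coord => C * min ‖P.2‖ 1 := by fun_prop
      simpa [hP] using this.tendsto P
    · exact (hs P hP).continuousAt_fderiv one_ne_zero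

section Coefficient

variable {M κ : ℝ} {a a₀ a₁ : ℝ → ℝ → ℝ} (ha : Coeff M a a₀ a₁)
include ha

/-- The coefficient as a function on the space-time. -/
def lift (a : ℝ → ℝ → ℝ) (P : Coord) : ℝ := a (P.1 - ‖P.2‖) ‖P.2‖

theorem Coeff.hasFDerivAt {P : Coord} (hP : P.2 ≠ 0) : ContDiffAt ℝ 1 (lift a) P ∧
    HasFDerivAt (lift a) (a₀ (P.1 - ‖P.2‖) ‖P.2‖ •
      (ContinuousLinearMap.fst ℝ ℝ (EuclideanSpace ℝ (Fin 3)) - fderiv ℝ (fun P : Coord => ‖P.2‖) P)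
      + a₁ (P.1 - ‖P.2‖) ‖P.2‖ • fderiv ℝ (fun P : Coord => ‖P.2‖) P) P := by
  have hr : 0 < ‖P.2‖ := norm_pos_iff.2 hP
  have hset : (univ : Set ℝ) ×ˢ Ioi (0 : ℝ) = {p : ℝ × ℝ | 0 < p.2} := by ext p; simp
  have hF := contDiffOn_of_partials convex_univ (convex_Ioi 0) uniqueDiffOn_univ
    (uniqueDiffOn_Ioi 0) (f := fun p : ℝ × ℝ => a p.1 p.2) (p₁ := fun p => a₀ p.1 p.2)
    (p₂ := fun p => a₁ p.1 p.2) (fun x hx => (ha.deriv₀ x.1 x.2 hx.2).hasDerivWithinAt)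
    (fun x hx => (ha.deriv₁ x.1 x.2 hx.2).hasDerivWithinAt) (hset ▸ ha.cont₀) (hset ▸ ha.cont₁)
  have hnhds : (univ : Set ℝ) ×ˢ Ioi (0 : ℝ) ∈ 𝓝 (P.1 - ‖P.2‖, ‖P.2‖) :=
    prod_mem_nhds univ_mem (Ioi_mem_nhds hr)
  have hF' := hF.contDiffAt hnhds
  have hin : ContDiffAt ℝ 1 (fun P : Coord => (P.1 - ‖P.2‖, ‖P.2‖)) P :=
    (contDiffAt_fst.sub (contDiffAt_radius hP)).prodMk (contDiffAt_radius hP)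
  refine ⟨ContDiffAt.comp (g := fun p : ℝ × ℝ => a p.1 p.2) P hF' hin, ?_⟩
  have hd := (hF'.differentiableAt one_ne_zero).hasFDerivAt
  have e1 : fderiv ℝ (fun p : ℝ × ℝ => a p.1 p.2) (P.1 - ‖P.2‖, ‖P.2‖) (1, 0) = a₀ (P.1 - ‖P.2‖) ‖P.2‖ :=
    (hd.comp_hasDerivAt_of_eq (P.1 - ‖P.2‖) ((hasDerivAt_id _).prodMk (hasDerivAt_const _ _)) rfl).unique
      (ha.deriv₀ _ _ hr)
  have e2 : fderiv ℝ (fun p : ℝ × ℝ => a p.1 p.2) (P.1 - ‖P.2‖, ‖P.2‖) (0, 1) = a₁ (P.1 - ‖P.2‖) ‖P.2‖ :=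
    (hd.comp_hasDerivAt_of_eq ‖P.2‖ ((hasDerivAt_const _ _).prodMk (hasDerivAt_id _)) rfl).unique
      (ha.deriv₁ _ _ hr)
  have hdr := ((contDiffAt_radius hP).differentiableAt one_ne_zero).hasFDerivAt
  have hg := hd.comp P ((hasFDerivAt_fst.sub hdr).prodMk hdr)
  refine hg.congr_fderiv ?_
  ext Z <;>
  · simp only [ContinuousLinearMap.coe_comp, Function.comp_apply, ContinuousLinearMap.prod_apply,
      add_apply, smul_apply, smul_eq_mul, ← e1, ← e2]
    rw [mul_comm, mul_comm (fderiv ℝ _ _ (0, 1)), ← smul_eq_mul, ← smul_eq_mul, ← map_smul, ← map_smul, ← map_add]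
    simp

theorem Coeff.norm_fderiv_le {P : Coord} (hP : P.2 ≠ 0) :
    ‖fderiv ℝ (lift a) P‖ ≤ 3 * M * min ‖P.2‖ 1 := by
  rw [(ha.hasFDerivAt hP).2.fderiv]
  refine (norm_add_le _ _).trans ?_
  rw [norm_smul, norm_smul, Real.norm_eq_abs, Real.norm_eq_abs]
  have hm : 0 ≤ M * min ‖P.2‖ 1 := mul_nonneg ha.nonneg (le_min (norm_nonneg _) zero_le_one)
  have h0 : |a₀ (P.1 - ‖P.2‖) ‖P.2‖| ≤ M * min ‖P.2‖ 1 := by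
    refine (ha.bd₀ _ _ (norm_nonneg _)).trans (div_le_self hm ?_)
    have := le_max_right (P.1 - ‖P.2‖) 0
    nlinarith
  have h1 := ha.bd₁ (P.1 - ‖P.2‖) _ (norm_nonneg P.2)
  have n2 := norm_fderiv_radius_le P
  have n1 : ‖ContinuousLinearMap.fst ℝ ℝ (EuclideanSpace ℝ (Fin 3)) - fderiv ℝ (fun P : Coord => ‖P.2‖) P‖ ≤ 2 := by
    refine (norm_sub_le _ _).trans ?_
    have := ContinuousLinearMap.norm_fst_le ℝ ℝ (EuclideanSpace ℝ (Fin 3))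
    linarith
  have i1 := mul_le_mul h0 n1 (norm_nonneg _) hm
  have i2 := mul_le_mul h1 n2 (norm_nonneg _) hm
  linarith

/-- The coefficient is O(r min(r, 1)), which more than compensates the derivative O(1/r) of the
direction-dependent factor. -/
theorem Coeff.mul_tame {m : Coord → ℝ} (hm : Tame κ m) : ContDiff ℝ 1 (fun P => lift a P * m P) ∧
    ∀ P, ‖fderiv ℝ (fun P => lift a P * m P) P‖ ≤ 4 * M * κ * min ‖P.2‖ 1 := by
  have hM := ha.nonneg
  have hκ := hm.nonneg
  refine contDiff_of_axis (fun P hP => (ha.hasFDerivAt hP).1.mul (hm.smooth P hP)) (fun P => ?_)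
    fun P hP => ?_
  · rw [abs_mul]
    have h0 : 0 ≤ ‖P.2‖ * min ‖P.2‖ 1 := mul_nonneg (norm_nonneg _) (le_min (norm_nonneg _) zero_le_one)
    have := mul_le_mul (ha.bd (P.1 - ‖P.2‖) _ (norm_nonneg P.2)) (hm.bd P) (abs_nonneg _) (by positivity)
    refine this.trans ?_
    nlinarith [mul_nonneg (mul_nonneg hM hκ) h0]
  · have hr : 0 < ‖P.2‖ := norm_pos_iff.2 hP
    rw [fderiv_fun_mul (ha.hasFDerivAt hP).2.differentiableAt (hm.diff hP)]
    refine (norm_add_le _ _).trans ?_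
    rw [norm_smul, norm_smul, Real.norm_eq_abs, Real.norm_eq_abs]
    have h1 := ha.bd (P.1 - ‖P.2‖) _ (norm_nonneg P.2)
    have h0 : 0 ≤ min ‖P.2‖ 1 := le_min (norm_nonneg _) zero_le_one
    have i1 := mul_le_mul h1 (hm.bd' P hP) (norm_nonneg _) (by positivity)
    have i2 := mul_le_mul (hm.bd P) (ha.norm_fderiv_le hP) (norm_nonneg _) hκ
    have e : M * (‖P.2‖ * min ‖P.2‖ 1) * (κ / ‖P.2‖) = M * κ * min ‖P.2‖ 1 := by field_simp
    rw [e] at i1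
    refine (add_le_add i1 i2).trans_eq ?_
    ring

end Coefficient

/-- The metric with radial coefficients `a, b`, as a bilinear form on tangent vectors. -/
def rhoL (P : Coord) : Coord →L[ℝ] ℝ :=
  ‖P.2‖⁻¹ • (innerSL ℝ P.2).comp (ContinuousLinearMap.snd ℝ ℝ (EuclideanSpace ℝ (Fin 3)))

def xiL (P : Coord) : Coord →L[ℝ] ℝ := ContinuousLinearMap.fst ℝ ℝ (EuclideanSpace ℝ (Fin 3)) - rhoL P

/-- The case a = b = 0 is the Minkowski form, so a and b measure the deviation from flat space. The
products of ξ and ρ are discontinuous on the axis, where a and b vanish. -/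
def met (a b : ℝ → ℝ → ℝ) (P : Coord) : Coord →L[ℝ] Coord →L[ℝ] ℝ :=
  ((isBoundedBilinearMap_inner (𝕜 := ℝ) (E := EuclideanSpace ℝ (Fin 3))).toContinuousLinearMap).bilinearComp
      (ContinuousLinearMap.snd ℝ ℝ (EuclideanSpace ℝ (Fin 3)))
      (ContinuousLinearMap.snd ℝ ℝ (EuclideanSpace ℝ (Fin 3)))
    - (ContinuousLinearMap.fst ℝ ℝ (EuclideanSpace ℝ (Fin 3))).smulRight
      (ContinuousLinearMap.fst ℝ ℝ (EuclideanSpace ℝ (Fin 3)))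
    - lift a P • (xiL P).smulRight (xiL P)
    - lift b P • ((xiL P).smulRight (rhoL P) + (rhoL P).smulRight (xiL P))

theorem rhoL_apply (P v : Coord) : rhoL P v = rho P v := by
  simp [rhoL, rho, div_eq_inv_mul]

theorem xiL_apply (P v : Coord) : xiL P v = xi P v := by simp [xiL, xi, rhoL_apply]

theorem met_apply (a b : ℝ → ℝ → ℝ) (P v w : Coord) : met a b P v w =
    inner ℝ v.2 w.2 - v.1 * w.1 - lift a P * (xi P v * xi P w)
      - lift b P * (xi P v * rho P w + rho P v * xi P w) := by
  have h : met a b P v w = inner ℝ v.2 w.2 - v.1 * w.1 - lift a P * (xiL P v * xiL P w)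
      - lift b P * (xiL P v * rhoL P w + rhoL P v * xiL P w) := rfl
  rw [h, xiL_apply, xiL_apply, rhoL_apply, rhoL_apply]

theorem met_symm (a b : ℝ → ℝ → ℝ) (P v w : Coord) : met a b P v w = met a b P w v := by
  rw [met_apply, met_apply, real_inner_comm]; ring

/-! ### Regularity and nondegeneracy of the metric -/

section Metric

variable {M : ℝ} {a a₀ a₁ b b₀ b₁ : ℝ → ℝ → ℝ} (ha : Coeff M a a₀ a₁) (hb : Coeff M b b₀ b₁)
include ha hb

theorem contDiff_met_apply (v w : Coord) : ContDiff ℝ 1 (fun P => met a b P v w) ∧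
    ∀ P, ‖fderiv ℝ (fun P => met a b P v w) P‖ ≤ 200 * M * ‖v‖ * ‖w‖ * min ‖P.2‖ 1 := by
  have h1 := ha.mul_tame ((tame_xi v).mul (tame_xi w))
  have h2 := hb.mul_tame (((tame_xi v).mul (tame_rho w)).add ((tame_rho v).mul (tame_xi w)))
  have e : (fun P => met a b P v w) = fun P => (inner ℝ v.2 w.2 - v.1 * w.1 - lift a P * (xi P v * xi P w))
      - lift b P * (xi P v * rho P w + rho P v * xi P w) := by
    funext P; exact met_apply a b P v w
  refine ⟨?_, fun P => ?_⟩
  · rw [e]; exact (contDiff_const.sub h1.1).sub h2.1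
  · have d1 := (h1.1.differentiable one_ne_zero P).hasFDerivAt
    have d2 := (h2.1.differentiable one_ne_zero P).hasFDerivAt
    have d3 : HasFDerivAt (fun P => (inner ℝ v.2 w.2 - v.1 * w.1 - lift a P * (xi P v * xi P w))
      - lift b P * (xi P v * rho P w + rho P v * xi P w)) _ P :=
      (d1.const_sub (inner ℝ v.2 w.2 - v.1 * w.1)).sub d2
    rw [e, d3.fderiv]
    refine (norm_sub_le _ _).trans ?_
    rw [norm_neg]
    refine (add_le_add (h1.2 P) (h2.2 P)).trans ?_
    have hM := ha.nonneg
    have : 0 ≤ M * ‖v‖ * ‖w‖ * min ‖P.2‖ 1 :=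
      mul_nonneg (by positivity) (le_min (norm_nonneg _) zero_le_one)
    nlinarith

theorem contDiff_met : ContDiff ℝ 1 (met a b) :=
  contDiff_clm_apply_iff.2 fun v => contDiff_clm_apply_iff.2 fun w => (contDiff_met_apply ha hb v w).1

theorem fderiv_met_apply (P Z v w : Coord) :
    fderiv ℝ (met a b) P Z v w = fderiv ℝ (fun P => met a b P v w) P Z := by
  have hd := ((contDiff_met ha hb).differentiable one_ne_zero P).hasFDerivAt
  have h1 := (hd.clm_apply (hasFDerivAt_const v P)).clm_apply (hasFDerivAt_const w P)
  rw [h1.fderiv]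
  simp

theorem abs_fderiv_met_le (P Z v w : Coord) :
    |fderiv ℝ (met a b) P Z v w| ≤ 200 * M * ‖v‖ * ‖w‖ * ‖Z‖ := by
  rw [fderiv_met_apply ha hb, ← Real.norm_eq_abs]
  refine (ContinuousLinearMap.le_opNorm _ _).trans ?_
  gcongr
  refine ((contDiff_met_apply ha hb v w).2 P).trans (mul_le_of_le_one_right ?_ (min_le_right _ _))
  have := ha.nonneg
  positivity

/-- The forms ξ and ρ do not depend on t, so only a and b are differentiated. Every term contains
the factor ξ(v), which off the axis is the rate of change of τ along v; this makes the energy loss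
integrable. -/
theorem fderiv_met_time (P v : Coord) : fderiv ℝ (met a b) P timeDir v v =
    if P.2 = 0 then 0 else -a₀ (P.1 - ‖P.2‖) ‖P.2‖ * xi P v ^ 2
      - 2 * b₀ (P.1 - ‖P.2‖) ‖P.2‖ * (xi P v * rho P v) := by
  rw [fderiv_met_apply ha hb]
  obtain ⟨hs, hbd⟩ := contDiff_met_apply ha hb v v
  split_ifs with hP
  · have := hbd P
    rw [hP, norm_zero, min_eq_left zero_le_one, mul_zero, norm_le_zero_iff] at this
    rw [this]; simp
  · have hr : 0 < ‖P.2‖ := norm_pos_iff.2 hP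
    have hd := (hs.differentiable one_ne_zero P).hasFDerivAt
    have hl : HasDerivAt (fun s : ℝ => ((s, P.2) : Coord)) timeDir P.1 :=
      (hasDerivAt_id _).prodMk (hasDerivAt_const _ _)
    refine (hd.comp_hasDerivAt_of_eq P.1 hl rfl).unique ?_
    have hsub : HasDerivAt (fun s : ℝ => s - ‖P.2‖) 1 P.1 := (hasDerivAt_id _).sub_const _
    have h1 := (ha.deriv₀ (P.1 - ‖P.2‖) _ hr).comp P.1 hsub
    have h2 := (hb.deriv₀ (P.1 - ‖P.2‖) _ hr).comp P.1 hsub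
    have h3 := ((h1.mul_const (xi P v ^ 2)).const_sub (inner ℝ v.2 v.2 - v.1 * v.1)).sub
      (h2.mul_const (2 * (xi P v * rho P v)))
    refine (h3.congr_deriv (by ring)).congr_of_eventuallyEq (Eventually.of_forall fun s => ?_)
    have e1 : xi (s, P.2) v = xi P v := rfl
    have e2 : rho (s, P.2) v = rho P v := rfl
    simp only [Function.comp_apply, met_apply, lift, e1, e2, Pi.sub_apply]
    ring

/-- The bilinear form is uniformly nondegenerate. -/
theorem norm_le_met (P v : Coord) : ‖v‖ ≤ 2 * ‖met a b P v‖ := by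
  rcases eq_or_ne v 0 with rfl | hv
  · simp
  have hv0 : 0 < ‖v‖ := norm_pos_iff.2 hv
  -- Reversing the time component turns the Minkowski form into the Euclidean norm. The perturbation
  -- is at most 3/100 · S², too small to destroy half of it.
  set w : Coord := (-v.1, v.2) with hw
  have hwn : ‖w‖ = ‖v‖ := by simp [hw, Prod.norm_def]
  have hA : |lift a P| ≤ 1 / 100 := ha.small _ _ (norm_nonneg _)
  have hB : |lift b P| ≤ 1 / 100 := hb.small _ _ (norm_nonneg _)
  have r1 := abs_rho_le P v
  have r2 : |rho P w| ≤ ‖v.2‖ := abs_rho_le P w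
  have x1 : |xi P v| ≤ |v.1| + ‖v.2‖ := (abs_sub _ _).trans (by linarith)
  have x2 : |xi P w| ≤ |v.1| + ‖v.2‖ := (abs_sub _ _).trans (by simp [hw]; linarith)
  have hv1 := abs_nonneg v.1
  have hv2 := norm_nonneg v.2
  set S := |v.1| + ‖v.2‖ with hS
  have hS0 : 0 ≤ S := by positivity
  have key : ∀ x y : ℝ, |x| ≤ S → |y| ≤ S → |x * y| ≤ S ^ 2 := fun x y hx hy => by
    rw [abs_mul, sq]; exact mul_le_mul hx hy (abs_nonneg _) hS0
  have k1 := key _ _ x1 x2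
  have k2 := key _ _ x1 (r2.trans (by linarith))
  have k3 := key _ _ (r1.trans (show ‖v.2‖ ≤ S by linarith)) x2
  have m1 : |lift a P * (xi P v * xi P w)| ≤ 1 / 100 * S ^ 2 := by
    rw [abs_mul]; exact mul_le_mul hA k1 (abs_nonneg _) (by norm_num)
  have m2 : |lift b P * (xi P v * rho P w + rho P v * xi P w)| ≤ 1 / 100 * (S ^ 2 + S ^ 2) := by
    rw [abs_mul]
    exact mul_le_mul hB ((abs_add_le _ _).trans (add_le_add k2 k3)) (abs_nonneg _) (by norm_num)
  have hSS : S ^ 2 ≤ 2 * (v.1 ^ 2 + ‖v.2‖ ^ 2) := by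
    rw [← sq_abs v.1]; nlinarith [sq_nonneg (|v.1| - ‖v.2‖)]
  have hnn : ‖v‖ ^ 2 ≤ v.1 ^ 2 + ‖v.2‖ ^ 2 := by
    rw [Prod.norm_def, Real.norm_eq_abs]
    rcases max_cases |v.1| ‖v.2‖ with ⟨h, _⟩ | ⟨h, _⟩ <;> rw [h]
    · rw [sq_abs]; nlinarith
    · nlinarith [sq_nonneg v.1]
  have hlow : ‖v‖ ^ 2 / 2 ≤ met a b P v w := by
    rw [met_apply]
    have : inner ℝ v.2 w.2 = ‖v.2‖ ^ 2 := real_inner_self_eq_norm_sq v.2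
    rw [this]
    have e : v.1 * w.1 = -v.1 ^ 2 := by simp [hw]; ring
    rw [e]
    have := (abs_le.1 m1).2; have := (abs_le.1 m2).2
    linarith [sq_nonneg ‖v‖]
  have hup : met a b P v w ≤ ‖met a b P v‖ * ‖v‖ := by
    rw [← hwn]; exact (Real.le_norm_self _).trans (ContinuousLinearMap.le_opNorm _ _)
  nlinarith

theorem exists_unit_met (P : Coord) : ∃ e : Coord ≃L[ℝ] (Coord →L[ℝ] ℝ), (e : Coord →L[ℝ] Coord →L[ℝ] ℝ) = met a b P := by
  have hinj : Function.Injective (met a b P) := by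
    rw [injective_iff_map_eq_zero]
    intro v hv
    have := norm_le_met ha hb P v
    rw [hv, norm_zero, mul_zero] at this
    exact norm_le_zero_iff.1 this
  have hdim : Module.finrank ℝ Coord = Module.finrank ℝ (Coord →L[ℝ] ℝ) := by
    rw [← LinearEquiv.finrank_eq (LinearMap.toContinuousLinearMap (𝕜 := ℝ) (E := Coord) (F' := ℝ))]
    exact Subspace.dual_finrank_eq.symm
  let e := LinearEquiv.ofInjectiveOfFinrankEq (met a b P : Coord →ₗ[ℝ] Coord →L[ℝ] ℝ) hinj hdim
  exact ⟨e.toContinuousLinearEquiv, ContinuousLinearMap.ext fun v => rfl⟩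

end Metric

end

/-! ### Peano's theorem and one-sided derivatives -/

section

section Peano

variable {F : Type*} [NormedAddCommGroup F] [NormedSpace ℝ F]

/-- The Euler scheme with step `h`. -/
def euler (G : F → F) (y₀ : F) (h : ℝ) : ℕ → F
  | 0 => y₀
  | k + 1 => euler G y₀ h k + h • G (euler G y₀ h k)

theorem norm_euler_sub_le {G : F → F} {y₀ : F} {h : ℝ} (hh : 0 ≤ h) {g : F} {ε : ℝ} {k l : ℕ} (hkl : k ≤ l)
    (H : ∀ j, k ≤ j → j < l → ‖G (euler G y₀ h j) - g‖ ≤ ε) :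
    ‖euler G y₀ h l - euler G y₀ h k - (((l : ℝ) - k) * h) • g‖ ≤ ε * (((l : ℝ) - k) * h) := by
  induction l, hkl using Nat.le_induction with
  | base => simp
  | succ l hkl ih =>
    have h1 := ih fun j hj hjl => H j hj (hjl.trans (Nat.lt_succ_self l))
    have h2 := H l hkl (Nat.lt_succ_self l)
    have e : euler G y₀ h (l + 1) - euler G y₀ h k - ((((l + 1 : ℕ) : ℝ) - k) * h) • g =
        (euler G y₀ h l - euler G y₀ h k - (((l : ℝ) - k) * h) • g) + h • (G (euler G y₀ h l) - g) := by
      rw [euler]; push_cast; module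
    rw [e]
    refine (norm_add_le _ _).trans ?_
    rw [norm_smul, Real.norm_eq_abs, abs_of_nonneg hh]
    have h3 := mul_le_mul_of_nonneg_left h2 hh
    push_cast
    linarith

/-- Peano's theorem for a bounded continuous vector field. -/
theorem exists_right_solution [ProperSpace F] {G : F → F} (hG : Continuous G) {M : ℝ} (hM : ∀ y, ‖G y‖ ≤ M)
    (y₀ : F) : ∃ y : ℝ → F, Continuous y ∧ y 0 = y₀ ∧
      ∀ s, 0 ≤ s → HasDerivWithinAt y (G (y s)) (Ici s) s := by
  have hM0 : 0 ≤ M := (norm_nonneg _).trans (hM 0)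
  set N : ℕ → ℝ := fun n => (n : ℝ) + 1 with hN
  have hNpos : ∀ n, 0 < N n := fun n => by positivity
  have hNt : Tendsto N atTop atTop := tendsto_atTop_add_const_right _ _ tendsto_natCast_atTop_atTop
  set yn : ℕ → ℝ → F := fun n s => euler G y₀ (N n)⁻¹ ⌊s * N n⌋₊ with hyn
  set d : ℕ → ℝ → ℝ → ℝ := fun n s t => ((⌊t * N n⌋₊ : ℝ) - ⌊s * N n⌋₊) * (N n)⁻¹ with hd
  -- Limits along a nonprincipal ultrafilter exist by compactness at every parameter simultaneously,
  -- so no subsequence of the Euler polygons has to be extracted.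
  let U : Ultrafilter ℕ := hyperfilter ℕ
  have hU : (U : Filter ℕ) ≤ atTop := Nat.hyperfilter_le_atTop
  have hdt : ∀ s t, 0 ≤ s → 0 ≤ t → Tendsto (fun n => d n s t) U (𝓝 (t - s)) := fun s t hs ht => by
    have h1 := ((tendsto_nat_floor_mul_div_atTop ht).comp hNt).sub
      ((tendsto_nat_floor_mul_div_atTop hs).comp hNt)
    refine (h1.congr fun n => ?_).mono_left hU
    simp only [hd, Function.comp_apply, div_eq_mul_inv]; ring
  have hfl : ∀ n s t, s ≤ t → ⌊s * N n⌋₊ ≤ ⌊t * N n⌋₊ := fun n s t hst =>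
    Nat.floor_le_floor (mul_le_mul_of_nonneg_right hst (hNpos n).le)
  have hstep : ∀ n (g : F) (ε s t : ℝ), s ≤ t →
      (∀ j, ⌊s * N n⌋₊ ≤ j → j < ⌊t * N n⌋₊ → ‖G (euler G y₀ (N n)⁻¹ j) - g‖ ≤ ε) →
      ‖yn n t - yn n s - d n s t • g‖ ≤ ε * d n s t := fun n g ε s t hst H =>
    norm_euler_sub_le (inv_nonneg.2 (hNpos n).le) (hfl n s t hst) H
  have hlip : ∀ n s t, s ≤ t → ‖yn n t - yn n s‖ ≤ M * d n s t := fun n s t hst => by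
    have := hstep n 0 M s t hst fun j _ _ => by rw [sub_zero]; exact hM _
    simpa using this
  have hyn0 : ∀ n, yn n 0 = y₀ := fun n => by simp [hyn, euler]
  have hlim : ∀ s, ∃ z, 0 ≤ s → Tendsto (fun n => yn n s) U (𝓝 z) := fun s => by
    by_cases hs : 0 ≤ s
    · have hb : ∀ᶠ n in (U : Filter ℕ), yn n s ∈ Metric.closedBall y₀ (M * (s + 1)) := by
        have h1 := (hdt 0 s le_rfl hs).eventually (eventually_le_nhds (show s - 0 < s + 1 by linarith))
        filter_upwards [h1] with n hn
        rw [mem_closedBall_iff_norm, ← hyn0 n]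
        exact (hlip n 0 s hs).trans (mul_le_mul_of_nonneg_left hn hM0)
      obtain ⟨z, _, hz⟩ := (isCompact_closedBall y₀ (M * (s + 1))).ultrafilter_le_nhds
        (U.map fun n => yn n s) (le_principal_iff.2 hb)
      exact ⟨z, fun _ => hz⟩
    · exact ⟨0, fun h => absurd h hs⟩
  choose z hz using hlim
  have hzlip : ∀ s t, 0 ≤ s → s ≤ t → ‖z t - z s‖ ≤ M * (t - s) := fun s t hs hst =>
    le_of_tendsto_of_tendsto' ((hz t (hs.trans hst)).sub (hz s hs)).norm
      ((hdt s t hs (hs.trans hst)).const_mul M) fun n => hlip n s t hst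
  have hz0 : z 0 = y₀ := tendsto_nhds_unique (hz 0 le_rfl) (by simp only [hyn0]; exact tendsto_const_nhds)
  have hzd : ∀ s, 0 ≤ s → HasDerivWithinAt z (G (z s)) (Ici s) s := fun s hs => by
    rw [hasDerivWithinAt_iff_isLittleO]
    refine Asymptotics.isLittleO_iff.2 fun ε hε => ?_
    obtain ⟨δ, hδ, hball⟩ := Metric.continuousAt_iff.1 (hG.continuousAt (x := z s)) ε hε
    -- Over a parameter interval of length η the Euler points move by at most δ/3, so they stay
    -- where G is within ε of its value at z s.
    obtain ⟨η, hη, hMη⟩ : ∃ η > 0, M * η ≤ δ / 3 :=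
      ⟨δ / 3 / (M + 1), by positivity, by
        rw [mul_div_assoc', div_le_iff₀ (by positivity)]; nlinarith⟩
    filter_upwards [self_mem_nhdsWithin, mem_nhdsWithin_of_mem_nhds (Iio_mem_nhds (show s < s + η / 2 by linarith))]
      with t ht htη
    have hst : s ≤ t := ht
    have hlt : t < s + η / 2 := htη
    have ht0 := hs.trans hst
    have h1 : ∀ᶠ n in (U : Filter ℕ), ‖yn n s - z s‖ < δ / 3 := by
      have := (tendsto_iff_norm_sub_tendsto_zero.1 (hz s hs)).eventually (gt_mem_nhds (show 0 < δ / 3 by positivity))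
      exact this
    have h2 := (hdt s t hs ht0).eventually (gt_mem_nhds (show t - s < η by linarith))
    have h3 : ∀ᶠ n in (U : Filter ℕ), ‖yn n t - yn n s - d n s t • G (z s)‖ ≤ ε * d n s t := by
      filter_upwards [h1, h2] with n hn1 hn2
      refine hstep n _ ε s t hst fun j hj hjl => ?_
      rw [← dist_eq_norm]
      refine (hball ?_).le
      have h4 := norm_euler_sub_le (G := G) (y₀ := y₀) (inv_nonneg.2 (hNpos n).le) (g := 0) (ε := M) hj
        fun i _ _ => by rw [sub_zero]; exact hM _
      rw [smul_zero, sub_zero] at h4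
      have h5 : ((j : ℝ) - ⌊s * N n⌋₊) * (N n)⁻¹ ≤ d n s t := by
        have : (j : ℝ) ≤ ⌊t * N n⌋₊ := by exact_mod_cast hjl.le
        have := inv_nonneg.2 (hNpos n).le
        simp only [hd]
        gcongr
      rw [dist_eq_norm]
      calc ‖euler G y₀ (N n)⁻¹ j - z s‖ ≤ ‖euler G y₀ (N n)⁻¹ j - yn n s‖ + ‖yn n s - z s‖ := norm_sub_le_norm_sub_add_norm_sub _ _ _
        _ ≤ M * η + ‖yn n s - z s‖ := by
          gcongr
          exact h4.trans (mul_le_mul_of_nonneg_left (h5.trans hn2.le) hM0)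
        _ < δ := by linarith
    have h6 := le_of_tendsto_of_tendsto (((hz t ht0).sub (hz s hs)).sub
      ((hdt s t hs ht0).smul_const (G (z s)))).norm ((hdt s t hs ht0).const_mul ε) h3
    rwa [Real.norm_eq_abs, abs_of_nonneg (by linarith : 0 ≤ t - s)]
  refine ⟨fun s => z (max s 0), ?_, by simp [hz0], fun s hs => ?_⟩
  · refine (LipschitzWith.of_dist_le_mul (K := M.toNNReal) fun s t => ?_).continuous
    rw [dist_eq_norm, Real.dist_eq, Real.coe_toNNReal _ hM0]
    refine le_trans ?_ (mul_le_mul_of_nonneg_left (abs_max_sub_max_le_abs s t 0) hM0)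
    rcases le_total (max s 0) (max t 0) with h | h
    · rw [norm_sub_rev, abs_sub_comm, abs_of_nonneg (sub_nonneg.2 h)]
      exact hzlip _ _ (le_max_right _ _) h
    · rw [abs_of_nonneg (sub_nonneg.2 h)]
      exact hzlip _ _ (le_max_right _ _) h
  · have e : ∀ t ∈ Ici s, z (max t 0) = z t := fun t ht => by rw [max_eq_left (hs.trans ht)]
    simp only [max_eq_left hs]
    exact (hzd s hs).congr e (e s self_mem_Ici)

/-- The difference with the primitive of the continuous right derivative has vanishing right
derivative, hence is constant. -/
theorem hasDerivWithinAt_of_right [CompleteSpace F] {y e : ℝ → F} (hy : ContinuousOn y (Ici 0))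
    (he : ContinuousOn e (Ici 0)) (hd : ∀ s, 0 ≤ s → HasDerivWithinAt y (e s) (Ici s) s) {s : ℝ} (hs : 0 ≤ s) :
    HasDerivWithinAt y (e s) (Ici 0) s := by
  have hc : Continuous fun s => e (max s 0) := he.comp_continuous (by fun_prop) fun s => le_max_right s 0
  have hz := fun s => hasDerivAt_primitive' hc s
  have key : ∀ t, 0 ≤ t → y t = y 0 + ∫ r in (0 : ℝ)..t, e (max r 0) := fun t ht => by
    have h1 := constant_of_has_deriv_right_zero (a := 0) (b := t)
      (f := fun t => y t - ∫ r in (0 : ℝ)..t, e (max r 0))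
      ((hy.mono Icc_subset_Ici_self).sub fun x _ => (hz x).continuousAt.continuousWithinAt)
      (fun x hx => by
        refine ((hd x hx.1).sub (hz x).hasDerivWithinAt).congr_deriv ?_
        rw [max_eq_left hx.1, sub_self]) t ⟨ht, le_rfl⟩
    simp only [intervalIntegral.integral_same, sub_zero] at h1
    rw [← h1]; abel
  have h2 := ((hz s).const_add (y 0)).hasDerivWithinAt (s := Ici 0)
  rw [max_eq_left hs] at h2
  exact h2.congr (fun t ht => key t ht) (key s hs)

end Peano

/-- A function with nonnegative right derivatives does not decrease. -/
theorem le_of_right_deriv_nonneg {f f' : ℝ → ℝ} {T : ℝ} (hf : ContinuousOn f (Icc 0 T))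
    (hd : ∀ s ∈ Ico 0 T, HasDerivWithinAt f (f' s) (Ici s) s) (h0 : ∀ s ∈ Ico 0 T, 0 ≤ f' s) {s : ℝ}
    (hs : s ∈ Icc 0 T) : f 0 ≤ f s := by
  have := image_le_of_deriv_right_le_deriv_boundary (f := fun s => -f s) (f' := fun s => -f' s)
    (B := fun _ => -f 0) (B' := fun _ => 0) hf.neg (fun x hx => (hd x hx).neg) le_rfl continuousOn_const
    (fun x _ => (hasDerivAt_const x _).hasDerivWithinAt) (fun x hx => by linarith [h0 x hx]) hs
  linarith

/-- A geodesic may cross the axis, where the radius is not differentiable. It has a right derivative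
there, which is why the energy argument works with right derivatives throughout. -/
theorem hasDerivWithinAt_norm_zero {F : Type*} [NormedAddCommGroup F] [NormedSpace ℝ F] {f : ℝ → F} {f' : F}
    {s : ℝ} (hf : HasDerivWithinAt f f' (Ici s) s) (h0 : f s = 0) :
    HasDerivWithinAt (fun s => ‖f s‖) ‖f'‖ (Ici s) s := by
  rw [hasDerivWithinAt_iff_isLittleO] at hf ⊢
  refine Asymptotics.isLittleO_iff.2 fun ε hε => ?_
  filter_upwards [Asymptotics.isLittleO_iff.1 hf hε, self_mem_nhdsWithin] with t ht hts
  refine le_trans ?_ ht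
  have hts' : 0 ≤ t - s := sub_nonneg.2 hts
  rw [h0, norm_zero, sub_zero, sub_zero, smul_eq_mul,
    show (t - s) * ‖f'‖ = ‖(t - s) • f'‖ by rw [norm_smul, Real.norm_eq_abs, abs_of_nonneg hts']]
  exact abs_norm_sub_norm_le _ _

/-! ### Energy estimates for causal geodesics -/

section Geodesics

variable {M : ℝ} {a a₀ a₁ b b₀ b₁ : ℝ → ℝ → ℝ} (ha : Coeff M a a₀ a₁) (hb : Coeff M b b₀ b₁)

theorem met_timeDir (a b : ℝ → ℝ → ℝ) (P v : Coord) :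
    met a b P v timeDir = -((1 + lift a P) * xi P v + (1 + lift b P) * rho P v) := by
  have h1 : rho P timeDir = 0 := by simp [rho, timeDir]
  have h2 : xi P timeDir = 1 := by rw [xi, h1, sub_zero]; rfl
  have h3 : v.1 = xi P v + rho P v := by simp [xi]
  rw [met_apply, h1, h2, h3]
  simp [timeDir]; ring

theorem met_self (a b : ℝ → ℝ → ℝ) (P v : Coord) : met a b P v v = ‖v.2‖ ^ 2 - rho P v ^ 2
    - xi P v * ((1 + lift a P) * xi P v + 2 * (1 + lift b P) * rho P v) := by
  have h3 : v.1 = xi P v + rho P v := by simp [xi]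
  rw [met_apply, real_inner_self_eq_norm_sq, h3]; ring

include ha hb

/-- With α = 1 + a and β = 1 + b, the energy is E = αξ + βρ, and causality gives ξ(αξ + 2βρ) ≥
|v.2|² - ρ² ≥ 0. A negative ξ would make αξ + 2βρ ≤ 0 and so 2E = αξ + (αξ + 2βρ) < 0. Hence both
factors are nonnegative and bounded by multiples of E, and the remaining bounds follow. -/
theorem causal_bounds {P v : Coord} (h1 : met a b P v v ≤ 0) {E : ℝ} (hE : met a b P v timeDir = -E)
    (hE0 : 0 < E) : 0 ≤ xi P v ∧ xi P v ≤ 4 * E ∧ |rho P v| ≤ 3 * E ∧ ‖v‖ ≤ 7 * E := by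
  have hA := abs_le.1 (ha.small (P.1 - ‖P.2‖) _ (norm_nonneg P.2))
  have hB := abs_le.1 (hb.small (P.1 - ‖P.2‖) _ (norm_nonneg P.2))
  have hr := abs_rho_le P v
  have hv1 : v.1 = xi P v + rho P v := by simp [xi]
  rw [met_self] at h1
  rw [met_timeDir, neg_inj] at hE
  change -(1 / 100) ≤ lift a P ∧ lift a P ≤ 1 / 100 at hA
  change -(1 / 100) ≤ lift b P ∧ lift b P ≤ 1 / 100 at hB
  set ξ := xi P v
  set ρ := rho P v
  set α := 1 + lift a P with hα
  set β := 1 + lift b P with hβ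
  have hα1 : 99 / 100 ≤ α := by linarith
  have hα2 : α ≤ 101 / 100 := by linarith
  have hβ1 : 99 / 100 ≤ β := by linarith
  have hβ2 : β ≤ 101 / 100 := by linarith
  have hρ2 : ρ ^ 2 ≤ ‖v.2‖ ^ 2 := by
    rw [← sq_abs ρ]; exact pow_le_pow_left₀ (abs_nonneg _) hr 2
  have hnn : 0 ≤ ξ * (α * ξ + 2 * β * ρ) := by linarith
  have hξ : 0 ≤ ξ := by
    by_contra hneg
    push Not at hneg
    have h2 : α * ξ + 2 * β * ρ ≤ 0 := by
      by_contra h3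
      push Not at h3
      have := mul_neg_of_neg_of_pos hneg h3
      linarith
    have h4 : α * ξ < 0 := mul_neg_of_pos_of_neg (by linarith) hneg
    linarith
  have hsum : 0 ≤ α * ξ + 2 * β * ρ := by
    rcases hξ.eq_or_lt with h0 | h0
    · rw [← h0, mul_zero, zero_add] at hE ⊢; linarith
    · exact nonneg_of_mul_nonneg_right hnn h0
  have hξ4 : ξ ≤ 4 * E := by nlinarith
  have hρu : ρ ≤ 3 * E := by
    by_contra h3
    push Not at h3
    nlinarith
  have hρl : -(3 * E) ≤ ρ := by
    by_contra h3
    push Not at h3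
    nlinarith
  refine ⟨hξ, hξ4, abs_le.2 ⟨hρl, hρu⟩, ?_⟩
  have hN : ‖v.2‖ ^ 2 ≤ (7 * E) ^ 2 := by
    have h5 : α * ξ + 2 * β * ρ ≤ 2 * E := by nlinarith [mul_nonneg (by linarith : 0 ≤ α) hξ]
    have h6 : ξ * (α * ξ + 2 * β * ρ) ≤ 4 * E * (2 * E) := mul_le_mul hξ4 h5 hsum (by linarith)
    have h7 : ρ ^ 2 ≤ (3 * E) ^ 2 := sq_le_sq' hρl hρu
    nlinarith
  rw [Prod.norm_def, max_le_iff, Real.norm_eq_abs, abs_le, hv1]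
  refine ⟨⟨by linarith, by linarith⟩, abs_le_of_sq_le_sq' hN (by linarith) |>.2⟩

/-- The energy of a causal geodesic is bounded above and below. -/
theorem energy_bounds {x v v' : ℝ → Coord} {T : ℝ} (hT0 : 0 < T) (cx : ContinuousOn x (Icc 0 T))
    (cv : ContinuousOn v (Icc 0 T)) (hx : ∀ s ∈ Ico 0 T, HasDerivWithinAt x (v s) (Ici s) s)
    (hv : ∀ s ∈ Ico 0 T, HasDerivWithinAt v (v' s) (Ici s) s)
    (hgeo : ∀ s ∈ Ico 0 T, ∀ Z, met a b (x s) (v' s) Z + fderiv ℝ (met a b) (x s) (v s) (v s) Z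
      - 1 / 2 * fderiv ℝ (met a b) (x s) Z (v s) (v s) = 0)
    (hpos : ∀ s ∈ Ico 0 T, met a b (x s) (v s) timeDir < 0) (h0 : met a b (x 0) (v 0) (v 0) ≤ 0)
    (hd0 : x 0 ∈ domain) {s : ℝ} (hs : s ∈ Icc 0 T) :
    met a b (x s) (v s) (v s) ≤ 0 ∧ x s ∈ domain ∧
      Real.exp (-(5 * M)) * -met a b (x 0) (v 0) timeDir ≤ -met a b (x s) (v s) timeDir ∧
      -met a b (x s) (v s) timeDir ≤ Real.exp (5 * M) * -met a b (x 0) (v 0) timeDir := by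
  have hM := ha.nonneg
  have hmetc : Continuous (met a b) := (contDiff_met ha hb).continuous
  have hmd : ∀ s ∈ Ico 0 T, HasDerivWithinAt (fun s => met a b (x s)) (fderiv ℝ (met a b) (x s) (v s)) (Ici s) s :=
    fun s hs => (((contDiff_met ha hb).differentiable one_ne_zero (x s)).hasFDerivAt).comp_hasDerivWithinAt s (hx s hs)
  have cm : ContinuousOn (fun s => met a b (x s)) (Icc 0 T) := hmetc.comp_continuousOn cx
  have cE : ContinuousOn (fun s => met a b (x s) (v s) timeDir) (Icc 0 T) :=
    (cm.clm_apply cv).clm_apply continuousOn_const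
  -- The squared length of the velocity is conserved, by the geodesic equation tested with the
  -- velocity itself.
  have hself : ∀ s ∈ Icc 0 T, met a b (x s) (v s) (v s) = met a b (x 0) (v 0) (v 0) :=
    constant_of_has_deriv_right_zero (f := fun s => met a b (x s) (v s) (v s))
      ((cm.clm_apply cv).clm_apply cv) fun s hs => by
      refine (((hmd s hs).clm_apply (hv s hs)).clm_apply (hv s hs)).congr_deriv ?_
      have := hgeo s hs (v s)
      have e := met_symm a b (x s) (v s) (v' s)
      simp only [add_apply]
      linarith
  have hcausal : ∀ s ∈ Icc 0 T, met a b (x s) (v s) (v s) ≤ 0 := fun s hs => (hself s hs).trans_le h0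
  -- the time at the centre
  set τ : ℝ → ℝ := fun s => (x s).1 - ‖(x s).2‖ with hτ
  have cτ : ContinuousOn τ (Icc 0 T) :=
    (continuous_fst.comp_continuousOn cx).sub (continuous_snd.comp_continuousOn cx).norm
  have hτd : ∀ s ∈ Ico 0 T, HasDerivWithinAt τ
      (if (x s).2 = 0 then (v s).1 - ‖(v s).2‖ else xi (x s) (v s)) (Ici s) s := fun s hs => by
    have hx1 : HasDerivWithinAt (fun s => (x s).1) (v s).1 (Ici s) s :=
      (ContinuousLinearMap.fst ℝ ℝ (EuclideanSpace ℝ (Fin 3))).hasFDerivAt.comp_hasDerivWithinAt s (hx s hs)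
    have hx2 : HasDerivWithinAt (fun s => (x s).2) (v s).2 (Ici s) s :=
      (ContinuousLinearMap.snd ℝ ℝ (EuclideanSpace ℝ (Fin 3))).hasFDerivAt.comp_hasDerivWithinAt s (hx s hs)
    split_ifs with h
    · exact hx1.sub (hasDerivWithinAt_norm_zero hx2 h)
    · have h1 := hx2.norm_sq.sqrt (pow_ne_zero 2 (norm_ne_zero_iff.2 h))
      simp only [Real.sqrt_sq (norm_nonneg _)] at h1
      refine (hx1.sub h1).congr_deriv ?_
      rw [xi, rho]
      have : ‖(x s).2‖ ≠ 0 := norm_ne_zero_iff.2 h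
      field_simp
  set τ' : ℝ → ℝ := fun s => if (x s).2 = 0 then (v s).1 - ‖(v s).2‖ else xi (x s) (v s) with hτ'
  set En : ℝ → ℝ := fun s => -met a b (x s) (v s) timeDir with hEn
  have hEpos : ∀ s ∈ Ico 0 T, 0 < En s := fun s hs => neg_pos.2 (hpos s hs)
  have hcb := fun s (hs : s ∈ Ico 0 T) => causal_bounds ha hb (hcausal s ⟨hs.1, hs.2.le⟩)
    (neg_neg (met a b (x s) (v s) timeDir)).symm (hEpos s hs)
  -- Off the axis the rate of τ is ξ ≥ 0. On the axis it is v.1 - |v.2|, nonnegative because the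
  -- metric is Minkowski there. So τ does not decrease and the curve stays in the domain.
  have hτ'0 : ∀ s ∈ Ico 0 T, 0 ≤ τ' s := fun s hs => by
    simp only [hτ']
    split_ifs with h
    · have h1 := hcausal s ⟨hs.1, hs.2.le⟩
      have h2 := (hcb s hs).1
      have r0 : rho (x s) (v s) = 0 := by simp [rho, h]
      have l0 : lift a (x s) = 0 := by
        have := ha.bd ((x s).1 - ‖(x s).2‖) _ (norm_nonneg (x s).2)
        rw [h, norm_zero, zero_mul, mul_zero] at this
        have := abs_nonpos_iff.1 this
        rw [lift, h, norm_zero]; exact this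
      rw [met_self, r0, l0] at h1
      rw [xi, r0, sub_zero] at h1 h2
      have : ‖(v s).2‖ ^ 2 ≤ (v s).1 ^ 2 := by linarith
      linarith [abs_le_of_sq_le_sq' this h2]
    · exact (hcb s hs).1
  have hτ0 : 0 ≤ τ 0 := sub_nonneg.2 hd0
  have hτs : ∀ s ∈ Icc 0 T, 0 ≤ τ s := fun s hs => hτ0.trans (le_of_right_deriv_nonneg cτ hτd hτ'0 hs)
  have hEd : ∀ s ∈ Ico 0 T, HasDerivWithinAt En (-(1 / 2 * fderiv ℝ (met a b) (x s) timeDir (v s) (v s))) (Ici s) s :=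
    fun s hs => by
      refine (((hmd s hs).clm_apply (hv s hs)).clm_apply (hasDerivWithinAt_const _ _ timeDir)).neg.congr_deriv ?_
      have := hgeo s hs timeDir
      simp only [add_apply, map_zero, add_zero]
      linarith
  -- One half of the time derivative of the metric is ξ/2 times a factor at most M/(1+τ)² · (4E + 2
  -- · 3E), whence the constant 5M.
  have hEb : ∀ s ∈ Ico 0 T, |1 / 2 * fderiv ℝ (met a b) (x s) timeDir (v s) (v s)| ≤
      5 * M * (τ' s / (1 + τ s) ^ 2) * En s := fun s hs => by
    obtain ⟨c1, c2, c3, _⟩ := hcb s hs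
    have hE := hEpos s hs
    have hτn := hτs s ⟨hs.1, hs.2.le⟩
    have ht0 := hτ'0 s hs
    rw [fderiv_met_time ha hb]
    simp only [hτ'] at ht0 ⊢
    split_ifs at ht0 ⊢ with h
    · rw [mul_zero, abs_zero]; positivity
    · have d1 := ha.bd₀ (τ s) _ (norm_nonneg (x s).2)
      have d2 := hb.bd₀ (τ s) _ (norm_nonneg (x s).2)
      rw [max_eq_left hτn] at d1 d2
      have hm : M * min ‖(x s).2‖ 1 / (1 + τ s) ^ 2 ≤ M / (1 + τ s) ^ 2 := by
        gcongr; exact mul_le_of_le_one_right hM (min_le_right _ _)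
      have d1' := d1.trans hm
      have d2' := d2.trans hm
      have e : (1 : ℝ) / 2 * (-a₀ (τ s) ‖(x s).2‖ * xi (x s) (v s) ^ 2
          - 2 * b₀ (τ s) ‖(x s).2‖ * (xi (x s) (v s) * rho (x s) (v s))) =
          -(1 / 2) * xi (x s) (v s) * (a₀ (τ s) ‖(x s).2‖ * xi (x s) (v s)
            + 2 * (b₀ (τ s) ‖(x s).2‖ * rho (x s) (v s))) := by ring
      change |(1 : ℝ) / 2 * (-a₀ (τ s) ‖(x s).2‖ * xi (x s) (v s) ^ 2
          - 2 * b₀ (τ s) ‖(x s).2‖ * (xi (x s) (v s) * rho (x s) (v s)))| ≤ _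
      rw [e, abs_mul, abs_mul, abs_neg, abs_of_nonneg c1, abs_of_nonneg (by norm_num : (0 : ℝ) ≤ 1 / 2)]
      have k1 : |a₀ (τ s) ‖(x s).2‖ * xi (x s) (v s)| ≤ M / (1 + τ s) ^ 2 * (4 * En s) := by
        rw [abs_mul, abs_of_nonneg c1]
        exact mul_le_mul d1' c2 c1 (by positivity)
      have k2 : |2 * (b₀ (τ s) ‖(x s).2‖ * rho (x s) (v s))| ≤ 2 * (M / (1 + τ s) ^ 2 * (3 * En s)) := by
        rw [abs_mul, abs_mul, abs_two]
        exact mul_le_mul_of_nonneg_left (mul_le_mul d2' c3 (abs_nonneg _) (by positivity)) zero_le_two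
      have k3 := (abs_add_le _ _).trans (add_le_add k1 k2)
      have k4 := mul_le_mul_of_nonneg_left k3 (show 0 ≤ 1 / 2 * xi (x s) (v s) by positivity)
      refine k4.trans_eq ?_
      ring
  -- Since the rate 5M τ'/(1+τ)² is minus the derivative of 5M/(1+τ), the product of E with
  -- exp(c/(1+τ)) is nondecreasing for c = -5M and nonincreasing for c = 5M.
  have hψ : ∀ c : ℝ, ∀ s ∈ Ico 0 T, HasDerivWithinAt (fun s => En s * Real.exp (c / (1 + τ s)))
      ((-(1 / 2 * fderiv ℝ (met a b) (x s) timeDir (v s) (v s))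
        - c * (τ' s / (1 + τ s) ^ 2) * En s) * Real.exp (c / (1 + τ s))) (Ici s) s := fun c s hs => by
    have hτn := hτs s ⟨hs.1, hs.2.le⟩
    have h1 : HasDerivWithinAt (fun s => c / (1 + τ s)) (-(c * τ' s) / (1 + τ s) ^ 2) (Ici s) s := by
      refine ((hasDerivWithinAt_const _ _ c).div ((hτd s hs).const_add 1) (by positivity)).congr_deriv ?_
      simp [hτ']
    refine ((hEd s hs).mul h1.exp).congr_deriv ?_
    ring
  have cψ : ∀ c : ℝ, ContinuousOn (fun s => En s * Real.exp (c / (1 + τ s))) (Icc 0 T) := fun c =>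
    cE.neg.mul ((continuousOn_const.div (continuousOn_const.add cτ) fun s hs => by
      exact (add_pos_of_pos_of_nonneg one_pos (hτs s hs)).ne').rexp)
  have hE0 : 0 < En 0 := hEpos 0 ⟨le_rfl, hT0⟩
  -- Positivity of the energy is assumed only before T; at T itself it is recovered from the
  -- monotone quantity.
  have hEs : 0 ≤ En s := by
    have h1 := le_of_right_deriv_nonneg (cψ (-(5 * M))) (hψ (-(5 * M))) (fun s hs => by
      refine mul_nonneg ?_ (Real.exp_pos _).le
      have := (abs_le.1 (hEb s hs)).2
      linarith) hs
    have h2 := (mul_pos hE0 (Real.exp_pos (-(5 * M) / (1 + τ 0)))).trans_le h1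
    exact (pos_of_mul_pos_left h2 (Real.exp_pos _).le).le
  refine ⟨hcausal s hs, sub_nonneg.1 (hτs s hs), ?_, ?_⟩
  · have h1 := le_of_right_deriv_nonneg (cψ (-(5 * M))) (hψ (-(5 * M))) (fun s hs => by
      refine mul_nonneg ?_ (Real.exp_pos _).le
      have := (abs_le.1 (hEb s hs)).2
      linarith) hs
    have h2 : Real.exp (-(5 * M)) ≤ Real.exp (-(5 * M) / (1 + τ 0)) := by
      rw [Real.exp_le_exp, neg_div, neg_le_neg_iff]
      exact div_le_self (by positivity) (by linarith)
    have h3 : Real.exp (-(5 * M) / (1 + τ s)) ≤ 1 := by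
      rw [Real.exp_le_one_iff]
      have := hτs s hs
      exact div_nonpos_of_nonpos_of_nonneg (by linarith) (by linarith)
    change Real.exp (-(5 * M)) * En 0 ≤ En s
    calc Real.exp (-(5 * M)) * En 0 ≤ Real.exp (-(5 * M) / (1 + τ 0)) * En 0 := by gcongr
      _ = En 0 * Real.exp (-(5 * M) / (1 + τ 0)) := mul_comm _ _
      _ ≤ En s * Real.exp (-(5 * M) / (1 + τ s)) := h1
      _ ≤ En s := mul_le_of_le_one_right hEs h3
  · have h1 := le_of_right_deriv_nonneg (cψ (5 * M)).neg (fun s hs => (hψ (5 * M) s hs).neg) (fun s hs => by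
      rw [← neg_mul]
      refine mul_nonneg ?_ (Real.exp_pos _).le
      have := (abs_le.1 (hEb s hs)).1
      linarith) hs
    have h1' := neg_le_neg_iff.1 h1
    have h2 : Real.exp (5 * M / (1 + τ 0)) ≤ Real.exp (5 * M) := by
      rw [Real.exp_le_exp]
      exact div_le_self (by positivity) (by linarith)
    have h3 : 1 ≤ Real.exp (5 * M / (1 + τ s)) := by
      have := hτs s hs
      exact Real.one_le_exp (by positivity)
    change En s ≤ Real.exp (5 * M) * En 0
    calc En s ≤ En s * Real.exp (5 * M / (1 + τ s)) := le_mul_of_one_le_right hEs h3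
      _ ≤ En 0 * Real.exp (5 * M / (1 + τ 0)) := h1'
      _ = Real.exp (5 * M / (1 + τ 0)) * En 0 := mul_comm _ _
      _ ≤ Real.exp (5 * M) * En 0 := by gcongr

end Geodesics

end

/-! ### Lorentzian signature and future completeness -/

section

theorem uniqueDiffOn_domain : UniqueDiffOn ℝ domain := by
  refine uniqueDiffOn_convex ?_ ⟨(1, 0), ?_⟩
  · intro P hP Q hQ s t hs ht hst
    have hP' : ‖P.2‖ ≤ P.1 := hP
    have hQ' : ‖Q.2‖ ≤ Q.1 := hQ
    change ‖s • P.2 + t • Q.2‖ ≤ s * P.1 + t * Q.1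
    refine (norm_add_le _ _).trans ?_
    rw [norm_smul, norm_smul, Real.norm_eq_abs, Real.norm_eq_abs, abs_of_nonneg hs, abs_of_nonneg ht]
    gcongr
  · refine mem_interior.2 ⟨{P | ‖P.2‖ < P.1}, fun P hP => show ‖P.2‖ ≤ P.1 from le_of_lt hP, ?_, by simp⟩
    exact isOpen_lt continuous_snd.norm continuous_fst

set_option maxSynthPendingDepth 3 in
theorem continuous_force {E : Type*} [NormedAddCommGroup E] [NormedSpace ℝ E] {B : E → E →L[ℝ] E →L[ℝ] ℝ}
    (hB : ContDiff ℝ 1 B) : Continuous fun y : E × E =>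
      (1 / 2 : ℝ) • ((fderiv ℝ B y.1).flip y.2).flip y.2 - fderiv ℝ B y.1 y.2 y.2 := by
  have hD : Continuous fun y : E × E => fderiv ℝ B y.1 :=
    (hB.continuous_fderiv one_ne_zero).comp continuous_fst
  have hf1 : Continuous fun y : E × E => (fderiv ℝ B y.1).flip y.2 :=
    ((ContinuousLinearMap.flipₗᵢ ℝ E E (E →L[ℝ] ℝ)).continuous.comp hD).clm_apply continuous_snd
  have hf2 : Continuous fun y : E × E => ((fderiv ℝ B y.1).flip y.2).flip y.2 :=
    ((ContinuousLinearMap.flipₗᵢ ℝ E E ℝ).continuous.comp hf1).clm_apply continuous_snd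
  exact (hf2.const_smul (1 / 2 : ℝ)).sub ((hD.clm_apply continuous_snd).clm_apply continuous_snd)

section Completeness

variable {M : ℝ} {a a₀ a₁ b b₀ b₁ : ℝ → ℝ → ℝ} (ha : Coeff M a a₀ a₁) (hb : Coeff M b b₀ b₁)
include ha hb

theorem fderivWithin_eq {q : Coord → Coord → Coord → ℝ} (hq : ∀ P ∈ domain, ∀ v w, q P v w = met a b P v w)
    {P : Coord} (hP : P ∈ domain) (v w Z : Coord) :
    fderivWithin ℝ (fun P => q P v w) domain P Z = fderiv ℝ (met a b) P Z v w := by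
  rw [fderivWithin_congr (fun Q hQ => hq Q hQ v w) (hq P hP v w),
    ((contDiff_met_apply ha hb v w).1.differentiable one_ne_zero P).fderivWithin (uniqueDiffOn_domain P hP),
    fderiv_met_apply ha hb]

/-- Orthogonality to ∂_t means βρ = -αξ, with α = 1 + a and β = 1 + b. The quadratic form then
becomes |w.2|² - ρ² + αξ², a sum of nonnegative terms that vanishes only for w = 0. -/
theorem isLorentzian {q : Coord → Coord → Coord → ℝ} (hq : ∀ P ∈ domain, ∀ v w, q P v w = met a b P v w) :
    IsLorentzian q domain timeDir := by
  refine ⟨fun v w => ((contDiff_met_apply ha hb v w).1.contDiffOn).congr fun P hP => hq P hP v w,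
    fun P hP => ⟨?_, fun w hw h => ?_⟩⟩
  · have hA := abs_le.1 (ha.small (P.1 - ‖P.2‖) _ (norm_nonneg P.2))
    change -(1 / 100) ≤ lift a P ∧ lift a P ≤ 1 / 100 at hA
    have h1 : rho P timeDir = 0 := by simp [rho, timeDir]
    have h2 : xi P timeDir = 1 := by rw [xi, h1, sub_zero]; rfl
    rw [hq P hP, met_timeDir, h1, h2]
    linarith
  · have hA := abs_le.1 (ha.small (P.1 - ‖P.2‖) _ (norm_nonneg P.2))
    have hB := abs_le.1 (hb.small (P.1 - ‖P.2‖) _ (norm_nonneg P.2))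
    change -(1 / 100) ≤ lift a P ∧ lift a P ≤ 1 / 100 at hA
    change -(1 / 100) ≤ lift b P ∧ lift b P ≤ 1 / 100 at hB
    rw [hq P hP, met_symm, met_timeDir] at h
    rw [hq P hP, met_self]
    have hr := abs_rho_le P w
    have hρ2 : rho P w ^ 2 ≤ ‖w.2‖ ^ 2 := by
      rw [← sq_abs (rho P w)]; exact pow_le_pow_left₀ (abs_nonneg _) hr 2
    have hβ : (1 + lift b P) * rho P w = -((1 + lift a P) * xi P w) := by linarith
    have e : xi P w * ((1 + lift a P) * xi P w + 2 * (1 + lift b P) * rho P w) =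
        -((1 + lift a P) * xi P w ^ 2) := by
      rw [mul_assoc 2, hβ]; ring
    rw [e]
    have h0 : 0 ≤ (1 + lift a P) * xi P w ^ 2 := mul_nonneg (by linarith) (sq_nonneg _)
    by_contra hneg
    push Not at hneg
    have hξ : xi P w = 0 := by
      have : (1 + lift a P) * xi P w ^ 2 = 0 := by linarith
      rcases mul_eq_zero.1 this with h1 | h1
      · linarith
      · exact pow_eq_zero_iff two_ne_zero |>.1 h1
    have hρ : rho P w = 0 := by
      rw [hξ, mul_zero, neg_zero] at hβ
      rcases mul_eq_zero.1 hβ with h1 | h1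
      · linarith
      · exact h1
    have hw2 : w.2 = 0 := by
      rw [hξ, hρ] at hneg
      have : ‖w.2‖ ^ 2 ≤ 0 := by linarith
      exact norm_eq_zero.1 (pow_eq_zero_iff two_ne_zero |>.1 (le_antisymm this (sq_nonneg _)))
    have hw1 : w.1 = 0 := by
      have : w.1 = xi P w + rho P w := by simp [xi]
      rw [this, hξ, hρ, add_zero]
    exact hw (Prod.ext hw1 hw2)

/-- The force covector of the geodesic equation. -/
def force (a b : ℝ → ℝ → ℝ) (y : Coord × Coord) : Coord →L[ℝ] ℝ :=
  (1 / 2 : ℝ) • ((fderiv ℝ (met a b) y.1).flip y.2).flip y.2 - fderiv ℝ (met a b) y.1 y.2 y.2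

/-- The acceleration of the geodesic through `y.1` with velocity `y.2`. -/
def acc (a b : ℝ → ℝ → ℝ) (y : Coord × Coord) : Coord := (met a b y.1).inverse (force a b y)

theorem met_acc (y : Coord × Coord) : met a b y.1 (acc a b y) = force a b y := by
  obtain ⟨e, he⟩ := exists_unit_met ha hb y.1
  rw [acc, ← he, ContinuousLinearMap.inverse_equiv]
  exact e.apply_symm_apply _

theorem force_apply (y : Coord × Coord) (Z : Coord) : force a b y Z =
    1 / 2 * fderiv ℝ (met a b) y.1 Z y.2 y.2 - fderiv ℝ (met a b) y.1 y.2 y.2 Z := rfl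

theorem eq_acc_iff {y : Coord × Coord} {v' : Coord} : v' = acc a b y ↔ ∀ Z, met a b y.1 v' Z
    + fderiv ℝ (met a b) y.1 y.2 y.2 Z - 1 / 2 * fderiv ℝ (met a b) y.1 Z y.2 y.2 = 0 := by
  constructor
  · rintro rfl Z
    rw [met_acc ha hb, force_apply ha hb]; ring
  · intro h
    have h1 : met a b y.1 (v' - acc a b y) = 0 := by
      rw [map_sub, met_acc ha hb]
      refine ContinuousLinearMap.ext fun Z => ?_
      have := h Z
      change met a b y.1 v' Z - force a b y Z = 0
      rw [force_apply ha hb]; linarith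
    have h2 := norm_le_met ha hb y.1 (v' - acc a b y)
    rw [h1, norm_zero, mul_zero] at h2
    exact sub_eq_zero.1 (norm_le_zero_iff.1 h2)

theorem continuous_acc : Continuous (acc a b) := by
  have hc := contDiff_met ha hb
  have hF : Continuous (force a b) := continuous_force hc
  have hI : Continuous fun y : Coord × Coord => (met a b y.1).inverse := by
    refine continuous_iff_continuousAt.2 fun y => ?_
    obtain ⟨e, he⟩ := exists_unit_met ha hb y.1
    have h1 := (contDiffAt_map_inverse (𝕜 := ℝ) (n := 0) e).continuousAt
    rw [he] at h1
    exact ContinuousAt.comp (g := ContinuousLinearMap.inverse) (f := fun y : Coord × Coord => met a b y.1)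
      h1 (hc.continuous.comp continuous_fst).continuousAt
  exact hI.clm_apply hF

/-- The constants are uniform over the space-time, so a bound on the velocity alone bounds the
acceleration; this allows the continuation to an end point. -/
theorem norm_acc_le (y : Coord × Coord) : ‖acc a b y‖ ≤ 600 * M * ‖y.2‖ ^ 2 := by
  have hM := ha.nonneg
  refine (norm_le_met ha hb y.1 _).trans ?_
  rw [met_acc ha hb]
  have : ‖force a b y‖ ≤ 300 * M * ‖y.2‖ ^ 2 := by
    refine ContinuousLinearMap.opNorm_le_bound _ (by positivity) fun Z => ?_
    rw [force_apply ha hb, Real.norm_eq_abs]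
    refine (abs_sub _ _).trans ?_
    rw [abs_mul, abs_of_nonneg (by norm_num : (0 : ℝ) ≤ 1 / 2)]
    have h1 := abs_fderiv_met_le ha hb y.1 Z y.2 y.2
    have h2 := abs_fderiv_met_le ha hb y.1 y.2 y.2 Z
    nlinarith
  linarith

theorem isGeodesicOn_iff {q : Coord → Coord → Coord → ℝ} (hq : ∀ P ∈ domain, ∀ v w, q P v w = met a b P v w)
    {I : Set ℝ} {γ : ℝ → Coord} : IsGeodesicOn q domain I γ ↔ ContDiffOn ℝ 2 γ I ∧ MapsTo γ I domain ∧
      ∀ s ∈ I, derivWithin (derivWithin γ I) I s = acc a b (γ s, derivWithin γ I s) := by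
  refine and_congr_right fun _ => and_congr_right fun hm => forall₂_congr fun s hs => ?_
  rw [eq_acc_iff ha hb]
  refine forall_congr' fun Z => ?_
  rw [hq _ (hm hs), fderivWithin_eq ha hb hq (hm hs), fderivWithin_eq ha hb hq (hm hs)]

/-- Velocities truncated to norm at most `R`. -/
def trunc (R : ℝ) (v : Coord) : Coord := (R / max R ‖v‖) • v

theorem norm_trunc_le {R : ℝ} (hR : 0 < R) (v : Coord) : ‖trunc R v‖ ≤ R := by
  have : 0 < max R ‖v‖ := lt_max_of_lt_left hR
  rw [trunc, norm_smul, Real.norm_eq_abs, abs_of_pos (div_pos hR this), div_mul_eq_mul_div, div_le_iff₀ this]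
  gcongr
  exact le_max_right _ _

theorem trunc_eq {R : ℝ} (hR : 0 < R) {v : Coord} (hv : ‖v‖ ≤ R) : trunc R v = v := by
  rw [trunc, max_eq_left hv, div_self hR.ne', one_smul]

theorem continuous_trunc_vel {R : ℝ} (hR : 0 < R) : Continuous (trunc R) :=
  (continuous_const.div (continuous_const.max continuous_norm)
    fun v => (lt_max_of_lt_left hR).ne').smul continuous_id

/-- Extension of a causal solution of the geodesic equation to all future times. -/
theorem exists_extension {y₀ : ℝ → Coord × Coord} {β : ℝ} (hβ : 0 < β)
    (hd : ∀ s ∈ Ico 0 β, HasDerivWithinAt y₀ ((y₀ s).2, acc a b (y₀ s)) (Ico 0 β) s)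
    (hcaus : ∀ s ∈ Ico 0 β, met a b (y₀ s).1 (y₀ s).2 (y₀ s).2 ≤ 0 ∧ met a b (y₀ s).1 (y₀ s).2 timeDir < 0)
    (hdom : (y₀ 0).1 ∈ domain) :
    ∃ y : ℝ → Coord × Coord, EqOn y y₀ (Ico 0 β) ∧ (∀ s, 0 ≤ s → (y s).1 ∈ domain) ∧
      ∀ s, 0 ≤ s → HasDerivWithinAt y ((y s).2, acc a b (y s)) (Ici 0) s := by
  have hM := ha.nonneg
  have h0 : (0 : ℝ) ∈ Ico 0 β := ⟨le_rfl, hβ⟩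
  set E₀ := -met a b (y₀ 0).1 (y₀ 0).2 timeDir with hE₀
  have hE₀pos : 0 < E₀ := neg_pos.2 (hcaus 0 h0).2
  -- The energy grows by at most the factor exp(5M), and a causal velocity is at most 7 times the
  -- energy.
  set R₀ := 7 * (Real.exp (5 * M) * E₀) with hR₀
  have hR₀pos : 0 < R₀ := by positivity
  -- energy bounds along a solution
  have key : ∀ (y : ℝ → Coord × Coord) (T : ℝ), 0 < T → y 0 = y₀ 0 → ContinuousOn y (Icc 0 T) →
      (∀ s ∈ Ico 0 T, HasDerivWithinAt y ((y s).2, acc a b (y s)) (Ici s) s) →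
      (∀ s ∈ Ico 0 T, met a b (y s).1 (y s).2 timeDir < 0) → ∀ s ∈ Icc 0 T,
      (y s).1 ∈ domain ∧ met a b (y s).1 (y s).2 timeDir < 0 ∧ ‖(y s).2‖ ≤ R₀ := by
    intro y T hT hy0 hc hy hpos s hs
    have h1 := energy_bounds ha hb (x := fun s => (y s).1) (v := fun s => (y s).2)
      (v' := fun s => acc a b (y s)) hT (continuous_fst.comp_continuousOn hc) (continuous_snd.comp_continuousOn hc)
      (fun s hs => (ContinuousLinearMap.fst ℝ Coord Coord).hasFDerivAt.comp_hasDerivWithinAt s (hy s hs))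
      (fun s hs => (ContinuousLinearMap.snd ℝ Coord Coord).hasFDerivAt.comp_hasDerivWithinAt s (hy s hs))
      (fun s hs => (eq_acc_iff ha hb (y := y s)).1 rfl) hpos (by rw [hy0]; exact (hcaus 0 h0).1)
      (by rw [hy0]; exact hdom) hs
    simp only [hy0] at h1
    obtain ⟨c1, c2, c3, c4⟩ := h1
    have c5 : 0 < -met a b (y s).1 (y s).2 timeDir := lt_of_lt_of_le (by positivity) c3
    refine ⟨c2, neg_pos.1 c5, ?_⟩
    exact (causal_bounds ha hb c1 (neg_neg _).symm c5).2.2.2.trans (by rw [hR₀]; gcongr)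
  have hc₀ : ContinuousOn y₀ (Ico 0 β) := fun s hs => (hd s hs).continuousWithinAt
  have hright : ∀ s ∈ Ico 0 β, HasDerivWithinAt y₀ ((y₀ s).2, acc a b (y₀ s)) (Ici s) s := fun s hs =>
    (hd s hs).mono_of_mem_nhdsWithin (mem_of_superset (Ico_mem_nhdsGE hs.2) (Ico_subset_Ico_left hs.1))
  have hv₀ : ∀ s ∈ Ico 0 β, ‖(y₀ s).2‖ ≤ R₀ := fun s hs => by
    obtain ⟨T, hsT, hTβ⟩ := exists_between hs.2
    exact (key y₀ T (hs.1.trans_lt hsT) rfl (hc₀.mono fun r hr => ⟨hr.1, hr.2.trans_lt hTβ⟩)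
      (fun r hr => hright r ⟨hr.1, hr.2.trans hTβ⟩) (fun r hr => (hcaus r ⟨hr.1, hr.2.trans hTβ⟩).2)
      s ⟨hs.1, hsT.le⟩).2.2
  -- continuation to the end point
  set L : ℝ := max R₀ (600 * M * R₀ ^ 2) with hL
  have hL0 : 0 ≤ L := hR₀pos.le.trans (le_max_left _ _)
  have hlip : LipschitzOnWith L.toNNReal y₀ (Ico 0 β) := by
    refine (convex_Ico 0 β).lipschitzOnWith_of_nnnorm_hasDerivWithin_le hd fun s hs => ?_
    rw [← NNReal.coe_le_coe, Real.coe_toNNReal _ hL0, coe_nnnorm, Prod.norm_def]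
    refine max_le_max (hv₀ s hs) ((norm_acc_le ha hb _).trans ?_)
    have := hv₀ s hs
    gcongr
  obtain ⟨y₁, hy₁, hy₁e⟩ := hlip.extend_finite_dimension
  have hy₁c : Continuous y₁ := hy₁.continuous
  -- continuation by Peano's theorem
  set R := R₀ + 1 with hR
  have hRpos : 0 < R := by positivity
  set G : Coord × Coord → Coord × Coord := fun y => (trunc R y.2, acc a b (y.1, trunc R y.2)) with hG
  have ht : Continuous fun y : Coord × Coord => trunc R y.2 := (continuous_trunc_vel ha hb hRpos).comp continuous_snd
  have hGc : Continuous G := ht.prodMk ((continuous_acc ha hb).comp (continuous_fst.prodMk ht))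
  have hGb : ∀ y, ‖G y‖ ≤ max R (600 * M * R ^ 2) := fun y => by
    rw [Prod.norm_def]
    have h1 := norm_trunc_le ha hb hRpos y.2
    refine max_le_max h1 ((norm_acc_le ha hb _).trans ?_)
    gcongr
  have hGeq : ∀ y : Coord × Coord, ‖y.2‖ ≤ R → G y = (y.2, acc a b y) := fun y hy => by
    simp only [hG, trunc_eq ha hb hRpos hy]
  obtain ⟨y₂, hy₂c, hy₂0, hy₂⟩ := exists_right_solution hGc hGb (y₁ β)
  set y : ℝ → Coord × Coord := fun s => if s ≤ β then y₁ s else y₂ (s - β) with hy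
  have hyc : Continuous y := hy₁c.if_le (hy₂c.comp (continuous_id.sub continuous_const)) continuous_id
    continuous_const fun s hs => by rw [hs]; simp [hy₂0]
  have hy_left : ∀ s ≤ β, y s = y₁ s := fun s hs => if_pos hs
  have hy_right : ∀ s, β ≤ s → y s = y₂ (s - β) := fun s hs => by
    rcases hs.eq_or_lt with rfl | hs
    · rw [hy_left _ le_rfl, sub_self, hy₂0]
    · exact if_neg (not_le.2 hs)
  have hye : EqOn y y₀ (Ico 0 β) := fun s hs => by rw [hy_left s hs.2.le, hy₁e hs]
  have hyG : ∀ s, 0 ≤ s → HasDerivWithinAt y (G (y s)) (Ici s) s := fun s hs => by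
    rcases lt_or_ge s β with hsβ | hsβ
    · have hm : s ∈ Ico 0 β := ⟨hs, hsβ⟩
      have h1 := hGeq (y₀ s) ((hv₀ s hm).trans (by linarith))
      rw [hye hm, h1]
      refine (hright s hm).congr_of_eventuallyEq ?_ (hye hm)
      filter_upwards [Ico_mem_nhdsGE hsβ] with r hr
      exact hye ⟨hs.trans hr.1, hr.2⟩
    · rw [hy_right s hsβ]
      have h1 := (hy₂ (s - β) (sub_nonneg.2 hsβ)).scomp s
        (((hasDerivAt_id s).sub_const β).hasDerivWithinAt (s := Ici s))
        fun r hr => sub_le_sub_right hr β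
      rw [one_smul] at h1
      exact h1.congr (fun r hr => hy_right r (hsβ.trans hr)) (hy_right s hsβ)
  have hy0 : y 0 = y₀ 0 := hye h0
  -- the truncation is never active
  have hcE : Continuous fun s => met a b (y s).1 (y s).2 timeDir :=
    (((contDiff_met ha hb).continuous.comp (continuous_fst.comp hyc)).clm_apply
      (continuous_snd.comp hyc)).clm_apply continuous_const
  have hgood : ∀ s, 0 ≤ s → ‖(y s).2‖ < R ∧ met a b (y s).1 (y s).2 timeDir < 0 := by
    by_contra hcon
    push Not at hcon
    obtain ⟨s₀, hs₀, hbad⟩ := hcon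
    set Z := {s : ℝ | 0 ≤ s ∧ (R ≤ ‖(y s).2‖ ∨ 0 ≤ met a b (y s).1 (y s).2 timeDir)} with hZ
    have hZc : IsClosed Z := isClosed_Ici.inter
      ((isClosed_le continuous_const (continuous_snd.comp hyc).norm).union (isClosed_le continuous_const hcE))
    have hZn : Z.Nonempty := ⟨s₀, hs₀, by
      by_cases h : R ≤ ‖(y s₀).2‖
      · exact Or.inl h
      · exact Or.inr (hbad (not_le.1 h))⟩
    have hZb : BddBelow Z := ⟨0, fun s hs => hs.1⟩
    have hmem := hZc.csInf_mem hZn hZb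
    set s₁ := sInf Z
    have hlt : ∀ s ∈ Ico 0 s₁, ‖(y s).2‖ < R ∧ met a b (y s).1 (y s).2 timeDir < 0 := fun s hs => by
      have : s ∉ Z := notMem_of_lt_csInf hs.2 hZb
      simp only [hZ, mem_ofPred_eq, not_and, not_or, not_le] at this
      exact this hs.1
    have hs₁ : 0 < s₁ := by
      refine hmem.1.lt_of_ne fun h => ?_
      have h2 := hmem.2
      rw [← h, hy0] at h2
      rcases h2 with h2 | h2
      · linarith [hv₀ 0 h0]
      · linarith [(hcaus 0 h0).2]
    -- Up to the first bad parameter the truncated field is the true one, so the energy estimate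
    -- applies on the closed interval. It gives a velocity at most R₀ < R and a positive energy,
    -- hence no bad parameter exists.
    have := key y s₁ hs₁ hy0 hyc.continuousOn (fun s hs => by
      rw [← hGeq _ (hlt s hs).1.le]; exact hyG s hs.1) (fun s hs => (hlt s hs).2) s₁ ⟨hs₁.le, le_rfl⟩
    rcases hmem.2 with h2 | h2
    · linarith [this.2.2]
    · linarith [this.2.1]
  have hfull : ∀ s, 0 ≤ s → HasDerivWithinAt y ((y s).2, acc a b (y s)) (Ici s) s := fun s hs => by
    rw [← hGeq _ (hgood s hs).1.le]; exact hyG s hs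
  refine ⟨y, hye, fun s hs => ?_, fun s hs => ?_⟩
  · exact (key y (s + 1) (by linarith) hy0 hyc.continuousOn (fun r hr => hfull r hr.1)
      (fun r hr => (hgood r hr.1).2) s ⟨hs, by linarith⟩).1
  · exact hasDerivWithinAt_of_right hyc.continuousOn
      ((continuous_snd.comp hyc).prodMk ((continuous_acc ha hb).comp hyc)).continuousOn hfull hs

/-- A geodesic is a solution of a first-order system for position and velocity; the extension of
that solution is C² because the acceleration is a continuous function of the state. -/
theorem isFutureComplete {q : Coord → Coord → Coord → ℝ} (hq : ∀ P ∈ domain, ∀ v w, q P v w = met a b P v w) :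
    IsFutureComplete q domain timeDir := by
  intro β γ hβ hγ hcaus
  obtain ⟨hs2, hm, hgeo⟩ := (isGeodesicOn_iff ha hb hq).1 hγ
  have hu : UniqueDiffOn ℝ (Ico 0 β) := uniqueDiffOn_Ico 0 β
  have hu' : UniqueDiffOn ℝ (Ici (0 : ℝ)) := uniqueDiffOn_Ici 0
  set v := derivWithin γ (Ico 0 β) with hv
  have hs1 : ContDiffOn ℝ 1 v (Ico 0 β) := by
    rw [show (2 : WithTop ℕ∞) = 1 + 1 by norm_num, contDiffOn_succ_iff_derivWithin hu] at hs2
    exact hs2.2.2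
  obtain ⟨y, hye, hyd, hy⟩ := exists_extension ha hb (y₀ := fun s => (γ s, v s)) hβ
    (fun s hs => by
      have h1 := (hs2.differentiableOn two_ne_zero s hs).hasDerivWithinAt
      have h2 := (hs1.differentiableOn one_ne_zero s hs).hasDerivWithinAt
      rw [hgeo s hs] at h2
      exact h1.prodMk h2)
    (fun s hs => by
      have := hcaus s hs
      rwa [hq _ (hm hs), hq _ (hm hs)] at this) (hm ⟨le_rfl, hβ⟩)
  have hx : ∀ s, 0 ≤ s → HasDerivWithinAt (fun s => (y s).1) (y s).2 (Ici 0) s := fun s hs =>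
    (ContinuousLinearMap.fst ℝ Coord Coord).hasFDerivAt.comp_hasDerivWithinAt s (hy s hs)
  have hw : ∀ s, 0 ≤ s → HasDerivWithinAt (fun s => (y s).2) (acc a b (y s)) (Ici 0) s := fun s hs =>
    (ContinuousLinearMap.snd ℝ Coord Coord).hasFDerivAt.comp_hasDerivWithinAt s (hy s hs)
  have hcy : ContinuousOn y (Ici 0) := fun s hs => (hy s hs).continuousWithinAt
  have e1 : EqOn (derivWithin (fun s => (y s).1) (Ici 0)) (fun s => (y s).2) (Ici 0) := fun s hs =>
    (hx s hs).derivWithin (hu' s hs)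
  have e2 : EqOn (derivWithin (fun s => (y s).2) (Ici 0)) (fun s => acc a b (y s)) (Ici 0) := fun s hs =>
    (hw s hs).derivWithin (hu' s hs)
  refine ⟨fun s => (y s).1, (isGeodesicOn_iff ha hb hq).2 ⟨?_, fun s hs => hyd s hs, fun s hs => ?_⟩,
    fun s hs => congrArg Prod.fst (hye hs)⟩
  · rw [show (2 : WithTop ℕ∞) = 1 + 1 by norm_num, contDiffOn_succ_iff_derivWithin hu']
    refine ⟨fun s hs => (hx s hs).differentiableWithinAt, by simp, ContDiffOn.congr ?_ e1⟩
    rw [show (1 : WithTop ℕ∞) = 0 + 1 by norm_num, contDiffOn_succ_iff_derivWithin hu']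
    refine ⟨fun s hs => (hw s hs).differentiableWithinAt, by simp, ContDiffOn.congr ?_ e2⟩
    exact contDiffOn_zero.2 ((continuous_acc ha hb).comp_continuousOn hcy)
  · rw [derivWithin_congr e1 (e1 hs), e2 hs, e1 hs]

end Completeness

end

/-! ### Hypotheses on the potential and the data, and final assembly -/

section

theorem rpow_add_one_le_sq {p t : ℝ} (hp : 1 ≤ p) (ht : 0 < t) (ht1 : t ≤ 1) :
    t ^ (p + 1) ≤ t ^ 2 := by
  have := Real.rpow_le_rpow_of_exponent_ge ht ht1 (show (2 : ℝ) ≤ p + 1 by linarith)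
  exact_mod_cast this

theorem abs_deriv₀_le {V : ℝ → ℝ} {K p t : ℝ} (hK : 0 ≤ K) (hp : 1 ≤ p)
    (hb : ∀ t : ℝ, 0 ≤ t →
      |V t| + t * |deriv₀ V t| + t ^ 2 * |deriv₀ (deriv₀ V) t| ≤ K * t ^ (p + 1))
    (ht : 0 < t) (ht1 : t ≤ 1) :
    |V t| ≤ K * t ∧ |deriv₀ V t| ≤ K * t ∧ t * |deriv₀ (deriv₀ V) t| ≤ K * t := by
  have h := (hb t ht.le).trans (mul_le_mul_of_nonneg_left (rpow_add_one_le_sq hp ht ht1) hK)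
  have a0 := abs_nonneg (V t)
  have a1 := mul_nonneg ht.le (abs_nonneg (deriv₀ V t))
  have a2 := mul_nonneg (sq_nonneg t) (abs_nonneg (deriv₀ (deriv₀ V) t))
  refine ⟨?_, ?_, ?_⟩
  · have : K * t ^ 2 ≤ K * t := mul_le_mul_of_nonneg_left (by nlinarith) hK
    linarith
  · refine le_of_mul_le_mul_left (a := t) ?_ ht
    linarith [show t * (K * t) = K * t ^ 2 by ring]
  · refine le_of_mul_le_mul_left (a := t) ?_ ht
    linarith [show t * (K * t) = K * t ^ 2 by ring,
      show t * (t * |deriv₀ (deriv₀ V) t|) = t ^ 2 * |deriv₀ (deriv₀ V) t| by ring]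

/-- On [0, 1] the growth condition is at most K t², and dividing by the weights t and t² gives the
three bounds for t > 0. -/
theorem pot_of_bound {V : ℝ → ℝ} {K p : ℝ} (hK : 0 ≤ K) (hp : 1 ≤ p)
    (hV : ContDiffOn ℝ 2 V (Ici 0))
    (hb : ∀ t : ℝ, 0 ≤ t →
      |V t| + t * |deriv₀ V t| + t ^ 2 * |deriv₀ (deriv₀ V) t| ≤ K * t ^ (p + 1)) :
    Pot V (deriv₀ V) (deriv₀ (deriv₀ V)) K := by
  have hV1 : ContDiffOn ℝ 1 (deriv₀ V) (Ici 0) :=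
    hV.derivWithin (uniqueDiffOn_Ici 0) (by norm_num)
  have h00 : (0 : ℝ) ^ (p + 1) = 0 := Real.zero_rpow (by linarith)
  -- At t = 0 the growth condition says nothing about V', since it carries the weight t. The value
  -- V'(0) = 0 is the limit of the bound K t by continuity.
  have hd0 : deriv₀ V 0 = 0 := by
    have hc : Tendsto (fun t => |deriv₀ V t|) (𝓝[>] 0) (𝓝 |deriv₀ V 0|) :=
      ((hV1.continuousOn 0 self_mem_Ici).mono_left (nhdsWithin_mono _ Ioi_subset_Ici_self)).abs
    have hz : Tendsto (fun t : ℝ => K * t) (𝓝[>] 0) (𝓝 0) := by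
      have : Tendsto (fun t : ℝ => K * t) (𝓝 0) (𝓝 (K * 0)) := tendsto_id.const_mul K
      rw [mul_zero] at this
      exact this.mono_left nhdsWithin_le_nhds
    refine abs_nonpos_iff.1 (le_of_tendsto_of_tendsto hc hz ?_)
    filter_upwards [Ioc_mem_nhdsGT (zero_lt_one' ℝ)] with t ht
    exact (abs_deriv₀_le hK hp hb ht.1 ht.2).2.1
  refine ⟨hK, fun t ht => (hV.differentiableOn (by norm_num) t ht).hasDerivWithinAt,
    fun t ht => (hV1.differentiableOn (by norm_num) t ht).hasDerivWithinAt,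
    hV1.continuousOn_derivWithin (uniqueDiffOn_Ici 0) le_rfl, fun t ht => ?_, fun t ht => ?_,
    fun t ht => ?_⟩ <;> rcases ht.1.eq_or_lt with rfl | h
  · have := hb 0 le_rfl
    simp only [h00, mul_zero, zero_mul, add_zero, ne_eq, OfNat.ofNat_ne_zero, not_false_eq_true,
      zero_pow] at this ⊢
    exact this
  · exact (abs_deriv₀_le hK hp hb h ht.2).1
  · simp [hd0]
  · exact (abs_deriv₀_le hK hp hb h ht.2).2.1
  · simp
  · exact (abs_deriv₀_le hK hp hb h ht.2).2.2

theorem abs_re_add_abs_im_le (z : ℂ) : |z.re| + |z.im| ≤ 2 * ‖z‖ := by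
  linarith [Complex.abs_re_le_norm z, Complex.abs_im_le_norm z]

theorem init_of_normX₀_lt {h₀ k₀ : ℝ → ℝ} {A : ℝ} (hh : ContDiffOn ℝ 1 h₀ (Ici 0))
    (hk : ContDiffOn ℝ 1 k₀ (Ici 0)) (hA : 0 ≤ A)
    (hN : normX₀ h₀ k₀ < ENNReal.ofReal (A / 80)) :
    Init A (cx h₀ k₀) (cx (deriv₀ h₀) (deriv₀ k₀)) ∧
      Continuous (cx (deriv₀ h₀) (deriv₀ k₀)) := by
  have hb : ∀ r : ℝ, 0 ≤ r → (1 + r) ^ 2 * (|h₀ r| + |k₀ r|)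
      + (1 + r) ^ 3 * (|deriv₀ h₀ r| + |deriv₀ k₀ r|) ≤ A / 80 := fun r hr => by
    refine (ENNReal.ofReal_le_ofReal_iff (by positivity)).1 (le_trans ?_ hN.le)
    exact le_iSup₂ (f := fun r (_ : r ∈ Ici (0 : ℝ)) => ENNReal.ofReal
      ((1 + r) ^ 2 * (|h₀ r| + |k₀ r|) + (1 + r) ^ 3 * (|deriv₀ h₀ r| + |deriv₀ k₀ r|))) r hr
  have ch := hh.continuousOn
  have ck := hk.continuousOn
  have ch' : ContinuousOn (deriv₀ h₀) (Ici 0) :=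
    hh.continuousOn_derivWithin (uniqueDiffOn_Ici 0) le_rfl
  have ck' : ContinuousOn (deriv₀ k₀) (Ici 0) :=
    hk.continuousOn_derivWithin (uniqueDiffOn_Ici 0) le_rfl
  have hc' := continuous_cx ch' ck'
  refine ⟨⟨continuous_cx ch ck, fun y hy => ?_, hc'.continuousOn, fun y hy => ?_,
    fun y hy => ?_⟩, hc'⟩
  · have e1 : HasDerivAt h₀ (deriv₀ h₀ y) y :=
      (hh.differentiableOn one_ne_zero y hy.le).hasDerivWithinAt.hasDerivAt (Ici_mem_nhds hy)
    have e2 : HasDerivAt k₀ (deriv₀ k₀ y) y :=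
      (hk.differentiableOn one_ne_zero y hy.le).hasDerivWithinAt.hasDerivAt (Ici_mem_nhds hy)
    have e3 := e1.ofReal_comp.add (e2.ofReal_comp.mul_const Complex.I)
    have e4 : cx (deriv₀ h₀) (deriv₀ k₀) y
        = (deriv₀ h₀ y : ℂ) + (deriv₀ k₀ y : ℂ) * Complex.I := by
      apply Complex.ext
      · simp [cx_re ch' ck' hy.le]
      · simp [cx_im ch' ck' hy.le]
    rw [e4]
    refine e3.congr_of_eventuallyEq ?_
    filter_upwards [Ioi_mem_nhds hy] with x hx
    have hx' : 0 ≤ x := le_of_lt hx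
    apply Complex.ext
    · simp [cx_re ch ck hx']
    · simp [cx_im ch ck hx']
  · have h1 : 0 < 1 + y := by linarith
    have := Complex.norm_le_abs_re_add_abs_im (cx h₀ k₀ y)
    rw [cx_re ch ck hy, cx_im ch ck hy] at this
    rw [le_div_iff₀ (by positivity)]
    have h2 := hb y hy
    have h3 : 0 ≤ (1 + y) ^ 3 * (|deriv₀ h₀ y| + |deriv₀ k₀ y|) := by positivity
    have h4 := mul_le_mul_of_nonneg_left this (show 0 ≤ (1 + y) ^ 2 by positivity)
    linarith
  · have h1 : 0 < 1 + y := by linarith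
    have := Complex.norm_le_abs_re_add_abs_im (cx (deriv₀ h₀) (deriv₀ k₀) y)
    rw [cx_re ch' ck' hy.le, cx_im ch' ck' hy.le] at this
    rw [le_div_iff₀ (by positivity)]
    have h2 := hb y hy.le
    have h3 : 0 ≤ (1 + y) ^ 2 * (|h₀ y| + |k₀ y|) := by positivity
    have h4 := mul_le_mul_of_nonneg_left this (show 0 ≤ (1 + y) ^ 3 by positivity)
    linarith

section Conclusion

variable {V : ℝ → ℝ} {K A : ℝ} {w ω₀ ω₁ : ℝ → ℝ → ℂ} {z₀ : ℝ → ℂ} {σ θ : ℝ → ℝ}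

theorem Sol.bijOn_centralTime (S : Sol V (deriv₀ V) A z₀ w ω₀ ω₁) (h0 : σ 0 = 0)
    (hm : StrictMono σ) (hd : ∀ u, HasDerivAt σ (cc (w (σ u))) u)
    (hσθ : Function.RightInverse θ σ) :
    BijOn (centralTime (fun u r => (w (σ u) r).re) (fun u r => (w (σ u) r).im))
      (Ici 0) (Ici 0) := by
  have e : centralTime (fun u r => (w (σ u) r).re) (fun u r => (w (σ u) r).im) = σ :=
    funext fun u => S.centralTime_eq h0 hm hd
  rw [e]
  refine ⟨fun u hu => S.time_nonneg h0 hm hd hu, hm.injective.injOn, fun τ hτ => ⟨θ τ, ?_, hσθ τ⟩⟩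
  rw [mem_Ici, ← hm.le_iff_le, h0, hσθ τ]
  exact hτ

/-- In the domain τ = t - r is nonnegative, so the reflected solution is the original one. The
factors g(u, 0) cancel because du = (dt - dr)/g(u, 0). -/
theorem Sol.bondiMetric_eq (S : Sol V (deriv₀ V) A z₀ w ω₀ ω₁) (h0 : σ 0 = 0)
    (hm : StrictMono σ) (hd : ∀ u, HasDerivAt σ (cc (w (σ u))) u)
    (hσθ : Function.RightInverse θ σ) {P : Coord} (hP : P ∈ domain) (v v' : Coord) :
    bondiMetric V (fun u r => (w (σ u) r).re) (fun u r => (w (σ u) r).im) P v v'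
      = met (fun τ r => GG (refl w τ) r * Gt V (refl w τ) r - 1)
          (fun τ r => GG (refl w τ) r - 1) P v v' := by
  have hτ : 0 ≤ P.1 - ‖P.2‖ := sub_nonneg.2 hP
  have hu : σ (retardedTime (fun u r => (w (σ u) r).re) (fun u r => (w (σ u) r).im)
      (P.1 - ‖P.2‖)) = P.1 - ‖P.2‖ := by
    rw [← S.centralTime_eq h0 hm hd]
    exact (S.bijOn_centralTime h0 hm hd hσθ).surjOn.rightInvOn_invFunOn hτ
  have hg0 : GG (w (P.1 - ‖P.2‖)) 0 = 1 := by simp [GG]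
  have hc := cc_pos (w (P.1 - ‖P.2‖))
  rw [met_apply]
  simp only [bondiMetric, hu, S.ball.gFun_eq _ (norm_nonneg _), S.ball.gFun_eq _ le_rfl,
    S.ball.gTilde_eq _ (norm_nonneg _), hg0, mul_one, lift, S.ball.refl_of_nonneg hτ, xi, rho]
  field_simp
  ring

theorem Sol.isLorentzian_isFutureComplete {V₂ : ℝ → ℝ} (S : Sol V (deriv₀ V) A z₀ w ω₀ ω₁)
    (hV : Small V (deriv₀ V) V₂ K (3 * A)) (h0 : σ 0 = 0)
    (hm : StrictMono σ) (hd : ∀ u, HasDerivAt σ (cc (w (σ u))) u)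
    (hσθ : Function.RightInverse θ σ) :
    IsLorentzian (bondiMetric V (fun u r => (w (σ u) r).re) (fun u r => (w (σ u) r).im))
      domain timeDir ∧
    IsFutureComplete (bondiMetric V (fun u r => (w (σ u) r).re) (fun u r => (w (σ u) r).im))
      domain timeDir := by
  have hA : 3 * A ≤ 1 := by nlinarith [hV.le, hV.nonneg, hV.pos]
  have ha := (S.refl_tfam hA).coeff_GG_mul_Gt hV (S.ball.prof_refl hA)
  have hb := (S.refl_tfam hA).coeff_GG hV (S.ball.prof_refl hA)
  have hq := fun P hP v v' => S.bondiMetric_eq h0 hm hd hσθ (P := P) hP v v'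
  exact ⟨isLorentzian ha hb hq, isFutureComplete ha hb hq⟩

/-- Passing from τ to u costs the factor 2 in the weight, hence at most 2³ = 8 in its powers, and
|Re| + |Im| costs another 2; this explains 16A. -/
theorem Sol.decay (S : Sol V (deriv₀ V) A z₀ w ω₀ ω₁) (hA : 0 < A) (h0 : σ 0 = 0)
    (hm : StrictMono σ) (hd : ∀ u, HasDerivAt σ (cc (w (σ u))) u)
    {u r C : ℝ} (hu2 : u ≤ 2 * σ u) (hu : 0 ≤ u) (hr : 0 ≤ r) (hC : 16 * A ≤ C) :
    |(w (σ u) r).re| + |(w (σ u) r).im| ≤ C * (1 + u + r) ^ (-2 : ℤ) ∧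
      |deriv₀ (fun r => (w (σ u) r).re) r| + |deriv₀ (fun r => (w (σ u) r).im) r|
        ≤ C * (1 + u + r) ^ (-3 : ℤ) := by
  have hτ := S.time_nonneg h0 hm hd hu
  have hp : 0 < 1 + u + r := by positivity
  have hp' : 0 < 1 + σ u + r := by positivity
  have hle : 1 + u + r ≤ 2 * (1 + σ u + r) := by linarith
  have key : ∀ (z : ℂ) (n : ℕ), n ≤ 3 → ‖z‖ ≤ A / (1 + σ u + r) ^ n →
      |z.re| + |z.im| ≤ C * (1 + u + r) ^ (-(n : ℤ)) := fun z n hn hz => by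
    have h1 : (1 + u + r) ^ n ≤ 8 * (1 + σ u + r) ^ n :=
      (pow_le_pow_left₀ hp.le hle n).trans (by
        rw [mul_pow]
        refine mul_le_mul_of_nonneg_right ?_ (by positivity)
        exact (pow_le_pow_right₀ (by norm_num : (1 : ℝ) ≤ 2) hn).trans (by norm_num))
    rw [zpow_neg, zpow_natCast, ← div_eq_mul_inv, le_div_iff₀ (by positivity)]
    rw [le_div_iff₀ (by positivity)] at hz
    calc (|z.re| + |z.im|) * (1 + u + r) ^ n
        ≤ (2 * ‖z‖) * (8 * (1 + σ u + r) ^ n) := by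
          gcongr
          exact abs_re_add_abs_im_le z
      _ = 16 * (‖z‖ * (1 + σ u + r) ^ n) := by ring
      _ ≤ C := by linarith
  refine ⟨key _ 2 (by norm_num) ((S.ball.prof _ hτ).bd r hr), ?_⟩
  rw [S.deriv₀_re h0 hm hd hu hr, S.deriv₀_im h0 hm hd hu hr]
  exact key _ 3 le_rfl (S.bd₁ _ r hτ hr)

theorem Sol.gTilde_pos {V₂ : ℝ → ℝ} (S : Sol V (deriv₀ V) A z₀ w ω₀ ω₁)
    (hV : Small V (deriv₀ V) V₂ K A) {τ r : ℝ} (hτ : 0 ≤ τ) (hr : 0 ≤ r) :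
    0 < gTilde V (fun r => (w τ r).re) (fun r => (w τ r).im) r := by
  rw [S.ball.gTilde_eq τ hr]
  have := ((S.ball.prof τ hτ).Gt_mem hV hr).1
  exact mul_pos (cc_pos _) (by linarith)

end Conclusion

end

end EYMH

end

theorem theorem4p1 :
    ∃ C : ℝ → ℝ, ContinuousOn C (Set.Ici 0) ∧ StrictMonoOn C (Set.Ici 0) ∧
      (∀ K, 0 ≤ K → 0 < C K) ∧
      ∀ K₀ p : ℝ, 0 ≤ K₀ → 3 / 2 ≤ p → ∃ ε : ℝ, 0 < ε ∧
        ∀ V : ℝ → ℝ, ContDiffOn ℝ 2 V (Set.Ici 0) →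
        (∀ t : ℝ, 0 ≤ t →
          |V t| + t * |EYMH.deriv₀ V t| + t ^ 2 * |EYMH.deriv₀ (EYMH.deriv₀ V) t|
            ≤ K₀ * t ^ (p + 1)) →
        ∀ h₀ k₀ : ℝ → ℝ,
        ContDiffOn ℝ 1 h₀ (Set.Ici 0) → ContDiffOn ℝ 1 k₀ (Set.Ici 0) →
        (fun r => |h₀ r| + |k₀ r|) =O[Filter.atTop] (fun r : ℝ => r ^ (-2 : ℤ)) →
        (fun r => |EYMH.deriv₀ h₀ r| + |EYMH.deriv₀ k₀ r|)
          =O[Filter.atTop] (fun r : ℝ => r ^ (-3 : ℤ)) →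
        EYMH.normX₀ h₀ k₀ < ENNReal.ofReal ε →
        ∃ h k : ℝ → ℝ → ℝ,
          EYMH.IsGlobalSolution V h₀ k₀ h k ∧
          (∀ h' k' : ℝ → ℝ → ℝ, EYMH.IsGlobalSolution V h₀ k₀ h' k' →
            ∀ u r : ℝ, 0 ≤ u → 0 ≤ r → h' u r = h u r ∧ k' u r = k u r) ∧
          (∀ u r : ℝ, 0 ≤ u → 0 ≤ r →
            |h u r| + |k u r| ≤ C K₀ * (1 + u + r) ^ (-2 : ℤ) ∧
            |EYMH.deriv₀ (h u) r| + |EYMH.deriv₀ (k u) r| ≤ C K₀ * (1 + u + r) ^ (-3 : ℤ)) ∧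
          (∀ u r : ℝ, 0 ≤ u → 0 ≤ r → 0 < EYMH.gTilde V (h u) (k u) r) ∧
          Set.BijOn (EYMH.centralTime h k) (Set.Ici 0) (Set.Ici 0) ∧
          EYMH.IsLorentzian (EYMH.bondiMetric V h k) EYMH.domain EYMH.timeDir ∧
          EYMH.IsFutureComplete (EYMH.bondiMetric V h k) EYMH.domain EYMH.timeDir := by
  refine ⟨fun K => 1 + K, by fun_prop, fun x _ y _ h => by simpa using h,
    fun K hK => by positivity, fun K p hK hp => ?_⟩
  have hK1 : 0 < 1 + K := by positivity
  -- The size is chosen so that 3A, not only A, meets the smallness condition: the reflected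
  -- solution is a profile with constant 3A.
  set A : ℝ := 1 / (600 * (1 + K)) with hAdef
  have hA : 0 < A := by positivity
  have hKA : (1 + K) * (3 * A) = 1 / 200 := by
    rw [hAdef]
    field_simp
    norm_num
  refine ⟨A / 80, by positivity, fun V hV hVb h₀ k₀ hh hk _ _ hN => ?_⟩
  have hPot := EYMH.pot_of_bound hK (by linarith) hV hVb
  have hS3 : EYMH.Small V _ _ K (3 * A) := ⟨hPot, by positivity, hKA.le⟩
  have hS : EYMH.Small V _ _ K A := ⟨hPot, hA, by nlinarith⟩
  obtain ⟨hI, hc'⟩ := EYMH.init_of_normX₀_lt hh hk hA.le hN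
  obtain ⟨w, hw, hfix⟩ := EYMH.exists_fixed_point hS hI
  obtain ⟨ω₀, ω₁, S⟩ := hw.exists_sol hS hI hc' hfix
  obtain ⟨σ, θ, h0, hm, hθσ, hσθ, hd, hθ, hu2⟩ := hw.exists_time
  have hre : ∀ r, 0 ≤ r → (EYMH.cx h₀ k₀ r).re = h₀ r := fun r hr =>
    EYMH.cx_re hh.continuousOn hk.continuousOn hr
  have him : ∀ r, 0 ≤ r → (EYMH.cx h₀ k₀ r).im = k₀ r := fun r hr =>
    EYMH.cx_im hh.continuousOn hk.continuousOn hr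
  refine ⟨fun u r => (w (σ u) r).re, fun u r => (w (σ u) r).im,
    S.isGlobalSolution h0 hm hd hre him,
    fun h' k' hG u r hu hr => hw.unique hS hI hfix hθσ hσθ h0 hθ hre him hG hu hr,
    fun u r hu hr => S.decay hA h0 hm hd (hu2 u hu) hu hr (by nlinarith),
    fun u r hu hr => S.gTilde_pos hS (S.time_nonneg h0 hm hd hu) hr,
    S.bijOn_centralTime h0 hm hd hσθ,
    S.isLorentzian_isFutureComplete hS3 h0 hm hd hσθ⟩
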